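/- Let $(\tilde M,g)$ be a smooth Riemannian manifold without boundary (Hausdorff, second countable) of dimension $n\ge 3$. Let $x\in C^\infty(\tilde M)$ satisfy $\mathrm dx\neq 0$ on $\{x=0\}$, and put $X=\{x\ge 0\}$, $\partial X=\{x=0\}$. Let $g_{sc}=x^{-4}\mathrm dx^2+x^{-2}h$ be a scattering metric on $X$: $h$ is a symmetric $2$-cotensor, smooth up to $\partial X$ and positive definite on $T\partial X$, and $g_{sc}$ is positive definite on $\{x>0\}$. Norms of tensors, $L^2_{sc}$ and the Sobolev spaces $H^{1,r}_{sc}$ are defined with respect to $g_{sc}$, its volume and its Levi-Civita connection $\nabla$: $$\|v\|^2_{H^{1,r}_{sc}(X)}=\|x^{-r}v\|^2_{L^2_{sc}(X)}+\|\nabla(x^{-r}v)\|^2_{L^2_{sc}(X)}.$$ Let $\Omega\subset X$ be a relatively compact domain with smooth boundary transversal to $\partial X$, and let $\bar H^{1,r}_{sc}(\Omega)$ be the space of restrictions to $\Omega$ of symmetric tensor fields in $H^{1,r}_{sc}(X)$, with the quotient norm. Let $\mathrm d^s$ be the symmetrization of the covariant derivative of $g$ (not of $g_{sc}$), and $\mathrm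 d^s_{\mathsf F}=e^{-\mathsf F/x}\,\mathrm d^s\,e^{\mathsf F/x}$, in the sense of distributions. Then for every $\mathsf F>0$ and $r\in\mathbb R$ there is a constant $C$ such that, for all (real- or complex-valued) symmetric $3$-tensor fields $u\in\bar H^{1,r}_{sc}(\Omega)$, $$\|u\|_{\bar H^{1,r}_{sc}(\Omega)}\le C\left(\|x^{-r}\mathrm d^s_{\mathsf F}u\|_{L^2_{sc}(\Omega)}+\|x^{-r}u\|_{L^2_{sc}(\Omega)}\right).$$ -/

import Mathlib

open scoped Manifold ContDiff NNReal ENNReal Topology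
open MeasureTheory

noncomputable section

namespace ScKorn

/-- The model space `ℝⁿ`. -/
abbrev Model (n : ℕ) : Type := EuclideanSpace ℝ (Fin n)

/-- The `i`-th vector of the standard basis of `ℝⁿ`. -/
def stdVec (n : ℕ) (i : Fin n) : Model n := EuclideanSpace.single i (1 : ℝ)

section Tensors

variable {n : ℕ} {M : Type*} [TopologicalSpace M] [ChartedSpace (Model n) M]

/-- Fields of bilinear forms on the tangent spaces of `M`. -/
abbrev BilinField (n : ℕ) (M : Type*) [TopologicalSpace M] [ChartedSpace (Model n) M] :=
  ∀ p : M, TangentSpace (𝓡 n) p →L[ℝ] TangentSpace (𝓡 n) p →L[ℝ] ℝ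

/-- Smoothness of a field of bilinear forms, as a section of the corresponding bundle. -/
def IsSmoothBilin [IsManifold (𝓡 n) ∞ M] (B : BilinField n M) : Prop :=
  ContMDiff (𝓡 n) ((𝓡 n).prod 𝓘(ℝ, Model n →L[ℝ] Model n →L[ℝ] ℝ)) ∞
    (fun p ↦ Bundle.TotalSpace.mk' (Model n →L[ℝ] Model n →L[ℝ] ℝ)
      (E := fun q : M ↦ TangentSpace (𝓡 n) q →L[ℝ] TangentSpace (𝓡 n) q →L[ℝ] ℝ) p (B p))

/-- (Rough) fields of covariant `m`-tensors on `M`, with values in `𝕜`. -/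
abbrev CovTensor (𝕜 : Type*) [RCLike 𝕜] (n : ℕ) (M : Type*) [TopologicalSpace M]
    [ChartedSpace (Model n) M] (m : ℕ) :=
  ∀ p : M, MultilinearMap ℝ (fun _ : Fin m ↦ TangentSpace (𝓡 n) p) 𝕜

/-- The differential of a real function at `p`, as a covector. -/
def dAt (n : ℕ) {M : Type*} [TopologicalSpace M] [ChartedSpace (Model n) M]
    (f : M → ℝ) (p : M) : TangentSpace (𝓡 n) p →L[ℝ] ℝ :=
  mfderiv (𝓡 n) 𝓘(ℝ, ℝ) f p

variable {𝕜 : Type*} [RCLike 𝕜] {m : ℕ}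

/-- A tensor field is symmetric if it is invariant under permutations of its arguments. -/
def IsSymm (u : CovTensor 𝕜 n M m) : Prop :=
  ∀ (p : M) (σ : Equiv.Perm (Fin m)), (u p).domDomCongr σ = u p

/-- Multiplication of a tensor field by a real function. -/
def fsmul (f : M → ℝ) (u : CovTensor 𝕜 n M m) : CovTensor 𝕜 n M m :=
  fun p ↦ f p • u p

/-- The symmetrization `(1/m!) ∑ σ, u (v_{σ 1}, …, v_{σ m})`. -/
def symmetrize (u : CovTensor 𝕜 n M m) : CovTensor 𝕜 n M m :=
  fun p ↦ ((m.factorial : ℝ)⁻¹) • ∑ σ : Equiv.Perm (Fin m), (u p).domDomCongr σ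

/-! ### Pointwise norms and the Riemannian volume -/

/-- The Gram matrix of `G p` in the standard basis of `T_p M = ℝⁿ`. -/
def gram (G : BilinField n M) (p : M) : Matrix (Fin n) (Fin n) ℝ :=
  Matrix.of fun i j ↦ G p (stdVec n i) (stdVec n j)

/-- The squared norm `|T|²_G = G^{i₁j₁} ⋯ G^{iₘjₘ} T_{i₁…iₘ} conj(T_{j₁…jₘ})` of an `m`-tensor
at `p` with respect to the inner product `G p`. (The value does not depend on the basis in which
it is computed.) -/
def tensorNormSq (G : BilinField n M) (p : M)
    (T : MultilinearMap ℝ (fun _ : Fin m ↦ TangentSpace (𝓡 n) p) 𝕜) : ℝ :=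
  ∑ i : Fin m → Fin n, ∑ j : Fin m → Fin n, (∏ a, (gram G p)⁻¹ (i a) (j a)) *
    RCLike.re (T (fun a ↦ stdVec n (i a)) * (starRingEnd 𝕜) (T (fun a ↦ stdVec n (j a))))

/-- The `i`-th coordinate vector field of the chart `φ` at the point with coordinates `y`. -/
def coordVec (φ : OpenPartialHomeomorph M (Model n)) (y : Model n) (i : Fin n) :
    TangentSpace (𝓡 n) (φ.symm y) :=
  mfderiv 𝓘(ℝ, Model n) (𝓡 n) φ.symm y (stdVec n i)

/-- The components `G_{ij}` of `G` in the chart `φ`, as functions of the coordinates. -/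
def chartGram (G : BilinField n M) (φ : OpenPartialHomeomorph M (Model n)) (y : Model n) :
    Matrix (Fin n) (Fin n) ℝ :=
  Matrix.of fun i j ↦ G (φ.symm y) (coordVec φ y i) (coordVec φ y j)

/-- The components `u_{j₁…jₘ}` of `u` in the chart `φ`, as functions of the coordinates. -/
def comp (φ : OpenPartialHomeomorph M (Model n)) (u : CovTensor 𝕜 n M m) (j : Fin m → Fin n)
    (y : Model n) : 𝕜 :=
  u (φ.symm y) (fun a ↦ coordVec φ y (j a))

/-- The measure `√|det G_{ij}| dy` on the domain of the chart `φ`. -/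
def chartVolume [MeasurableSpace M] (G : BilinField n M)
    (φ : OpenPartialHomeomorph M (Model n)) : Measure M :=
  (((volume : Measure (Model n)).restrict φ.target).withDensity
    (fun y ↦ ENNReal.ofReal (√|(chartGram G φ y).det|))).map φ.symm

/-- The Riemannian volume measure of `G`. The measures `√|det G_{ij}| dy` of two charts agree on
the overlap of their domains; the least measure that dominates all of them is the one that
restricts to `√|det G_{ij}| dy` on the domain of every chart. -/
def riemVolume [MeasurableSpace M] (G : BilinField n M) : Measure M :=
  ⨆ φ ∈ IsManifold.maximalAtlas (𝓡 n) ∞ M, chartVolume G φ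

/-- The norm of `L²(U; G)`, in `[0, ∞]`. -/
def l2Norm [MeasurableSpace M] (G : BilinField n M) (U : Set M) (u : CovTensor 𝕜 n M m) : ℝ≥0∞ :=
  (∫⁻ p in U, ENNReal.ofReal (tensorNormSq G p (u p)) ∂(riemVolume G)) ^ (1 / 2 : ℝ)

/-! ### The covariant derivative in the weak sense -/

/-- The Christoffel symbol
`Γ^q_{kj} = ½ G^{qs} (∂_k G_{sj} + ∂_j G_{sk} - ∂_s G_{kj})` in the chart `φ`. -/
def christoffel (G : BilinField n M) (φ : OpenPartialHomeomorph M (Model n)) (q k j : Fin n)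
    (y : Model n) : ℝ :=
  (1 / 2) * ∑ s, (chartGram G φ y)⁻¹ q s *
    (fderiv ℝ (fun z ↦ chartGram G φ z s j) y (stdVec n k)
      + fderiv ℝ (fun z ↦ chartGram G φ z s k) y (stdVec n j)
      - fderiv ℝ (fun z ↦ chartGram G φ z k j) y (stdVec n s))

/-- `w = ∇u` on the open set `U` in the sense of distributions, where `∇` is the Levi-Civita
connection of `G`: in every chart the components are locally integrable and
`w_{j₁…jₘ k} = ∂_k u_{j₁…jₘ} - ∑ₚ Γ^q_{k jₚ} u_{j₁…jₚ₋₁ q jₚ₊₁…jₘ}`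
against all test functions. The index of differentiation is the last one. -/
def IsWeakCovDeriv (G : BilinField n M) (U : Set M) (u : CovTensor 𝕜 n M m)
    (w : CovTensor 𝕜 n M (m + 1)) : Prop :=
  ∀ φ ∈ IsManifold.maximalAtlas (𝓡 n) ∞ M,
    (∀ j, LocallyIntegrableOn (comp φ u j) (φ.target ∩ φ.symm ⁻¹' U)) ∧
    (∀ l, LocallyIntegrableOn (comp φ w l) (φ.target ∩ φ.symm ⁻¹' U)) ∧
    ∀ (j : Fin m → Fin n) (k : Fin n) (ψ : Model n → ℝ), ContDiff ℝ ∞ ψ →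
      HasCompactSupport ψ → tsupport ψ ⊆ φ.target ∩ φ.symm ⁻¹' U →
      ∫ y, (fderiv ℝ ψ y (stdVec n k)) • comp φ u j y =
        - ∫ y, ψ y • (comp φ w (Fin.snoc (α := fun _ ↦ Fin n) j k) y +
            ∑ a : Fin m, ∑ q : Fin n,
              christoffel G φ q k (j a) y • comp φ u (Function.update j a q) y)

end Tensors

section Scattering

variable {n : ℕ} {M : Type*} [TopologicalSpace M] [ChartedSpace (Model n) M]

/-- The interior `{x > 0}` of `X = {x ≥ 0}`. -/
def interiorX (x : M → ℝ) : Set M := {p | 0 < x p}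

/-- `x` is a smooth function, and a boundary defining function of `X = {x ≥ 0}`. -/
structure IsBoundaryDefining (n : ℕ) {M : Type*} [TopologicalSpace M] [ChartedSpace (Model n) M]
    (x : M → ℝ) : Prop where
  smooth : ContMDiff (𝓡 n) 𝓘(ℝ, ℝ) ∞ x
  regular : ∀ p, x p = 0 → dAt n x p ≠ 0

/-- The metric `x⁻⁴ dx² + x⁻² h`. -/
def gsc (x : M → ℝ) (h : BilinField n M) : BilinField n M :=
  fun p ↦ ((x p) ^ 4)⁻¹ • (dAt n x p).smulRight (dAt n x p) + ((x p) ^ 2)⁻¹ • h p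

/-- `x⁻⁴ dx² + x⁻² h` is a scattering metric on `X`: the `2`-cotensor `h` is symmetric and smooth
up to the boundary, `x⁻⁴ dx² + x⁻² h` is positive definite in the interior of `X`, and `h` is
positive definite on the tangent spaces `ker dx` of `∂X = {x = 0}`. -/
structure IsScatteringMetric [IsManifold (𝓡 n) ∞ M] (x : M → ℝ) (h : BilinField n M) : Prop where
  symm : ∀ p v w, h p v w = h p w v
  smooth : IsSmoothBilin h
  pos_interior : ∀ p, 0 < x p → ∀ v, v ≠ 0 → 0 < gsc x h p v v
  pos_boundary : ∀ p, x p = 0 → ∀ v, v ≠ 0 → dAt n x p v = 0 → 0 < h p v v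

/-- `D ∩ X` is a relatively compact domain in `X = {x ≥ 0}` with smooth boundary, transversal to
`∂X = {x = 0}`: near each point of `X` on the boundary of `D`, the set `D` is the superlevel set
`{ρ > 0}` of a smooth function `ρ` with `dρ ≠ 0`, and `dρ`, `dx` are linearly independent where
the boundary of `D` meets `∂X`. -/
structure IsTransversalDomain (n : ℕ) {M : Type*} [TopologicalSpace M] [ChartedSpace (Model n) M]
    (x : M → ℝ) (D : Set M) : Prop where
  isOpen : IsOpen D
  isCompact : IsCompact (closure D ∩ {p | 0 ≤ x p})
  boundary : ∀ q ∈ frontier D, 0 ≤ x q → ∃ (U : Set M) (ρ : M → ℝ), IsOpen U ∧ q ∈ U ∧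
    ContMDiffOn (𝓡 n) 𝓘(ℝ, ℝ) ∞ ρ U ∧ D ∩ U = {p | 0 < ρ p} ∩ U ∧ dAt n ρ q ≠ 0 ∧
    (x q = 0 → LinearIndependent ℝ ![dAt n ρ q, dAt n x q])

variable {𝕜 : Type*} [RCLike 𝕜] {m : ℕ}

/-- Multiplication by `x^{-r}`. -/
def weight (x : M → ℝ) (r : ℝ) (u : CovTensor 𝕜 n M m) : CovTensor 𝕜 n M m :=
  fsmul (fun p ↦ (x p) ^ (-r)) u

/-- The norm of `H^{1,r}_sc(X) = x^r H^1_sc(X)`, namely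
`‖v‖² = ‖x^{-r} v‖²_{L²_sc} + ‖∇(x^{-r} v)‖²_{L²_sc}` with the connection, the norms and the
volume of `g_sc`; it is `∞` if `v` does not belong to the space.
(The weak derivative is unique almost everywhere.) -/
def scSobolevNorm [MeasurableSpace M] (x : M → ℝ) (h : BilinField n M) (r : ℝ)
    (v : CovTensor 𝕜 n M m) : ℝ≥0∞ :=
  ⨅ (W : CovTensor 𝕜 n M (m + 1)) (_ : IsWeakCovDeriv (gsc x h) (interiorX x) (weight x r v) W),
    (l2Norm (gsc x h) (interiorX x) (weight x r v) ^ 2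
      + l2Norm (gsc x h) (interiorX x) W ^ 2) ^ (1 / 2 : ℝ)

/-- The norm of the space `H̄^{1,r}_sc(Ω)` of restrictions to `Ω` of symmetric tensors in
`H^{1,r}_sc(X)`: the quotient norm, that is the infimum of the norms of all extensions. It is `∞`
if `u` does not belong to the space. Only the values of `u` on `Ω` matter. -/
def scSobolevBarNorm [MeasurableSpace M] (x : M → ℝ) (h : BilinField n M) (Ω : Set M) (r : ℝ)
    (u : CovTensor 𝕜 n M m) : ℝ≥0∞ :=
  ⨅ (v : CovTensor 𝕜 n M m) (_ : IsSymm v) (_ : ∀ p ∈ Ω, v p = u p), scSobolevNorm x h r v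

/-- `w = d^s_F u` on `Ω`, where `d^s_F = e^{-F/x} d^s e^{F/x}` and `d^s` is the symmetrization of
the covariant derivative of the metric `g` (not of `g_sc`). -/
def IsSymmDiffF (g : BilinField n M) (x : M → ℝ) (Ω : Set M) (F : ℝ)
    (u : CovTensor 𝕜 n M m) (w : CovTensor 𝕜 n M (m + 1)) : Prop :=
  ∃ W : CovTensor 𝕜 n M (m + 1),
    IsWeakCovDeriv g Ω (fsmul (fun p ↦ Real.exp (F / x p)) u) W ∧
    ∀ p ∈ Ω, w p = fsmul (fun p ↦ Real.exp (-F / x p)) (symmetrize W) p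

end Scattering

end ScKorn

end

/-! Near a boundary point with coordinates (x, y), pass to z = (1/x, y/x). In these coordinates the
coefficients of the scattering metric are smooth functions of (x, y) up to x = 0
(`pullBilin_gsc_scChart`), so the metric is uniformly comparable with the Euclidean one and its
Christoffel symbols are bounded. The Christoffel symbols of the smooth metric g are bounded as well
(`christoffel_scChart`). Conjugation by e^{F/x} contributes F d(1/x), and the weight x^r contributes
r d(log x); both are bounded, since 1/x is a coordinate. Hence, with t = x^{-r} u, the components of
x^{-r} d^s_F u are those of the flat symmetrized gradient of t, plus terms of order zero in t with
bounded coefficients. On a compact piece of {x > 0} any chart has these properties. Finitely many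
such patches cover the closure of the domain (`exists_patch`), and a partition of unity reduces the
claim to Korn's inequality on the whole space or on a half space.

On the whole space (`korn_univ`), pair the symmetrized gradient with the gradient D and expand the
symmetrization as a sum over permutations. A permutation that fixes the index of differentiation
gives the squared norm of D, because the tensor is symmetric. Any other one reduces to the
transposition of that index with a tensor index, and two integrations by parts turn its term into
the square of a divergence. So every term is nonnegative, the identity alone gives the squared norm
of D, and the Cauchy–Schwarz inequality bounds D by its symmetrization.

On a half space (`exists_korn_extension`), extend by a combination of pull-backs under four scalings
z_i → -s z_i. Pull-back multiplies a component with l normal indices by (-s)^l. The coefficients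
make the traces match for l = 0, 1, 2, 3, which is what a 3-tensor needs, so the derivative of the
extension is the reflection of the derivative. The factor depends only on the number of normal
indices, hence reflection commutes with symmetrization: the symmetrized gradient of the extension is
controlled by the symmetrized gradient on the half space alone, and Korn's inequality on the whole
space bounds the rest.

The sum of the local extensions is a competitor in the quotient norm. The hypothesis that u lies in
the Sobolev space enters only qualitatively, to make the local pieces square integrable together
with their derivatives. Since all derivatives are distributional, the chart independence of weak
covariant derivatives (`ChartWeak.transfer`) and the change of connection
(`exists_isWeakCovDeriv_fsmul`) are proved along the way. -/

noncomputable section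

namespace ScKorn

/-! ### Weak directional derivatives on open subsets of Euclidean space. -/

section WeakDerivatives

variable {n : ℕ} {𝕜 : Type*} [RCLike 𝕜]

/-- `d` is the derivative of `f` in the direction `v` on `R`, in the sense of distributions. -/
structure WeakDeriv (R : Set (Model n)) (v : Model n) (f d : Model n → 𝕜) : Prop where
  loc : LocallyIntegrableOn f R
  loc_deriv : LocallyIntegrableOn d R
  eq : ∀ ψ : Model n → ℝ, ContDiff ℝ ∞ ψ → HasCompactSupport ψ → tsupport ψ ⊆ R →
    ∫ y, fderiv ℝ ψ y v • f y = - ∫ y, ψ y • d y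

variable {R R₁ R₂ : Set (Model n)} {v : Model n} {f f₁ f₂ d d₁ d₂ : Model n → 𝕜}

theorem locallyIntegrableOn_iff_compact (hR : IsOpen R) :
    LocallyIntegrableOn f R ↔ ∀ K ⊆ R, IsCompact K → IntegrableOn f K :=
  locallyIntegrableOn_iff hR.isLocallyClosed

theorem integrable_smul_of_locallyIntegrableOn (hf : LocallyIntegrableOn f R) (hR : IsOpen R)
    {a : Model n → ℝ} (ha : Continuous a) (hac : HasCompactSupport a) (haR : tsupport a ⊆ R) :
    Integrable (fun y ↦ a y • f y) := by
  have h1 : IntegrableOn f (tsupport a) := (locallyIntegrableOn_iff_compact hR).1 hf _ haR hac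
  have h2 : IntegrableOn (fun y ↦ a y • f y) (tsupport a) :=
    h1.continuousOn_smul ha.continuousOn hac
  refine (integrableOn_iff_integrable_of_support_subset ?_).1 h2
  intro y hy
  apply subset_tsupport
  intro h0
  simp [h0] at hy

theorem tsupport_fderiv_apply_subset (ψ : Model n → ℝ) (v : Model n) :
    tsupport (fun y ↦ fderiv ℝ ψ y v) ⊆ tsupport ψ := by
  refine closure_minimal ?_ (isClosed_tsupport _)
  intro y hy
  apply support_fderiv_subset (𝕜 := ℝ)
  intro h0
  simp [h0] at hy

theorem hasCompactSupport_fderiv_apply {ψ : Model n → ℝ} (h : HasCompactSupport ψ) (v : Model n) :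
    HasCompactSupport (fun y ↦ fderiv ℝ ψ y v) :=
  h.of_isClosed_subset (isClosed_tsupport _) (tsupport_fderiv_apply_subset ψ v)

theorem contDiff_fderiv_apply {ψ : Model n → ℝ} (h : ContDiff ℝ ∞ ψ) (v : Model n) :
    ContDiff ℝ ∞ (fun y ↦ fderiv ℝ ψ y v) :=
  (h.fderiv_right (m := ∞) (by simp)).clm_apply contDiff_const

namespace WeakDeriv

theorem integrable_fderiv_smul (h : WeakDeriv R v f d) (hR : IsOpen R) {ψ : Model n → ℝ}
    (hψ : ContDiff ℝ ∞ ψ) (hc : HasCompactSupport ψ) (hs : tsupport ψ ⊆ R) (w : Model n) :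
    Integrable (fun y ↦ fderiv ℝ ψ y w • f y) :=
  integrable_smul_of_locallyIntegrableOn h.loc hR (contDiff_fderiv_apply hψ w).continuous
    (hasCompactSupport_fderiv_apply hc w) ((tsupport_fderiv_apply_subset ψ w).trans hs)

theorem integrable_smul_deriv (h : WeakDeriv R v f d) (hR : IsOpen R) {ψ : Model n → ℝ}
    (hψ : ContDiff ℝ ∞ ψ) (hc : HasCompactSupport ψ) (hs : tsupport ψ ⊆ R) :
    Integrable (fun y ↦ ψ y • d y) :=
  integrable_smul_of_locallyIntegrableOn h.loc_deriv hR hψ.continuous hc hs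

theorem mono (h : WeakDeriv R v f d) (hR : R₁ ⊆ R) : WeakDeriv R₁ v f d :=
  ⟨h.loc.mono_set hR, h.loc_deriv.mono_set hR, fun ψ h1 h2 h3 ↦ h.eq ψ h1 h2 (h3.trans hR)⟩

/-- Test functions and their gradients vanish off R, so values outside R play no role in the
integrals over the whole space. -/
theorem congr (h : WeakDeriv R v f d) (hR : IsOpen R) (hf : Set.EqOn f f₁ R)
    (hd : Set.EqOn d d₁ R) : WeakDeriv R v f₁ d₁ := by
  refine ⟨?_, ?_, fun ψ h1 h2 h3 ↦ ?_⟩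
  · rw [locallyIntegrableOn_iff_compact hR]
    intro K hK hKc
    exact ((locallyIntegrableOn_iff_compact hR).1 h.loc K hK hKc).congr_fun_ae
      ((ae_restrict_iff' hKc.measurableSet).2 (.of_forall fun y hy ↦ hf (hK hy)))
  · rw [locallyIntegrableOn_iff_compact hR]
    intro K hK hKc
    exact ((locallyIntegrableOn_iff_compact hR).1 h.loc_deriv K hK hKc).congr_fun_ae
      ((ae_restrict_iff' hKc.measurableSet).2 (.of_forall fun y hy ↦ hd (hK hy)))
  · have e1 : ∀ y, fderiv ℝ ψ y v • f₁ y = fderiv ℝ ψ y v • f y := fun y ↦ by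
      by_cases hy : y ∈ R
      · rw [hf hy]
      · have : fderiv ℝ ψ y v = 0 := image_eq_zero_of_notMem_tsupport (f := fun y ↦ fderiv ℝ ψ y v)
          fun h ↦ hy (h3 (tsupport_fderiv_apply_subset ψ v h))
        simp [this]
    have e2 : ∀ y, ψ y • d₁ y = ψ y • d y := fun y ↦ by
      by_cases hy : y ∈ R
      · rw [hd hy]
      · have : ψ y = 0 := image_eq_zero_of_notMem_tsupport fun h ↦ hy (h3 h)
        simp [this]
    simp_rw [e1, e2]
    exact h.eq ψ h1 h2 h3

theorem zero : WeakDeriv R v (0 : Model n → 𝕜) 0 :=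
  ⟨locallyIntegrableOn_zero, locallyIntegrableOn_zero, fun ψ _ _ _ ↦ by simp⟩

theorem add (h₁ : WeakDeriv R v f₁ d₁) (h₂ : WeakDeriv R v f₂ d₂) (hR : IsOpen R) :
    WeakDeriv R v (f₁ + f₂) (d₁ + d₂) := by
  refine ⟨h₁.loc.add h₂.loc, h₁.loc_deriv.add h₂.loc_deriv, fun ψ a b c ↦ ?_⟩
  simp only [Pi.add_apply, smul_add]
  rw [integral_add (h₁.integrable_fderiv_smul hR a b c v) (h₂.integrable_fderiv_smul hR a b c v),
    integral_add (h₁.integrable_smul_deriv hR a b c) (h₂.integrable_smul_deriv hR a b c),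
    h₁.eq ψ a b c, h₂.eq ψ a b c]
  ring

theorem sum {ι : Type*} (s : Finset ι) {f d : ι → Model n → 𝕜} (hR : IsOpen R)
    (h : ∀ i ∈ s, WeakDeriv R v (f i) (d i)) :
    WeakDeriv R v (fun y ↦ ∑ i ∈ s, f i y) (fun y ↦ ∑ i ∈ s, d i y) := by
  classical
  induction s using Finset.induction_on with
  | empty =>
    simp only [Finset.sum_empty]
    exact zero
  | insert i s hi ih =>
    simp only [Finset.sum_insert hi]
    exact (h i (Finset.mem_insert_self i s)).add
      (ih fun j hj ↦ h j (Finset.mem_insert_of_mem hj)) hR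

end WeakDeriv

/-- Off U the function vanishes on a neighbourhood of each point, because the complement of K is
open. -/
theorem contDiff_of_contDiffOn_of_closed {F : Type*} [NormedAddCommGroup F] [NormedSpace ℝ F]
    {U K : Set (Model n)} {a : Model n → F} (hU : IsOpen U) (hK : IsClosed K) (hKU : K ⊆ U)
    (ha : ContDiffOn ℝ ∞ a U) (h0 : ∀ y ∉ K, a y = 0) : ContDiff ℝ ∞ a := by
  rw [contDiff_iff_contDiffAt]
  intro y
  by_cases hy : y ∈ U
  · exact (ha y hy).contDiffAt (hU.mem_nhds hy)
  · have : a =ᶠ[𝓝 y] fun _ ↦ 0 := by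
      filter_upwards [hK.isOpen_compl.mem_nhds (fun h ↦ hy (hKU h))] with z hz using h0 z hz
    exact contDiffAt_const.congr_of_eventuallyEq this

/-- The product of a test function and a function that is smooth near its support. -/
theorem contDiff_mul_of_tsupport_subset {ψ a : Model n → ℝ} (hR : IsOpen R)
    (hψ : ContDiff ℝ ∞ ψ) (hs : tsupport ψ ⊆ R) (ha : ContDiffOn ℝ ∞ a R) :
    ContDiff ℝ ∞ (fun y ↦ ψ y * a y) :=
  contDiff_of_contDiffOn_of_closed hR (isClosed_tsupport ψ) hs (hψ.contDiffOn.mul ha)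
    fun y hy ↦ by simp [image_eq_zero_of_notMem_tsupport hy]

namespace WeakDeriv

theorem _root_.MeasureTheory.LocallyIntegrableOn.smul_contDiffOn (hf : LocallyIntegrableOn f R)
    (hR : IsOpen R) {a : Model n → ℝ} (ha : ContinuousOn a R) :
    LocallyIntegrableOn (fun y ↦ a y • f y) R := by
  rw [locallyIntegrableOn_iff_compact hR] at hf ⊢
  intro K hK hKc
  exact (hf K hK hKc).continuousOn_smul (ha.mono hK) hKc

theorem continuousOn_fderiv_apply (hR : IsOpen R) {a : Model n → ℝ} (ha : ContDiffOn ℝ ∞ a R)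
    (v : Model n) : ContinuousOn (fun y ↦ fderiv ℝ a y v) R :=
  (ha.continuousOn_fderiv_of_isOpen hR (by simp)).clm_apply continuousOn_const

/-- If ψ is a test function on R then so is ψ a, although a is smooth on R only; testing with it
gives the product rule. -/
theorem smul (h : WeakDeriv R v f d) (hR : IsOpen R) {a : Model n → ℝ} (ha : ContDiffOn ℝ ∞ a R) :
    WeakDeriv R v (fun y ↦ a y • f y) (fun y ↦ a y • d y + fderiv ℝ a y v • f y) := by
  have l1 := h.loc.smul_contDiffOn hR ha.continuousOn
  have l2 := h.loc_deriv.smul_contDiffOn hR ha.continuousOn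
  have l3 := h.loc.smul_contDiffOn hR (continuousOn_fderiv_apply hR ha v)
  refine ⟨l1, l2.add l3, fun ψ hψ hc hs ↦ ?_⟩
  have hψa := contDiff_mul_of_tsupport_subset hR hψ hs ha
  have hca : HasCompactSupport (fun y ↦ ψ y * a y) := hc.mul_right
  have hsa : tsupport (fun y ↦ ψ y * a y) ⊆ R := (tsupport_mul_subset_left).trans hs
  have key := h.eq _ hψa hca hsa
  have i2 := integrable_smul_of_locallyIntegrableOn l2 hR hψ.continuous hc hs
  have i3 := integrable_smul_of_locallyIntegrableOn l3 hR hψ.continuous hc hs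
  have i1 := integrable_smul_of_locallyIntegrableOn l1 hR (contDiff_fderiv_apply hψ v).continuous
    (hasCompactSupport_fderiv_apply hc v) ((tsupport_fderiv_apply_subset ψ v).trans hs)
  have e : ∀ y, fderiv ℝ (fun y ↦ ψ y * a y) y v • f y =
      fderiv ℝ ψ y v • a y • f y + ψ y • fderiv ℝ a y v • f y := by
    intro y
    by_cases hy : y ∈ R
    · have da : DifferentiableAt ℝ a y :=
        ((ha y hy).contDiffAt (hR.mem_nhds hy)).differentiableAt (by simp)
      have dψ : DifferentiableAt ℝ ψ y := hψ.differentiable (by simp) y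
      rw [fderiv_fun_mul dψ da]
      simp only [add_apply, _root_.smul_apply, smul_eq_mul, add_smul, mul_smul]
      rw [smul_comm (a y), add_comm]
    · have hy' : y ∉ tsupport ψ := fun h ↦ hy (hs h)
      have h1 : fderiv ℝ (fun y ↦ ψ y * a y) y v = 0 :=
        image_eq_zero_of_notMem_tsupport (f := fun z ↦ fderiv ℝ (fun y ↦ ψ y * a y) z v)
          fun h ↦ hy (hsa (tsupport_fderiv_apply_subset _ v h))
      have h2 : fderiv ℝ ψ y v = 0 := image_eq_zero_of_notMem_tsupport
        (f := fun y ↦ fderiv ℝ ψ y v) fun h ↦ hy' (tsupport_fderiv_apply_subset ψ v h)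
      simp [h1, h2, image_eq_zero_of_notMem_tsupport hy']
  simp_rw [e] at key
  rw [integral_add i1 i3] at key
  simp_rw [smul_add]
  rw [integral_add i2 i3]
  simp_rw [mul_smul] at key
  linear_combination key

/-- Weak derivatives are determined almost everywhere. -/
theorem ae_unique (h₁ : WeakDeriv R v f d₁) (h₂ : WeakDeriv R v f d₂) (hR : IsOpen R) :
    ∀ᵐ y, y ∈ R → d₁ y = d₂ y := by
  have := hR.ae_eq_zero_of_integral_contDiff_smul_eq_zero (μ := volume)
    (f := d₁ - d₂) (h₁.loc_deriv.sub h₂.loc_deriv) (fun ψ a b c ↦ by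
      simp only [Pi.sub_apply, smul_sub]
      rw [integral_sub (h₁.integrable_smul_deriv hR a b c) (h₂.integrable_smul_deriv hR a b c)]
      linear_combination h₁.eq ψ a b c - h₂.eq ψ a b c)
  filter_upwards [this] with y hy hyR
  exact sub_eq_zero.1 (hy hyR)

/-- A weak derivative on two open sets is a weak derivative on the union. -/
theorem union (h₁ : WeakDeriv R₁ v f d) (h₂ : WeakDeriv R₂ v f d) (hR₁ : IsOpen R₁)
    (hR₂ : IsOpen R₂) : WeakDeriv (R₁ ∪ R₂) v f d := by
  have hl : ∀ g : Model n → 𝕜, LocallyIntegrableOn g R₁ → LocallyIntegrableOn g R₂ →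
      LocallyIntegrableOn g (R₁ ∪ R₂) := by
    intro g h1 h2 y hy
    rw [(hR₁.union hR₂).nhdsWithin_eq hy]
    rcases hy with hy | hy
    · rw [← hR₁.nhdsWithin_eq hy]; exact h1 y hy
    · rw [← hR₂.nhdsWithin_eq hy]; exact h2 y hy
  refine ⟨hl _ h₁.loc h₂.loc, hl _ h₁.loc_deriv h₂.loc_deriv, fun ψ hψ hc hs ↦ ?_⟩
  -- A test function on the union is split into one test function for each of the two open sets.
  obtain ⟨p, hp⟩ := SmoothPartitionOfUnity.exists_isSubordinate 𝓘(ℝ, Model n)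
    (isClosed_tsupport ψ) (fun b : Bool ↦ if b then R₁ else R₂)
    (by intro b; cases b <;> simpa) (by
      intro y hy
      rcases hs hy with h | h
      · exact Set.mem_iUnion.2 ⟨true, by simpa⟩
      · exact Set.mem_iUnion.2 ⟨false, by simpa⟩)
  have hpc : ∀ b, ContDiff ℝ ∞ (fun y ↦ p b y * ψ y) := fun b ↦
    (p b).contMDiff.contDiff.mul hψ
  have hpk : ∀ b, HasCompactSupport (fun y ↦ p b y * ψ y) := fun b ↦ hc.mul_left
  have hps : ∀ b, tsupport (fun y ↦ p b y * ψ y) ⊆ if b then R₁ else R₂ := fun b ↦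
    tsupport_mul_subset_left.trans (hp b)
  have hsum : ψ = fun y ↦ p true y * ψ y + p false y * ψ y := by
    funext y
    by_cases hy : y ∈ tsupport ψ
    · have := p.sum_eq_one hy
      rw [finsum_eq_sum_of_fintype, Fintype.sum_bool] at this
      rw [← add_mul, this, one_mul]
    · simp [image_eq_zero_of_notMem_tsupport hy]
  have ht := h₁.eq _ (hpc true) (hpk true) (by simpa using hps true)
  have hf := h₂.eq _ (hpc false) (hpk false) (by simpa using hps false)
  have it := h₁.integrable_fderiv_smul hR₁ (hpc true) (hpk true) (by simpa using hps true) v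
  have jf := h₂.integrable_fderiv_smul hR₂ (hpc false) (hpk false) (by simpa using hps false) v
  have it' := h₁.integrable_smul_deriv hR₁ (hpc true) (hpk true) (by simpa using hps true)
  have jf' := h₂.integrable_smul_deriv hR₂ (hpc false) (hpk false) (by simpa using hps false)
  have e1 : ∀ y, fderiv ℝ ψ y v • f y = fderiv ℝ (fun y ↦ p true y * ψ y) y v • f y +
      fderiv ℝ (fun y ↦ p false y * ψ y) y v • f y := by
    intro y
    conv_lhs => rw [hsum]
    rw [fderiv_fun_add ((hpc true).differentiable (by simp) y)
      ((hpc false).differentiable (by simp) y), add_apply, add_smul]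
  have e2 : ∀ y, ψ y • d y = (p true y * ψ y) • d y + (p false y * ψ y) • d y := by
    intro y
    rw [← add_smul]
    congr 1
    exact congrFun hsum y
  simp_rw [e1, e2]
  rw [integral_add it jf, integral_add it' jf', ht, hf]
  ring

/-- Extension by zero of a function with relatively closed support. -/
theorem extend_zero {K : Set (Model n)} (h : WeakDeriv R v f d) (hR : IsOpen R)
    (hK : IsOpen (R₁ \ K)) (hsub : R₁ ∩ K ⊆ R) (hf : ∀ y ∈ R₁ \ K, f y = 0)
    (hd : ∀ y ∈ R₁ \ K, d y = 0) : WeakDeriv R₁ v f d := by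
  have h0 : WeakDeriv (R₁ \ K) v f d :=
    (zero : WeakDeriv (R₁ \ K) v (0 : Model n → 𝕜) 0).congr hK (fun y hy ↦ (hf y hy).symm)
      (fun y hy ↦ (hd y hy).symm)
  -- R and the part of R₁ off K cover R₁, and on the latter everything vanishes.
  refine (h.union h0 hR hK).mono fun y hy ↦ ?_
  by_cases hyK : y ∈ K
  · exact Or.inl (hsub ⟨hy, hyK⟩)
  · exact Or.inr ⟨hy, hyK⟩

end WeakDeriv

end WeakDerivatives

end ScKorn

end


noncomputable section

namespace ScKorn

/-! ### Weak derivatives under diffeomorphisms. -/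

section ChangeOfVariables

variable {n : ℕ} {𝕜 : Type*} [RCLike 𝕜]

theorem clm_det_eq (A : Model n →L[ℝ] Model n) :
    A.det = (Matrix.of fun i j ↦ (A (stdVec n j)) i).det := by
  rw [ContinuousLinearMap.det, ← LinearMap.det_toMatrix (EuclideanSpace.basisFun (Fin n) ℝ).toBasis]
  congr 1

theorem contDiff_det : ContDiff ℝ ∞ (fun A : Model n →L[ℝ] Model n ↦ A.det) := by
  simp_rw [clm_det_eq]
  simp_rw [Matrix.det_apply]
  refine ContDiff.sum fun σ _ ↦ ContDiff.const_smul _ (contDiff_prod fun i _ ↦ ?_)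
  simp only [Matrix.of_apply]
  have h : ContDiff ℝ ∞ (fun A : Model n →L[ℝ] Model n ↦ A (stdVec n i)) :=
    contDiff_id.clm_apply contDiff_const
  exact (EuclideanSpace.proj (𝕜 := ℝ) (σ i)).contDiff.comp h

theorem integral_fderiv_apply_eq_zero {ψ : Model n → ℝ} (hψ : ContDiff ℝ ∞ ψ)
    (hc : HasCompactSupport ψ) (v : Model n) : ∫ y, fderiv ℝ ψ y v = 0 := by
  have h1 : Integrable (fun y ↦ fderiv ℝ ψ y v) :=
    (contDiff_fderiv_apply hψ v).continuous.integrable_of_hasCompactSupport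
      (hasCompactSupport_fderiv_apply hc v)
  have h := integral_mul_fderiv_eq_neg_fderiv_mul_of_integrable (𝕜 := ℝ) (μ := volume)
    (f := fun _ : Model n ↦ (1 : ℝ)) (g := ψ) (v := v) (by simp) (by simpa using h1)
    (by simpa using hψ.continuous.integrable_of_hasCompactSupport hc)
    (fun y _ ↦ by fun_prop) (fun y _ ↦ hψ.differentiable (by simp) y)
  simpa using h

theorem stdVec_apply (i j : Fin n) : stdVec n i j = if j = i then 1 else 0 := by
  simp [stdVec]

theorem sum_smul_stdVec (v : Model n) : ∑ l, v l • stdVec n l = v := by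
  ext j
  simp [stdVec_apply, Finset.sum_apply]

theorem clm_eq_sum {F : Type*} [NormedAddCommGroup F] [NormedSpace ℝ F] (A : Model n →L[ℝ] F)
    (v : Model n) : A v = ∑ l, v l • A (stdVec n l) := by
  conv_lhs => rw [← sum_smul_stdVec v]
  simp

theorem integral_mul_fderiv_apply {η ψ : Model n → ℝ} (hη : ContDiff ℝ ∞ η)
    (hψ : ContDiff ℝ ∞ ψ) (hc : HasCompactSupport ψ) (v : Model n) :
    ∫ y, η y * fderiv ℝ ψ y v = - ∫ y, fderiv ℝ η y v * ψ y := by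
  refine integral_mul_fderiv_eq_neg_fderiv_mul_of_integrable (𝕜 := ℝ) (μ := volume) ?_ ?_ ?_
    (fun y _ ↦ hη.differentiable (by simp) y) (fun y _ ↦ hψ.differentiable (by simp) y)
  · exact ((contDiff_fderiv_apply hη v).continuous.mul
      hψ.continuous).integrable_of_hasCompactSupport hc.mul_left
  · exact (hη.continuous.mul (contDiff_fderiv_apply hψ v).continuous).integrable_of_hasCompactSupport
      (hasCompactSupport_fderiv_apply hc v).mul_left
  · exact (hη.continuous.mul hψ.continuous).integrable_of_hasCompactSupport hc.mul_left

variable {R : Set (Model n)} {f : Model n → 𝕜} {τ : OpenPartialHomeomorph (Model n) (Model n)}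

theorem symm_image_eq (hR : R ⊆ τ.target) : τ.symm '' R = τ.source ∩ τ ⁻¹' R := by
  rw [τ.symm_image_eq_source_inter_preimage hR]

theorem hasFDerivAt_symm (hσ : ContDiffOn ℝ ∞ τ.symm τ.target) {x : Model n} (hx : x ∈ τ.target) :
    HasFDerivAt τ.symm (fderiv ℝ τ.symm x) x :=
  (((hσ x hx).contDiffAt (τ.open_target.mem_nhds hx)).differentiableAt (by simp)).hasFDerivAt

theorem hasFDerivAt_of_source (hτ : ContDiffOn ℝ ∞ τ τ.source) {x : Model n} (hx : x ∈ τ.source) :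
    HasFDerivAt τ (fderiv ℝ τ x) x :=
  (((hτ x hx).contDiffAt (τ.open_source.mem_nhds hx)).differentiableAt (by simp)).hasFDerivAt

theorem fderiv_symm_comp (hτ : ContDiffOn ℝ ∞ τ τ.source) (hσ : ContDiffOn ℝ ∞ τ.symm τ.target)
    {x : Model n} (hx : x ∈ τ.source) :
    (fderiv ℝ τ.symm (τ x)).comp (fderiv ℝ τ x) = ContinuousLinearMap.id ℝ _ := by
  have h1 := (hasFDerivAt_symm hσ (τ.map_source hx)).comp x (hasFDerivAt_of_source hτ hx)
  refine h1.unique ((hasFDerivAt_id x).congr_of_eventuallyEq ?_)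
  filter_upwards [τ.open_source.mem_nhds hx] with y hy
  simp [τ.left_inv hy]

theorem fderiv_comp_symm (hτ : ContDiffOn ℝ ∞ τ τ.source) (hσ : ContDiffOn ℝ ∞ τ.symm τ.target)
    {x : Model n} (hx : x ∈ τ.target) :
    (fderiv ℝ τ (τ.symm x)).comp (fderiv ℝ τ.symm x) = ContinuousLinearMap.id ℝ _ := by
  have := fderiv_symm_comp (τ := τ.symm) (by simpa using hσ) (by simpa using hτ) (x := x)
    (by simpa using hx)
  simpa using this

theorem det_fderiv_symm_ne_zero (hτ : ContDiffOn ℝ ∞ τ τ.source)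
    (hσ : ContDiffOn ℝ ∞ τ.symm τ.target) {x : Model n} (hx : x ∈ τ.target) :
    (fderiv ℝ τ.symm x).det ≠ 0 := by
  have h := congrArg (fun A : Model n →L[ℝ] Model n ↦ A.det) (fderiv_comp_symm hτ hσ hx)
  simp only [ContinuousLinearMap.det,
    ContinuousLinearMap.coe_id, LinearMap.det_id] at h
  intro h0
  simp only [ContinuousLinearMap.det] at h0
  simp [h0] at h

theorem contDiffOn_abs_det_symm (hτ : ContDiffOn ℝ ∞ τ τ.source)
    (hσ : ContDiffOn ℝ ∞ τ.symm τ.target) :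
    ContDiffOn ℝ ∞ (fun x ↦ |(fderiv ℝ τ.symm x).det|) τ.target := by
  have h1 : ContDiffOn ℝ ∞ (fun x ↦ (fderiv ℝ τ.symm x).det) τ.target :=
    contDiff_det.comp_contDiffOn (hσ.fderiv_of_isOpen τ.open_target (by simp))
  exact fun x hx ↦ (h1 x hx).abs (det_fderiv_symm_ne_zero hτ hσ hx)

theorem setIntegral_preimage_eq (hσ : ContDiffOn ℝ ∞ τ.symm τ.target) (hR : R ⊆ τ.target)
    (hRo : IsOpen R) (G : Model n → 𝕜) :
    ∫ y in τ.source ∩ τ ⁻¹' R, G y = ∫ x in R, |(fderiv ℝ τ.symm x).det| • G (τ.symm x) := by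
  rw [← symm_image_eq hR]
  exact integral_image_eq_integral_abs_det_fderiv_smul _ hRo.measurableSet
    (fun x hx ↦ (hasFDerivAt_symm hσ (hR hx)).hasFDerivWithinAt)
    (τ.symm.injOn.mono (by simpa using hR)) G

/-- The change of variables over a compact set produces the Jacobian determinant as a factor; it is
continuous and has no zeros, so it can be divided out. -/
theorem LocallyIntegrableOn.comp_diffeo (hτ : ContDiffOn ℝ ∞ τ τ.source)
    (hσ : ContDiffOn ℝ ∞ τ.symm τ.target) (hRo : IsOpen R)
    (hf : LocallyIntegrableOn f R) :
    LocallyIntegrableOn (fun y ↦ f (τ y)) (τ.source ∩ τ ⁻¹' R) := by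
  have ho : IsOpen (τ.source ∩ τ ⁻¹' R) := τ.isOpen_inter_preimage hRo
  rw [locallyIntegrableOn_iff_compact ho]
  rw [locallyIntegrableOn_iff_compact hRo] at hf
  intro K hK hKc
  have hKs : K ⊆ τ.source := fun y hy ↦ (hK hy).1
  have h1 := hf (τ '' K) (by rintro _ ⟨y, hy, rfl⟩; exact (hK hy).2)
    (hKc.image_of_continuousOn (τ.continuousOn.mono hKs))
  rw [integrableOn_image_iff_integrableOn_abs_det_fderiv_smul volume hKc.measurableSet
    (fun x hx ↦ (hasFDerivAt_of_source hτ (hKs hx)).hasFDerivWithinAt) (τ.injOn.mono hKs)] at h1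
  have hne : ∀ y ∈ τ.source, (fderiv ℝ τ y).det ≠ 0 := fun y hy ↦ by
    have := det_fderiv_symm_ne_zero (τ := τ.symm) (by simpa using hσ) (by simpa using hτ)
      (x := y) (by simpa using hy)
    simpa using this
  have hcont : ContinuousOn (fun y ↦ |(fderiv ℝ τ y).det|⁻¹) K := by
    refine ContinuousOn.inv₀ ?_ fun y hy ↦ abs_ne_zero.2 (hne y (hKs hy))
    exact ((ContinuousLinearMap.continuous_det.comp_continuousOn
      (hτ.continuousOn_fderiv_of_isOpen τ.open_source (by simp))).abs).mono hKs
  refine (h1.continuousOn_smul hcont hKc).congr_fun (fun y hy ↦ ?_) hKc.measurableSet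
  simp only [smul_smul]
  rw [inv_mul_cancel₀ (abs_ne_zero.2 (hne y (hKs hy))), one_smul]

variable {ψ : Model n → ℝ}

/-- Transports a test function to the other coordinates. The indicator discards the meaningless
values of `τ.symm` outside R. -/
theorem contDiff_indicator_comp_symm (hσ : ContDiffOn ℝ ∞ τ.symm τ.target) (hR : R ⊆ τ.target)
    (hRo : IsOpen R) (hψ : ContDiff ℝ ∞ ψ) (hc : HasCompactSupport ψ)
    (hs : tsupport ψ ⊆ τ.source ∩ τ ⁻¹' R) :
    ContDiff ℝ ∞ (R.indicator fun x ↦ ψ (τ.symm x)) ∧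
      HasCompactSupport (R.indicator fun x ↦ ψ (τ.symm x)) ∧
      tsupport (R.indicator fun x ↦ ψ (τ.symm x)) ⊆ R := by
  have hK : IsCompact (τ '' tsupport ψ) :=
    hc.isCompact.image_of_continuousOn (τ.continuousOn.mono fun y hy ↦ (hs hy).1)
  have hKR : τ '' tsupport ψ ⊆ R := by rintro _ ⟨y, hy, rfl⟩; exact (hs hy).2
  have h0 : ∀ x ∉ τ '' tsupport ψ, R.indicator (fun x ↦ ψ (τ.symm x)) x = 0 := by
    intro x hx
    by_cases hxR : x ∈ R
    · rw [Set.indicator_of_mem hxR]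
      refine image_eq_zero_of_notMem_tsupport fun h ↦ hx ⟨_, h, τ.right_inv (hR hxR)⟩
    · exact Set.indicator_of_notMem hxR _
  have hts : tsupport (R.indicator fun x ↦ ψ (τ.symm x)) ⊆ τ '' tsupport ψ :=
    closure_minimal (fun x hx ↦ by_contra fun h ↦ hx (h0 x h)) hK.isClosed
  refine ⟨contDiff_of_contDiffOn_of_closed hRo hK.isClosed hKR ?_ h0,
    hK.of_isClosed_subset (isClosed_tsupport _) hts, hts.trans hKR⟩
  exact (hψ.comp_contDiffOn (hσ.mono hR)).congr fun x hx ↦ Set.indicator_of_mem hx _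

/-- The identity `∑ ∂_l (∂_v τ^l ψ |det|) = (∂_v ψ) |det|` in the new coordinates. -/
theorem ae_divergence_eq (hτ : ContDiffOn ℝ ∞ τ τ.source)
    (hσ : ContDiffOn ℝ ∞ τ.symm τ.target) (hR : R ⊆ τ.target) (hRo : IsOpen R)
    (hψ : ContDiff ℝ ∞ ψ) (hc : HasCompactSupport ψ) (hs : tsupport ψ ⊆ τ.source ∩ τ ⁻¹' R)
    (v : Model n) (Ψ : Fin n → Model n → ℝ) (hΨ : ∀ l x, Ψ l x =
      R.indicator (fun x ↦ ψ (τ.symm x)) x *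
        (fderiv ℝ τ (τ.symm x) v l * |(fderiv ℝ τ.symm x).det|))
    (hΨs : ∀ l, ContDiff ℝ ∞ (Ψ l)) (hΨc : ∀ l, HasCompactSupport (Ψ l)) :
    ∀ᵐ x, ∑ l, fderiv ℝ (Ψ l) x (stdVec n l) =
      R.indicator (fun x ↦ |(fderiv ℝ τ.symm x).det| • fderiv ℝ ψ (τ.symm x) v) x := by
  have hψv := contDiff_indicator_comp_symm hσ hR hRo (contDiff_fderiv_apply hψ v)
    (hasCompactSupport_fderiv_apply hc v) ((tsupport_fderiv_apply_subset ψ v).trans hs)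
  have hQ : (R.indicator fun x ↦ |(fderiv ℝ τ.symm x).det| • fderiv ℝ ψ (τ.symm x) v) =
      fun x ↦ R.indicator (fun x ↦ fderiv ℝ ψ (τ.symm x) v) x * |(fderiv ℝ τ.symm x).det| := by
    funext x
    by_cases hx : x ∈ R
    · simp [hx, mul_comm]
    · simp [hx]
  have hQc : ContDiff ℝ ∞ (fun x ↦ R.indicator (fun x ↦ fderiv ℝ ψ (τ.symm x) v) x *
      |(fderiv ℝ τ.symm x).det|) :=
    contDiff_mul_of_tsupport_subset hRo hψv.1 hψv.2.2 ((contDiffOn_abs_det_symm hτ hσ).mono hR)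
  rw [hQ]
  -- No derivative of the Jacobian determinant is computed. Both sides are tested against η, the
  -- derivative on the left is moved to η, and in the old coordinates the claim becomes that the
  -- integral of the derivative of ψ · (η ∘ τ) along v is zero.
  refine ae_eq_of_integral_contDiff_smul_eq ?_ ?_ ?_
  · exact (continuous_finsetSum _ fun l _ ↦
      (contDiff_fderiv_apply (hΨs l) _).continuous).locallyIntegrable
  · exact hQc.continuous.locallyIntegrable
  intro η hη hηc
  simp_rw [smul_eq_mul, Finset.mul_sum]
  have hi0 : ∀ l, Integrable (fun x ↦ η x * fderiv ℝ (Ψ l) x (stdVec n l)) := fun l ↦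
    (hη.continuous.mul
      (contDiff_fderiv_apply (hΨs l) _).continuous).integrable_of_hasCompactSupport hηc.mul_right
  have hi0' : ∀ l, Integrable (fun x ↦ fderiv ℝ η x (stdVec n l) * Ψ l x) := fun l ↦
    ((contDiff_fderiv_apply hη _).continuous.mul
    (hΨs l).continuous).integrable_of_hasCompactSupport (hΨc l).mul_left
  rw [integral_finsetSum _ fun l _ ↦ hi0 l]
  simp_rw [integral_mul_fderiv_apply hη (hΨs _) (hΨc _)]
  rw [Finset.sum_neg_distrib, ← integral_finsetSum _ fun l _ ↦ hi0' l]
  have ho : IsOpen (τ.source ∩ τ ⁻¹' R) := τ.isOpen_inter_preimage hRo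
  have hητ : ContDiffOn ℝ ∞ (fun y ↦ η (τ y)) (τ.source ∩ τ ⁻¹' R) :=
    hη.comp_contDiffOn (hτ.mono Set.inter_subset_left)
  have hP := contDiff_mul_of_tsupport_subset ho hψ hs hητ
  have hint := integral_fderiv_apply_eq_zero hP hc.mul_right v
  have hsP : tsupport (fun y ↦ ψ y * η (τ y)) ⊆ τ.source ∩ τ ⁻¹' R :=
    tsupport_mul_subset_left.trans hs
  have hA : ∫ x, ∑ l, fderiv ℝ η x (stdVec n l) * Ψ l x =
      ∫ y in τ.source ∩ τ ⁻¹' R, ψ y * fderiv ℝ η (τ y) (fderiv ℝ τ y v) := by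
    rw [setIntegral_preimage_eq hσ hR hRo, ← integral_indicator hRo.measurableSet]
    congr 1
    funext x
    by_cases hx : x ∈ R
    · rw [Set.indicator_of_mem hx, τ.right_inv (hR hx),
        clm_eq_sum (fderiv ℝ η x) (fderiv ℝ τ (τ.symm x) v), smul_eq_mul, Finset.mul_sum,
        Finset.mul_sum]
      refine Finset.sum_congr rfl fun l _ ↦ ?_
      rw [hΨ, Set.indicator_of_mem hx, smul_eq_mul]
      ring
    · rw [Set.indicator_of_notMem hx]
      exact Finset.sum_eq_zero fun l _ ↦ by rw [hΨ, Set.indicator_of_notMem hx]; simp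
  have hB : ∫ x, η x * (R.indicator (fun x ↦ fderiv ℝ ψ (τ.symm x) v) x *
      |(fderiv ℝ τ.symm x).det|) =
      ∫ y in τ.source ∩ τ ⁻¹' R, η (τ y) * fderiv ℝ ψ y v := by
    rw [setIntegral_preimage_eq hσ hR hRo, ← integral_indicator hRo.measurableSet]
    congr 1
    funext x
    by_cases hx : x ∈ R
    · rw [Set.indicator_of_mem hx, Set.indicator_of_mem hx, τ.right_inv (hR hx), smul_eq_mul]
      ring
    · rw [Set.indicator_of_notMem hx, Set.indicator_of_notMem hx]; simp
  rw [hA, hB, neg_eq_iff_add_eq_zero, ← hint,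
    ← setIntegral_eq_integral_of_forall_compl_eq_zero (s := τ.source ∩ τ ⁻¹' R)
      (f := fun y ↦ fderiv ℝ (fun y ↦ ψ y * η (τ y)) y v)
      (fun y hy ↦ image_eq_zero_of_notMem_tsupport
        (f := fun z ↦ fderiv ℝ (fun y ↦ ψ y * η (τ y)) z v)
        fun h ↦ hy (hsP (tsupport_fderiv_apply_subset _ v h)))]
  have hder : ∀ y ∈ τ.source ∩ τ ⁻¹' R, fderiv ℝ (fun y ↦ ψ y * η (τ y)) y v =
      ψ y * fderiv ℝ η (τ y) (fderiv ℝ τ y v) + η (τ y) * fderiv ℝ ψ y v := by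
    intro y hy
    have h1 := (hη.differentiable (by simp) (τ y)).hasFDerivAt.comp y
      (hasFDerivAt_of_source hτ hy.1)
    have h2 := ((hψ.differentiable (by simp) y).hasFDerivAt.mul h1).fderiv
    have h3 : (ψ * (η ∘ τ)) = fun y ↦ ψ y * η (τ y) := rfl
    rw [h3] at h2
    rw [h2]
    simp
  have hi1 : IntegrableOn (fun y ↦ ψ y * fderiv ℝ η (τ y) (fderiv ℝ τ y v))
      (τ.source ∩ τ ⁻¹' R) := by
    refine Integrable.integrableOn ?_
    have hcont : ContinuousOn (fun y ↦ fderiv ℝ η (τ y) (fderiv ℝ τ y v))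
        (τ.source ∩ τ ⁻¹' R) := by
      refine ContinuousOn.clm_apply ?_ ?_
      · exact (hη.continuous_fderiv (by simp)).comp_continuousOn
          (τ.continuousOn.mono Set.inter_subset_left)
      · exact ((hτ.continuousOn_fderiv_of_isOpen τ.open_source (by simp)).clm_apply
          continuousOn_const).mono Set.inter_subset_left
    simpa [smul_eq_mul] using integrable_smul_of_locallyIntegrableOn (𝕜 := ℝ)
      (hcont.locallyIntegrableOn ho.measurableSet) ho hψ.continuous hc hs
  have hi2 : IntegrableOn (fun y ↦ η (τ y) * fderiv ℝ ψ y v) (τ.source ∩ τ ⁻¹' R) := by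
    refine Integrable.integrableOn ?_
    have := integrable_smul_of_locallyIntegrableOn (𝕜 := ℝ)
      (hητ.continuousOn.locallyIntegrableOn ho.measurableSet) ho
      (contDiff_fderiv_apply hψ v).continuous (hasCompactSupport_fderiv_apply hc v)
      ((tsupport_fderiv_apply_subset ψ v).trans hs)
    simpa [smul_eq_mul, mul_comm] using this
  rw [setIntegral_congr_fun ho.measurableSet hder, integral_add hi1 hi2]

/-- The chain rule for weak derivatives and diffeomorphisms. -/
theorem WeakDeriv.comp_diffeo (hτ : ContDiffOn ℝ ∞ τ τ.source)
    (hσ : ContDiffOn ℝ ∞ τ.symm τ.target) (hR : R ⊆ τ.target) (hRo : IsOpen R)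
    {d : Fin n → Model n → 𝕜} (h : ∀ l, WeakDeriv R (stdVec n l) f (d l)) (v : Model n)
    (hf : LocallyIntegrableOn f R) :
    WeakDeriv (τ.source ∩ τ ⁻¹' R) v (fun y ↦ f (τ y))
      (fun y ↦ ∑ l, fderiv ℝ τ y v l • d l (τ y)) := by
  have ho : IsOpen (τ.source ∩ τ ⁻¹' R) := τ.isOpen_inter_preimage hRo
  have hAc : ∀ l, ContDiffOn ℝ ∞ (fun y ↦ fderiv ℝ τ y v l) τ.source := fun l ↦
    (EuclideanSpace.proj (𝕜 := ℝ) l).contDiff.comp_contDiffOn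
      ((hτ.fderiv_of_isOpen τ.open_source (m := ∞) (by simp)).clm_apply contDiffOn_const)
  refine ⟨LocallyIntegrableOn.comp_diffeo hτ hσ hRo hf, ?_, fun ψ hψ hc hs ↦ ?_⟩
  · have : ∀ s : Finset (Fin n), LocallyIntegrableOn
        (fun y ↦ ∑ l ∈ s, fderiv ℝ τ y v l • d l (τ y)) (τ.source ∩ τ ⁻¹' R) := by
      intro s
      induction s using Finset.induction_on with
      | empty => simp only [Finset.sum_empty]; exact locallyIntegrableOn_zero
      | insert l s hl ih =>
        simp only [Finset.sum_insert hl]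
        exact ((LocallyIntegrableOn.comp_diffeo hτ hσ hRo (h l).loc_deriv).smul_contDiffOn ho
          ((hAc l).continuousOn.mono Set.inter_subset_left)).add ih
    exact this _
  · obtain ⟨hI1, hI2, hI3⟩ := contDiff_indicator_comp_symm hσ hR hRo hψ hc hs
    have hAσ : ∀ l, ContDiffOn ℝ ∞
        (fun x ↦ fderiv ℝ τ (τ.symm x) v l * |(fderiv ℝ τ.symm x).det|) R := fun l ↦
      (((hAc l).comp hσ fun x hx ↦ τ.map_target hx).mul (contDiffOn_abs_det_symm hτ hσ)).mono hR
    -- The test function for the l-th derivative in the new coordinates carries the chain rule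
    -- coefficient and the Jacobian.
    set Ψ : Fin n → Model n → ℝ := fun l x ↦ R.indicator (fun x ↦ ψ (τ.symm x)) x *
        (fderiv ℝ τ (τ.symm x) v l * |(fderiv ℝ τ.symm x).det|) with hΨ
    have hΨs : ∀ l, ContDiff ℝ ∞ (Ψ l) := fun l ↦
      contDiff_mul_of_tsupport_subset hRo hI1 hI3 (hAσ l)
    have hΨc : ∀ l, HasCompactSupport (Ψ l) := fun l ↦ hI2.mul_right
    have hΨR : ∀ l, tsupport (Ψ l) ⊆ R := fun l ↦ tsupport_mul_subset_left.trans hI3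
    have hae := ae_divergence_eq hτ hσ hR hRo hψ hc hs v Ψ (fun _ _ ↦ rfl) hΨs hΨc
    have key : ∑ l, ∫ x, fderiv ℝ (Ψ l) x (stdVec n l) • f x = - ∑ l, ∫ x, Ψ l x • d l x := by
      rw [← Finset.sum_neg_distrib]
      exact Finset.sum_congr rfl fun l _ ↦ (h l).eq _ (hΨs l) (hΨc l) (hΨR l)
    rw [← integral_finsetSum _ fun l _ ↦
        (h l).integrable_fderiv_smul hRo (hΨs l) (hΨc l) (hΨR l) _,
      ← integral_finsetSum _ fun l _ ↦
        (h l).integrable_smul_deriv hRo (hΨs l) (hΨc l) (hΨR l)] at key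
    have hL : ∫ x, ∑ l, fderiv ℝ (Ψ l) x (stdVec n l) • f x =
        ∫ y, fderiv ℝ ψ y v • f (τ y) := by
      rw [← setIntegral_eq_integral_of_forall_compl_eq_zero (s := τ.source ∩ τ ⁻¹' R)
        (f := fun y ↦ fderiv ℝ ψ y v • f (τ y)) (fun y hy ↦ by
          rw [image_eq_zero_of_notMem_tsupport (f := fun z ↦ fderiv ℝ ψ z v)
            fun h ↦ hy (hs (tsupport_fderiv_apply_subset _ v h)), zero_smul]),
        setIntegral_preimage_eq hσ hR hRo, ← integral_indicator hRo.measurableSet]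
      refine integral_congr_ae ?_
      filter_upwards [hae] with x hx
      rw [← Finset.sum_smul, hx]
      by_cases hxR : x ∈ R
      · rw [Set.indicator_of_mem hxR, Set.indicator_of_mem hxR, τ.right_inv (hR hxR), smul_eq_mul,
          mul_smul]
      · rw [Set.indicator_of_notMem hxR, Set.indicator_of_notMem hxR, zero_smul]
    have hD : ∫ x, ∑ l, Ψ l x • d l x =
        ∫ y, ψ y • ∑ l, fderiv ℝ τ y v l • d l (τ y) := by
      rw [← setIntegral_eq_integral_of_forall_compl_eq_zero (s := τ.source ∩ τ ⁻¹' R)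
        (f := fun y ↦ ψ y • ∑ l, fderiv ℝ τ y v l • d l (τ y)) (fun y hy ↦ by
          rw [image_eq_zero_of_notMem_tsupport fun h ↦ hy (hs h), zero_smul]),
        setIntegral_preimage_eq hσ hR hRo, ← integral_indicator hRo.measurableSet]
      congr 1
      funext x
      by_cases hxR : x ∈ R
      · rw [Set.indicator_of_mem hxR, τ.right_inv (hR hxR), Finset.smul_sum, Finset.smul_sum]
        refine Finset.sum_congr rfl fun l _ ↦ ?_
        simp only [hΨ, Set.indicator_of_mem hxR, smul_smul]
        congr 1
        ring
      · rw [Set.indicator_of_notMem hxR]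
        exact Finset.sum_eq_zero fun l _ ↦ by
          simp only [hΨ, Set.indicator_of_notMem hxR, zero_mul, zero_smul]
    rw [← hL, key, hD]

end ChangeOfVariables

end ScKorn

end


noncomputable section

namespace ScKorn

/-! ### Symmetry of weak second derivatives in L². -/

section Correlation

variable {n : ℕ} {𝕜 : Type*} [RCLike 𝕜]

/-- The correlation `w ↦ ∫ b (y + w) * conj (a y)` of two functions. -/
def corr (a b : Model n → 𝕜) (w : Model n) : 𝕜 := ∫ y, b (y + w) * (starRingEnd 𝕜) (a y)

variable {a b f g d d' : Model n → 𝕜}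

/-- The correlation is the L² inner product of a with the translates of b, and translation is
continuous in L². -/
theorem continuous_corr (ha : MemLp a 2) (hb : MemLp b 2) : Continuous (corr a b) := by
  let T : Model n → C(Model n, Model n) := fun w ↦ ⟨fun y ↦ y + w, by fun_prop⟩
  have hT : Continuous T := by
    refine ContinuousMap.continuous_of_continuous_uncurry _ ?_
    exact (continuous_snd.add continuous_fst : Continuous fun p : Model n × Model n ↦ p.2 + p.1)
  have hm : ∀ w, MeasurePreserving (T w) volume volume := fun w ↦ measurePreserving_add_right volume w
  have hcont : Continuous fun w ↦
      Lp.compMeasurePreserving (T w) (hm w) (hb.toLp b) :=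
    continuous_const.compMeasurePreservingLp hT hm (by simp)
  have heq : corr a b = fun w ↦
      inner 𝕜 (ha.toLp a) (Lp.compMeasurePreserving (T w) (hm w) (hb.toLp b)) := by
    funext w
    rw [L2.inner_def]
    refine integral_congr_ae ?_
    filter_upwards [ha.coeFn_toLp, Lp.coeFn_compMeasurePreserving (hb.toLp b) (hm w),
      (hm w).quasiMeasurePreserving.ae_eq_comp hb.coeFn_toLp] with y h1 h2 h3
    rw [h1, h2, h3, RCLike.inner_apply]
    rfl
  rw [heq]
  exact continuous_const.inner hcont

/-- The joint integrability behind Fubini's theorem: for each w the integral over y is at most the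
sum of the two squared L² norms, and φ has compact support. -/
theorem integrable_corr_kernel (ha : MemLp a 2) (hb : MemLp b 2) {φ : Model n → ℝ}
    (hφ : Continuous φ) (hc : HasCompactSupport φ) :
    Integrable (Function.uncurry fun w y ↦ φ w • (b (y + w) * (starRingEnd 𝕜) (a y)))
      ((volume : Measure (Model n)).prod volume) := by
  have hbm : AEStronglyMeasurable (fun p : Model n × Model n ↦ b (p.2 + p.1))
      ((volume : Measure (Model n)).prod volume) := by
    have h1 : Measure.QuasiMeasurePreserving (fun p : Model n × Model n ↦ p.1 + p.2)
        ((volume : Measure (Model n)).prod volume) volume :=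
      Measure.quasiMeasurePreserving_snd.comp
        (measurePreserving_prod_add (volume : Measure (Model n)) volume).quasiMeasurePreserving
    simpa [add_comm, Function.comp_def] using hb.1.comp_quasiMeasurePreserving h1
  have ham : AEStronglyMeasurable (fun p : Model n × Model n ↦ (starRingEnd 𝕜) (a p.2))
      ((volume : Measure (Model n)).prod volume) :=
    (RCLike.continuous_conj.comp_aestronglyMeasurable ha.1).comp_quasiMeasurePreserving
      Measure.quasiMeasurePreserving_snd
  have hm : AEStronglyMeasurable
      (Function.uncurry fun w y ↦ φ w • (b (y + w) * (starRingEnd 𝕜) (a y)))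
      ((volume : Measure (Model n)).prod volume) :=
    (hφ.comp continuous_fst).aestronglyMeasurable.smul (hbm.mul ham)
  have ia : Integrable (fun y ↦ ‖a y‖ ^ 2) := ha.integrable_norm_pow (by simp)
  have ib : Integrable (fun y ↦ ‖b y‖ ^ 2) := hb.integrable_norm_pow (by simp)
  have hab : ∀ w, Integrable (fun y ↦ b (y + w) * (starRingEnd 𝕜) (a y)) := fun w ↦
    (hb.comp_measurePreserving (measurePreserving_add_right volume w)).integrable_mul ha.star
  rw [integrable_prod_iff hm]
  refine ⟨.of_forall fun w ↦ (hab w).smul (φ w), ?_⟩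
  refine Integrable.mono' (g := fun w ↦ ‖φ w‖ * ((∫ y, ‖b y‖ ^ 2) + ∫ y, ‖a y‖ ^ 2))
    (((hφ.integrable_of_hasCompactSupport hc).norm).mul_const _) hm.norm.integral_prod_right'
    (.of_forall fun w ↦ ?_)
  rw [Real.norm_of_nonneg (integral_nonneg fun y ↦ norm_nonneg _)]
  simp only [Function.uncurry_apply_pair, norm_smul]
  rw [integral_const_mul]
  refine mul_le_mul_of_nonneg_left ?_ (norm_nonneg _)
  have e1 : ∫ y, ‖b y‖ ^ 2 = ∫ y, ‖b (y + w)‖ ^ 2 :=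
    (integral_add_right_eq_self (fun y ↦ ‖b y‖ ^ 2) w).symm
  rw [e1, ← integral_add (ib.comp_add_right w) ia]
  refine integral_mono (hab w).norm ((ib.comp_add_right w).add ia) fun y ↦ ?_
  simp only [norm_mul, RCLike.norm_conj]
  nlinarith [sq_nonneg (‖b (y + w)‖ - ‖a y‖), sq_nonneg (‖b (y + w)‖), sq_nonneg (‖a y‖)]

/-- After Fubini, the inner integral at fixed y tests the weak derivative against the translate of φ
by y. -/
theorem integral_smul_corr_deriv_right (ha : MemLp a 2) (hg : MemLp g 2) (hd : MemLp d 2)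
    {v : Model n} (h : WeakDeriv Set.univ v g d) {φ : Model n → ℝ} (hφ : ContDiff ℝ ∞ φ)
    (hc : HasCompactSupport φ) :
    ∫ w, φ w • corr a d w = - ∫ w, fderiv ℝ φ w v • corr a g w := by
  simp only [corr, ← integral_smul]
  rw [integral_integral_swap (integrable_corr_kernel ha hd hφ.continuous hc),
    integral_integral_swap (integrable_corr_kernel ha hg
      (contDiff_fderiv_apply hφ v).continuous (hasCompactSupport_fderiv_apply hc v)),
    ← integral_neg]
  congr 1
  funext y
  simp_rw [← smul_mul_assoc]
  rw [integral_mul_const, integral_mul_const, ← neg_mul]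
  congr 1
  have hsub : ContDiff ℝ ∞ (fun z ↦ φ (z - y)) := hφ.comp (contDiff_id.sub contDiff_const)
  have hsubc : HasCompactSupport (fun z ↦ φ (z - y)) := by
    simpa [sub_eq_add_neg] using! hc.comp_homeomorph (Homeomorph.addRight (-y))
  have key := h.eq _ hsub hsubc (Set.subset_univ _)
  have e : ∀ z, fderiv ℝ (fun z ↦ φ (z - y)) z v = fderiv ℝ φ (z - y) v := fun z ↦ by
    rw [fderiv_comp_sub]
  simp_rw [e] at key
  rw [← integral_sub_right_eq_self (fun w ↦ φ w • d (y + w)) y,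
    ← integral_sub_right_eq_self (fun w ↦ fderiv ℝ φ w v • g (y + w)) y]
  simp only [add_sub_cancel]
  rw [key, neg_neg]

theorem corr_conj (w : Model n) : corr a b w = (starRingEnd 𝕜) (corr b a (-w)) := by
  simp only [corr]
  rw [← integral_conj, ← integral_add_right_eq_self
    (fun y ↦ (starRingEnd 𝕜) (a (y + -w) * (starRingEnd 𝕜) (b y))) w]
  congr 1
  funext y
  simp [mul_comm]

/-- Follows from the derivative in the other factor by conjugation and w → -w; the reflection of φ
absorbs the minus sign. -/
theorem integral_smul_corr_deriv_left (hb : MemLp b 2) (hf : MemLp f 2) (hd : MemLp d 2)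
    {v : Model n} (h : WeakDeriv Set.univ v f d) {φ : Model n → ℝ} (hφ : ContDiff ℝ ∞ φ)
    (hc : HasCompactSupport φ) :
    ∫ w, φ w • corr d b w = ∫ w, fderiv ℝ φ w v • corr f b w := by
  have hn : ContDiff ℝ ∞ (fun z ↦ φ (-z)) := hφ.comp contDiff_neg
  have hnc : HasCompactSupport (fun z ↦ φ (-z)) := hc.comp_homeomorph (Homeomorph.neg (Model n))
  have key := integral_smul_corr_deriv_right hb hf hd h hn hnc
  have e : ∀ z, fderiv ℝ (fun z ↦ φ (-z)) z v = - fderiv ℝ φ (-z) v := fun z ↦ by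
    have h1 : HasFDerivAt φ (fderiv ℝ φ (-z)) (-z) := (hφ.differentiable (by simp) _).hasFDerivAt
    have h2 := (h1.comp z (hasFDerivAt_id z).neg).fderiv
    simp only [Function.comp_def] at h2
    rw [h2]
    simp
  simp_rw [e, neg_smul, integral_neg, neg_neg] at key
  have t : ∀ (χ : Model n → ℝ) (p : Model n → 𝕜),
      ∫ w, χ w • corr p b w = (starRingEnd 𝕜) (∫ w, χ (-w) • corr b p w) := by
    intro χ p
    rw [← integral_conj, ← integral_neg_eq_self]
    congr 1
    funext w
    rw [corr_conj, neg_neg]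
    simp [RCLike.real_smul_eq_coe_mul]
  rw [t, t, key]

/-- Weak second derivatives commute. -/
theorem integral_deriv_mul_conj_deriv {v w : Model n} {fv fw gv gw : Model n → 𝕜}
    (hf : MemLp f 2) (hg : MemLp g 2) (hfv : MemLp fv 2) (hfw : MemLp fw 2) (hgv : MemLp gv 2)
    (hgw : MemLp gw 2) (dfv : WeakDeriv Set.univ v f fv) (dfw : WeakDeriv Set.univ w f fw)
    (dgv : WeakDeriv Set.univ v g gv) (dgw : WeakDeriv Set.univ w g gw) :
    ∫ y, gw y * (starRingEnd 𝕜) (fv y) = ∫ y, gv y * (starRingEnd 𝕜) (fw y) := by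
  have h1 : ∀ φ : Model n → ℝ, ContDiff ℝ ∞ φ → HasCompactSupport φ →
      ∫ z, φ z • corr fv gw z = ∫ z, φ z • corr fw gv z := by
    intro φ hφ hc
    rw [integral_smul_corr_deriv_right hfv hg hgw dgw hφ hc,
      integral_smul_corr_deriv_right hfw hg hgv dgv hφ hc,
      integral_smul_corr_deriv_left hg hf hfv dfv (contDiff_fderiv_apply hφ w)
        (hasCompactSupport_fderiv_apply hc w),
      integral_smul_corr_deriv_left hg hf hfw dfw (contDiff_fderiv_apply hφ v)
        (hasCompactSupport_fderiv_apply hc v)]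
    congr 1
    congr 1
    funext z
    congr 1
    have hs : IsSymmSndFDerivAt ℝ φ z := (hφ.contDiffAt).isSymmSndFDerivAt (by
      rw [minSmoothness_of_isRCLikeNormedField]
      exact WithTop.coe_le_coe.2 (le_top : (2 : ℕ∞) ≤ ⊤))
    have hd : DifferentiableAt ℝ (fderiv ℝ φ) z :=
      (hφ.fderiv_right (m := ∞) (by simp)).differentiable (by simp) z
    rw [fderiv_clm_apply hd (differentiableAt_const _), fderiv_clm_apply hd
      (differentiableAt_const _)]
    simpa using hs.eq v w
  -- Both correlations are the same second derivative of the correlation of f and g, in the sense of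
  -- distributions. Being continuous they agree everywhere, and their values at 0 are the two
  -- integrals. No approximation by smooth functions is needed.
  have h2 : corr fv gw = corr fw gv :=
    ((continuous_corr hfv hgw).ae_eq_iff_eq volume (continuous_corr hfw hgv)).1
      (ae_eq_of_integral_contDiff_smul_eq (continuous_corr hfv hgw).locallyIntegrable
        (continuous_corr hfw hgv).locallyIntegrable h1)
  simpa [corr] using congrFun h2 0

end Correlation

end ScKorn

end


noncomputable section

namespace ScKorn

/-! ### Korn's inequality on the whole space. -/

section Korn

variable {n m : ℕ} {𝕜 : Type*} [RCLike 𝕜]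

/-- The symmetrization of the components of a tensor. -/
def symComp {ι : Type*} (D : (Fin m → ι) → 𝕜) (L : Fin m → ι) : 𝕜 :=
  ((m.factorial : ℝ)⁻¹) • ∑ σ : Equiv.Perm (Fin m), D (L ∘ σ)

/-- The tensor `f` with components in `L²(R)` has the weak derivative `D` in `L²(R)`; the index of
differentiation is the last one. -/
structure IsH1 (R : Set (Model n)) (f : (Fin m → Fin n) → Model n → 𝕜)
    (D : (Fin (m + 1) → Fin n) → Model n → 𝕜) : Prop where
  memLp : ∀ J, MemLp (f J) 2 (volume.restrict R)
  memLp_deriv : ∀ L, MemLp (D L) 2 (volume.restrict R)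
  deriv : ∀ J k, WeakDeriv R (stdVec n k) (f J) (D (Fin.snoc (α := fun _ ↦ Fin n) J k))

variable {f : (Fin m → Fin n) → Model n → 𝕜} {D : (Fin (m + 1) → Fin n) → Model n → 𝕜}

theorem re_integral_mul_conj_self (A : Model n → 𝕜) :
    RCLike.re (∫ y, A y * (starRingEnd 𝕜) (A y)) = ∫ y, ‖A y‖ ^ 2 := by
  have : ∀ y, A y * (starRingEnd 𝕜) (A y) = ((‖A y‖ ^ 2 : ℝ) : 𝕜) := fun y ↦ by
    rw [RCLike.mul_conj]; push_cast; rfl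
  simp_rw [this]
  rw [integral_ofReal, RCLike.ofReal_re]

theorem MemLp.integrable_mul_conj {A B : Model n → 𝕜} (hA : MemLp A 2) (hB : MemLp B 2) :
    Integrable fun y ↦ A y * (starRingEnd 𝕜) (B y) :=
  hA.integrable_mul hB.star

/-- The derivative of a symmetric tensor is symmetric in the indices of the tensor. -/
theorem IsH1.ae_comp_perm {R : Set (Model n)} (hR : IsOpen R) (h : IsH1 R f D)
    (hs : ∀ J (σ : Equiv.Perm (Fin m)), ∀ y ∈ R, f (J ∘ σ) y = f J y)
    (L : Fin (m + 1) → Fin n) (σ : Equiv.Perm (Fin (m + 1))) (hσ : σ (Fin.last m) = Fin.last m) :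
    ∀ᵐ y, y ∈ R → D (L ∘ σ) y = D L y := by
  -- A permutation that fixes the last index restricts to a permutation of the tensor indices;
  -- uniqueness of weak derivatives then transfers the symmetry of f to D.
  have hσ' : ∀ i : Fin m, ∃ j : Fin m, j.castSucc = σ i.castSucc := fun i ↦ by
    refine Fin.exists_castSucc_eq.2 fun h ↦ ?_
    rw [← hσ] at h
    exact (Fin.castSucc_lt_last i).ne (σ.injective h)
  choose s hs' using hσ'
  have hinj : Function.Injective s := fun i j hij ↦ by
    have := (hs' i).symm.trans ((congrArg Fin.castSucc hij).trans (hs' j))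
    exact Fin.castSucc_injective _ (σ.injective this)
  let ρ : Equiv.Perm (Fin m) := Equiv.ofBijective s (Finite.injective_iff_bijective.1 hinj)
  have h1 := h.deriv (Fin.init L) (L (Fin.last m))
  have h2 := h.deriv (Fin.init L ∘ ρ) (L (Fin.last m))
  have e1 : (Fin.snoc (α := fun _ ↦ Fin n) (Fin.init L) (L (Fin.last m))) = L :=
    Fin.snoc_init_self L
  have e2 : (Fin.snoc (α := fun _ ↦ Fin n) (Fin.init L ∘ ρ) (L (Fin.last m))) = L ∘ σ := by
    funext i
    induction i using Fin.lastCases with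
    | last => simp [hσ]
    | cast i =>
      rw [Fin.snoc_castSucc]
      simp only [Function.comp_apply]
      rw [← hs' i]
      rfl
  rw [e1] at h1
  rw [e2] at h2
  exact (h2.congr hR (fun y hy ↦ hs _ ρ y hy) (fun y _ ↦ rfl)).ae_unique h1 hR

theorem IsH1.memLp_univ (h : IsH1 Set.univ f D) (J) : MemLp (f J) 2 := by
  simpa using h.memLp J

theorem IsH1.memLp_deriv_univ (h : IsH1 Set.univ f D) (L) : MemLp (D L) 2 := by
  simpa using h.memLp_deriv L

/-- Isolates the two indices that the transposition exchanges: q is the first tensor index and p the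
index of differentiation. -/
theorem sum_snoc_cons {A : Type*} [AddCommMonoid A] (G : (Fin (m + 2) → Fin n) → A) :
    ∑ L, G L = ∑ I : Fin m → Fin n, ∑ q : Fin n, ∑ p : Fin n,
      G (Fin.snoc (α := fun _ ↦ Fin n) (Fin.cons (α := fun _ ↦ Fin n) q I) p) := by
  rw [← (Fin.snocEquiv fun _ : Fin (m + 2) ↦ Fin n).sum_comp, Fintype.sum_prod_type_right,
    ← (Fin.consEquiv fun _ : Fin (m + 1) ↦ Fin n).sum_comp, Fintype.sum_prod_type_right]
  rfl

/-- Integration by parts turns the mixed terms into the square of the divergence. -/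
theorem sum_integral_swap_nonneg {f : (Fin (m + 1) → Fin n) → Model n → 𝕜}
    {D : (Fin (m + 2) → Fin n) → Model n → 𝕜} (h : IsH1 Set.univ f D) :
    0 ≤ ∑ L, RCLike.re (∫ y, D (L ∘ Equiv.swap 0 (Fin.last (m + 1))) y *
      (starRingEnd 𝕜) (D L y)) := by
  rw [sum_snoc_cons]
  refine Finset.sum_nonneg fun I _ ↦ ?_
  let N : Fin n → Fin n → (Fin (m + 2) → Fin n) := fun q p ↦
    Fin.snoc (α := fun _ ↦ Fin n) (Fin.cons (α := fun _ ↦ Fin n) q I) p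
  have hsw : ∀ q p, N q p ∘ Equiv.swap 0 (Fin.last (m + 1)) = N p q := by
    intro q p
    funext i
    induction i using Fin.lastCases with
    | last =>
      have : (0 : Fin (m + 2)) = Fin.castSucc 0 := rfl
      simp only [Function.comp_apply, Equiv.swap_apply_right, N]
      rw [Fin.snoc_last, this, Fin.snoc_castSucc, Fin.cons_zero]
    | cast i =>
      induction i using Fin.cases with
      | zero => simp [N]
      | succ i =>
        have h1 : (i.succ.castSucc : Fin (m + 2)) ≠ 0 := by
          rw [← Fin.succ_castSucc]; exact Fin.succ_ne_zero _
        have h2 : (i.succ.castSucc : Fin (m + 2)) ≠ Fin.last (m + 1) :=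
          (Fin.castSucc_lt_last _).ne
        simp only [Function.comp_apply, Equiv.swap_apply_of_ne_of_ne h1 h2, N]
        rw [Fin.snoc_castSucc, Fin.snoc_castSucc, Fin.cons_succ, Fin.cons_succ]
  -- In indices: the integral of ∂_q f_{pI} · conj(∂_p f_{qI}) equals that of ∂_p f_{pI} · conj(∂_q
  -- f_{qI}). Summed over p and q, the right side is the squared norm of the divergence of f at
  -- fixed I.
  have hswap : ∀ q p, ∫ y, D (N q p ∘ Equiv.swap 0 (Fin.last (m + 1))) y *
      (starRingEnd 𝕜) (D (N q p) y) = ∫ y, D (N p p) y * (starRingEnd 𝕜) (D (N q q) y) := by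
    intro q p
    rw [hsw]
    exact integral_deriv_mul_conj_deriv (h.memLp_univ _) (h.memLp_univ _)
      (h.memLp_deriv_univ _) (h.memLp_deriv_univ _) (h.memLp_deriv_univ _) (h.memLp_deriv_univ _)
      (h.deriv _ p) (h.deriv _ q) (h.deriv _ p) (h.deriv _ q)
  change 0 ≤ ∑ q, ∑ p, RCLike.re (∫ y, D (N q p ∘ Equiv.swap 0 (Fin.last (m + 1))) y *
      (starRingEnd 𝕜) (D (N q p) y))
  simp_rw [hswap]
  have : ∑ q, ∑ p, RCLike.re (∫ y, D (N p p) y * (starRingEnd 𝕜) (D (N q q) y)) =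
      RCLike.re (∫ y, (∑ p, D (N p p) y) * (starRingEnd 𝕜) (∑ q, D (N q q) y)) := by
    simp_rw [map_sum, Finset.sum_mul, Finset.mul_sum]
    have hint : ∀ p q, Integrable (fun y ↦ D (N p p) y * (starRingEnd 𝕜) (D (N q q) y)) :=
      fun p q ↦ MemLp.integrable_mul_conj (h.memLp_deriv_univ _) (h.memLp_deriv_univ _)
    rw [integral_finsetSum _ fun p _ ↦ integrable_finsetSum _ fun q _ ↦ hint p q, map_sum,
      Finset.sum_comm]
    refine Finset.sum_congr rfl fun p _ ↦ ?_
    rw [integral_finsetSum _ fun q _ ↦ hint p q, map_sum]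
  rw [this, re_integral_mul_conj_self]
  exact integral_nonneg fun y ↦ by positivity

theorem sum_integral_perm_eq_of_fix (h : IsH1 Set.univ f D)
    (hs : ∀ J (σ : Equiv.Perm (Fin m)) y, f (J ∘ σ) y = f J y)
    (σ : Equiv.Perm (Fin (m + 1))) (hσ : σ (Fin.last m) = Fin.last m) :
    ∑ L, RCLike.re (∫ y, D (L ∘ σ) y * (starRingEnd 𝕜) (D L y)) = ∑ L, ∫ y, ‖D L y‖ ^ 2 := by
  refine Finset.sum_congr rfl fun L _ ↦ ?_
  rw [← re_integral_mul_conj_self]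
  congr 1
  refine integral_congr_ae ?_
  filter_upwards [h.ae_comp_perm isOpen_univ (fun J σ y _ ↦ hs J σ y) L σ hσ] with y hy
  rw [hy trivial]

/-- A permutation σ that moves the last index equals π s ρ, where s exchanges the first and the last
index and π, ρ fix the last. The symmetry of the tensor removes π and ρ, and the term becomes that
of s, a sum of squares of divergences. -/
theorem sum_integral_perm_nonneg {f : (Fin (m + 1) → Fin n) → Model n → 𝕜}
    {D : (Fin (m + 2) → Fin n) → Model n → 𝕜} (h : IsH1 Set.univ f D)
    (hs : ∀ J (σ : Equiv.Perm (Fin (m + 1))) y, f (J ∘ σ) y = f J y)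
    (σ : Equiv.Perm (Fin (m + 2))) :
    0 ≤ ∑ L, RCLike.re (∫ y, D (L ∘ σ) y * (starRingEnd 𝕜) (D L y)) := by
  by_cases hσ : σ (Fin.last (m + 1)) = Fin.last (m + 1)
  · rw [sum_integral_perm_eq_of_fix h hs σ hσ]
    exact Finset.sum_nonneg fun L _ ↦ integral_nonneg fun y ↦ by positivity
  set a := σ (Fin.last (m + 1)) with ha
  set s : Equiv.Perm (Fin (m + 2)) := Equiv.swap 0 (Fin.last (m + 1)) with hsdef
  set π : Equiv.Perm (Fin (m + 2)) := Equiv.swap 0 a with hπ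
  have h0 : (0 : Fin (m + 2)) ≠ Fin.last (m + 1) := (Fin.last_pos' (n := m + 1)).ne
  have hπl : π (Fin.last (m + 1)) = Fin.last (m + 1) :=
    Equiv.swap_apply_of_ne_of_ne h0.symm (Ne.symm hσ)
  set ρ : Equiv.Perm (Fin (m + 2)) := s * π * σ with hρ
  have hρl : ρ (Fin.last (m + 1)) = Fin.last (m + 1) := by
    simp only [hρ, Equiv.Perm.coe_mul, Function.comp_apply, ← ha, hπ, hsdef]
    rw [Equiv.swap_apply_right, Equiv.swap_apply_left]
  have hdec : ∀ L : Fin (m + 2) → Fin n, L ∘ σ = ((L ∘ π) ∘ s) ∘ ρ := by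
    intro L
    funext i
    simp [hρ, hsdef, hπ]
  have key : ∑ L, RCLike.re (∫ y, D (L ∘ σ) y * (starRingEnd 𝕜) (D L y)) =
      ∑ L, RCLike.re (∫ y, D ((L ∘ π) ∘ s) y * (starRingEnd 𝕜) (D (L ∘ π) y)) := by
    refine Finset.sum_congr rfl fun L _ ↦ ?_
    congr 1
    refine integral_congr_ae ?_
    filter_upwards [h.ae_comp_perm isOpen_univ (fun J σ y _ ↦ hs J σ y) ((L ∘ π) ∘ s) ρ hρl,
      h.ae_comp_perm isOpen_univ (fun J σ y _ ↦ hs J σ y) L π hπl] with y h1 h2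
    rw [hdec, h1 trivial, h2 trivial]
  rw [key]
  have hre := (Equiv.arrowCongr π.symm (Equiv.refl (Fin n))).sum_comp
    fun L ↦ RCLike.re (∫ y, D (L ∘ s) y * (starRingEnd 𝕜) (D L y))
  exact (sum_integral_swap_nonneg h).trans_eq hre.symm

/-- Korn's inequality on `ℝⁿ`. -/
theorem korn_univ {f : (Fin (m + 1) → Fin n) → Model n → 𝕜}
    {D : (Fin (m + 2) → Fin n) → Model n → 𝕜} (h : IsH1 Set.univ f D)
    (hs : ∀ J (σ : Equiv.Perm (Fin (m + 1))) y, f (J ∘ σ) y = f J y) :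
    ∑ L, ∫ y, ‖D L y‖ ^ 2 ≤
      (((m + 2).factorial : ℝ)) ^ 2 * ∑ L, ∫ y, ‖symComp (fun L ↦ D L y) L‖ ^ 2 := by
  obtain ⟨c, hc⟩ : ∃ c : ℝ, c = ((m + 2).factorial : ℝ) := ⟨_, rfl⟩
  have hcpos : 0 < c := by rw [hc]; exact_mod_cast Nat.factorial_pos _
  rw [← hc]
  have hS : ∀ L, MemLp (fun y ↦ symComp (fun L ↦ D L y) L) 2 := by
    intro L
    have := (memLp_finsetSum (Finset.univ : Finset (Equiv.Perm (Fin (m + 2)))) fun σ _ ↦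
      h.memLp_deriv_univ (L ∘ σ)).const_smul (c⁻¹)
    simp only [symComp, ← hc]
    exact this
  -- All terms of the sum over σ are nonnegative, and the identity contributes exactly the left
  -- side.
  have h1 : ∑ L, ∫ y, ‖D L y‖ ^ 2 ≤ ∑ σ : Equiv.Perm (Fin (m + 2)), ∑ L,
      RCLike.re (∫ y, D (L ∘ σ) y * (starRingEnd 𝕜) (D L y)) := by
    have h0 := sum_integral_perm_eq_of_fix h hs 1 (Equiv.Perm.one_apply _)
    refine h0.symm.trans_le ?_
    exact Finset.single_le_sum (f := fun σ : Equiv.Perm (Fin (m + 2)) ↦ ∑ L,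
      RCLike.re (∫ y, D (L ∘ σ) y * (starRingEnd 𝕜) (D L y)))
      (fun σ _ ↦ sum_integral_perm_nonneg h hs σ) (Finset.mem_univ 1)
  -- Summing over σ inside the integral restores the symmetrization, up to the factor c = (m + 2)!.
  have h2 : ∀ L, ∑ σ : Equiv.Perm (Fin (m + 2)),
      RCLike.re (∫ y, D (L ∘ σ) y * (starRingEnd 𝕜) (D L y)) =
      c * RCLike.re (∫ y, symComp (fun L ↦ D L y) L * (starRingEnd 𝕜) (D L y)) := by
    intro L
    rw [← map_sum, ← integral_finsetSum _ fun σ _ ↦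
      MemLp.integrable_mul_conj (h.memLp_deriv_univ _) (h.memLp_deriv_univ _)]
    simp only [symComp, smul_mul_assoc, ← Finset.sum_mul]
    rw [integral_smul, RCLike.smul_re, ← hc, ← mul_assoc, mul_inv_cancel₀ hcpos.ne', one_mul]
  -- Young's inequality: half of the squared norm of D is absorbed at the end, which leaves the
  -- factor c².
  have h3 : ∀ L, c * RCLike.re (∫ y, symComp (fun L ↦ D L y) L * (starRingEnd 𝕜) (D L y)) ≤
      (c ^ 2 * (∫ y, ‖symComp (fun L ↦ D L y) L‖ ^ 2) + ∫ y, ‖D L y‖ ^ 2) / 2 := by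
    intro L
    have hi := MemLp.integrable_mul_conj (hS L) (h.memLp_deriv_univ L)
    have i1 : Integrable (fun y ↦ ‖symComp (fun L ↦ D L y) L‖ ^ 2) :=
      (hS L).integrable_norm_pow (by simp)
    have i2 : Integrable (fun y ↦ ‖D L y‖ ^ 2) :=
      (h.memLp_deriv_univ L).integrable_norm_pow (by simp)
    rw [← integral_re hi, ← integral_const_mul, ← integral_const_mul,
      ← integral_add (i1.const_mul _) i2, ← integral_div]
    refine integral_mono (hi.re.const_mul c) (((i1.const_mul _).add i2).div_const 2) fun y ↦ ?_
    have h4 := RCLike.re_le_norm (symComp (fun L ↦ D L y) L * (starRingEnd 𝕜) (D L y))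
    rw [norm_mul, RCLike.norm_conj] at h4
    have h5 := mul_le_mul_of_nonneg_left h4 hcpos.le
    simp only at h5 ⊢
    nlinarith [sq_nonneg (c * ‖symComp (fun L ↦ D L y) L‖ - ‖D L y‖)]
  rw [Finset.sum_comm] at h1
  have h4 : ∑ L, ∫ y, ‖D L y‖ ^ 2 ≤ ∑ L,
      (c ^ 2 * (∫ y, ‖symComp (fun L ↦ D L y) L‖ ^ 2) + ∫ y, ‖D L y‖ ^ 2) / 2 :=
    h1.trans (Finset.sum_le_sum fun L _ ↦ (h2 L).trans_le (h3 L))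
  rw [← Finset.sum_div, Finset.sum_add_distrib, ← Finset.mul_sum] at h4
  linarith

end Korn

end ScKorn

end


noncomputable section

namespace ScKorn

/-! ### Integration by parts on a half space. -/

section HalfSpace

variable {n : ℕ} {𝕜 : Type*} [RCLike 𝕜]

/-- The open half space `{z_i > 0}`. -/
def halfSpace (i : Fin n) : Set (Model n) := {z | 0 < z i}

theorem isOpen_halfSpace (i : Fin n) : IsOpen (halfSpace i) :=
  isOpen_lt continuous_const (EuclideanSpace.proj (𝕜 := ℝ) i).continuous

theorem exists_bound_smoothTransition :
    ∃ C : ℝ, ∀ t, |deriv Real.smoothTransition t| ≤ C ∧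
      ((t < 0 ∨ 1 < t) → deriv Real.smoothTransition t = 0) := by
  have hc : Continuous (deriv Real.smoothTransition) :=
    (Real.smoothTransition.contDiff (n := 1)).continuous_deriv le_rfl
  obtain ⟨C, hC⟩ := (isCompact_Icc (a := (0 : ℝ)) (b := 1)).exists_bound_of_continuousOn
    hc.continuousOn
  have h0 : ∀ t, (t < 0 ∨ 1 < t) → deriv Real.smoothTransition t = 0 := by
    intro t ht
    rcases ht with ht | ht
    · have : Real.smoothTransition =ᶠ[𝓝 t] fun _ ↦ 0 := by
        filter_upwards [Iio_mem_nhds ht] with s hs using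
          Real.smoothTransition.zero_of_nonpos (le_of_lt hs)
      rw [this.deriv_eq, deriv_const]
    · have : Real.smoothTransition =ᶠ[𝓝 t] fun _ ↦ 1 := by
        filter_upwards [Ioi_mem_nhds ht] with s hs using
          Real.smoothTransition.one_of_one_le (le_of_lt hs)
      rw [this.deriv_eq, deriv_const]
  refine ⟨max C 0, fun t ↦ ⟨?_, h0 t⟩⟩
  by_cases ht : t < 0 ∨ 1 < t
  · simp [h0 t ht]
  · push Not at ht
    exact (hC t ⟨ht.1, ht.2⟩).trans (le_max_left _ _)

/-- A test function is Lipschitz; compare z with its projection to the hyperplane {z_i = 0}. -/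
theorem exists_abs_le_of_eq_zero {ψ : Model n → ℝ} (hψ : ContDiff ℝ ∞ ψ)
    (hc : HasCompactSupport ψ) (i : Fin n) (h0 : ∀ z : Model n, z i = 0 → ψ z = 0) :
    ∃ C : ℝ, 0 ≤ C ∧ ∀ z, |ψ z| ≤ C * |z i| := by
  obtain ⟨C, hC⟩ := (hψ.of_le (m := 1) (by simp)).lipschitzWith_of_hasCompactSupport hc (by simp)
  refine ⟨C, C.2, fun z ↦ ?_⟩
  have h1 : ψ (z - z i • stdVec n i) = 0 := h0 _ (by simp [stdVec_apply])
  have h2 := hC.dist_le_mul z (z - z i • stdVec n i)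
  rw [h1, dist_zero_right, dist_self_sub_right, norm_smul] at h2
  simpa [stdVec] using h2

/-- Integration by parts on a half space. -/
theorem integral_halfSpace_fderiv {i k : Fin n} {f d : Model n → 𝕜}
    (h : WeakDeriv (halfSpace i) (stdVec n k) f d)
    (hf : ∀ K, IsCompact K → IntegrableOn f (halfSpace i ∩ K))
    (hd : ∀ K, IsCompact K → IntegrableOn d (halfSpace i ∩ K))
    {ψ : Model n → ℝ} (hψ : ContDiff ℝ ∞ ψ) (hc : HasCompactSupport ψ)
    (hk : k ≠ i ∨ ∀ z : Model n, z i = 0 → ψ z = 0) :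
    ∫ y in halfSpace i, fderiv ℝ ψ y (stdVec n k) • f y = - ∫ y in halfSpace i, ψ y • d y := by
  obtain ⟨C₁, hC₁⟩ := exists_bound_smoothTransition
  have hC₁0 : 0 ≤ C₁ := (abs_nonneg _).trans (hC₁ 0).1
  have hHm := (isOpen_halfSpace i).measurableSet
  let p : Model n →L[ℝ] ℝ := EuclideanSpace.proj (𝕜 := ℝ) i
  -- A cutoff that vanishes for z_i ≤ 1/(N + 1) and equals 1 for z_i ≥ 2/(N + 1), so that η ψ is a
  -- test function in the open half space.
  let η : ℕ → Model n → ℝ := fun N z ↦ Real.smoothTransition ((N + 1) * p z - 1)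
  have hη : ∀ N, ContDiff ℝ ∞ (η N) := fun N ↦
    Real.smoothTransition.contDiff.comp ((contDiff_const.mul p.contDiff).sub contDiff_const)
  have hη01 : ∀ N z, |η N z| ≤ 1 := fun N z ↦ by
    rw [abs_of_nonneg (Real.smoothTransition.nonneg _)]
    exact Real.smoothTransition.le_one _
  have hηd : ∀ N z, HasFDerivAt (η N)
      ((deriv Real.smoothTransition ((N + 1) * p z - 1)) • (((N : ℝ) + 1) • p)) z := by
    intro N z
    have h1 : HasDerivAt Real.smoothTransition (deriv Real.smoothTransition ((N + 1) * p z - 1))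
        ((N + 1) * p z - 1) :=
      ((Real.smoothTransition.contDiff (n := 1)).differentiable (by simp) _).hasDerivAt
    have h2 : HasFDerivAt (fun z ↦ ((N : ℝ) + 1) * p z - 1) (((N : ℝ) + 1) • p) z :=
      (p.hasFDerivAt.const_mul _).sub_const _
    exact h1.comp_hasFDerivAt z h2
  let Ψ : ℕ → Model n → ℝ := fun N z ↦ η N z * ψ z
  have hΨ : ∀ N, ContDiff ℝ ∞ (Ψ N) := fun N ↦ (hη N).mul hψ
  have hΨc : ∀ N, HasCompactSupport (Ψ N) := fun N ↦ hc.mul_left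
  have hΨs : ∀ N, tsupport (Ψ N) ⊆ halfSpace i := by
    intro N
    have h1 : tsupport (η N) ⊆ {z | 1 / ((N : ℝ) + 1) ≤ z i} := by
      refine closure_minimal ?_ (isClosed_le continuous_const p.continuous)
      intro z hz
      by_contra hlt
      refine hz (Real.smoothTransition.zero_of_nonpos ?_)
      have hN : (0 : ℝ) < N + 1 := by positivity
      have hlt' : z i < 1 / ((N : ℝ) + 1) := not_le.1 hlt
      rw [lt_div_iff₀ hN] at hlt'
      have : p z = z i := rfl
      rw [this]
      linarith [mul_comm (z i) ((N : ℝ) + 1)]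
    refine tsupport_mul_subset_left.trans (h1.trans fun z hz ↦ ?_)
    have h2 : 0 < 1 / ((N : ℝ) + 1) := by positivity
    exact h2.trans_le hz
  have hΨd : ∀ N z, fderiv ℝ (Ψ N) z (stdVec n k) = η N z * fderiv ℝ ψ z (stdVec n k) +
      deriv Real.smoothTransition ((N + 1) * z i - 1) * (N + 1) * stdVec n k i * ψ z := by
    intro N z
    have := ((hηd N z).mul (hψ.differentiable (by simp) z).hasFDerivAt).fderiv
    have h3 : (η N * ψ) = Ψ N := rfl
    rw [h3] at this
    rw [this]
    have hp : ∀ w, p w = w i := fun w ↦ rfl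
    simp [hp]
    ring
  obtain ⟨C₀, hC₀⟩ : ∃ C, ∀ z, ‖fderiv ℝ ψ z (stdVec n k)‖ ≤ C :=
    (hasCompactSupport_fderiv_apply hc _).exists_bound_of_continuous
      (contDiff_fderiv_apply hψ _).continuous
  -- The derivative of the cutoff is of size N + 1 in a layer of width 2/(N + 1). It is harmless if
  -- the direction is tangential, and also if ψ vanishes linearly at the hyperplane.
  obtain ⟨C₂, hC₂0, hC₂⟩ : ∃ C : ℝ, 0 ≤ C ∧ ∀ z, |stdVec n k i * ψ z| ≤ C * |z i| := by
    rcases hk with hk | hk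
    · exact ⟨0, le_rfl, fun z ↦ by simp [stdVec_apply, hk.symm]⟩
    · obtain ⟨C, hC, h⟩ := exists_abs_le_of_eq_zero hψ hc i hk
      refine ⟨C, hC, fun z ↦ le_trans ?_ (h z)⟩
      rw [abs_mul, stdVec_apply]
      split_ifs <;> simp
  have hz0 : ∀ z ∉ tsupport ψ, ψ z = 0 ∧ fderiv ℝ ψ z (stdVec n k) = 0 := fun z hz ↦
    ⟨image_eq_zero_of_notMem_tsupport hz, image_eq_zero_of_notMem_tsupport
      (f := fun z ↦ fderiv ℝ ψ z (stdVec n k)) fun h ↦ hz (tsupport_fderiv_apply_subset _ _ h)⟩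
  have hbound : ∀ N z, |fderiv ℝ (Ψ N) z (stdVec n k)| ≤
      (tsupport ψ).indicator (fun _ ↦ C₀ + 2 * C₁ * C₂) z := by
    intro N z
    by_cases hz : z ∈ tsupport ψ
    · rw [Set.indicator_of_mem hz, hΨd]
      refine (abs_add_le _ _).trans (add_le_add ?_ ?_)
      · rw [abs_mul]
        exact (mul_le_of_le_one_left (abs_nonneg _) (hη01 N z)).trans (hC₀ z)
      · have hN : (0 : ℝ) < N + 1 := by positivity
        by_cases ht : ((N + 1) * z i - 1 < 0 ∨ 1 < (N + 1) * z i - 1)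
        · rw [(hC₁ _).2 ht]
          simp only [zero_mul, abs_zero]
          positivity
        · push Not at ht
          have h1 : (N + 1) * |z i| ≤ 2 := by
            rw [← abs_of_pos hN, ← abs_mul, abs_of_nonneg] <;> linarith
          rw [mul_assoc, abs_mul, abs_mul, abs_of_pos hN]
          calc _ ≤ C₁ * (N + 1) * (C₂ * |z i|) := by
                gcongr
                · exact (hC₁ _).1
                · exact hC₂ z
            _ = C₁ * C₂ * ((N + 1) * |z i|) := by ring
            _ ≤ C₁ * C₂ * 2 := by gcongr
            _ = 2 * C₁ * C₂ := by ring
    · rw [Set.indicator_of_notMem hz, hΨd, (hz0 z hz).1, (hz0 z hz).2]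
      simp
  have hev : ∀ z ∈ halfSpace i, ∀ᶠ N : ℕ in Filter.atTop, 1 < (N + 1) * z i - 1 := by
    intro z hz
    obtain ⟨N₀, hN₀⟩ := exists_nat_gt (2 / z i)
    filter_upwards [Filter.eventually_ge_atTop N₀] with N hN
    have hz' : 0 < z i := hz
    rw [div_lt_iff₀ hz'] at hN₀
    have : (N₀ : ℝ) ≤ N := by exact_mod_cast hN
    nlinarith
  -- Dominated convergence: near a fixed point of the half space the cutoff is 1 for large N, and
  -- the bound above does not depend on N.
  have hlim1 : Filter.Tendsto (fun N ↦ ∫ y in halfSpace i, fderiv ℝ (Ψ N) y (stdVec n k) • f y)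
      Filter.atTop (𝓝 (∫ y in halfSpace i, fderiv ℝ ψ y (stdVec n k) • f y)) := by
    refine tendsto_integral_of_dominated_convergence
      (fun z ↦ (tsupport ψ).indicator (fun z ↦ (C₀ + 2 * C₁ * C₂) * ‖f z‖) z) ?_ ?_ ?_ ?_
    · intro N
      exact (contDiff_fderiv_apply (hΨ N) _).continuous.aestronglyMeasurable.smul
        (h.loc.aestronglyMeasurable)
    · rw [integrable_indicator_iff (isClosed_tsupport ψ).measurableSet, IntegrableOn,
        Measure.restrict_restrict (isClosed_tsupport ψ).measurableSet, Set.inter_comm]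
      exact ((hf _ hc).norm).const_mul _
    · intro N
      refine .of_forall fun z ↦ ?_
      rw [norm_smul]
      refine (mul_le_mul_of_nonneg_right (hbound N z) (norm_nonneg _)).trans_eq ?_
      by_cases hz : z ∈ tsupport ψ <;> simp [hz]
    · rw [ae_restrict_iff' hHm]
      refine .of_forall fun z hz ↦ tendsto_const_nhds.congr' ?_
      filter_upwards [hev z hz] with N hN
      rw [hΨd, (hC₁ _).2 (Or.inr hN)]
      have : η N z = 1 := Real.smoothTransition.one_of_one_le hN.le
      simp [this]
  have hlim2 : Filter.Tendsto (fun N ↦ ∫ y in halfSpace i, Ψ N y • d y)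
      Filter.atTop (𝓝 (∫ y in halfSpace i, ψ y • d y)) := by
    obtain ⟨C₃, hC₃⟩ := hc.exists_bound_of_continuous hψ.continuous
    refine tendsto_integral_of_dominated_convergence
      (fun z ↦ (tsupport ψ).indicator (fun z ↦ C₃ * ‖d z‖) z) ?_ ?_ ?_ ?_
    · intro N
      exact (hΨ N).continuous.aestronglyMeasurable.smul (h.loc_deriv.aestronglyMeasurable)
    · rw [integrable_indicator_iff (isClosed_tsupport ψ).measurableSet, IntegrableOn,
        Measure.restrict_restrict (isClosed_tsupport ψ).measurableSet, Set.inter_comm]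
      exact ((hd _ hc).norm).const_mul _
    · intro N
      refine .of_forall fun z ↦ ?_
      rw [norm_smul]
      by_cases hz : z ∈ tsupport ψ
      · rw [Set.indicator_of_mem hz]
        gcongr
        rw [norm_mul]
        exact (mul_le_of_le_one_left (norm_nonneg _) (hη01 N z)).trans (hC₃ z)
      · simp [Ψ, (hz0 z hz).1, hz]
    · rw [ae_restrict_iff' hHm]
      refine .of_forall fun z hz ↦ tendsto_const_nhds.congr' ?_
      filter_upwards [hev z hz] with N hN
      have : η N z = 1 := Real.smoothTransition.one_of_one_le hN.le
      simp [Ψ, this]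
  have hkey : ∀ N, ∫ y in halfSpace i, fderiv ℝ (Ψ N) y (stdVec n k) • f y =
      - ∫ y in halfSpace i, Ψ N y • d y := by
    intro N
    rw [setIntegral_eq_integral_of_forall_compl_eq_zero fun z hz ↦ ?_,
      setIntegral_eq_integral_of_forall_compl_eq_zero fun z hz ↦ ?_]
    · exact h.eq _ (hΨ N) (hΨc N) (hΨs N)
    · rw [image_eq_zero_of_notMem_tsupport fun h ↦ hz (hΨs N h), zero_smul]
    · rw [image_eq_zero_of_notMem_tsupport (f := fun z ↦ fderiv ℝ (Ψ N) z (stdVec n k))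
        fun h ↦ hz (hΨs N (tsupport_fderiv_apply_subset _ _ h)), zero_smul]
  simp_rw [hkey] at hlim1
  exact tendsto_nhds_unique hlim1 hlim2.neg

end HalfSpace

end ScKorn

end


noncomputable section

namespace ScKorn

/-! ### Extension across a hyperplane by higher order reflection. -/

section Reflection

variable {n : ℕ} {𝕜 : Type*} [RCLike 𝕜]

/-- Multiplication of the `i`-th coordinate by `t`. -/
def scaleAt (i : Fin n) (t : ℝ) : Model n →L[ℝ] Model n :=
  ContinuousLinearMap.id ℝ _ + (t - 1) • (EuclideanSpace.proj (𝕜 := ℝ) i).smulRight (stdVec n i)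

theorem scaleAt_eq (i : Fin n) (t : ℝ) (z : Model n) :
    scaleAt i t z = z + ((t - 1) * z i) • stdVec n i := by
  simp [scaleAt, smul_smul]

theorem scaleAt_apply (i : Fin n) (t : ℝ) (z : Model n) (j : Fin n) :
    scaleAt i t z j = if j = i then t * z i else z j := by
  rw [scaleAt_eq]
  by_cases h : j = i
  · subst h; simp [stdVec_apply]; ring
  · simp [stdVec_apply, h]

theorem scaleAt_scaleAt (i : Fin n) (s t : ℝ) (z : Model n) :
    scaleAt i s (scaleAt i t z) = scaleAt i (s * t) z := by
  ext j
  simp only [scaleAt_apply]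
  split_ifs <;> ring

theorem scaleAt_one (i : Fin n) (z : Model n) : scaleAt i 1 z = z := by
  simp [scaleAt_eq]

theorem det_scaleAt (i : Fin n) (t : ℝ) : (scaleAt i t).det = t := by
  rw [clm_det_eq]
  have : (Matrix.of fun j k ↦ (scaleAt i t (stdVec n k)) j) =
      Matrix.diagonal fun j ↦ if j = i then t else 1 := by
    ext j k
    simp only [Matrix.of_apply, scaleAt_apply, stdVec_apply, Matrix.diagonal_apply]
    by_cases h1 : j = i <;> by_cases h2 : j = k <;> simp_all [eq_comm]
  rw [this, Matrix.det_diagonal]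
  simp

theorem scaleAt_bijective (i : Fin n) {t : ℝ} (ht : t ≠ 0) : Function.Bijective (scaleAt i t) :=
  Function.bijective_iff_has_inverse.2 ⟨scaleAt i t⁻¹,
    fun z ↦ by rw [scaleAt_scaleAt, inv_mul_cancel₀ ht, scaleAt_one],
    fun z ↦ by rw [scaleAt_scaleAt, mul_inv_cancel₀ ht, scaleAt_one]⟩

theorem integral_comp_scaleAt (i : Fin n) {t : ℝ} (ht : t ≠ 0) (G : Model n → 𝕜) :
    ∫ z, G (scaleAt i t z) = |t|⁻¹ • ∫ z, G z := by
  have h := integral_image_eq_integral_abs_det_fderiv_smul volume MeasurableSet.univ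
    (fun x _ ↦ (scaleAt i t).hasFDerivAt.hasFDerivWithinAt) (scaleAt_bijective i ht).1.injOn G
  rw [Set.image_univ, (scaleAt_bijective i ht).2.range_eq, det_scaleAt] at h
  simp only [setIntegral_univ] at h
  rw [h, integral_smul, smul_smul, inv_mul_cancel₀ (abs_ne_zero.2 ht), one_smul]

theorem lintegral_comp_scaleAt (i : Fin n) {t : ℝ} (ht : t ≠ 0) (G : Model n → ℝ≥0∞) :
    ∫⁻ z, G (scaleAt i t z) = ENNReal.ofReal |t|⁻¹ * ∫⁻ z, G z := by
  have h := lintegral_image_eq_lintegral_abs_det_fderiv_mul volume MeasurableSet.univ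
    (fun x _ ↦ (scaleAt i t).hasFDerivAt.hasFDerivWithinAt) (scaleAt_bijective i ht).1.injOn G
  rw [Set.image_univ, (scaleAt_bijective i ht).2.range_eq, det_scaleAt] at h
  simp only [Measure.restrict_univ] at h
  rw [h, lintegral_const_mul' _ _ ENNReal.ofReal_ne_top, ← mul_assoc,
    ← ENNReal.ofReal_mul (by positivity), inv_mul_cancel₀ (abs_ne_zero.2 ht),
    ENNReal.ofReal_one, one_mul]

theorem quasiMeasurePreserving_scaleAt (i : Fin n) {t : ℝ} (ht : t ≠ 0) :
    Measure.QuasiMeasurePreserving (scaleAt i t) volume volume := by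
  refine ⟨(scaleAt i t).continuous.measurable, Measure.AbsolutelyContinuous.mk fun s hs h0 ↦ ?_⟩
  rw [Measure.map_apply (scaleAt i t).continuous.measurable hs,
    ← lintegral_indicator_one ((scaleAt i t).continuous.measurable hs)]
  have := lintegral_comp_scaleAt i ht (s.indicator 1)
  rw [lintegral_indicator_one hs, h0, mul_zero] at this
  exact this

theorem MemLp.comp_scaleAt {g : Model n → 𝕜} (hg : MemLp g 2) (i : Fin n) {t : ℝ} (ht : t ≠ 0) :
    MemLp (fun z ↦ g (scaleAt i t z)) 2 := by
  refine ⟨hg.1.comp_quasiMeasurePreserving (quasiMeasurePreserving_scaleAt i ht), ?_⟩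
  have h := hg.2
  rw [eLpNorm_lt_top_iff_lintegral_rpow_enorm_lt_top (by simp) (by simp)] at h ⊢
  rw [lintegral_comp_scaleAt i ht fun z ↦ ‖g z‖ₑ ^ (2 : ℝ≥0∞).toReal]
  exact ENNReal.mul_lt_top ENNReal.ofReal_lt_top h

/-- The coefficients of the reflection. -/
def reflCoef : Fin 4 → ℝ := ![10, -20, 15, -4]

/-- The scales of the reflection. -/
def reflScale (a : Fin 4) : ℝ := -((a : ℕ) + 1)

theorem reflScale_neg (a : Fin 4) : reflScale a < 0 := by
  unfold reflScale
  have : (0 : ℝ) < (a : ℕ) + 1 := by positivity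
  linarith

theorem reflScale_ne_zero (a : Fin 4) : reflScale a ≠ 0 :=
  (reflScale_neg a).ne

/-- A Vandermonde system for the scales -1, -2, -3, -4. Its four equations serve components with 0,
1, 2 or 3 normal indices. -/
theorem sum_reflCoef {l : ℕ} (hl : l ≤ 3) : ∑ a, reflCoef a * reflScale a ^ l = 1 := by
  interval_cases l <;> simp [Fin.sum_univ_four, reflCoef, reflScale] <;> norm_num

/-- The extension of a tensor component from the half space `{z_i > 0}` by reflection. The integer
`l` is the number of the indices of the component that are equal to `i`. -/
def reflect (i : Fin n) (l : ℕ) (g : Model n → 𝕜) (z : Model n) : 𝕜 :=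
  (halfSpace i).indicator g z +
    ∑ a, (reflCoef a * reflScale a ^ l) • (halfSpace i).indicator g (scaleAt i (reflScale a) z)

variable {i : Fin n} {f d g : Model n → 𝕜}

/-- The scales are negative, so the reflected terms only see points outside the half space. -/
theorem reflect_of_mem {z : Model n} (hz : z ∈ halfSpace i) (l : ℕ) :
    reflect i l g z = g z := by
  have : ∀ a, scaleAt i (reflScale a) z ∉ halfSpace i := fun a h ↦ by
    have h' : 0 < scaleAt i (reflScale a) z i := h
    have hz' : 0 < z i := hz
    rw [scaleAt_apply, if_pos rfl, reflScale] at h'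
    have : (0 : ℝ) ≤ (a : ℕ) := by positivity
    nlinarith
  simp [reflect, hz, this]

theorem memLp_indicator (hg : MemLp g 2 (volume.restrict (halfSpace i))) :
    MemLp ((halfSpace i).indicator g) 2 :=
  (memLp_indicator_iff_restrict (isOpen_halfSpace i).measurableSet).2 hg

theorem memLp_reflect (hg : MemLp g 2 (volume.restrict (halfSpace i))) (l : ℕ) :
    MemLp (reflect i l g) 2 :=
  (memLp_indicator hg).add (memLp_finsetSum _ fun a _ ↦
    (MemLp.comp_scaleAt (memLp_indicator hg) i (reflScale_ne_zero a)).const_smul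
      (reflCoef a * reflScale a ^ l))

theorem integrable_smul_of_memLp (hg : MemLp g 2) {φ : Model n → ℝ} (hφ : Continuous φ)
    (hc : HasCompactSupport φ) : Integrable fun z ↦ φ z • g z :=
  (hg.locallyIntegrable (by norm_num)).integrable_smul_left_of_hasCompactSupport hφ hc

/-- A linear change of variables moves the reflection to the test function, with the Jacobian factor
1/|s|. The weak derivative of a reflection thus becomes an integration by parts on the half space.
-/
theorem integral_smul_reflect (hg : MemLp g 2 (volume.restrict (halfSpace i))) (l : ℕ)
    {φ : Model n → ℝ} (hφ : Continuous φ) (hc : HasCompactSupport φ) :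
    ∫ z, φ z • reflect i l g z = ∫ z in halfSpace i, (φ z + ∑ a, (reflCoef a * reflScale a ^ l *
      |reflScale a|⁻¹) * φ (scaleAt i (reflScale a)⁻¹ z)) • g z := by
  have hm := (isOpen_halfSpace i).measurableSet
  have hg0 := memLp_indicator hg
  have hcomp : ∀ a, HasCompactSupport fun z ↦ φ (scaleAt i (reflScale a)⁻¹ z) := fun a ↦ by
    refine HasCompactSupport.of_support_subset_isCompact
      (hc.isCompact.image (scaleAt i (reflScale a)).continuous) fun z hz ↦ ?_
    refine ⟨scaleAt i (reflScale a)⁻¹ z, subset_tsupport _ hz, ?_⟩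
    rw [scaleAt_scaleAt, mul_inv_cancel₀ (reflScale_ne_zero a), scaleAt_one]
  have i0 := integrable_smul_of_memLp hg0 hφ hc
  have ia : ∀ a, Integrable fun z ↦ φ z • ((reflCoef a * reflScale a ^ l) •
      (halfSpace i).indicator g (scaleAt i (reflScale a) z)) := fun a ↦
    integrable_smul_of_memLp
      ((MemLp.comp_scaleAt hg0 i (reflScale_ne_zero a)).const_smul (reflCoef a * reflScale a ^ l))
      hφ hc
  have ib : ∀ a, Integrable fun z ↦ φ (scaleAt i (reflScale a)⁻¹ z) •
      (halfSpace i).indicator g z := fun a ↦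
    integrable_smul_of_memLp hg0 (hφ.comp (scaleAt i _).continuous) (hcomp a)
  simp only [reflect, smul_add, Finset.smul_sum]
  rw [integral_add i0 (integrable_finsetSum _ fun a _ ↦ ia a), integral_finsetSum _ fun a _ ↦ ia a]
  have e1 : ∀ a, ∫ z, φ z • ((reflCoef a * reflScale a ^ l) •
      (halfSpace i).indicator g (scaleAt i (reflScale a) z)) =
      ∫ z, (reflCoef a * reflScale a ^ l * |reflScale a|⁻¹) •
        (φ (scaleAt i (reflScale a)⁻¹ z) • (halfSpace i).indicator g z) := by
    intro a
    rw [integral_smul, mul_smul, ← integral_comp_scaleAt i (reflScale_ne_zero a), ← integral_smul]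
    congr 1
    funext z
    rw [scaleAt_scaleAt, inv_mul_cancel₀ (reflScale_ne_zero a), scaleAt_one, smul_comm]
  simp_rw [e1]
  have ic : ∀ a, Integrable fun z ↦ (reflCoef a * reflScale a ^ l * |reflScale a|⁻¹) •
      (φ (scaleAt i (reflScale a)⁻¹ z) • (halfSpace i).indicator g z) := fun a ↦
    (ib a).smul (reflCoef a * reflScale a ^ l * |reflScale a|⁻¹)
  rw [← integral_finsetSum _ fun a _ ↦ ic a,
    ← integral_add i0 (integrable_finsetSum _ fun a _ ↦ ic a), ← integral_indicator hm]
  congr 1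
  funext z
  by_cases hz : z ∈ halfSpace i
  · simp [hz, add_smul, Finset.sum_smul, mul_smul]
  · simp [hz]

theorem MemLp.integrableOn_inter_compact {R : Set (Model n)} {g : Model n → 𝕜}
    (hg : MemLp g 2 (volume.restrict R)) {K : Set (Model n)} (hK : IsCompact K) :
    IntegrableOn g (R ∩ K) := by
  rw [IntegrableOn, Set.inter_comm, ← Measure.restrict_restrict hK.measurableSet]
  have : IsFiniteMeasure ((volume.restrict R).restrict K) := by
    refine ⟨?_⟩
    rw [Measure.restrict_apply_univ]
    exact (Measure.restrict_apply_le _ _).trans_lt hK.measure_lt_top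
  exact (hg.restrict K).integrable (by norm_num)

/-- The extension by reflection is weakly differentiable. -/
theorem WeakDeriv.reflect {k : Fin n} (h : WeakDeriv (halfSpace i) (stdVec n k) f d)
    (hf : MemLp f 2 (volume.restrict (halfSpace i)))
    (hd : MemLp d 2 (volume.restrict (halfSpace i))) {l : ℕ} (hl : l ≤ 3) :
    WeakDeriv Set.univ (stdVec n k) (reflect i l f)
      (reflect i (l + if k = i then 1 else 0) d) := by
  refine ⟨((memLp_reflect hf l).locallyIntegrable (by norm_num)).locallyIntegrableOn _,
    ((memLp_reflect hd _).locallyIntegrable (by norm_num)).locallyIntegrableOn _,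
    fun ψ hψ hc _ ↦ ?_⟩
  rw [integral_smul_reflect hf l (contDiff_fderiv_apply hψ _).continuous
    (hasCompactSupport_fderiv_apply hc _), integral_smul_reflect hd _ hψ.continuous hc]
  -- The transposed reflection of ψ, with the exponent that belongs to the derivative. It need not
  -- vanish near the hyperplane, hence the recourse to `integral_halfSpace_fderiv`.
  let Ψ : Model n → ℝ := fun z ↦ ψ z + ∑ a, (reflCoef a *
    reflScale a ^ (l + if k = i then 1 else 0) * |reflScale a|⁻¹) *
      ψ (scaleAt i (reflScale a)⁻¹ z)
  have hψR : ∀ a, ContDiff ℝ ∞ fun z ↦ ψ (scaleAt i (reflScale a)⁻¹ z) := fun a ↦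
    hψ.comp (scaleAt i _).contDiff
  have hΨ : ContDiff ℝ ∞ Ψ := hψ.add (ContDiff.sum fun a _ ↦ contDiff_const.mul (hψR a))
  have hΨc : HasCompactSupport Ψ := by
    refine HasCompactSupport.of_support_subset_isCompact (K := tsupport ψ ∪ ⋃ a,
      scaleAt i (reflScale a) '' tsupport ψ) (hc.isCompact.union (isCompact_iUnion fun a ↦
        hc.isCompact.image (scaleAt i (reflScale a)).continuous)) fun z hz ↦ ?_
    by_contra hn
    simp only [Set.mem_union, Set.mem_iUnion, not_or, not_exists] at hn
    refine hz ?_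
    have h1 : ψ z = 0 := image_eq_zero_of_notMem_tsupport hn.1
    have h2 : ∀ a, ψ (scaleAt i (reflScale a)⁻¹ z) = 0 := fun a ↦
      image_eq_zero_of_notMem_tsupport fun h ↦ hn.2 a ⟨_, h, by
        rw [scaleAt_scaleAt, mul_inv_cancel₀ (reflScale_ne_zero a), scaleAt_one]⟩
    simp [Ψ, h1, h2]
  -- In the direction i the chain rule gives a factor 1/s, which lowers the exponent l + 1 to l; the
  -- other directions leave the exponent l unchanged.
  have hder : ∀ z, fderiv ℝ Ψ z (stdVec n k) = fderiv ℝ ψ z (stdVec n k) +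
      ∑ a, (reflCoef a * reflScale a ^ l * |reflScale a|⁻¹) *
        fderiv ℝ ψ (scaleAt i (reflScale a)⁻¹ z) (stdVec n k) := by
    intro z
    have h1 : ∀ a, HasFDerivAt (fun z ↦ ψ (scaleAt i (reflScale a)⁻¹ z))
        ((fderiv ℝ ψ (scaleAt i (reflScale a)⁻¹ z)).comp (scaleAt i (reflScale a)⁻¹)) z := fun a ↦
      (hψ.differentiable (by simp) _).hasFDerivAt.comp z (scaleAt i _).hasFDerivAt
    have h2 : HasFDerivAt Ψ _ z := (hψ.differentiable (by simp) z).hasFDerivAt.add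
      (HasFDerivAt.fun_sum fun a _ ↦ (h1 a).const_mul (reflCoef a *
        reflScale a ^ (l + if k = i then 1 else 0) * |reflScale a|⁻¹))
    rw [h2.fderiv]
    simp only [add_apply, _root_.sum_apply, _root_.smul_apply,
      ContinuousLinearMap.comp_apply, smul_eq_mul]
    congr 1
    refine Finset.sum_congr rfl fun a _ ↦ ?_
    have h3 : scaleAt i (reflScale a)⁻¹ (stdVec n k) =
        (if k = i then (reflScale a)⁻¹ else 1) • stdVec n k := by
      ext j
      rw [scaleAt_apply]
      by_cases h1 : k = i
      · subst h1
        by_cases h2 : j = k <;> simp [stdVec_apply, h2]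
      · by_cases h2 : j = i
        · subst h2; simp [stdVec_apply, h1, Ne.symm h1]
        · simp [h1, h2]
    rw [h3, map_smul, smul_eq_mul]
    have h4 := reflScale_ne_zero a
    split_ifs
    · field_simp
      ring
    · simp
  have hk : k ≠ i ∨ ∀ z : Model n, z i = 0 → Ψ z = 0 := by
    by_cases hki : k = i
    · right
      intro z hz
      have h1 : ∀ a, scaleAt i (reflScale a)⁻¹ z = z := fun a ↦ by simp [scaleAt_eq, hz]
      -- Since s < 0, 1/|s| = -1/s. On the hyperplane Ψ is therefore ψ times 1 - ∑ c s^l, which is 0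
      -- for l ≤ 3.
      have h2 : ∀ a, reflCoef a * reflScale a ^ (l + 1) * |reflScale a|⁻¹ =
          - (reflCoef a * reflScale a ^ l) := by
        intro a
        have h4 := reflScale_ne_zero a
        rw [abs_of_neg (reflScale_neg a), pow_succ, inv_neg]
        field_simp
      simp only [Ψ, h1, hki, if_true, h2]
      rw [← Finset.sum_mul, Finset.sum_neg_distrib, sum_reflCoef hl]
      ring
    · exact Or.inl hki
  have key := integral_halfSpace_fderiv h (fun K hK ↦ MemLp.integrableOn_inter_compact hf hK)
    (fun K hK ↦ MemLp.integrableOn_inter_compact hd hK) hΨ hΨc hk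
  simp_rw [hder] at key
  exact key

end Reflection

end ScKorn

end


noncomputable section

namespace ScKorn

/-! ### Korn's inequality on a half space, through the extension. -/

section Extension

variable {n m : ℕ} {𝕜 : Type*} [RCLike 𝕜]

/-- The square of the `L²` norm on `S`. -/
def sqNorm (S : Set (Model n)) (g : Model n → 𝕜) : ℝ≥0∞ := ∫⁻ y in S, ‖g y‖ₑ ^ 2

variable {S : Set (Model n)} {f g : Model n → 𝕜}

theorem enorm_sum_sq_le {ι : Type*} (s : Finset ι) (a : ι → 𝕜) :
    ‖∑ i ∈ s, a i‖ₑ ^ 2 ≤ (s.card : ℝ≥0∞) * ∑ i ∈ s, ‖a i‖ₑ ^ 2 := by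
  have h : ‖∑ i ∈ s, a i‖ ^ 2 ≤ s.card * ∑ i ∈ s, ‖a i‖ ^ 2 :=
    (pow_le_pow_left₀ (norm_nonneg _) (norm_sum_le _ _) 2).trans sq_sum_le_card_mul_sum_sq
  simp_rw [← ofReal_norm, ← ENNReal.ofReal_pow (norm_nonneg _)]
  rw [← ENNReal.ofReal_sum_of_nonneg (fun i _ ↦ by positivity), ← ENNReal.ofReal_natCast,
    ← ENNReal.ofReal_mul (by positivity)]
  exact ENNReal.ofReal_le_ofReal h

theorem sqNorm_sum_le {ι : Type*} (s : Finset ι) (g : ι → Model n → 𝕜)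
    (hg : ∀ i ∈ s, AEStronglyMeasurable (g i) (volume.restrict S)) :
    sqNorm S (fun y ↦ ∑ i ∈ s, g i y) ≤ (s.card : ℝ≥0∞) * ∑ i ∈ s, sqNorm S (g i) := by
  unfold sqNorm
  rw [← lintegral_finsetSum' _ fun i hi ↦ ((hg i hi).enorm.pow_const 2),
    ← lintegral_const_mul' _ _ (by simp)]
  exact lintegral_mono fun y ↦ enorm_sum_sq_le s fun i ↦ g i y

theorem sqNorm_mono_ae {C : ℝ} (h : ∀ᵐ y ∂(volume.restrict S), ‖f y‖ ≤ C * ‖g y‖) :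
    sqNorm S f ≤ ENNReal.ofReal (C ^ 2) * sqNorm S g := by
  unfold sqNorm
  rw [← lintegral_const_mul' _ _ ENNReal.ofReal_ne_top]
  refine lintegral_mono_ae ?_
  filter_upwards [h] with y hy
  rw [← ofReal_norm, ← ofReal_norm, ← ENNReal.ofReal_pow (norm_nonneg _),
    ← ENNReal.ofReal_pow (norm_nonneg _), ← ENNReal.ofReal_mul (by positivity), ← mul_pow]
  exact ENNReal.ofReal_le_ofReal (pow_le_pow_left₀ (norm_nonneg _) hy 2)

theorem memLp_two_iff : MemLp g 2 (volume.restrict S) ↔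
    AEStronglyMeasurable g (volume.restrict S) ∧ sqNorm S g < ⊤ := by
  unfold MemLp sqNorm
  rw [eLpNorm_lt_top_iff_lintegral_rpow_enorm_lt_top (by simp) (by simp)]
  simp

theorem sqNorm_univ_eq (hg : MemLp g 2) : sqNorm Set.univ g = ENNReal.ofReal (∫ y, ‖g y‖ ^ 2) := by
  rw [ofReal_integral_eq_lintegral_ofReal (hg.integrable_norm_pow (by simp))
    (.of_forall fun y ↦ by positivity), sqNorm, Measure.restrict_univ]
  congr 1
  funext y
  rw [← ofReal_norm, ENNReal.ofReal_pow (norm_nonneg _)]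

variable {i : Fin n}

/-- Five terms, each with a coefficient of size at most 20 · 4⁴ = 5120. The bound l ≤ 4 rather than
3 leaves room for the derivative of a 3-tensor, which has four indices. -/
theorem sqNorm_reflect_le (hg : MemLp g 2 (volume.restrict (halfSpace i))) {l : ℕ} (hl : l ≤ 4) :
    sqNorm Set.univ (reflect i l g) ≤ ENNReal.ofReal (10 ^ 12) * sqNorm (halfSpace i) g := by
  have hg0 := memLp_indicator hg
  let G : Option (Fin 4) → Model n → 𝕜 := fun o ↦ o.elim ((halfSpace i).indicator g) fun a z ↦
    (reflCoef a * reflScale a ^ l) • (halfSpace i).indicator g (scaleAt i (reflScale a) z)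
  have hG : reflect i l g = fun z ↦ ∑ o, G o z := by
    funext z
    rw [Fintype.sum_option]
    rfl
  have hGm : ∀ o, AEStronglyMeasurable (G o) (volume.restrict Set.univ) := by
    rw [Measure.restrict_univ]
    rintro (_ | a)
    · exact hg0.1
    · exact ((MemLp.comp_scaleAt hg0 i (reflScale_ne_zero a)).const_smul
        (reflCoef a * reflScale a ^ l)).1
  have h0 : sqNorm Set.univ ((halfSpace i).indicator g) = sqNorm (halfSpace i) g := by
    unfold sqNorm
    rw [Measure.restrict_univ, ← lintegral_indicator (isOpen_halfSpace i).measurableSet]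
    congr 1
    funext y
    by_cases hy : y ∈ halfSpace i <;> simp [hy]
  have hone : ∀ o, sqNorm Set.univ (G o) ≤ ENNReal.ofReal (5120 ^ 2) * sqNorm (halfSpace i) g := by
    rintro (_ | a)
    · change sqNorm Set.univ ((halfSpace i).indicator g) ≤ _
      rw [h0]
      exact le_mul_of_one_le_left' (by rw [ENNReal.one_le_ofReal]; norm_num)
    · have h1 : sqNorm Set.univ (G (some a)) ≤ ENNReal.ofReal (5120 ^ 2) *
          sqNorm Set.univ (fun z ↦ (halfSpace i).indicator g (scaleAt i (reflScale a) z)) := by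
        refine sqNorm_mono_ae (.of_forall fun z ↦ ?_)
        simp only [G, Option.elim]
        rw [norm_smul]
        gcongr
        have hc : |reflCoef a| ≤ 20 := by fin_cases a <;> norm_num [reflCoef]
        have hs1 : |reflScale a| ≤ 4 := by
          fin_cases a <;> simp [reflScale] <;> norm_num
        rw [norm_mul, norm_pow, Real.norm_eq_abs, Real.norm_eq_abs]
        calc |reflCoef a| * |reflScale a| ^ l ≤ 20 * 4 ^ 4 := by
              gcongr
              exact (pow_le_pow_left₀ (abs_nonneg _) hs1 l).trans
                (pow_le_pow_right₀ (by norm_num) hl)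
          _ = 5120 := by norm_num
      refine h1.trans (mul_le_mul_right ?_ _)
      have h2 := lintegral_comp_scaleAt i (reflScale_ne_zero a)
        fun z ↦ ‖(halfSpace i).indicator g z‖ₑ ^ 2
      rw [← h0]
      unfold sqNorm
      rw [Measure.restrict_univ, h2]
      refine mul_le_of_le_one_left' ?_
      rw [ENNReal.ofReal_le_one]
      refine inv_le_one_of_one_le₀ ?_
      fin_cases a <;> simp [reflScale] <;> norm_num
  rw [hG]
  refine (sqNorm_sum_le _ _ fun o _ ↦ hGm o).trans ?_
  refine (mul_le_mul_right (Finset.sum_le_sum fun o _ ↦ hone o) _).trans ?_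
  rw [Finset.sum_const, nsmul_eq_mul, ← mul_assoc, ← mul_assoc]
  gcongr
  rw [← ENNReal.ofReal_natCast, ← ENNReal.ofReal_mul (by positivity),
    ← ENNReal.ofReal_mul (by positivity)]
  apply ENNReal.ofReal_le_ofReal
  norm_num

/-- The number of the indices that are equal to `i`. -/
def numIdx (i : Fin n) (J : Fin m → Fin n) : ℕ := ∑ a, if J a = i then 1 else 0

theorem numIdx_le (J : Fin m → Fin n) : numIdx i J ≤ m := by
  unfold numIdx
  calc _ ≤ ∑ _a : Fin m, 1 := Finset.sum_le_sum fun a _ ↦ by split_ifs <;> simp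
    _ = m := by simp

theorem numIdx_snoc (J : Fin m → Fin n) (k : Fin n) :
    numIdx i (Fin.snoc (α := fun _ ↦ Fin n) J k) = numIdx i J + if k = i then 1 else 0 := by
  unfold numIdx
  rw [Fin.sum_univ_castSucc]
  simp only [Fin.snoc_castSucc, Fin.snoc_last]

theorem numIdx_comp_perm (J : Fin m → Fin n) (σ : Equiv.Perm (Fin m)) :
    numIdx i (J ∘ σ) = numIdx i J :=
  Equiv.sum_comp σ fun a ↦ if J a = i then 1 else 0

theorem memLp_symComp {D : (Fin m → Fin n) → Model n → 𝕜}
    (h : ∀ L, MemLp (D L) 2 (volume.restrict S)) (L : Fin m → Fin n) :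
    MemLp (fun y ↦ symComp (fun L ↦ D L y) L) 2 (volume.restrict S) := by
  have := (memLp_finsetSum (Finset.univ : Finset (Equiv.Perm (Fin m))) fun σ _ ↦
    h (L ∘ σ)).const_smul ((m.factorial : ℝ)⁻¹)
  exact this

/-- A permutation of the indices does not change how many of them are normal, so the coefficients of
the reflection come out of the symmetrization. -/
theorem symComp_reflect (D : (Fin m → Fin n) → Model n → 𝕜) (L : Fin m → Fin n) (y : Model n) :
    symComp (fun L ↦ reflect i (numIdx i L) (D L) y) L =
      reflect i (numIdx i L) (fun y ↦ symComp (fun L ↦ D L y) L) y := by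
  have hind : ∀ z, (halfSpace i).indicator (fun y ↦ symComp (fun L ↦ D L y) L) z =
      symComp (fun L ↦ (halfSpace i).indicator (D L) z) L := by
    intro z
    by_cases hz : z ∈ halfSpace i <;> simp [hz, symComp]
  unfold reflect
  simp_rw [hind]
  unfold symComp
  simp_rw [numIdx_comp_perm]
  rw [Finset.sum_add_distrib, smul_add]
  congr 1
  simp_rw [Finset.smul_sum]
  rw [Finset.sum_comm]
  exact Finset.sum_congr rfl fun a _ ↦ Finset.sum_congr rfl fun σ _ ↦ smul_comm _ _ _

/-- Korn's inequality for the squares of the norms. -/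
theorem sqNorm_korn {f : (Fin (m + 1) → Fin n) → Model n → 𝕜}
    {D : (Fin (m + 2) → Fin n) → Model n → 𝕜} (h : IsH1 Set.univ f D)
    (hs : ∀ J (σ : Equiv.Perm (Fin (m + 1))) y, f (J ∘ σ) y = f J y) :
    ∑ L, sqNorm Set.univ (D L) ≤ ENNReal.ofReal (((m + 2).factorial : ℝ) ^ 2) *
      ∑ L, sqNorm Set.univ (fun y ↦ symComp (fun L ↦ D L y) L) := by
  have hS : ∀ L, MemLp (fun y ↦ symComp (fun L ↦ D L y) L) 2 := fun L ↦ by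
    simpa using memLp_symComp (S := Set.univ) h.memLp_deriv L
  simp_rw [fun L ↦ sqNorm_univ_eq (h.memLp_deriv_univ L), fun L ↦ sqNorm_univ_eq (hS L)]
  rw [← ENNReal.ofReal_sum_of_nonneg fun L _ ↦ integral_nonneg fun y ↦ by positivity,
    ← ENNReal.ofReal_sum_of_nonneg fun L _ ↦ integral_nonneg fun y ↦ by positivity,
    ← ENNReal.ofReal_mul (sq_nonneg _)]
  exact ENNReal.ofReal_le_ofReal (korn_univ h hs)

/-- The sets to which the reflection in `{z_i = 0}` restricts. -/
def IsReflStable (i : Fin n) (K : Set (Model n)) : Prop :=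
  ∀ t : ℝ, 1 ≤ t → ∀ z, scaleAt i (-t) z ∈ K → z ∈ K

/-- Extension of symmetric `3`-tensors from a half space (or the whole space) to `ℝⁿ`, together with
Korn's inequality for the extension. -/
theorem exists_korn_extension {H K : Set (Model n)} (hH : H = Set.univ ∨
    H = halfSpace i ∧ IsReflStable i K)
    {f : (Fin 3 → Fin n) → Model n → 𝕜} {D : (Fin 4 → Fin n) → Model n → 𝕜} (h : IsH1 H f D)
    (hs : ∀ J (σ : Equiv.Perm (Fin 3)) y, f (J ∘ σ) y = f J y)
    (hf0 : ∀ J, ∀ y ∉ K, f J y = 0) (hD0 : ∀ L, ∀ y ∉ K, D L y = 0) :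
    ∃ (f' : (Fin 3 → Fin n) → Model n → 𝕜) (D' : (Fin 4 → Fin n) → Model n → 𝕜),
      IsH1 Set.univ f' D' ∧ (∀ J (σ : Equiv.Perm (Fin 3)) y, f' (J ∘ σ) y = f' J y) ∧
      (∀ J, ∀ y ∈ H, f' J y = f J y) ∧ (∀ J, ∀ y ∉ K, f' J y = 0) ∧
      (∀ L, ∀ y ∉ K, D' L y = 0) ∧
      ∑ J, sqNorm Set.univ (f' J) ≤ ENNReal.ofReal (10 ^ 15) * ∑ J, sqNorm H (f J) ∧
      ∑ L, sqNorm Set.univ (D' L) ≤ ENNReal.ofReal (10 ^ 15) *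
        ∑ L, sqNorm H (fun y ↦ symComp (fun L ↦ D L y) L) := by
  rcases hH with rfl | ⟨rfl, hK⟩
  · refine ⟨f, D, h, hs, fun _ _ _ ↦ rfl, hf0, hD0, ?_, ?_⟩
    · exact le_mul_of_one_le_left' (by rw [ENNReal.one_le_ofReal]; norm_num)
    · refine (sqNorm_korn (m := 2) h hs).trans ?_
      gcongr
      norm_num [Nat.factorial]
  · have hzero : ∀ (l : ℕ) (g : Model n → 𝕜), (∀ y ∉ K, g y = 0) → ∀ y ∉ K, reflect i l g y = 0 := by
      intro l g hg y hy
      have h1 : (halfSpace i).indicator g y = 0 := by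
        by_cases hyH : y ∈ halfSpace i <;> simp [hyH, hg y hy]
      have h2 : ∀ a, (halfSpace i).indicator g (scaleAt i (reflScale a) y) = 0 := by
        intro a
        have : scaleAt i (reflScale a) y ∉ K := fun h ↦ hy (hK ((a : ℕ) + 1) (by simp) y h)
        by_cases hyH : scaleAt i (reflScale a) y ∈ halfSpace i <;> simp [hyH, hg _ this]
      simp [reflect, h1, h2]
    have hH1 : IsH1 Set.univ (fun J ↦ reflect i (numIdx i J) (f J))
        (fun L ↦ reflect i (numIdx i L) (D L)) := by
      refine ⟨fun J ↦ by simpa using memLp_reflect (h.memLp J) _,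
        fun L ↦ by simpa using memLp_reflect (h.memLp_deriv L) _, fun J k ↦ ?_⟩
      rw [numIdx_snoc]
      -- A 3-tensor has at most three normal indices, which is exactly the range in which the
      -- reflections match.
      exact (h.deriv J k).reflect (h.memLp J) (h.memLp_deriv _) (numIdx_le J)
    have hsym : ∀ J (σ : Equiv.Perm (Fin 3)) y, reflect i (numIdx i (J ∘ σ)) (f (J ∘ σ)) y =
        reflect i (numIdx i J) (f J) y := fun J σ y ↦ by
      rw [numIdx_comp_perm, funext (hs J σ)]
    refine ⟨fun J ↦ reflect i (numIdx i J) (f J), fun L ↦ reflect i (numIdx i L) (D L), hH1, hsym,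
      fun J y hy ↦ reflect_of_mem hy _, fun J ↦ hzero _ _ (hf0 J), fun L ↦ hzero _ _ (hD0 L), ?_, ?_⟩
    · rw [Finset.mul_sum]
      refine Finset.sum_le_sum fun J _ ↦
        (sqNorm_reflect_le (h.memLp J) ((numIdx_le J).trans (by norm_num))).trans ?_
      gcongr <;> norm_num
    · refine (sqNorm_korn (m := 2) hH1 hsym).trans ?_
      -- The symmetrized gradient of the extension is the reflection of the symmetrized gradient, so
      -- the full gradient on the half space does not enter the bound. The final constant is at
      -- least (4!)² · 10¹².
      simp_rw [symComp_reflect]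
      have h3 := Finset.sum_le_sum fun L (_ : L ∈ Finset.univ) ↦ sqNorm_reflect_le (i := i)
        (memLp_symComp (S := halfSpace i) h.memLp_deriv L) (numIdx_le (i := i) L)
      rw [← Finset.mul_sum] at h3
      refine (mul_le_mul_right h3 _).trans ?_
      rw [← mul_assoc, ← ENNReal.ofReal_mul (by positivity)]
      gcongr
      norm_num [Nat.factorial]

end Extension

end ScKorn

end


noncomputable section

namespace ScKorn

/-! ### Tensors and bilinear forms in charts. -/

section Charts

variable {n : ℕ} {M : Type*} [TopologicalSpace M] [ChartedSpace (Model n) M]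
  {𝕜 : Type*} [RCLike 𝕜] {m : ℕ}

/-- The coordinate frame of a chart, as a linear map. -/
def chartD (φ : OpenPartialHomeomorph M (Model n)) (y : Model n) : Model n →L[ℝ] Model n :=
  mfderiv 𝓘(ℝ, Model n) (𝓡 n) φ.symm y

/-- The value of a tensor field at a point, as a tensor on `ℝⁿ`. -/
def rawTensor (u : CovTensor 𝕜 n M m) (p : M) : MultilinearMap ℝ (fun _ : Fin m ↦ Model n) 𝕜 := u p

/-- The value of a field of bilinear forms at a point, as a bilinear form on `ℝⁿ`. -/
def rawBilin (G : BilinField n M) (p : M) : Model n →L[ℝ] Model n →L[ℝ] ℝ := G p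

/-- A tensor field in the coordinates of a chart. -/
def pullTensor (φ : OpenPartialHomeomorph M (Model n)) (u : CovTensor 𝕜 n M m) (y : Model n) :
    MultilinearMap ℝ (fun _ : Fin m ↦ Model n) 𝕜 :=
  (rawTensor u (φ.symm y)).compLinearMap fun _ ↦ (chartD φ y : Model n →ₗ[ℝ] Model n)

/-- A field of bilinear forms in the coordinates of a chart. -/
def pullBilin (G : BilinField n M) (φ : OpenPartialHomeomorph M (Model n)) (y : Model n) :
    Model n →L[ℝ] Model n →L[ℝ] ℝ :=
  (rawBilin G (φ.symm y)).bilinearComp (chartD φ y) (chartD φ y)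

variable {φ φ' : OpenPartialHomeomorph M (Model n)}

theorem comp_eq_pullTensor (u : CovTensor 𝕜 n M m) (J : Fin m → Fin n) (y : Model n) :
    comp φ u J y = pullTensor φ u y (fun a ↦ stdVec n (J a)) := rfl

theorem chartGram_eq_pullBilin (G : BilinField n M) (y : Model n) (i j : Fin n) :
    chartGram G φ y i j = pullBilin G φ y (stdVec n i) (stdVec n j) := rfl

theorem pullBilin_apply (G : BilinField n M) (y v w : Model n) :
    pullBilin G φ y v w = rawBilin G (φ.symm y) (chartD φ y v) (chartD φ y w) := rfl

theorem pullTensor_apply (u : CovTensor 𝕜 n M m) (y : Model n) (v : Fin m → Model n) :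
    pullTensor φ u y v = rawTensor u (φ.symm y) (fun a ↦ chartD φ y (v a)) := rfl

section Transition

/-- The change of coordinates from `φ'` to `φ`. -/
def transition (φ φ' : OpenPartialHomeomorph M (Model n)) :
    OpenPartialHomeomorph (Model n) (Model n) := φ'.symm.trans φ

theorem transition_symm : (transition φ φ').symm = transition φ' φ := by
  simp [transition, OpenPartialHomeomorph.trans_symm_eq_symm_trans_symm]

theorem transition_source : (transition φ φ').source = φ'.target ∩ φ'.symm ⁻¹' φ.source := by
  simp [transition, OpenPartialHomeomorph.trans_source]

theorem transition_target : (transition φ φ').target = φ.target ∩ φ.symm ⁻¹' φ'.source := by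
  rw [← OpenPartialHomeomorph.symm_source, transition_symm, transition_source]

theorem symm_transition {y : Model n} (hy : y ∈ (transition φ φ').source) :
    φ.symm (transition φ φ' y) = φ'.symm y := by
  rw [transition_source] at hy
  exact φ.left_inv hy.2

end Transition

variable [IsManifold (𝓡 n) ∞ M]

theorem contMDiffOn_symm_chart (hφ : φ ∈ IsManifold.maximalAtlas (𝓡 n) ∞ M) :
    ContMDiffOn 𝓘(ℝ, Model n) (𝓡 n) ∞ φ.symm φ.target :=
  contMDiffOn_symm_of_mem_maximalAtlas hφ

theorem contDiffOn_transition (hφ : φ ∈ IsManifold.maximalAtlas (𝓡 n) ∞ M)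
    (hφ' : φ' ∈ IsManifold.maximalAtlas (𝓡 n) ∞ M) :
    ContDiffOn ℝ ∞ (transition φ φ') (transition φ φ').source := by
  rw [← contMDiffOn_iff_contDiffOn, transition_source]
  exact (contMDiffOn_of_mem_maximalAtlas hφ).comp
    ((contMDiffOn_symm_chart hφ').mono Set.inter_subset_left) Set.inter_subset_right

theorem contDiffOn_transition_symm (hφ : φ ∈ IsManifold.maximalAtlas (𝓡 n) ∞ M)
    (hφ' : φ' ∈ IsManifold.maximalAtlas (𝓡 n) ∞ M) :
    ContDiffOn ℝ ∞ (transition φ φ').symm (transition φ φ').target := by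
  rw [transition_symm, ← OpenPartialHomeomorph.symm_source, transition_symm]
  exact contDiffOn_transition hφ' hφ

theorem mdifferentiableAt_symm_chart (hφ : φ ∈ IsManifold.maximalAtlas (𝓡 n) ∞ M) {y : Model n}
    (hy : y ∈ φ.target) : MDifferentiableAt 𝓘(ℝ, Model n) (𝓡 n) φ.symm y :=
  ((contMDiffOn_symm_chart hφ).contMDiffAt (φ.open_target.mem_nhds hy)).mdifferentiableAt (by simp)

theorem chartD_eq (hφ : φ ∈ IsManifold.maximalAtlas (𝓡 n) ∞ M)
    (hφ' : φ' ∈ IsManifold.maximalAtlas (𝓡 n) ∞ M) {y : Model n}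
    (hy : y ∈ (transition φ φ').source) :
    chartD φ' y = (chartD φ (transition φ φ' y)).comp (fderiv ℝ (transition φ φ') y) := by
  have hev : φ'.symm =ᶠ[𝓝 y] φ.symm ∘ transition φ φ' := by
    filter_upwards [(transition φ φ').open_source.mem_nhds hy] with z hz
    exact (symm_transition hz).symm
  have hty : transition φ φ' y ∈ φ.target := by
    have := (transition φ φ').map_source hy
    rw [transition_target] at this
    exact this.1
  have h1 := mdifferentiableAt_symm_chart hφ hty
  have h2 : MDifferentiableAt 𝓘(ℝ, Model n) 𝓘(ℝ, Model n) (transition φ φ') y :=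
    (hasFDerivAt_of_source (contDiffOn_transition hφ hφ') hy).differentiableAt.mdifferentiableAt
  have h3 : mfderiv 𝓘(ℝ, Model n) (𝓡 n) (φ.symm ∘ transition φ φ') y =
      (chartD φ (transition φ φ' y)).comp (fderiv ℝ (transition φ φ') y) := by
    rw [mfderiv_comp y h1 h2, mfderiv_eq_fderiv]
    rfl
  rw [← h3]
  exact hev.mfderiv_eq

theorem chartD_injective (hφ : φ ∈ IsManifold.maximalAtlas (𝓡 n) ∞ M) {y : Model n}
    (hy : y ∈ φ.target) : Function.Injective (chartD φ y) := by
  have h1 := mdifferentiableAt_symm_chart hφ hy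
  have h2 : MDifferentiableAt (𝓡 n) 𝓘(ℝ, Model n) φ (φ.symm y) :=
    ((contMDiffOn_of_mem_maximalAtlas hφ).contMDiffAt
      (φ.open_source.mem_nhds (φ.map_target hy))).mdifferentiableAt (by simp)
  have h3 : mfderiv 𝓘(ℝ, Model n) 𝓘(ℝ, Model n) (φ ∘ φ.symm) y = ContinuousLinearMap.id ℝ _ := by
    have hev : φ ∘ φ.symm =ᶠ[𝓝 y] id := by
      filter_upwards [φ.open_target.mem_nhds hy] with z hz using φ.right_inv hz
    rw [hev.mfderiv_eq]
    exact mfderiv_id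
  rw [mfderiv_comp y h2 h1] at h3
  intro v w hvw
  have h4 : ∀ v : Model n, mfderiv (𝓡 n) 𝓘(ℝ, Model n) φ (φ.symm y) (chartD φ y v) = v := fun v ↦
    DFunLike.congr_fun h3 v
  rw [← h4 v, hvw]
  exact h4 w

theorem chartD_surjective (hφ : φ ∈ IsManifold.maximalAtlas (𝓡 n) ∞ M) {y : Model n}
    (hy : y ∈ φ.target) : Function.Surjective (chartD φ y) :=
  LinearMap.injective_iff_surjective.1 (chartD_injective hφ hy)

theorem rawTensor_congr (u : CovTensor 𝕜 n M m) {p q : M} (h : p = q) :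
    rawTensor u p = rawTensor u q := by rw [h]

theorem rawBilin_congr (G : BilinField n M) {p q : M} (h : p = q) :
    rawBilin G p = rawBilin G q := by rw [h]

theorem pullTensor_eq (hφ : φ ∈ IsManifold.maximalAtlas (𝓡 n) ∞ M)
    (hφ' : φ' ∈ IsManifold.maximalAtlas (𝓡 n) ∞ M) {y : Model n}
    (hy : y ∈ (transition φ φ').source) (u : CovTensor 𝕜 n M m) (v : Fin m → Model n) :
    pullTensor φ' u y v = pullTensor φ u (transition φ φ' y)
      (fun a ↦ fderiv ℝ (transition φ φ') y (v a)) := by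
  rw [pullTensor_apply, pullTensor_apply, chartD_eq hφ hφ' hy,
    rawTensor_congr u (symm_transition hy)]
  rfl

theorem pullBilin_eq (hφ : φ ∈ IsManifold.maximalAtlas (𝓡 n) ∞ M)
    (hφ' : φ' ∈ IsManifold.maximalAtlas (𝓡 n) ∞ M) {y : Model n}
    (hy : y ∈ (transition φ φ').source) (G : BilinField n M) (v w : Model n) :
    pullBilin G φ' y v w = pullBilin G φ (transition φ φ' y)
      (fderiv ℝ (transition φ φ') y v) (fderiv ℝ (transition φ φ') y w) := by
  rw [pullBilin_apply, pullBilin_apply, chartD_eq hφ hφ' hy,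
    rawBilin_congr G (symm_transition hy)]
  rfl

theorem contDiffOn_pullBilin_of_apply {B : Model n → Model n →L[ℝ] Model n →L[ℝ] ℝ}
    {R : Set (Model n)} (h : ∀ v w, ContDiffOn ℝ ∞ (fun y ↦ B y v w) R) : ContDiffOn ℝ ∞ B R :=
  contDiffOn_clm_apply.2 fun v ↦ contDiffOn_clm_apply.2 fun w ↦ h v w

/-- The coordinate field is the tangent map of `φ.symm` applied to a constant section. -/
theorem contMDiffOn_frame (hφ : φ ∈ IsManifold.maximalAtlas (𝓡 n) ∞ M) (v : Model n) :
    ContMDiffOn 𝓘(ℝ, Model n) ((𝓡 n).prod 𝓘(ℝ, Model n)) ∞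
      (fun y ↦ Bundle.TotalSpace.mk' (Model n) (E := fun q : M ↦ TangentSpace (𝓡 n) q) (φ.symm y)
        (chartD φ y v)) φ.target := by
  have h1 := (contMDiffOn_symm_chart hφ).contMDiffOn_tangentMapWithin (m := ∞) (by simp)
    φ.open_target.uniqueMDiffOn
  have h2 := (contMDiff_vectorSpace_iff_contDiff (𝕜 := ℝ) (E := Model n)
    (V := fun _ : Model n ↦ (v : Model n)) (n := ∞)).2 contDiff_const
  refine (h1.comp h2.contMDiffOn (s := φ.target) fun y hy ↦ hy).congr fun y hy ↦ ?_
  simp only [Function.comp_apply, tangentMapWithin]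
  congr 1
  have : mfderivWithin 𝓘(ℝ, Model n) (𝓡 n) φ.symm φ.target y =
      mfderiv 𝓘(ℝ, Model n) (𝓡 n) φ.symm y := mfderivWithin_of_isOpen φ.open_target hy
  exact (DFunLike.congr_fun this v).symm

theorem contDiffOn_pullBilin {B : BilinField n M} (hB : IsSmoothBilin B)
    (hφ : φ ∈ IsManifold.maximalAtlas (𝓡 n) ∞ M) : ContDiffOn ℝ ∞ (pullBilin B φ) φ.target := by
  refine contDiffOn_pullBilin_of_apply fun v w ↦ ?_
  rw [← contMDiffOn_iff_contDiffOn]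
  intro y hy
  have hv := contMDiffOn_frame hφ v y hy
  have hw := contMDiffOn_frame hφ w y hy
  have hb := contMDiffOn_symm_chart hφ y hy
  have : ContMDiffWithinAt 𝓘(ℝ, Model n) ((𝓡 n).prod 𝓘(ℝ)) ∞
      (fun z ↦ Bundle.TotalSpace.mk' ℝ (E := Bundle.Trivial M ℝ) (φ.symm z)
        (B (φ.symm z) (chartD φ z v) (chartD φ z w))) φ.target y := by
    apply ContMDiffWithinAt.clm_bundle_apply₂ (F₁ := Model n) (F₂ := Model n)
    · exact ContMDiffAt.comp_contMDiffWithinAt y hB.contMDiffAt hb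
    · exact hv
    · exact hw
  simp only [Bundle.contMDiffWithinAt_totalSpace] at this
  exact this.2

/-- `G` is a smooth Riemannian metric on the set `U`. -/
structure MetricOn (G : BilinField n M) (U : Set M) : Prop where
  symm : ∀ p v w, rawBilin G p v w = rawBilin G p w v
  pos : ∀ p ∈ U, ∀ v, v ≠ 0 → 0 < rawBilin G p v v
  smooth : ∀ φ ∈ IsManifold.maximalAtlas (𝓡 n) ∞ M,
    ContDiffOn ℝ ∞ (pullBilin G φ) (φ.target ∩ φ.symm ⁻¹' U)

theorem metricOn_of_riemannian (g : Bundle.ContMDiffRiemannianMetric (𝓡 n) ∞ (Model n)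
    (fun p : M ↦ TangentSpace (𝓡 n) p)) (U : Set M) : MetricOn g.inner U where
  symm p v w := g.symm p v w
  pos p _ v hv := g.pos p v hv
  smooth _ hφ := (contDiffOn_pullBilin g.contMDiff hφ).mono Set.inter_subset_left

variable {x : M → ℝ} {h : BilinField n M}

theorem contDiffOn_comp_symm {a : M → ℝ} {U : Set M} (ha : ContMDiffOn (𝓡 n) 𝓘(ℝ, ℝ) ∞ a U)
    (hφ : φ ∈ IsManifold.maximalAtlas (𝓡 n) ∞ M) :
    ContDiffOn ℝ ∞ (fun y ↦ a (φ.symm y)) (φ.target ∩ φ.symm ⁻¹' U) := by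
  rw [← contMDiffOn_iff_contDiffOn]
  exact ha.comp ((contMDiffOn_symm_chart hφ).mono Set.inter_subset_left) Set.inter_subset_right

theorem dAt_chartD {a : M → ℝ} (hφ : φ ∈ IsManifold.maximalAtlas (𝓡 n) ∞ M) {y : Model n}
    (hy : y ∈ φ.target) (ha : MDifferentiableAt (𝓡 n) 𝓘(ℝ, ℝ) a (φ.symm y)) (v : Model n) :
    dAt n a (φ.symm y) (chartD φ y v) = fderiv ℝ (fun y ↦ a (φ.symm y)) y v := by
  have h1 := mfderiv_comp y ha (mdifferentiableAt_symm_chart hφ hy)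
  rw [mfderiv_eq_fderiv] at h1
  exact (DFunLike.congr_fun h1 v).symm

theorem pullBilin_gsc (hx : IsBoundaryDefining n x) (hφ : φ ∈ IsManifold.maximalAtlas (𝓡 n) ∞ M)
    {y : Model n} (hy : y ∈ φ.target) (v w : Model n) :
    pullBilin (gsc x h) φ y v w = ((x (φ.symm y)) ^ 4)⁻¹ *
      (fderiv ℝ (fun y ↦ x (φ.symm y)) y v * fderiv ℝ (fun y ↦ x (φ.symm y)) y w) +
      ((x (φ.symm y)) ^ 2)⁻¹ * pullBilin h φ y v w := by
  have ha : MDifferentiableAt (𝓡 n) 𝓘(ℝ, ℝ) x (φ.symm y) :=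
    hx.smooth.mdifferentiableAt (by simp)
  rw [← dAt_chartD hφ hy ha, ← dAt_chartD hφ hy ha]
  rfl

theorem metricOn_gsc (hx : IsBoundaryDefining n x) (hh : IsScatteringMetric x h) :
    MetricOn (gsc x h) (interiorX x) where
  symm p v w := by
    change ((x p) ^ 4)⁻¹ * (dAt n x p v * dAt n x p w) + ((x p) ^ 2)⁻¹ * h p v w =
      ((x p) ^ 4)⁻¹ * (dAt n x p w * dAt n x p v) + ((x p) ^ 2)⁻¹ * h p w v
    rw [hh.symm p v w, mul_comm (dAt n x p v)]
  pos p hp v hv := hh.pos_interior p hp v hv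
  smooth φ hφ := by
    refine contDiffOn_pullBilin_of_apply fun v w ↦ ?_
    have hxs : ContDiffOn ℝ ∞ (fun y ↦ x (φ.symm y)) φ.target := by
      simpa using contDiffOn_comp_symm hx.smooth.contMDiffOn (U := Set.univ) hφ
    have hd : ∀ v, ContDiffOn ℝ ∞ (fun y ↦ fderiv ℝ (fun y ↦ x (φ.symm y)) y v) φ.target :=
      fun v ↦ (hxs.fderiv_of_isOpen φ.open_target (m := ∞) (by simp)).clm_apply contDiffOn_const
    have hhs : ContDiffOn ℝ ∞ (fun y ↦ pullBilin h φ y v w) φ.target :=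
      ((contDiffOn_pullBilin hh.smooth hφ).clm_apply contDiffOn_const).clm_apply contDiffOn_const
    have hne : ∀ y ∈ φ.target ∩ φ.symm ⁻¹' interiorX x, x (φ.symm y) ≠ 0 := fun y hy ↦
      (show 0 < x (φ.symm y) from hy.2).ne'
    have hxs' := hxs.mono (t := φ.target ∩ φ.symm ⁻¹' interiorX x) Set.inter_subset_left
    refine ContDiffOn.congr (f := fun y ↦ ((x (φ.symm y)) ^ 4)⁻¹ *
      (fderiv ℝ (fun y ↦ x (φ.symm y)) y v * fderiv ℝ (fun y ↦ x (φ.symm y)) y w) +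
      ((x (φ.symm y)) ^ 2)⁻¹ * pullBilin h φ y v w) ?_ fun y hy ↦ pullBilin_gsc hx hφ hy.1 v w
    exact (((hxs'.pow 4).inv fun y hy ↦ pow_ne_zero _ (hne y hy)).mul
      (((hd v).mul (hd w)).mono Set.inter_subset_left)).add
      (((hxs'.pow 2).inv fun y hy ↦ pow_ne_zero _ (hne y hy)).mul (hhs.mono Set.inter_subset_left))

end Charts

end ScKorn

end


noncomputable section

namespace ScKorn

/-! ### Christoffel symbols and their transformation law. -/

section Christoffel

variable {n : ℕ} {M : Type*} [TopologicalSpace M] [ChartedSpace (Model n) M]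
  {𝕜 : Type*} [RCLike 𝕜] {m : ℕ}

/-- The bilinear map `(u, v) ↦ ∑ Γ^q_{kj} u^k v^j` in the coordinates of a chart. -/
def chMap (G : BilinField n M) (φ : OpenPartialHomeomorph M (Model n)) (y : Model n) :
    Model n →ₗ[ℝ] Model n →ₗ[ℝ] Model n :=
  LinearMap.mk₂ ℝ (fun u v ↦ ∑ q, (∑ k, ∑ j, u k * v j * christoffel G φ q k j y) • stdVec n q)
    (by intros; simp [add_mul, Finset.sum_add_distrib, add_smul])
    (by intros; simp [Finset.smul_sum, Finset.mul_sum, smul_smul, mul_assoc])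
    (by intros; simp [add_mul, mul_add, Finset.sum_add_distrib, add_smul])
    (by intros; simp [Finset.smul_sum, Finset.mul_sum, smul_smul, mul_assoc, mul_left_comm])

/-- Koszul's formula: the Christoffel symbols with lowered index. -/
def koszul (B : Model n → Model n →L[ℝ] Model n →L[ℝ] ℝ) (y u v w : Model n) : ℝ :=
  (1 / 2) * (fderiv ℝ B y u w v + fderiv ℝ B y v w u - fderiv ℝ B y w u v)

variable {G : BilinField n M} {φ φ' : OpenPartialHomeomorph M (Model n)} {U : Set M}

theorem chMap_stdVec (y : Model n) (k j : Fin n) :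
    chMap G φ y (stdVec n k) (stdVec n j) = ∑ q, christoffel G φ q k j y • stdVec n q := by
  simp [chMap, stdVec_apply]

theorem chartGram_symm (hG : ∀ p v w, rawBilin G p v w = rawBilin G p w v) (y : Model n)
    (i j : Fin n) : chartGram G φ y i j = chartGram G φ y j i := hG _ _ _

theorem sum_chartGram_mul (y : Model n) (v : Model n) (i : Fin n) :
    ∑ j, chartGram G φ y i j * v j = pullBilin G φ y (stdVec n i) v := by
  rw [clm_eq_sum (pullBilin G φ y (stdVec n i)) v]
  exact Finset.sum_congr rfl fun j _ ↦ mul_comm _ _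

variable [IsManifold (𝓡 n) ∞ M]

theorem pullBilin_pos (hG : MetricOn G U) (hφ : φ ∈ IsManifold.maximalAtlas (𝓡 n) ∞ M)
    {y : Model n} (hy : y ∈ φ.target ∩ φ.symm ⁻¹' U) {v : Model n} (hv : v ≠ 0) :
    0 < pullBilin G φ y v v := by
  refine hG.pos _ hy.2 _ fun h ↦ hv (chartD_injective hφ hy.1 ?_)
  exact h.trans (map_zero (chartD φ y)).symm

theorem det_chartGram_ne_zero (hG : MetricOn G U) (hφ : φ ∈ IsManifold.maximalAtlas (𝓡 n) ∞ M)
    {y : Model n} (hy : y ∈ φ.target ∩ φ.symm ⁻¹' U) : (chartGram G φ y).det ≠ 0 := by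
  intro h0
  obtain ⟨v, hv, hv0⟩ := Matrix.exists_mulVec_eq_zero_iff.2 h0
  have hne : (WithLp.toLp 2 v : Model n) ≠ 0 := fun h ↦ hv (by
    ext i; exact congrArg (fun w : Model n ↦ w i) h)
  have h1 : ∀ i, pullBilin G φ y (stdVec n i) (WithLp.toLp 2 v) = 0 := fun i ↦ by
    rw [← sum_chartGram_mul]
    exact congrFun hv0 i
  have h2 := pullBilin_pos hG hφ hy hne
  have h3 := congrArg (fun w : Model n ↦ pullBilin G φ y w (WithLp.toLp 2 v))
    (sum_smul_stdVec (WithLp.toLp 2 v : Model n))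
  simp only [map_sum, map_smul, ContinuousLinearMap.sum_apply, ContinuousLinearMap.smul_apply, h1,
    smul_zero, Finset.sum_const_zero] at h3
  exact h2.ne h3

theorem isOpen_region (hU : IsOpen U) : IsOpen (φ.target ∩ φ.symm ⁻¹' U) :=
  φ.symm.isOpen_inter_preimage hU

theorem differentiableAt_pullBilin (hG : MetricOn G U) (hU : IsOpen U)
    (hφ : φ ∈ IsManifold.maximalAtlas (𝓡 n) ∞ M) {y : Model n}
    (hy : y ∈ φ.target ∩ φ.symm ⁻¹' U) : DifferentiableAt ℝ (pullBilin G φ) y :=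
  ((hG.smooth φ hφ).contDiffAt ((isOpen_region hU).mem_nhds hy)).differentiableAt (by simp)

theorem fderiv_clm_apply_apply {B : Model n → Model n →L[ℝ] Model n →L[ℝ] ℝ} {y : Model n}
    (hB : DifferentiableAt ℝ B y) (c v w : Model n) :
    fderiv ℝ (fun z ↦ B z v w) y c = fderiv ℝ B y c v w := by
  have h1 : HasFDerivAt (fun z ↦ B z v w) _ y :=
    ((hB.hasFDerivAt.clm_apply (hasFDerivAt_const v y)).clm_apply (hasFDerivAt_const w y))
  rw [h1.fderiv]
  simp

/-- Lowering the index cancels the inverse Gram matrix on basis vectors, and trilinearity gives the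
general case. This form of the Christoffel symbols can be differentiated under a change of
coordinates without handling inverse matrices. -/
theorem pullBilin_chMap (hG : MetricOn G U) (hU : IsOpen U)
    (hφ : φ ∈ IsManifold.maximalAtlas (𝓡 n) ∞ M) {y : Model n}
    (hy : y ∈ φ.target ∩ φ.symm ⁻¹' U) (u v w : Model n) :
    pullBilin G φ y (chMap G φ y u v) w = koszul (pullBilin G φ) y u v w := by
  have hB := differentiableAt_pullBilin hG hU hφ hy
  have key : ∀ k j s, pullBilin G φ y (chMap G φ y (stdVec n k) (stdVec n j)) (stdVec n s) =
      koszul (pullBilin G φ) y (stdVec n k) (stdVec n j) (stdVec n s) := by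
    intro k j s
    have hc : ∀ q, christoffel G φ q k j y = ∑ s, (chartGram G φ y)⁻¹ q s *
        koszul (pullBilin G φ) y (stdVec n k) (stdVec n j) (stdVec n s) := fun q ↦ by
      simp only [christoffel, koszul, chartGram_eq_pullBilin, fderiv_clm_apply_apply hB,
        Finset.mul_sum]
      exact Finset.sum_congr rfl fun s _ ↦ by ring
    rw [chMap_stdVec, map_sum, ContinuousLinearMap.sum_apply]
    simp only [map_smul, ContinuousLinearMap.smul_apply, smul_eq_mul, hc]
    have h1 : ∀ q, pullBilin G φ y (stdVec n q) (stdVec n s) = chartGram G φ y s q := fun q ↦ by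
      rw [chartGram_symm hG.symm, chartGram_eq_pullBilin]
    have h2 : chartGram G φ y * (chartGram G φ y)⁻¹ = 1 :=
      Matrix.mul_nonsing_inv _ (det_chartGram_ne_zero hG hφ hy).isUnit
    have h3 : ∀ t, ∑ q, chartGram G φ y s q * (chartGram G φ y)⁻¹ q t = if s = t then 1 else 0 :=
      fun t ↦ by
        have := congrFun (congrFun h2 s) t
        rwa [Matrix.mul_apply, Matrix.one_apply] at this
    calc _ = ∑ t, (∑ q, chartGram G φ y s q * (chartGram G φ y)⁻¹ q t) *
          koszul (pullBilin G φ) y (stdVec n k) (stdVec n j) (stdVec n t) := by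
          simp only [Finset.sum_mul, h1]
          rw [Finset.sum_comm]
          exact Finset.sum_congr rfl fun t _ ↦ Finset.sum_congr rfl fun q _ ↦ by ring
      _ = _ := by simp [h3]
  have hL : ∀ u v w, pullBilin G φ y (chMap G φ y u v) w = ∑ k, ∑ j, ∑ s, u k * v j * w s *
      pullBilin G φ y (chMap G φ y (stdVec n k) (stdVec n j)) (stdVec n s) := by
    intro u v w
    conv_lhs => rw [← sum_smul_stdVec u, ← sum_smul_stdVec v, ← sum_smul_stdVec w]
    simp only [map_sum, map_smul, LinearMap.sum_apply, LinearMap.smul_apply,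
      ContinuousLinearMap.sum_apply, ContinuousLinearMap.smul_apply, smul_eq_mul, Finset.mul_sum,
      Finset.sum_mul]
    rw [Finset.sum_comm]
    conv_lhs => enter [2, j]; rw [Finset.sum_comm]
    rw [Finset.sum_comm]
    exact Finset.sum_congr rfl fun k _ ↦ Finset.sum_congr rfl fun j _ ↦
      Finset.sum_congr rfl fun s _ ↦ by ring
  have hR : ∀ u v w, koszul (pullBilin G φ) y u v w = ∑ k, ∑ j, ∑ s, u k * v j * w s *
      koszul (pullBilin G φ) y (stdVec n k) (stdVec n j) (stdVec n s) := by
    intro u v w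
    have e : ∀ a b c, fderiv ℝ (pullBilin G φ) y a b c = ∑ k, ∑ j, ∑ s, a k * b j * c s *
        fderiv ℝ (pullBilin G φ) y (stdVec n k) (stdVec n j) (stdVec n s) := by
      intro a b c
      rw [clm_eq_sum (fderiv ℝ (pullBilin G φ) y) a]
      simp only [ContinuousLinearMap.sum_apply, ContinuousLinearMap.smul_apply]
      refine Finset.sum_congr rfl fun k _ ↦ ?_
      rw [clm_eq_sum (fderiv ℝ (pullBilin G φ) y (stdVec n k)) b]
      simp only [ContinuousLinearMap.sum_apply, ContinuousLinearMap.smul_apply, Finset.smul_sum]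
      refine Finset.sum_congr rfl fun j _ ↦ ?_
      rw [clm_eq_sum (fderiv ℝ (pullBilin G φ) y (stdVec n k) (stdVec n j)) c]
      simp only [smul_eq_mul, Finset.mul_sum]
      exact Finset.sum_congr rfl fun s _ ↦ by ring
    simp only [koszul]
    rw [e u w v, e v w u, e w u v]
    have e1 : ∑ k, ∑ j, ∑ s, u k * w j * v s *
        fderiv ℝ (pullBilin G φ) y (stdVec n k) (stdVec n j) (stdVec n s) =
        ∑ k, ∑ j, ∑ s, u k * v j * w s *
        fderiv ℝ (pullBilin G φ) y (stdVec n k) (stdVec n s) (stdVec n j) :=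
      Finset.sum_congr rfl fun k _ ↦ by
        rw [Finset.sum_comm]
        exact Finset.sum_congr rfl fun j _ ↦ Finset.sum_congr rfl fun s _ ↦ by ring
    have e2 : ∑ k, ∑ j, ∑ s, v k * w j * u s *
        fderiv ℝ (pullBilin G φ) y (stdVec n k) (stdVec n j) (stdVec n s) =
        ∑ k, ∑ j, ∑ s, u k * v j * w s *
        fderiv ℝ (pullBilin G φ) y (stdVec n j) (stdVec n s) (stdVec n k) := by
      rw [Finset.sum_comm]
      conv_lhs => enter [2, j]; rw [Finset.sum_comm]
      rw [Finset.sum_comm]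
      refine Finset.sum_congr rfl fun k _ ↦ ?_
      rw [Finset.sum_comm]
      exact Finset.sum_congr rfl fun j _ ↦ Finset.sum_congr rfl fun s _ ↦ by ring
    have e3 : ∑ k, ∑ j, ∑ s, w k * u j * v s *
        fderiv ℝ (pullBilin G φ) y (stdVec n k) (stdVec n j) (stdVec n s) =
        ∑ k, ∑ j, ∑ s, u k * v j * w s *
        fderiv ℝ (pullBilin G φ) y (stdVec n s) (stdVec n k) (stdVec n j) := by
      rw [Finset.sum_comm]
      refine Finset.sum_congr rfl fun k _ ↦ ?_
      rw [Finset.sum_comm]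
      exact Finset.sum_congr rfl fun j _ ↦ Finset.sum_congr rfl fun s _ ↦ by ring
    rw [e1, e2, e3]
    simp only [← Finset.sum_add_distrib, ← Finset.sum_sub_distrib, Finset.mul_sum]
    exact Finset.sum_congr rfl fun k _ ↦ Finset.sum_congr rfl fun j _ ↦
      Finset.sum_congr rfl fun s _ ↦ by ring
  rw [hL, hR]
  simp only [key]

theorem eq_of_pullBilin_eq (hG : MetricOn G U) (hφ : φ ∈ IsManifold.maximalAtlas (𝓡 n) ∞ M)
    {y : Model n} (hy : y ∈ φ.target ∩ φ.symm ⁻¹' U) {u v : Model n}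
    (h : ∀ w, pullBilin G φ y u w = pullBilin G φ y v w) : u = v := by
  by_contra hne
  have h1 := pullBilin_pos hG hφ hy (sub_ne_zero.2 hne)
  have h2 : pullBilin G φ y (u - v) (u - v) = 0 := by
    rw [(pullBilin G φ y).map_sub u v, ContinuousLinearMap.sub_apply, h, sub_self]
  exact h1.ne' h2

/-- The inverse Gram matrix is smooth by Cramer's rule, as the determinant has no zeros. -/
theorem contDiffOn_christoffel (hG : MetricOn G U) (hU : IsOpen U)
    (hφ : φ ∈ IsManifold.maximalAtlas (𝓡 n) ∞ M) (q k j : Fin n) :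
    ContDiffOn ℝ ∞ (christoffel G φ q k j) (φ.target ∩ φ.symm ⁻¹' U) := by
  have hB := hG.smooth φ hφ
  have he : ∀ a b, ContDiffOn ℝ ∞ (fun z ↦ chartGram G φ z a b) (φ.target ∩ φ.symm ⁻¹' U) :=
    fun a b ↦ (hB.clm_apply contDiffOn_const).clm_apply contDiffOn_const
  have hd : ∀ a b c, ContDiffOn ℝ ∞ (fun y ↦ fderiv ℝ (fun z ↦ chartGram G φ z a b) y (stdVec n c))
      (φ.target ∩ φ.symm ⁻¹' U) := fun a b c ↦
    ((he a b).fderiv_of_isOpen (isOpen_region hU) (m := ∞) (by simp)).clm_apply contDiffOn_const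
  have hdet : ∀ (A : Model n → Matrix (Fin n) (Fin n) ℝ), (∀ a b, ContDiffOn ℝ ∞ (fun z ↦ A z a b)
      (φ.target ∩ φ.symm ⁻¹' U)) → ContDiffOn ℝ ∞ (fun z ↦ (A z).det) (φ.target ∩ φ.symm ⁻¹' U) := by
    intro A hA
    simp only [Matrix.det_apply]
    exact ContDiffOn.sum fun σ _ ↦ (contDiffOn_prod fun a _ ↦ hA _ _).const_smul _
  have hinv : ∀ a b, ContDiffOn ℝ ∞ (fun z ↦ (chartGram G φ z)⁻¹ a b)
      (φ.target ∩ φ.symm ⁻¹' U) := by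
    intro a b
    simp only [Matrix.inv_def, Matrix.smul_apply, smul_eq_mul, Ring.inverse_eq_inv',
      Matrix.adjugate_apply]
    refine ((hdet _ he).inv fun y hy ↦ det_chartGram_ne_zero hG hφ hy).mul (hdet _ fun c d ↦ ?_)
    by_cases hcd : c = b
    · subst hcd; simp only [Matrix.updateRow_self]; exact contDiffOn_const
    · simp only [Matrix.updateRow_ne hcd]; exact he c d
  exact contDiffOn_const.mul (ContDiffOn.sum fun s _ ↦
    (hinv q s).mul (((hd _ _ _).add (hd _ _ _)).sub (hd _ _ _)))

theorem fderiv_fderiv_symm {τ : Model n → Model n} {y : Model n} (hτ : ContDiffAt ℝ ∞ τ y)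
    (u v : Model n) : fderiv ℝ (fderiv ℝ τ) y u v = fderiv ℝ (fderiv ℝ τ) y v u := by
  have h := (hτ.isSymmSndFDerivAt (n := ∞) (by
    rw [minSmoothness_of_isRCLikeNormedField]; exact WithTop.coe_le_coe.2 (le_top : (2 : ℕ∞) ≤ ⊤)))
  exact h u v

/-- Differentiating the pulled back form yields six terms with second derivatives of τ. By the
symmetry of D²τ and of B, four of them cancel and the other two coincide. -/
theorem koszul_pull {B : Model n → Model n →L[ℝ] Model n →L[ℝ] ℝ}
    {B' : Model n → Model n →L[ℝ] Model n →L[ℝ] ℝ} {τ : Model n → Model n} {y : Model n}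
    (hτ : ContDiffAt ℝ ∞ τ y) (hB : DifferentiableAt ℝ B (τ y)) (hB' : DifferentiableAt ℝ B' y)
    (hs : ∀ v w, B (τ y) v w = B (τ y) w v)
    (h : ∀ᶠ z in 𝓝 y, ∀ v w, B' z v w = B (τ z) (fderiv ℝ τ z v) (fderiv ℝ τ z w))
    (u v w : Model n) : koszul B' y u v w =
      koszul B (τ y) (fderiv ℝ τ y u) (fderiv ℝ τ y v) (fderiv ℝ τ y w) +
      B (τ y) (fderiv ℝ (fderiv ℝ τ) y u v) (fderiv ℝ τ y w) := by
  have hd : DifferentiableAt ℝ (fderiv ℝ τ) y :=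
    (hτ.fderiv_right (m := ∞) (by simp)).differentiableAt (by simp)
  have e : ∀ c v w, fderiv ℝ B' y c v w =
      fderiv ℝ B (τ y) (fderiv ℝ τ y c) (fderiv ℝ τ y v) (fderiv ℝ τ y w) +
      B (τ y) (fderiv ℝ (fderiv ℝ τ) y c v) (fderiv ℝ τ y w) +
      B (τ y) (fderiv ℝ τ y v) (fderiv ℝ (fderiv ℝ τ) y c w) := by
    intro c v w
    rw [← fderiv_clm_apply_apply hB']
    have hev : (fun z ↦ B' z v w) =ᶠ[𝓝 y] fun z ↦ B (τ z) (fderiv ℝ τ z v) (fderiv ℝ τ z w) := by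
      filter_upwards [h] with z hz using hz v w
    have hBτ : HasFDerivAt (B ∘ τ) ((fderiv ℝ B (τ y)).comp (fderiv ℝ τ y)) y :=
      hB.hasFDerivAt.comp (g := B) (f := τ) y (hτ.differentiableAt (by simp)).hasFDerivAt
    have h2 : HasFDerivAt (fun z ↦ B (τ z) (fderiv ℝ τ z v) (fderiv ℝ τ z w)) _ y :=
      (hBτ.clm_apply (hd.hasFDerivAt.clm_apply (hasFDerivAt_const v y))).clm_apply
        (hd.hasFDerivAt.clm_apply (hasFDerivAt_const w y))
    rw [hev.fderiv_eq, h2.fderiv]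
    simp
    ring
  simp only [koszul, e]
  rw [fderiv_fderiv_symm hτ w u, fderiv_fderiv_symm hτ w v, fderiv_fderiv_symm hτ v u,
    hs (fderiv ℝ τ y u), hs (fderiv ℝ τ y w)]
  ring

/-- The transformation law of the Christoffel symbols. -/
theorem chMap_transition (hG : MetricOn G U) (hU : IsOpen U)
    (hφ : φ ∈ IsManifold.maximalAtlas (𝓡 n) ∞ M) (hφ' : φ' ∈ IsManifold.maximalAtlas (𝓡 n) ∞ M)
    {y : Model n} (hy : y ∈ (transition φ φ').source) (hyU : φ'.symm y ∈ U) (u v : Model n) :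
    fderiv ℝ (transition φ φ') y (chMap G φ' y u v) =
      chMap G φ (transition φ φ' y) (fderiv ℝ (transition φ φ') y u)
        (fderiv ℝ (transition φ φ') y v) + fderiv ℝ (fderiv ℝ (transition φ φ')) y u v := by
  set τ := transition φ φ' with hτd
  have hτ := contDiffOn_transition hφ hφ'
  have hσ := contDiffOn_transition_symm hφ hφ'
  have hτy : ContDiffAt ℝ ∞ τ y := hτ.contDiffAt (τ.open_source.mem_nhds hy)
  have hy' : y ∈ φ'.target ∩ φ'.symm ⁻¹' U := by
    have := hy; rw [hτd, transition_source] at this; exact ⟨this.1, hyU⟩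
  have hty : τ y ∈ φ.target ∩ φ.symm ⁻¹' U := by
    have h1 := τ.map_source hy
    rw [hτd, transition_target] at h1
    exact ⟨h1.1, by rw [Set.mem_preimage, hτd, symm_transition hy]; exact hyU⟩
  refine eq_of_pullBilin_eq hG hφ hty fun w ↦ ?_
  -- Dτ is invertible, so it suffices to pair with vectors Dτ w', for which the pulled back Koszul
  -- formula is available.
  have hsurj : ∃ w', fderiv ℝ τ y w' = w := ⟨fderiv ℝ τ.symm (τ y) w, by
    have := fderiv_comp_symm hτ hσ (τ.map_source hy)
    rw [τ.left_inv hy] at this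
    exact DFunLike.congr_fun this w⟩
  obtain ⟨w', rfl⟩ := hsurj
  rw [map_add, ContinuousLinearMap.add_apply, pullBilin_chMap hG hU hφ hty,
    ← pullBilin_eq hφ hφ' hy, pullBilin_chMap hG hU hφ' hy']
  refine koszul_pull hτy (differentiableAt_pullBilin hG hU hφ hty)
    (differentiableAt_pullBilin hG hU hφ' hy') (fun _ _ ↦ hG.symm _ _ _) ?_ u v w'
  filter_upwards [τ.open_source.mem_nhds hy] with z hz v w using pullBilin_eq hφ hφ' hz G v w

end Christoffel

end ScKorn

end


noncomputable section

namespace ScKorn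

/-! ### The product rule for tensors evaluated on vector fields. -/

section Leibniz

variable {n : ℕ} {𝕜 : Type*} [RCLike 𝕜] {m : ℕ}

theorem multilinear_expand {F : Type*} [AddCommGroup F] [Module ℝ F]
    (S : MultilinearMap ℝ (fun _ : Fin m ↦ Model n) F) (v : Fin m → Model n) :
    S v = ∑ J : Fin m → Fin n, (∏ a, v a (J a)) • S (fun a ↦ stdVec n (J a)) := by
  conv_lhs => rw [show v = fun a ↦ ∑ l, v a l • stdVec n l from
    funext fun a ↦ (sum_smul_stdVec (v a)).symm]
  rw [MultilinearMap.map_sum]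
  exact Finset.sum_congr rfl fun J _ ↦ MultilinearMap.map_smul_univ _ _ _

/-- Apply a linear map in one slot of a multilinear map. -/
def slotMap (T : MultilinearMap ℝ (fun _ : Fin m ↦ Model n) 𝕜) (a : Fin m)
    (L : Model n →ₗ[ℝ] Model n) : MultilinearMap ℝ (fun _ : Fin m ↦ Model n) 𝕜 :=
  T.compLinearMap fun b ↦ if b = a then L else LinearMap.id

theorem slotMap_apply (T : MultilinearMap ℝ (fun _ : Fin m ↦ Model n) 𝕜) (a : Fin m)
    (L : Model n →ₗ[ℝ] Model n) (v : Fin m → Model n) :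
    slotMap T a L v = T (Function.update v a (L (v a))) := by
  rw [slotMap, MultilinearMap.compLinearMap_apply]
  congr 1
  funext b
  by_cases hb : b = a
  · subst hb; simp
  · simp [hb]

theorem fderiv_prod_update {v : Fin m → Model n → Model n} {y : Model n}
    (hv : ∀ a, DifferentiableAt ℝ (v a) y) (J : Fin m → Fin n) (c : Model n) :
    fderiv ℝ (fun y ↦ ∏ a, v a y (J a)) y c =
      ∑ a, ∏ b, (Function.update (fun a ↦ v a y) a (fderiv ℝ (v a) y c)) b (J b) := by
  have h1 : ∀ a ∈ (Finset.univ : Finset (Fin m)), HasFDerivAt (fun y ↦ v a y (J a))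
      ((EuclideanSpace.proj (𝕜 := ℝ) (J a)).comp (fderiv ℝ (v a) y)) y := fun a _ ↦
    (EuclideanSpace.proj (𝕜 := ℝ) (J a) : Model n →L[ℝ] ℝ).hasFDerivAt.comp y (hv a).hasFDerivAt
  rw [(HasFDerivAt.finset_prod h1).fderiv]
  simp only [ContinuousLinearMap.sum_apply, ContinuousLinearMap.smul_apply, smul_eq_mul]
  refine Finset.sum_congr rfl fun a _ ↦ ?_
  rw [← Finset.mul_prod_erase Finset.univ _ (Finset.mem_univ a), mul_comm]
  congr 1
  · simp
  · exact Finset.prod_congr rfl fun b hb ↦ by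
      rw [Function.update_of_ne (Finset.ne_of_mem_erase hb)]

variable {R : Set (Model n)}

/-- The product rule for the weak derivative of a tensor evaluated on smooth vector fields. -/
theorem WeakDeriv.tensor_apply (hR : IsOpen R)
    {T : Model n → MultilinearMap ℝ (fun _ : Fin m ↦ Model n) 𝕜}
    {S : Model n → MultilinearMap ℝ (fun _ : Fin (m + 1) ↦ Model n) 𝕜}
    {Γ : Model n → Model n →ₗ[ℝ] Model n →ₗ[ℝ] Model n} {c : Model n}
    (h : ∀ J : Fin m → Fin n, WeakDeriv R c (fun y ↦ T y fun a ↦ stdVec n (J a))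
      (fun y ↦ S y (Fin.snoc (α := fun _ ↦ Model n) (fun a ↦ stdVec n (J a)) c) +
        ∑ a, T y (Function.update (fun a ↦ stdVec n (J a)) a (Γ y c (stdVec n (J a))))))
    {v : Fin m → Model n → Model n} (hv : ∀ a, ContDiffOn ℝ ∞ (v a) R) :
    WeakDeriv R c (fun y ↦ T y fun a ↦ v a y)
      (fun y ↦ S y (Fin.snoc (α := fun _ ↦ Model n) (fun a ↦ v a y) c) +
        ∑ a, T y (Function.update (fun a ↦ v a y) a
          (fderiv ℝ (v a) y c + Γ y c (v a y)))) := by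
  have hc : ∀ J : Fin m → Fin n, ContDiffOn ℝ ∞ (fun y ↦ ∏ a, v a y (J a)) R := fun J ↦
    contDiffOn_prod fun a _ ↦ (EuclideanSpace.proj (𝕜 := ℝ) (J a)).contDiff.comp_contDiffOn (hv a)
  -- Expand in the components of T. The coefficients are products of coordinates of the fields,
  -- whose derivatives produce the terms with D v_a; multilinearity reassembles the rest.
  refine (WeakDeriv.sum Finset.univ hR fun J _ ↦ (h J).smul hR (hc J)).congr hR ?_ ?_
  · intro y hy
    exact (multilinear_expand (T y) _).symm
  · intro y hy
    have hd : ∀ a, DifferentiableAt ℝ (v a) y := fun a ↦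
      ((hv a).contDiffAt (hR.mem_nhds hy)).differentiableAt (by simp)
    simp only [fderiv_prod_update hd]
    have e1 := congrArg (fun f ↦ f c) (multilinear_expand (S y).curryRight fun a ↦ v a y)
    simp only [MultilinearMap.curryRight_apply, LinearMap.sum_apply, LinearMap.smul_apply] at e1
    have e2 := fun a ↦ multilinear_expand (slotMap (T y) a (Γ y c)) fun a ↦ v a y
    have e3 := fun a ↦ multilinear_expand (T y) (Function.update (fun a ↦ v a y) a
      (fderiv ℝ (v a) y c))
    simp only [slotMap_apply] at e2
    simp only [MultilinearMap.map_update_add]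
    rw [e1]
    simp only [e2, e3, smul_add, Finset.sum_add_distrib, Finset.smul_sum, Finset.sum_smul]
    rw [Finset.sum_comm (f := fun (J : Fin m → Fin n) (a : Fin m) ↦
      (∏ b, (Function.update (fun a ↦ v a y) a (fderiv ℝ (v a) y c)) b (J b)) •
        T y fun a ↦ stdVec n (J a)),
      Finset.sum_comm (f := fun (J : Fin m → Fin n) (a : Fin m) ↦
      (∏ a, (v a y) (J a)) • T y (Function.update (fun a ↦ stdVec n (J a)) a
        (Γ y c (stdVec n (J a)))))]
    abel

end Leibniz

/-! ### Independence of the weak covariant derivative of the chart. -/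

section Transfer

variable {n : ℕ} {M : Type*} [TopologicalSpace M] [ChartedSpace (Model n) M]
  {𝕜 : Type*} [RCLike 𝕜] {m : ℕ}

/-- `w = ∇u` in the sense of distributions, in the open subset `R` of the domain of a chart. -/
structure ChartWeak (G : BilinField n M) (φ : OpenPartialHomeomorph M (Model n))
    (R : Set (Model n)) (u : CovTensor 𝕜 n M m) (w : CovTensor 𝕜 n M (m + 1)) : Prop where
  loc : ∀ J, LocallyIntegrableOn (comp φ u J) R
  loc_deriv : ∀ L, LocallyIntegrableOn (comp φ w L) R
  deriv : ∀ (J : Fin m → Fin n) (k : Fin n), WeakDeriv R (stdVec n k) (comp φ u J)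
    (fun y ↦ comp φ w (Fin.snoc (α := fun _ ↦ Fin n) J k) y + ∑ a : Fin m, ∑ q : Fin n,
      christoffel G φ q k (J a) y • comp φ u (Function.update J a q) y)

variable {G : BilinField n M} {φ φ' : OpenPartialHomeomorph M (Model n)} {U : Set M}
  {R : Set (Model n)} {u : CovTensor 𝕜 n M m} {w : CovTensor 𝕜 n M (m + 1)}

theorem locallyIntegrableOn_finset_sum {ι : Type*} (s : Finset ι) {f : ι → Model n → 𝕜}
    (h : ∀ i ∈ s, LocallyIntegrableOn (f i) R) : LocallyIntegrableOn (fun y ↦ ∑ i ∈ s, f i y) R := by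
  classical
  induction s using Finset.induction_on with
  | empty => simp only [Finset.sum_empty]; exact locallyIntegrableOn_zero
  | insert l s hl ih =>
    simp only [Finset.sum_insert hl]
    exact (h l (Finset.mem_insert_self _ _)).add
      (ih fun i hi ↦ h i (Finset.mem_insert_of_mem hi))

theorem ChartWeak.mono {R' : Set (Model n)} (h : ChartWeak G φ R u w) (hR : R' ⊆ R) :
    ChartWeak G φ R' u w :=
  ⟨fun J ↦ (h.loc J).mono_set hR, fun L ↦ (h.loc_deriv L).mono_set hR,
    fun J k ↦ (h.deriv J k).mono hR⟩

theorem comp_snoc (w : CovTensor 𝕜 n M (m + 1)) (J : Fin m → Fin n) (k : Fin n) (y : Model n) :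
    comp φ w (Fin.snoc (α := fun _ ↦ Fin n) J k) y =
      pullTensor φ w y (Fin.snoc (α := fun _ ↦ Model n) (fun a ↦ stdVec n (J a)) (stdVec n k)) := by
  rw [comp_eq_pullTensor]
  congr 1
  funext a
  refine Fin.lastCases ?_ (fun i ↦ ?_) a <;> simp

theorem sum_christoffel (J : Fin m → Fin n) (k : Fin n) (a : Fin m) (y : Model n) :
    ∑ q : Fin n, christoffel G φ q k (J a) y • comp φ u (Function.update J a q) y =
      pullTensor φ u y (Function.update (fun a ↦ stdVec n (J a)) a
        (chMap G φ y (stdVec n k) (stdVec n (J a)))) := by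
  rw [chMap_stdVec, MultilinearMap.map_update_sum]
  refine Finset.sum_congr rfl fun q _ ↦ ?_
  rw [MultilinearMap.map_update_smul, comp_eq_pullTensor]
  congr 2
  funext b
  by_cases hb : b = a
  · subst hb; simp
  · simp [hb]

/-- The local integrability of w need not be checked: w is the weak derivative minus Christoffel
terms, which are locally integrable. -/
theorem ChartWeak.of_deriv (hΓ : ∀ q k j, ContinuousOn (christoffel G φ q k j) R) (hR : IsOpen R)
    (h1 : ∀ J, LocallyIntegrableOn (comp φ u J) R)
    (h : ∀ (J : Fin m → Fin n) (k : Fin n), WeakDeriv R (stdVec n k) (comp φ u J)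
    (fun y ↦ comp φ w (Fin.snoc (α := fun _ ↦ Fin n) J k) y + ∑ a : Fin m, ∑ q : Fin n,
      christoffel G φ q k (J a) y • comp φ u (Function.update J a q) y)) :
    ChartWeak G φ R u w := by
  refine ⟨h1, fun L ↦ ?_, h⟩
  have h2 := (h (Fin.init L) (L (Fin.last m))).loc_deriv.sub
    (locallyIntegrableOn_finset_sum Finset.univ fun a _ ↦
      locallyIntegrableOn_finset_sum Finset.univ fun q _ ↦
        (h1 (Function.update (Fin.init (α := fun _ ↦ Fin n) L) a q)).smul_contDiffOn hR
          (hΓ q (L (Fin.last m)) (Fin.init (α := fun _ ↦ Fin n) L a)))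
  convert h2 using 1
  funext y
  simp [Fin.snoc_init_self]

variable [IsManifold (𝓡 n) ∞ M]

/-- The only addition on the right is local integrability of the Christoffel terms, which are
products of locally integrable and continuous functions. -/
theorem isWeakCovDeriv_iff (hG : MetricOn G U) (hU : IsOpen U) : IsWeakCovDeriv G U u w ↔
    ∀ φ ∈ IsManifold.maximalAtlas (𝓡 n) ∞ M, ChartWeak G φ (φ.target ∩ φ.symm ⁻¹' U) u w := by
  refine ⟨fun h φ hφ ↦ ?_, fun h φ hφ ↦ ⟨(h φ hφ).loc, (h φ hφ).loc_deriv, fun J k ψ ↦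
    ((h φ hφ).deriv J k).eq ψ⟩⟩
  obtain ⟨h1, h2, h3⟩ := h φ hφ
  refine ⟨h1, h2, fun J k ↦ ⟨h1 J, ?_, fun ψ ↦ h3 J k ψ⟩⟩
  exact (h2 _).add (locallyIntegrableOn_finset_sum Finset.univ fun a _ ↦
      locallyIntegrableOn_finset_sum Finset.univ fun q _ ↦
        (h1 _).smul_contDiffOn (isOpen_region hU) (contDiffOn_christoffel hG hU hφ _ _ _).continuousOn)

/-- The weak covariant derivative does not depend on the chart. -/
theorem ChartWeak.transfer (hG : MetricOn G U) (hU : IsOpen U)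
    (hφ : φ ∈ IsManifold.maximalAtlas (𝓡 n) ∞ M) (hφ' : φ' ∈ IsManifold.maximalAtlas (𝓡 n) ∞ M)
    (hR : R ⊆ φ.target ∩ φ.symm ⁻¹' U) (hRo : IsOpen R) (hn : 0 < n)
    (h : ChartWeak G φ R u w) : ChartWeak G φ' ((transition φ φ').source ∩ transition φ φ' ⁻¹' R) u w := by
  set τ := transition φ φ' with hτd
  have hτ := contDiffOn_transition hφ hφ'
  have hσ := contDiffOn_transition_symm hφ hφ'
  rw [← hτd] at hτ hσ
  have ho : IsOpen (τ.source ∩ τ ⁻¹' R) := τ.isOpen_inter_preimage hRo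
  have hRt : IsOpen (R ∩ τ.target) := hRo.inter τ.open_target
  have hset : τ.source ∩ τ ⁻¹' (R ∩ τ.target) = τ.source ∩ τ ⁻¹' R := by
    ext y
    exact ⟨fun hy ↦ ⟨hy.1, hy.2.1⟩, fun hy ↦ ⟨hy.1, hy.2, τ.map_source hy.1⟩⟩
  have hsub : τ.source ∩ τ ⁻¹' R ⊆ φ'.target ∩ φ'.symm ⁻¹' U := by
    intro y hy
    have h1 := hy.1
    rw [hτd, transition_source] at h1
    have h2 := (hR hy.2).2
    rw [Set.mem_preimage, hτd, symm_transition hy.1] at h2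
    exact ⟨h1.1, h2⟩
  have hW : ∀ (J : Fin m → Fin n) (k : Fin n), WeakDeriv (τ.source ∩ τ ⁻¹' R) (stdVec n k)
      (comp φ' u J) (fun y ↦ comp φ' w (Fin.snoc (α := fun _ ↦ Fin n) J k) y +
        ∑ a : Fin m, ∑ q : Fin n,
          christoffel G φ' q k (J a) y • comp φ' u (Function.update J a q) y) := by
    intro J k
    have hsm : ∀ a : Fin m, ContDiffOn ℝ ∞ (fun z ↦ fderiv ℝ τ (τ.symm z) (stdVec n (J a)))
        (R ∩ τ.target) := fun a ↦
      (((hτ.fderiv_of_isOpen τ.open_source (m := ∞) (by simp)).clm_apply contDiffOn_const).comp hσ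
        fun z hz ↦ τ.map_target hz).mono Set.inter_subset_right
    -- The components in the chart φ' are the tensor evaluated on the fields Dτ e_J. Differentiate
    -- these in the chart φ, then change variables.
    have hT := fun l ↦ WeakDeriv.tensor_apply (T := pullTensor φ u) (S := pullTensor φ w)
      (Γ := chMap G φ) (c := stdVec n l) hRt (fun J ↦ by
        have := (h.deriv J l).mono (Set.inter_subset_left (t := τ.target))
        simp only [comp_snoc, sum_christoffel] at this
        exact this) hsm
    have hC := WeakDeriv.comp_diffeo hτ hσ Set.inter_subset_right hRt hT (stdVec n k) (hT k).loc
    rw [hset] at hC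
    refine hC.congr ho ?_ ?_
    · intro y hy
      simp only [τ.left_inv hy.1]
      exact (pullTensor_eq hφ hφ' hy.1 u _).symm
    · intro y hy
      have hdτ : HasFDerivAt (fderiv ℝ τ) (fderiv ℝ (fderiv ℝ τ) y) y :=
        (((hτ.fderiv_of_isOpen τ.open_source (m := ∞) (by simp)).contDiffAt
          (τ.open_source.mem_nhds hy.1)).differentiableAt (by simp)).hasFDerivAt
      have hds : HasFDerivAt τ.symm (fderiv ℝ τ.symm (τ y)) (τ y) :=
        hasFDerivAt_symm hσ (τ.map_source hy.1)
      have hcomp := fderiv_symm_comp hτ hσ hy.1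
      have hD : ∀ a : Fin m, fderiv ℝ (fun z ↦ fderiv ℝ τ (τ.symm z) (stdVec n (J a))) (τ y)
          (fderiv ℝ τ y (stdVec n k)) = fderiv ℝ (fderiv ℝ τ) y (stdVec n k) (stdVec n (J a)) := by
        intro a
        have h1 : HasFDerivAt (fderiv ℝ τ) (fderiv ℝ (fderiv ℝ τ) y) (τ.symm (τ y)) := by
          rw [τ.left_inv hy.1]; exact hdτ
        have h2 := (h1.comp (g := fderiv ℝ τ) (f := τ.symm) (τ y) hds).clm_apply
          (hasFDerivAt_const (stdVec n (J a)) (τ y))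
        have h3 : fderiv ℝ (fun z ↦ fderiv ℝ τ (τ.symm z) (stdVec n (J a))) (τ y) = _ := h2.fderiv
        rw [h3]
        have h4 : fderiv ℝ τ.symm (τ y) (fderiv ℝ τ y (stdVec n k)) = stdVec n k :=
          DFunLike.congr_fun hcomp _
        simp [h4]
      simp only [comp_snoc, sum_christoffel, τ.left_inv hy.1]
      -- The derivative is linear in its direction, so the sum over l from the chain rule is the
      -- derivative in the direction Dτ e_k.
      have hlin := (clm_eq_sum (F := 𝕜) (LinearMap.toContinuousLinearMap
        ((pullTensor φ w (τ y)).curryRight (fun a ↦ fderiv ℝ τ y (stdVec n (J a))) +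
        ∑ a, (pullTensor φ u (τ y)).toLinearMap (fun a ↦ fderiv ℝ τ y (stdVec n (J a))) a ∘ₗ
          (((fderiv ℝ (fun z ↦ fderiv ℝ τ (τ.symm z) (stdVec n (J a))) (τ y) :
            Model n →L[ℝ] Model n) : Model n →ₗ[ℝ] Model n) +
          (chMap G φ (τ y)).flip (fderiv ℝ τ y (stdVec n (J a)))))) (fderiv ℝ τ y (stdVec n k))).symm
      simp only [LinearMap.coe_toContinuousLinearMap', LinearMap.add_apply,
        MultilinearMap.curryRight_apply, LinearMap.sum_apply, LinearMap.comp_apply,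
        MultilinearMap.toLinearMap_apply, LinearMap.flip_apply, ContinuousLinearMap.coe_coe,
        hD] at hlin
      rw [hlin]
      congr 1
      · rw [pullTensor_eq hφ hφ' hy.1 w]
        congr 1
        funext a
        refine Fin.lastCases ?_ (fun i ↦ ?_) a <;> simp [hτd]
      · refine Finset.sum_congr rfl fun a _ ↦ ?_
        rw [pullTensor_eq hφ hφ' hy.1 u]
        congr 1
        funext b
        by_cases hb : b = a
        · subst hb
          simp only [Function.update_self]
          -- The second derivative of τ that arises from differentiating the fields is the
          -- inhomogeneous term of the transformation law.
          rw [chMap_transition hG hU hφ hφ' hy.1 (hsub hy).2, add_comm]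
        · simp [hb, hτd]
  exact ChartWeak.of_deriv (fun q k j ↦
    (contDiffOn_christoffel hG hU hφ' q k j).continuousOn.mono hsub) ho (fun J ↦ (hW J ⟨0, hn⟩).loc) hW

end Transfer

end ScKorn

end


noncomputable section

namespace ScKorn

/-! ### Tensor fields assembled from components in one chart. -/

section OfComp

variable {n : ℕ} {M : Type*} [TopologicalSpace M] [ChartedSpace (Model n) M]
  {𝕜 : Type*} [RCLike 𝕜] {m : ℕ}

/-- The differential of a chart, as a linear map. -/
def chartInvD (φ : OpenPartialHomeomorph M (Model n)) (p : M) : Model n →L[ℝ] Model n :=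
  mfderiv (𝓡 n) 𝓘(ℝ, Model n) φ p

/-- The tensor on `ℝⁿ` with given components. -/
def tensorOfComp (c : (Fin m → Fin n) → 𝕜) : MultilinearMap ℝ (fun _ : Fin m ↦ Model n) 𝕜 :=
  ∑ J : Fin m → Fin n, ((MultilinearMap.mkPiAlgebra ℝ (Fin m) ℝ).compLinearMap fun a ↦
    ((EuclideanSpace.proj (𝕜 := ℝ) (J a) : Model n →L[ℝ] ℝ) : Model n →ₗ[ℝ] ℝ)).smulRight (c J)

theorem tensorOfComp_apply (c : (Fin m → Fin n) → 𝕜) (v : Fin m → Model n) :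
    tensorOfComp c v = ∑ J : Fin m → Fin n, (∏ a, v a (J a)) • c J := by
  simp [tensorOfComp, MultilinearMap.sum_apply]

theorem tensorOfComp_stdVec (c : (Fin m → Fin n) → 𝕜) (J : Fin m → Fin n) :
    tensorOfComp c (fun a ↦ stdVec n (J a)) = c J := by
  rw [tensorOfComp_apply, Finset.sum_eq_single J]
  · simp [stdVec_apply]
  · intro L _ hL
    obtain ⟨a, ha⟩ := Function.ne_iff.1 hL
    rw [Finset.prod_eq_zero (Finset.mem_univ a), zero_smul]
    simp [stdVec_apply, ha]
  · simp

open Classical in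
/-- The tensor field, supported in the domain of a chart, with given components in this chart. -/
def ofComp (φ : OpenPartialHomeomorph M (Model n)) (c : (Fin m → Fin n) → Model n → 𝕜) :
    CovTensor 𝕜 n M m := fun p ↦
  if p ∈ φ.source then (tensorOfComp fun J ↦ c J (φ p)).compLinearMap
    fun _ ↦ (chartInvD φ p : Model n →ₗ[ℝ] Model n) else 0

variable {φ φ' : OpenPartialHomeomorph M (Model n)} {c : (Fin m → Fin n) → Model n → 𝕜}

theorem rawTensor_ofComp {p : M} (hp : p ∈ φ.source) (v : Fin m → Model n) :
    rawTensor (ofComp φ c) p v = tensorOfComp (fun J ↦ c J (φ p)) fun a ↦ chartInvD φ p (v a) := by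
  rw [rawTensor, ofComp, if_pos hp]
  rfl

theorem ofComp_eq_zero {p : M} (hp : p ∈ φ.source → ∀ J, c J (φ p) = 0) :
    ofComp φ c p = 0 := by
  rw [ofComp]
  split_ifs with h
  · ext v
    change tensorOfComp (fun J ↦ c J (φ p)) (fun a ↦ chartInvD φ p (v a)) = 0
    rw [tensorOfComp_apply]
    simp [hp h]
  · rfl

theorem isSymm_ofComp (hc : ∀ J (σ : Equiv.Perm (Fin m)) y, c (J ∘ σ) y = c J y) :
    IsSymm (ofComp φ c) := by
  intro p σ
  rw [ofComp]
  split_ifs with h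
  · ext v
    change tensorOfComp (fun J ↦ c J (φ p)) (fun a ↦ chartInvD φ p (v (σ a))) =
      tensorOfComp (fun J ↦ c J (φ p)) (fun a ↦ chartInvD φ p (v a))
    rw [tensorOfComp_apply, tensorOfComp_apply]
    refine Fintype.sum_equiv (σ.symm.arrowCongr (Equiv.refl (Fin n))).symm _ _ fun J ↦ ?_
    have : ((σ.symm.arrowCongr (Equiv.refl (Fin n))).symm J) = J ∘ σ.symm := rfl
    rw [this, hc J σ.symm]
    congr 1
    exact Fintype.prod_equiv σ _ _ fun a ↦ by simp
  · ext v; rfl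

variable [IsManifold (𝓡 n) ∞ M]

theorem chartInvD_chartD (hφ : φ ∈ IsManifold.maximalAtlas (𝓡 n) ∞ M) {y : Model n}
    (hy : y ∈ φ.target) (v : Model n) : chartInvD φ (φ.symm y) (chartD φ y v) = v := by
  have h1 := mdifferentiableAt_symm_chart hφ hy
  have h2 : MDifferentiableAt (𝓡 n) 𝓘(ℝ, Model n) φ (φ.symm y) :=
    ((contMDiffOn_of_mem_maximalAtlas hφ).contMDiffAt
      (φ.open_source.mem_nhds (φ.map_target hy))).mdifferentiableAt (by simp)
  have h3 : mfderiv 𝓘(ℝ, Model n) 𝓘(ℝ, Model n) (φ ∘ φ.symm) y = ContinuousLinearMap.id ℝ _ := by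
    have hev : φ ∘ φ.symm =ᶠ[𝓝 y] id := by
      filter_upwards [φ.open_target.mem_nhds hy] with z hz using φ.right_inv hz
    rw [hev.mfderiv_eq]
    exact mfderiv_id
  rw [mfderiv_comp y h2 h1] at h3
  exact DFunLike.congr_fun h3 v

theorem pullTensor_ofComp (hφ : φ ∈ IsManifold.maximalAtlas (𝓡 n) ∞ M) {y : Model n}
    (hy : y ∈ φ.target) (v : Fin m → Model n) :
    pullTensor φ (ofComp φ c) y v = tensorOfComp (fun J ↦ c J y) v := by
  rw [pullTensor_apply, rawTensor_ofComp (φ.map_target hy), φ.right_inv hy]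
  simp only [chartInvD_chartD hφ hy]

theorem comp_ofComp (hφ : φ ∈ IsManifold.maximalAtlas (𝓡 n) ∞ M) {y : Model n}
    (hy : y ∈ φ.target) (J : Fin m → Fin n) : comp φ (ofComp φ c) J y = c J y := by
  rw [comp_eq_pullTensor, pullTensor_ofComp hφ hy, tensorOfComp_stdVec]

theorem isSymm_of_comp {u : CovTensor 𝕜 n M m} (hφ : φ ∈ IsManifold.maximalAtlas (𝓡 n) ∞ M)
    {y : Model n} (hu : IsSymm u) (J : Fin m → Fin n) (σ : Equiv.Perm (Fin m)) :
    comp φ u (J ∘ σ) y = comp φ u J y :=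
  DFunLike.congr_fun (hu (φ.symm y) σ) fun a ↦ coordVec φ y (J a)

variable {G : BilinField n M} {U : Set M}

/-- The components of the covariant derivative in terms of those of the derivative. -/
def covComp (G : BilinField n M) (φ : OpenPartialHomeomorph M (Model n))
    (c : (Fin m → Fin n) → Model n → 𝕜) (d : (Fin (m + 1) → Fin n) → Model n → 𝕜)
    (L : Fin (m + 1) → Fin n) (y : Model n) : 𝕜 :=
  d L y - ∑ a : Fin m, ∑ q : Fin n, christoffel G φ q (L (Fin.last m)) (L a.castSucc) y •
    c (Function.update (Fin.init (α := fun _ ↦ Fin n) L) a q) y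

/-- A compactly supported (in a relative sense) tensor field in a chart, extended by zero. -/
theorem isWeakCovDeriv_ofComp (hn : 0 < n) (hG : MetricOn G U) (hU : IsOpen U)
    (hφ : φ ∈ IsManifold.maximalAtlas (𝓡 n) ∞ M) (hs : φ.source ⊆ U) {K : Set (Model n)}
    (hK : IsOpen (U \ {p | p ∈ φ.source ∧ φ p ∈ K}))
    {d : (Fin (m + 1) → Fin n) → Model n → 𝕜} (hc0 : ∀ J, ∀ y ∉ K, c J y = 0)
    (hd0 : ∀ L, ∀ y ∉ K, d L y = 0)
    (h : ∀ (J : Fin m → Fin n) k, WeakDeriv φ.target (stdVec n k) (c J)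
      (d (Fin.snoc (α := fun _ ↦ Fin n) J k))) :
    IsWeakCovDeriv G U (ofComp φ c) (ofComp φ (covComp G φ c d)) := by
  have hreg : φ.target ∩ φ.symm ⁻¹' U = φ.target :=
    Set.inter_eq_left.2 fun y hy ↦ hs (φ.map_target hy)
  have hΓ : ∀ q k j, ContinuousOn (christoffel G φ q k j) φ.target := fun q k j ↦ by
    have := (contDiffOn_christoffel hG hU hφ q k j).continuousOn
    rwa [hreg] at this
  have hW : ChartWeak G φ φ.target (ofComp φ c) (ofComp φ (covComp G φ c d)) := by
    have hd : ∀ (J : Fin m → Fin n) (k : Fin n), WeakDeriv φ.target (stdVec n k)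
        (comp φ (ofComp φ c) J) (fun y ↦ comp φ (ofComp φ (covComp G φ c d))
          (Fin.snoc (α := fun _ ↦ Fin n) J k) y + ∑ a : Fin m, ∑ q : Fin n,
      christoffel G φ q k (J a) y • comp φ (ofComp φ c) (Function.update J a q) y) := by
      intro J k
      refine (h J k).congr φ.open_target (fun y hy ↦ (comp_ofComp hφ hy J).symm) fun y hy ↦ ?_
      simp only [comp_ofComp hφ hy, covComp, Fin.snoc_last, Fin.snoc_castSucc, Fin.init_snoc]
      rw [sub_add_cancel]
    exact ChartWeak.of_deriv hΓ φ.open_target (fun J ↦ (hd J ⟨0, hn⟩).loc) hd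
  rw [isWeakCovDeriv_iff hG hU]
  intro φ' hφ'
  -- In another chart the equation holds on the overlap by transfer, and off the preimage of K both
  -- tensors vanish; these two open sets cover the region.
  have hT := hW.transfer hG hU hφ hφ' hreg.ge φ.open_target hn
  have hset : (transition φ φ').source ∩ transition φ φ' ⁻¹' φ.target =
      (transition φ φ').source := by
    refine Set.inter_eq_left.2 fun y hy ↦ ?_
    have := (transition φ φ').map_source hy
    rw [transition_target] at this
    exact this.1
  rw [hset] at hT
  set K' : Set (Model n) := φ'.symm ⁻¹' {p | p ∈ φ.source ∧ φ p ∈ K} with hK'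
  -- The support is closed relative to U only. It may run off to x = 0, so compactness is not
  -- available.
  have hKo : IsOpen ((φ'.target ∩ φ'.symm ⁻¹' U) \ K') := by
    have : (φ'.target ∩ φ'.symm ⁻¹' U) \ K' =
        φ'.target ∩ φ'.symm ⁻¹' (U \ {p | p ∈ φ.source ∧ φ p ∈ K}) := by
      ext y; simp [hK', and_assoc]
    rw [this]
    exact φ'.symm.isOpen_inter_preimage hK
  have hsub : (φ'.target ∩ φ'.symm ⁻¹' U) ∩ K' ⊆ (transition φ φ').source := by
    intro y hy
    rw [transition_source]
    exact ⟨hy.1.1, hy.2.1⟩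
  have h0 : ∀ y ∈ (φ'.target ∩ φ'.symm ⁻¹' U) \ K', ofComp φ c (φ'.symm y) = 0 ∧
      ofComp φ (covComp G φ c d) (φ'.symm y) = 0 := by
    intro y hy
    refine ⟨ofComp_eq_zero fun hp J ↦ hc0 J _ fun hk ↦ hy.2 ⟨hp, hk⟩,
      ofComp_eq_zero fun hp L ↦ ?_⟩
    have hk : φ (φ'.symm y) ∉ K := fun hk ↦ hy.2 ⟨hp, hk⟩
    simp [covComp, hd0 _ _ hk, hc0 _ _ hk]
  have hf0 : ∀ J, ∀ y ∈ (φ'.target ∩ φ'.symm ⁻¹' U) \ K', comp φ' (ofComp φ c) J y = 0 := by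
    intro J y hy
    rw [comp, (h0 y hy).1]; rfl
  have hD : ∀ (J : Fin m → Fin n) (k : Fin n), WeakDeriv (φ'.target ∩ φ'.symm ⁻¹' U) (stdVec n k)
        (comp φ' (ofComp φ c) J) (fun y ↦ comp φ' (ofComp φ (covComp G φ c d))
          (Fin.snoc (α := fun _ ↦ Fin n) J k) y + ∑ a : Fin m, ∑ q : Fin n,
      christoffel G φ' q k (J a) y • comp φ' (ofComp φ c) (Function.update J a q) y) := by
    intro J k
    refine (hT.deriv J k).extend_zero (transition φ φ').open_source hKo hsub (hf0 J) fun y hy ↦ ?_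
    simp only [hf0 _ y hy, smul_zero, Finset.sum_const_zero, add_zero]
    rw [comp, (h0 y hy).2]; rfl
  exact ChartWeak.of_deriv (fun q k j ↦ (contDiffOn_christoffel hG hU hφ' q k j).continuousOn)
    (isOpen_region hU) (fun J ↦ (hD J ⟨0, hn⟩).loc) hD

theorem IsWeakCovDeriv.sum {ι : Type*} (s : Finset ι) (hG : MetricOn G U) (hU : IsOpen U)
    {u : ι → CovTensor 𝕜 n M m} {w : ι → CovTensor 𝕜 n M (m + 1)}
    (h : ∀ i ∈ s, IsWeakCovDeriv G U (u i) (w i)) :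
    IsWeakCovDeriv G U (fun p ↦ ∑ i ∈ s, u i p) (fun p ↦ ∑ i ∈ s, w i p) := by
  rw [isWeakCovDeriv_iff hG hU]
  intro φ hφ
  have h' := fun i hi ↦ (isWeakCovDeriv_iff hG hU).1 (h i hi) φ hφ
  have hc : ∀ {l : ℕ} (v : ι → CovTensor 𝕜 n M l) (J : Fin l → Fin n),
      comp φ (fun p ↦ ∑ i ∈ s, v i p) J = fun y ↦ ∑ i ∈ s, comp φ (v i) J y := fun v J ↦ by
    funext y
    simp [comp, MultilinearMap.sum_apply]
  refine ⟨fun J ↦ ?_, fun L ↦ ?_, fun J k ↦ ?_⟩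
  · rw [hc]
    exact locallyIntegrableOn_finset_sum s fun i hi ↦ (h' i hi).loc J
  · rw [hc]
    exact locallyIntegrableOn_finset_sum s fun i hi ↦ (h' i hi).loc_deriv L
  · have := WeakDeriv.sum s (isOpen_region hU) fun i hi ↦ (h' i hi).deriv J k
    simp only [hc]
    convert this using 2 with y
    simp only [Finset.sum_add_distrib, Finset.smul_sum]
    congr 1
    exact (Finset.sum_comm.trans (Finset.sum_congr rfl fun a _ ↦ Finset.sum_comm)).symm

end OfComp

/-! ### Weak differentiability with respect to another connection. -/

section ChangeConnection

variable {n : ℕ} {M : Type*} [TopologicalSpace M] [ChartedSpace (Model n) M]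
  {𝕜 : Type*} [RCLike 𝕜] {m : ℕ}

/-- The `m + 1`-tensor `(v, w) ↦ ℓ(w) T(v) + ∑ a, T(v₁, …, S(w, v_a), …, v_m)`. -/
def derivationTensor (T : MultilinearMap ℝ (fun _ : Fin m ↦ Model n) 𝕜)
    (S : Model n →ₗ[ℝ] Model n →ₗ[ℝ] Model n) (l : Model n →L[ℝ] ℝ) :
    MultilinearMap ℝ (fun _ : Fin (m + 1) ↦ Model n) 𝕜 :=
  ∑ k : Fin n, ((LinearMap.smulRightₗ
    ((EuclideanSpace.proj (𝕜 := ℝ) k : Model n →L[ℝ] ℝ) : Model n →ₗ[ℝ] ℝ)).compMultilinearMap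
      (l (stdVec n k) • T + ∑ a, slotMap T a (S (stdVec n k)))).uncurryRight

theorem derivationTensor_snoc (T : MultilinearMap ℝ (fun _ : Fin m ↦ Model n) 𝕜)
    (S : Model n →ₗ[ℝ] Model n →ₗ[ℝ] Model n) (l : Model n →L[ℝ] ℝ) (v : Fin m → Model n)
    (w : Model n) : derivationTensor T S l (Fin.snoc (α := fun _ ↦ Model n) v w) =
      l w • T v + ∑ a, T (Function.update v a (S w (v a))) := by
  have hlin := (clm_eq_sum (F := 𝕜) (LinearMap.toContinuousLinearMap
    ((l : Model n →ₗ[ℝ] ℝ).smulRight (T v) + ∑ a, T.toLinearMap v a ∘ₗ S.flip (v a))) w)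
  simp only [LinearMap.coe_toContinuousLinearMap', LinearMap.add_apply, LinearMap.sum_apply,
    LinearMap.comp_apply, MultilinearMap.toLinearMap_apply, LinearMap.flip_apply,
    ContinuousLinearMap.coe_coe, LinearMap.smulRight_apply] at hlin
  rw [hlin]
  simp [derivationTensor, MultilinearMap.sum_apply, slotMap_apply, MultilinearMap.add_apply]
  exact Finset.sum_congr rfl fun k _ ↦ by rw [smul_comm, Finset.smul_sum]

/-- The differential of a function at a point, as a covector on `ℝⁿ`. -/
def rawCovector (n : ℕ) {M : Type*} [TopologicalSpace M] [ChartedSpace (Model n) M] (f : M → ℝ)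
    (p : M) : Model n →L[ℝ] ℝ := dAt n f p

/-- The difference of the Levi-Civita connections of two metrics. -/
def diffTensor (G₁ G₂ : BilinField n M) (p : M) : Model n →ₗ[ℝ] Model n →ₗ[ℝ] Model n :=
  ((chMap G₁ (chartAt (Model n) p) (chartAt (Model n) p p) -
    chMap G₂ (chartAt (Model n) p) (chartAt (Model n) p p)).compl₁₂
      (chartInvD (chartAt (Model n) p) p : Model n →ₗ[ℝ] Model n)
      (chartInvD (chartAt (Model n) p) p : Model n →ₗ[ℝ] Model n)).compr₂
      (chartD (chartAt (Model n) p) (chartAt (Model n) p p) : Model n →ₗ[ℝ] Model n)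

variable [IsManifold (𝓡 n) ∞ M] {G₁ G₂ : BilinField n M} {U V : Set M}
  {φ : OpenPartialHomeomorph M (Model n)}

/-- The inhomogeneous terms of the two transformation laws cancel, so the difference, computed in
the preferred chart at the point, has the tensorial form in every chart. -/
theorem diffTensor_chartD (h₁ : MetricOn G₁ U) (h₂ : MetricOn G₂ U) (hU : IsOpen U)
    (hφ : φ ∈ IsManifold.maximalAtlas (𝓡 n) ∞ M) {y : Model n} (hy : y ∈ φ.target)
    (hyU : φ.symm y ∈ U) (v w : Model n) :
    diffTensor G₁ G₂ (φ.symm y) (chartD φ y v) (chartD φ y w) =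
      chartD φ y (chMap G₁ φ y v w - chMap G₂ φ y v w) := by
  set φ₀ := chartAt (Model n) (φ.symm y) with hφ₀
  have h0 : φ₀ ∈ IsManifold.maximalAtlas (𝓡 n) ∞ M := IsManifold.chart_mem_maximalAtlas _
  have hs : y ∈ (transition φ₀ φ).source := by
    rw [transition_source]
    exact ⟨hy, mem_chart_source _ _⟩
  have ht : transition φ₀ φ y = φ₀ (φ.symm y) := rfl
  have ht' : transition φ₀ φ y ∈ φ₀.target := φ₀.map_source (mem_chart_source _ _)
  have hsy : φ₀.symm (transition φ₀ φ y) = φ.symm y := symm_transition hs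
  have hB := fun v ↦ chartInvD_chartD h0 ht' v
  rw [hsy] at hB
  have e1 := chMap_transition h₁ hU h0 hφ hs hyU v w
  have e2 := chMap_transition h₂ hU h0 hφ hs hyU v w
  rw [chartD_eq h0 hφ hs]
  simp only [ContinuousLinearMap.comp_apply, map_sub, e1, e2]
  simp only [diffTensor, ← hφ₀, LinearMap.compr₂_apply, LinearMap.compl₁₂_apply,
    ContinuousLinearMap.coe_coe, hB, LinearMap.sub_apply, ← ht, map_sub, map_add]
  abel

/-- Weak differentiability does not depend on the connection; product rule. -/
theorem exists_isWeakCovDeriv_fsmul (h₁ : MetricOn G₁ U) (h₂ : MetricOn G₂ U) (hU : IsOpen U)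
    (hV : IsOpen V) (hVU : V ⊆ U) (hn : 0 < n) {u : CovTensor 𝕜 n M m}
    {w : CovTensor 𝕜 n M (m + 1)}
    (h : IsWeakCovDeriv G₁ U u w) {f : M → ℝ} (hf : ContMDiffOn (𝓡 n) 𝓘(ℝ, ℝ) ∞ f V) :
    ∃ w', IsWeakCovDeriv G₂ V (fsmul f u) w' := by
  have h₂V : MetricOn G₂ V := ⟨h₂.symm, fun p hp ↦ h₂.pos p (hVU hp), fun φ hφ ↦
    (h₂.smooth φ hφ).mono fun y hy ↦ ⟨hy.1, hVU hy.2⟩⟩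
  -- The classical formula: f w, plus the term with df, plus f times the action of the difference of
  -- the connections on u.
  refine ⟨fun p ↦ f p • rawTensor w p + derivationTensor (rawTensor u p)
    (f p • diffTensor G₁ G₂ p) (rawCovector n f p), (isWeakCovDeriv_iff h₂V hV).2 fun φ hφ ↦ ?_⟩
  have h' := ((isWeakCovDeriv_iff h₁ hU).1 h φ hφ).mono
    (R' := φ.target ∩ φ.symm ⁻¹' V) fun y hy ↦ ⟨hy.1, hVU hy.2⟩
  have hfs := contDiffOn_comp_symm hf hφ
  set w' : CovTensor 𝕜 n M (m + 1) := fun p ↦ f p • rawTensor w p +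
    derivationTensor (rawTensor u p) (f p • diffTensor G₁ G₂ p) (rawCovector n f p) with hw'
  have hD : ∀ (J : Fin m → Fin n) (k : Fin n), WeakDeriv (φ.target ∩ φ.symm ⁻¹' V) (stdVec n k)
      (comp φ (fsmul f u) J) (fun y ↦ comp φ w' (Fin.snoc (α := fun _ ↦ Fin n) J k) y +
      ∑ a : Fin m, ∑ q : Fin n,
        christoffel G₂ φ q k (J a) y • comp φ (fsmul f u) (Function.update J a q) y) := by
    intro J k
    refine ((h'.deriv J k).smul (isOpen_region hV) hfs).congr (isOpen_region hV)
      (fun y hy ↦ rfl) fun y hy ↦ ?_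
    have hdf : MDifferentiableAt (𝓡 n) 𝓘(ℝ, ℝ) f (φ.symm y) :=
      (hf.contMDiffAt (hV.mem_nhds hy.2)).mdifferentiableAt (by simp)
    have e1 : pullTensor φ w' y (Fin.snoc (α := fun _ ↦ Model n) (fun a ↦ stdVec n (J a))
        (stdVec n k)) = f (φ.symm y) • pullTensor φ w y (Fin.snoc (α := fun _ ↦ Model n)
        (fun a ↦ stdVec n (J a)) (stdVec n k)) + (fderiv ℝ (fun y ↦ f (φ.symm y)) y (stdVec n k) •
        pullTensor φ u y (fun a ↦ stdVec n (J a)) +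
        ∑ a, f (φ.symm y) • pullTensor φ u y (Function.update (fun a ↦ stdVec n (J a)) a
          (chMap G₁ φ y (stdVec n k) (stdVec n (J a)) -
            chMap G₂ φ y (stdVec n k) (stdVec n (J a))))) := by
      have hsn : (fun a ↦ chartD φ y ((Fin.snoc (α := fun _ ↦ Model n) (fun a ↦ stdVec n (J a))
          (stdVec n k) : Fin (m + 1) → Model n) a)) = Fin.snoc (α := fun _ ↦ Model n)
          (fun a ↦ chartD φ y (stdVec n (J a))) (chartD φ y (stdVec n k)) := by
        funext a
        refine Fin.lastCases ?_ (fun i ↦ ?_) a <;> simp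
      have : ∀ v, pullTensor φ w' y v = f (φ.symm y) • pullTensor φ w y v +
          derivationTensor (rawTensor u (φ.symm y))
            (f (φ.symm y) • diffTensor G₁ G₂ (φ.symm y)) (rawCovector n f (φ.symm y))
            (fun a ↦ chartD φ y (v a)) := fun v ↦ rfl
      rw [this, hsn, derivationTensor_snoc]
      congr 2
      · rw [← dAt_chartD hφ hy.1 hdf]
        rfl
      · refine Finset.sum_congr rfl fun a _ ↦ ?_
        rw [LinearMap.smul_apply, LinearMap.smul_apply,
          diffTensor_chartD h₁ h₂ hU hφ hy.1 (hVU hy.2), MultilinearMap.map_update_smul]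
        congr 1
        rw [pullTensor_apply]
        congr 1
        funext b
        by_cases hb : b = a
        · subst hb; simp
        · simp [hb]
    have e2 : ∀ J, comp φ (fsmul f u) J y = f (φ.symm y) • comp φ u J y := fun J ↦ rfl
    simp only [e2, comp_snoc, e1]
    simp only [smul_comm _ (f (φ.symm y)), ← Finset.smul_sum, sum_christoffel,
      MultilinearMap.map_update_sub, Finset.sum_sub_distrib, smul_add, smul_sub]
    rw [comp_eq_pullTensor]
    abel
  exact ChartWeak.of_deriv (fun q k j ↦ (contDiffOn_christoffel h₂V hV hφ q k j).continuousOn)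
    (isOpen_region hV) (fun J ↦ (hD J ⟨0, hn⟩).loc) hD

end ChangeConnection

end ScKorn

end


noncomputable section

namespace ScKorn

/-! ### Linear algebra of pinched inner products. -/

section Frames

variable {n : ℕ} {𝕜 : Type*} [RCLike 𝕜] {m : ℕ}

/-- `b` is an orthonormal frame for the inner product `Q`. -/
structure OrthoFrame (Q : Model n →L[ℝ] Model n →L[ℝ] ℝ) (b : Fin n → Model n) : Prop where
  ortho : ∀ c d, Q (b c) (b d) = if c = d then 1 else 0
  expand : ∀ v, v = ∑ c, Q (b c) v • b c

theorem exists_orthoFrame {Q : Model n →L[ℝ] Model n →L[ℝ] ℝ} (hs : ∀ v w, Q v w = Q w v)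
    (hp : ∀ v, v ≠ 0 → 0 < Q v v) : ∃ b, OrthoFrame Q b := by
  let B : LinearMap.BilinForm ℝ (Model n) :=
    LinearMap.mk₂ ℝ (fun v w ↦ Q v w) (by simp) (by simp) (by simp) (by simp)
  have hB : ∀ v w, B v w = Q v w := fun v w ↦ rfl
  have hsym : LinearMap.IsSymm B := ⟨fun v w ↦ hs v w⟩
  obtain ⟨e, he⟩ := LinearMap.BilinForm.exists_orthogonal_basis hsym
  have hfr : Module.finrank ℝ (Model n) = n := by simp
  let e' := e.reindex (finCongr hfr)
  have ho : ∀ c d, c ≠ d → Q (e' c) (e' d) = 0 := fun c d hcd ↦ by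
    simp only [e', Module.Basis.reindex_apply]
    exact he (by simpa using hcd)
  have hpos : ∀ c, 0 < Q (e' c) (e' c) := fun c ↦ hp _ (e'.ne_zero c)
  set b : Fin n → Model n := fun c ↦ (√(Q (e' c) (e' c)))⁻¹ • e' c with hb
  have hor : ∀ c d, Q (b c) (b d) = if c = d then 1 else 0 := by
    intro c d
    simp only [hb, map_smul, ContinuousLinearMap.smul_apply, smul_eq_mul]
    split_ifs with h
    · subst h
      have h1 := Real.sqrt_pos.2 (hpos c)
      have h2 := Real.mul_self_sqrt (hpos c).le
      field_simp
      nlinarith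
    · rw [ho c d h]; simp
  refine ⟨b, hor, fun v ↦ ?_⟩
  have hv : v = ∑ c, (√(Q (e' c) (e' c)) * e'.repr v c) • b c := by
    conv_lhs => rw [← e'.sum_repr v]
    refine Finset.sum_congr rfl fun c _ ↦ ?_
    have h1 := Real.sqrt_pos.2 (hpos c)
    rw [hb, smul_smul]
    congr 1
    field_simp
  have hc : ∀ c, Q (b c) v = √(Q (e' c) (e' c)) * e'.repr v c := fun c ↦ by
    conv_lhs => rw [hv]
    simp [hor]
  conv_lhs => rw [hv]
  simp only [hc]

/-- Expansion of the sum of the squares of a multilinear map on a frame. -/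
theorem sum_norm_sq_eq (T : MultilinearMap ℝ (fun _ : Fin m ↦ Model n) 𝕜) (b : Fin n → Model n) :
    ∑ c : Fin m → Fin n, ‖T fun a ↦ b (c a)‖ ^ 2 =
      ∑ i : Fin m → Fin n, ∑ j : Fin m → Fin n, (∏ a, ∑ k, b k (i a) * b k (j a)) *
        RCLike.re (T (fun a ↦ stdVec n (i a)) * (starRingEnd 𝕜) (T fun a ↦ stdVec n (j a))) := by
  have h1 : ∀ c : Fin m → Fin n, ‖T fun a ↦ b (c a)‖ ^ 2 = ∑ i : Fin m → Fin n,
      ∑ j : Fin m → Fin n, (∏ a, b (c a) (i a) * b (c a) (j a)) *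
        RCLike.re (T (fun a ↦ stdVec n (i a)) * (starRingEnd 𝕜) (T fun a ↦ stdVec n (j a))) := by
    intro c
    have h2 : ‖T fun a ↦ b (c a)‖ ^ 2 = RCLike.re ((T fun a ↦ b (c a)) *
        (starRingEnd 𝕜) (T fun a ↦ b (c a))) := by
      rw [RCLike.mul_conj]; norm_cast
    rw [h2, multilinear_expand T fun a ↦ b (c a)]
    rw [map_sum, Finset.sum_mul_sum, map_sum]
    refine Finset.sum_congr rfl fun i _ ↦ ?_
    rw [map_sum]
    refine Finset.sum_congr rfl fun j _ ↦ ?_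
    rw [Finset.prod_mul_distrib, RCLike.real_smul_eq_coe_mul, RCLike.real_smul_eq_coe_mul,
      map_mul (starRingEnd 𝕜), RCLike.conj_ofReal, ← RCLike.re_ofReal_mul]
    congr 1
    push_cast
    ring
  simp only [h1, Finset.prod_univ_sum, Fintype.piFinset_univ, Finset.sum_mul]
  rw [Finset.sum_comm]
  exact Finset.sum_congr rfl fun i _ ↦ by rw [Finset.sum_comm]

/-- Multilinear expansion into n^m terms and the Cauchy–Schwarz inequality. -/
theorem norm_sq_apply_le (T : MultilinearMap ℝ (fun _ : Fin m ↦ Model n) 𝕜) {b : Fin n → Model n}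
    {α : Fin m → Fin n → ℝ} {v : Fin m → Model n} (hv : ∀ a, v a = ∑ k, α a k • b k) {s : ℝ}
    (hα : ∀ a k, α a k ^ 2 ≤ s) :
    ‖T v‖ ^ 2 ≤ (s ^ m * n ^ m) * ∑ c : Fin m → Fin n, ‖T fun a ↦ b (c a)‖ ^ 2 := by
  have e : T v = ∑ c : Fin m → Fin n, (∏ a, α a (c a)) • T fun a ↦ b (c a) := by
    rw [show v = fun a ↦ ∑ k, α a k • b k from funext hv, MultilinearMap.map_sum]
    exact Finset.sum_congr rfl fun J _ ↦ MultilinearMap.map_smul_univ _ _ _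
  calc ‖T v‖ ^ 2 ≤ (∑ c : Fin m → Fin n, |∏ a, α a (c a)| * ‖T fun a ↦ b (c a)‖) ^ 2 := by
        rw [e]
        gcongr
        refine (norm_sum_le _ _).trans (Finset.sum_le_sum fun c _ ↦ ?_)
        rw [norm_smul, Real.norm_eq_abs]
    _ ≤ (Finset.univ : Finset (Fin m → Fin n)).card *
        ∑ c : Fin m → Fin n, (|∏ a, α a (c a)| * ‖T fun a ↦ b (c a)‖) ^ 2 :=
        sq_sum_le_card_mul_sum_sq
    _ ≤ n ^ m * ∑ c : Fin m → Fin n, s ^ m * ‖T fun a ↦ b (c a)‖ ^ 2 := by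
        rw [Finset.card_univ, Fintype.card_fun, Fintype.card_fin, Fintype.card_fin]
        push_cast
        gcongr with c
        rw [mul_pow, sq_abs, ← Finset.prod_pow]
        gcongr
        calc ∏ a, α a (c a) ^ 2 ≤ ∏ _a : Fin m, s :=
              Finset.prod_le_prod (fun _ _ ↦ sq_nonneg _) fun a _ ↦ hα a (c a)
          _ = s ^ m := by simp
    _ = _ := by rw [← Finset.mul_sum]; ring

/-- `Q` is pinched between multiples of the Euclidean inner product. -/
def Pinched (lam : ℝ) (Q : Model n →L[ℝ] Model n →L[ℝ] ℝ) : Prop :=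
  ∀ v, lam⁻¹ * ‖v‖ ^ 2 ≤ Q v v ∧ Q v v ≤ lam * ‖v‖ ^ 2

theorem norm_stdVec (i : Fin n) : ‖stdVec n i‖ = 1 := by simp [stdVec]

variable {Q : Model n →L[ℝ] Model n →L[ℝ] ℝ} {lam : ℝ} {b : Fin n → Model n}

theorem OrthoFrame.coord_sq_le (hb : OrthoFrame Q b) (hQ : Pinched lam Q) (hl : 0 < lam)
    (c i : Fin n) : (b c i) ^ 2 ≤ lam := by
  have h1 := (hQ (b c)).1
  rw [hb.ortho, if_pos rfl, inv_mul_le_iff₀ hl, mul_one] at h1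
  refine le_trans ?_ h1
  rw [EuclideanSpace.norm_sq_eq]
  have := Finset.single_le_sum (f := fun i ↦ ‖b c i‖ ^ 2) (fun _ _ ↦ by positivity)
    (Finset.mem_univ i)
  simpa using this

/-- By Parseval's identity the squares of the coefficients of e_i add up to Q(e_i, e_i), which is at
most lam. -/
theorem OrthoFrame.coeff_sq_le (hs : ∀ v w, Q v w = Q w v) (hb : OrthoFrame Q b)
    (hQ : Pinched lam Q) (c i : Fin n) : (Q (b c) (stdVec n i)) ^ 2 ≤ lam := by
  have h1 := (hQ (stdVec n i)).2
  rw [norm_stdVec, one_pow, mul_one] at h1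
  refine le_trans ?_ h1
  have h2 : Q (stdVec n i) (stdVec n i) = ∑ c, Q (b c) (stdVec n i) ^ 2 := by
    conv_lhs => rw [hb.expand (stdVec n i)]
    simp only [map_sum, map_smul, ContinuousLinearMap.sum_apply, ContinuousLinearMap.smul_apply,
      smul_eq_mul, hb.ortho]
    simp [sq]
  rw [h2]
  exact Finset.single_le_sum (f := fun c ↦ Q (b c) (stdVec n i) ^ 2) (fun _ _ ↦ by positivity)
    (Finset.mem_univ c)

theorem sum_frame_le (hb : OrthoFrame Q b) (hQ : Pinched lam Q) (hl : 0 < lam)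
    (T : MultilinearMap ℝ (fun _ : Fin m ↦ Model n) 𝕜) :
    ∑ c : Fin m → Fin n, ‖T fun a ↦ b (c a)‖ ^ 2 ≤
      (lam ^ m * n ^ m * n ^ m) * ∑ c : Fin m → Fin n, ‖T fun a ↦ stdVec n (c a)‖ ^ 2 := by
  calc _ ≤ ∑ _c : Fin m → Fin n, (lam ^ m * n ^ m) *
        ∑ c : Fin m → Fin n, ‖T fun a ↦ stdVec n (c a)‖ ^ 2 :=
        Finset.sum_le_sum fun c _ ↦ norm_sq_apply_le T (fun a ↦ (sum_smul_stdVec (b (c a))).symm)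
          fun a k ↦ hb.coord_sq_le hQ hl _ _
    _ = _ := by
        rw [Finset.sum_const, Finset.card_univ, Fintype.card_fun, Fintype.card_fin,
          Fintype.card_fin, nsmul_eq_mul]
        push_cast
        ring

theorem sum_stdVec_le (hs : ∀ v w, Q v w = Q w v) (hb : OrthoFrame Q b) (hQ : Pinched lam Q)
    (T : MultilinearMap ℝ (fun _ : Fin m ↦ Model n) 𝕜) :
    ∑ c : Fin m → Fin n, ‖T fun a ↦ stdVec n (c a)‖ ^ 2 ≤
      (lam ^ m * n ^ m * n ^ m) * ∑ c : Fin m → Fin n, ‖T fun a ↦ b (c a)‖ ^ 2 := by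
  calc _ ≤ ∑ _c : Fin m → Fin n, (lam ^ m * n ^ m) *
        ∑ c : Fin m → Fin n, ‖T fun a ↦ b (c a)‖ ^ 2 :=
        Finset.sum_le_sum fun c _ ↦ norm_sq_apply_le T (fun a ↦ hb.expand _)
          fun a k ↦ hb.coeff_sq_le hs hQ _ _
    _ = _ := by
        rw [Finset.sum_const, Finset.card_univ, Fintype.card_fun, Fintype.card_fin,
          Fintype.card_fin, nsmul_eq_mul]
        push_cast
        ring

/-- The matrix of `Q`. -/
def matrixOf (Q : Model n →L[ℝ] Model n →L[ℝ] ℝ) : Matrix (Fin n) (Fin n) ℝ :=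
  Matrix.of fun i j ↦ Q (stdVec n i) (stdVec n j)

theorem OrthoFrame.matrix_mul (hb : OrthoFrame Q b) :
    (Matrix.of fun c i ↦ b c i) * matrixOf Q * (Matrix.of fun c i ↦ b c i).transpose = 1 := by
  ext c d
  rw [Matrix.one_apply, ← hb.ortho c d, clm_eq_sum (Q (b c)) (b d), Matrix.mul_apply]
  refine Finset.sum_congr rfl fun j _ ↦ ?_
  rw [Matrix.mul_apply, clm_eq_sum Q (b c)]
  simp [matrixOf, Finset.sum_mul, mul_comm]

/-- If B Q Bᵀ = 1 then Q⁻¹ = Bᵀ B. This turns the index expression of the tensor norm into a sum of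
squares over an orthonormal frame. -/
theorem OrthoFrame.matrix_inv (hb : OrthoFrame Q b) (i j : Fin n) :
    (matrixOf Q)⁻¹ i j = ∑ k, b k i * b k j := by
  set B : Matrix (Fin n) (Fin n) ℝ := Matrix.of fun c i ↦ b c i with hB
  have h1 : B * matrixOf Q * B.transpose = 1 := hb.matrix_mul
  have h2 : B.transpose * (B * matrixOf Q) = 1 := mul_eq_one_comm.1 h1
  rw [← Matrix.mul_assoc] at h2
  rw [Matrix.inv_eq_left_inv h2, Matrix.mul_apply]
  rfl

/-- The matrix of the frame and its inverse both have entries of size at most √lam, so the Leibniz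
formula bounds both determinants; the determinant of Q is the inverse square of the first. -/
theorem OrthoFrame.det_bounds (hs : ∀ v w, Q v w = Q w v) (hb : OrthoFrame Q b)
    (hQ : Pinched lam Q) (hl : 0 < lam) :
    (((n.factorial : ℝ) * (√lam) ^ n) ^ 2)⁻¹ ≤ |(matrixOf Q).det| ∧
      |(matrixOf Q).det| ≤ ((n.factorial : ℝ) * (√lam) ^ n) ^ 2 := by
  have hP : (matrixOf Q).det * (Matrix.of fun c i ↦ b c i).det ^ 2 = 1 := by
    have := congrArg Matrix.det hb.matrix_mul
    rw [Matrix.det_mul, Matrix.det_mul, Matrix.det_transpose, Matrix.det_one] at this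
    linarith
  set B : Matrix (Fin n) (Fin n) ℝ := Matrix.of fun c i ↦ b c i with hB
  set Z : Matrix (Fin n) (Fin n) ℝ := Matrix.of fun i c ↦ Q (b c) (stdVec n i) with hZ
  have hZB : Z * B = 1 := by
    ext i j
    rw [Matrix.mul_apply, Matrix.one_apply]
    have := congrArg (fun v : Model n ↦ v j) (hb.expand (stdVec n i))
    simp only [stdVec_apply, WithLp.ofLp_sum, WithLp.ofLp_smul, Finset.sum_apply, Pi.smul_apply,
      smul_eq_mul] at this
    simp only [hZ, hB, Matrix.of_apply, ← this, eq_comm]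
  have hZd : Z.det * B.det = 1 := by rw [← Matrix.det_mul, hZB, Matrix.det_one]
  have bd : ∀ A : Matrix (Fin n) (Fin n) ℝ, (∀ i j, A i j ^ 2 ≤ lam) →
      A.det ^ 2 ≤ ((n.factorial : ℝ) * (√lam) ^ n) ^ 2 := by
    intro A hA
    have := Matrix.det_le (abv := AbsoluteValue.abs) (A := A) (x := √lam) fun i j ↦
      Real.abs_le_sqrt (hA i j)
    simp only [Fintype.card_fin, nsmul_eq_mul] at this
    rw [← sq_abs]
    exact pow_le_pow_left₀ (abs_nonneg _) this 2
  have b1 := bd B fun c i ↦ hb.coord_sq_le hQ hl c i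
  have b2 := bd Z fun i c ↦ hb.coeff_sq_le hs hQ c i
  have hBne : B.det ≠ 0 := right_ne_zero_of_mul_eq_one hZd
  have hdet : |(matrixOf Q).det| = (B.det ^ 2)⁻¹ := by
    rw [eq_inv_of_mul_eq_one_left hP, abs_of_nonneg (by positivity)]
  have hdet' : |(matrixOf Q).det| = Z.det ^ 2 := by
    rw [hdet, eq_inv_of_mul_eq_one_left hZd, inv_pow]
  refine ⟨?_, hdet' ▸ b2⟩
  rw [hdet]
  exact inv_anti₀ (by positivity) b1

end Frames

/-! ### Pointwise tensor norms in charts. -/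

section Norms

variable {n : ℕ} {M : Type*} [TopologicalSpace M] [ChartedSpace (Model n) M]
  {𝕜 : Type*} [RCLike 𝕜] {m : ℕ} {G : BilinField n M} {U : Set M}
  {φ : OpenPartialHomeomorph M (Model n)}

theorem tensorNormSq_eq_frame {p : M} {b : Fin n → Model n} (hb : OrthoFrame (rawBilin G p) b)
    (u : CovTensor 𝕜 n M m) :
    tensorNormSq G p (u p) = ∑ c : Fin m → Fin n, ‖rawTensor u p fun a ↦ b (c a)‖ ^ 2 := by
  rw [sum_norm_sq_eq]
  simp only [← hb.matrix_inv]
  rfl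

variable [IsManifold (𝓡 n) ∞ M]

theorem exists_frame_rawBilin (hG : MetricOn G U) {p : M} (hp : p ∈ U) :
    ∃ b, OrthoFrame (rawBilin G p) b :=
  exists_orthoFrame (hG.symm p) (hG.pos p hp)

theorem tensorNormSq_nonneg (hG : MetricOn G U) {p : M} (hp : p ∈ U) (u : CovTensor 𝕜 n M m) :
    0 ≤ tensorNormSq G p (u p) := by
  obtain ⟨b, hb⟩ := exists_frame_rawBilin hG hp
  rw [tensorNormSq_eq_frame hb]
  positivity

theorem tensorNormSq_sum_le (hG : MetricOn G U) {p : M} (hp : p ∈ U) {ι : Type*} (s : Finset ι)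
    (u : ι → CovTensor 𝕜 n M m) :
    tensorNormSq G p (∑ i ∈ s, u i p) ≤ s.card * ∑ i ∈ s, tensorNormSq G p (u i p) := by
  obtain ⟨b, hb⟩ := exists_frame_rawBilin hG hp
  rw [tensorNormSq_eq_frame hb (fun p ↦ ∑ i ∈ s, u i p)]
  simp only [tensorNormSq_eq_frame hb]
  rw [Finset.sum_comm, Finset.mul_sum]
  refine Finset.sum_le_sum fun c _ ↦ ?_
  have : rawTensor (fun p ↦ ∑ i ∈ s, u i p) p (fun a ↦ b (c a)) =
      ∑ i ∈ s, rawTensor (u i) p (fun a ↦ b (c a)) := by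
    change (∑ i ∈ s, rawTensor (u i) p) (fun a ↦ b (c a)) = _
    rw [MultilinearMap.sum_apply]
  rw [this]
  calc _ ≤ (∑ i ∈ s, ‖rawTensor (u i) p (fun a ↦ b (c a))‖) ^ 2 := by
        gcongr; exact norm_sum_le _ _
    _ ≤ _ := sq_sum_le_card_mul_sum_sq

/-- The frame of the chart carries an orthonormal frame for the pulled back metric to one for G at
the point, so the norm can be computed on components. -/
theorem tensorNormSq_eq_chart (hφ : φ ∈ IsManifold.maximalAtlas (𝓡 n) ∞ M) {y : Model n}
    (hy : y ∈ φ.target) {b : Fin n → Model n}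
    (hb : OrthoFrame (pullBilin G φ y) b) (u : CovTensor 𝕜 n M m) :
    tensorNormSq G (φ.symm y) (u (φ.symm y)) =
      ∑ c : Fin m → Fin n, ‖pullTensor φ u y fun a ↦ b (c a)‖ ^ 2 := by
  have hb' : OrthoFrame (rawBilin G (φ.symm y)) fun c ↦ chartD φ y (b c) := by
    refine ⟨fun c d ↦ hb.ortho c d, fun v ↦ ?_⟩
    obtain ⟨w, rfl⟩ := chartD_surjective hφ hy v
    conv_lhs => rw [hb.expand w, map_sum]
    simp only [map_smul]
    rfl
  rw [tensorNormSq_eq_frame hb']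
  rfl

theorem pullBilin_symm (hG : MetricOn G U) (y v w : Model n) :
    pullBilin G φ y v w = pullBilin G φ y w v := hG.symm _ _ _

theorem tensorNormSq_le_comp (hG : MetricOn G U) (hφ : φ ∈ IsManifold.maximalAtlas (𝓡 n) ∞ M)
    {y : Model n} (hy : y ∈ φ.target ∩ φ.symm ⁻¹' U) {lam : ℝ} (hl : 0 < lam)
    (hQ : Pinched lam (pullBilin G φ y)) (u : CovTensor 𝕜 n M m) :
    tensorNormSq G (φ.symm y) (u (φ.symm y)) ≤
      (lam ^ m * n ^ m * n ^ m) * ∑ J : Fin m → Fin n, ‖comp φ u J y‖ ^ 2 := by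
  obtain ⟨b, hb⟩ := exists_orthoFrame (pullBilin_symm hG y)
    fun v hv ↦ pullBilin_pos hG hφ hy hv
  rw [tensorNormSq_eq_chart hφ hy.1 hb]
  simp only [comp_eq_pullTensor]
  exact sum_frame_le hb hQ hl (pullTensor φ u y)

theorem comp_le_tensorNormSq (hG : MetricOn G U) (hφ : φ ∈ IsManifold.maximalAtlas (𝓡 n) ∞ M)
    {y : Model n} (hy : y ∈ φ.target ∩ φ.symm ⁻¹' U) {lam : ℝ}
    (hQ : Pinched lam (pullBilin G φ y)) (u : CovTensor 𝕜 n M m) :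
    ∑ J : Fin m → Fin n, ‖comp φ u J y‖ ^ 2 ≤
      (lam ^ m * n ^ m * n ^ m) * tensorNormSq G (φ.symm y) (u (φ.symm y)) := by
  obtain ⟨b, hb⟩ := exists_orthoFrame (pullBilin_symm hG y)
    fun v hv ↦ pullBilin_pos hG hφ hy hv
  rw [tensorNormSq_eq_chart hφ hy.1 hb]
  simp only [comp_eq_pullTensor]
  exact sum_stdVec_le (pullBilin_symm hG y) hb hQ (pullTensor φ u y)

theorem det_chartGram_bounds (hG : MetricOn G U) (hφ : φ ∈ IsManifold.maximalAtlas (𝓡 n) ∞ M)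
    {y : Model n} (hy : y ∈ φ.target ∩ φ.symm ⁻¹' U) {lam : ℝ} (hl : 0 < lam)
    (hQ : Pinched lam (pullBilin G φ y)) :
    ((n.factorial : ℝ) * (√lam) ^ n)⁻¹ ≤ √|(chartGram G φ y).det| ∧
      √|(chartGram G φ y).det| ≤ (n.factorial : ℝ) * (√lam) ^ n := by
  obtain ⟨b, hb⟩ := exists_orthoFrame (pullBilin_symm hG y)
    fun v hv ↦ pullBilin_pos hG hφ hy hv
  have h := hb.det_bounds (pullBilin_symm hG y) hQ hl
  have h0 : (0 : ℝ) ≤ (n.factorial : ℝ) * (√lam) ^ n := by positivity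
  rw [← inv_pow] at h
  exact ⟨(Real.sqrt_le_sqrt h.1).trans' (Real.sqrt_sq (inv_nonneg.2 h0)).ge,
    (Real.sqrt_le_sqrt h.2).trans (Real.sqrt_sq h0).le⟩

end Norms

end ScKorn

end


noncomputable section

namespace ScKorn

/-! ### The Riemannian volume in a chart. -/

section Volume

variable {n : ℕ} {M : Type*} [TopologicalSpace M] [ChartedSpace (Model n) M]
  [MeasurableSpace M] [BorelSpace M] {G : BilinField n M} {U : Set M}
  {φ φ' : OpenPartialHomeomorph M (Model n)}

/-- The density of the Riemannian volume in a chart. -/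
def chartDensity (G : BilinField n M) (φ : OpenPartialHomeomorph M (Model n)) (y : Model n) :
    ℝ≥0∞ := ENNReal.ofReal (√|(chartGram G φ y).det|)

theorem measurableEmbedding_symm (φ : OpenPartialHomeomorph M (Model n)) :
    MeasurableEmbedding (φ.target.domRestrict φ.symm) :=
  φ.symm.isOpenEmbedding_restrict.measurableEmbedding

theorem measurableSet_inter_preimage_symm {E : Set M} (hE : MeasurableSet E) :
    MeasurableSet (φ.symm ⁻¹' E ∩ φ.target) := by
  have h1 := (measurableEmbedding_symm φ).measurable hE
  have h2 := (MeasurableEmbedding.subtype_coe φ.open_target.measurableSet).measurableSet_image.2 h1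
  convert h2 using 1
  ext y
  simp [Set.domRestrict, and_comm]

theorem measurableSet_image_symm {S : Set (Model n)} (hS : MeasurableSet S) (hSt : S ⊆ φ.target) :
    MeasurableSet (φ.symm '' S) := by
  have h1 := (measurableEmbedding_symm φ).measurableSet_image.2
    (measurable_subtype_coe (p := fun y ↦ y ∈ φ.target) hS)
  convert h1 using 1
  ext p
  constructor
  · rintro ⟨y, hy, rfl⟩
    exact ⟨⟨y, hSt hy⟩, hy, rfl⟩
  · rintro ⟨y, hy, rfl⟩
    exact ⟨y, hy, rfl⟩

theorem aemeasurable_symm (φ : OpenPartialHomeomorph M (Model n)) (f : Model n → ℝ≥0∞) :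
    AEMeasurable φ.symm (((volume : Measure (Model n)).restrict φ.target).withDensity f) :=
  (φ.continuousOn_symm.aemeasurable φ.open_target.measurableSet).mono_ac
    (withDensity_absolutelyContinuous _ _)

theorem chartVolume_apply {E : Set M} (hE : MeasurableSet E) :
    chartVolume G φ E = ∫⁻ y in φ.symm ⁻¹' E ∩ φ.target, chartDensity G φ y := by
  rw [chartVolume, Measure.map_apply_of_aemeasurable (aemeasurable_symm φ _) hE,
    withDensity_apply', Measure.restrict_restrict' φ.open_target.measurableSet]
  rfl

variable [IsManifold (𝓡 n) ∞ M]

theorem chartDensity_transition (hφ : φ ∈ IsManifold.maximalAtlas (𝓡 n) ∞ M)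
    (hφ' : φ' ∈ IsManifold.maximalAtlas (𝓡 n) ∞ M) {y : Model n}
    (hy : y ∈ (transition φ φ').source) : chartDensity G φ' y =
      ENNReal.ofReal |(fderiv ℝ (transition φ φ') y).det| *
        chartDensity G φ (transition φ φ' y) := by
  set A := fderiv ℝ (transition φ φ') y with hA
  set P : Matrix (Fin n) (Fin n) ℝ := Matrix.of fun i j ↦ (A (stdVec n j)) i with hP
  have h1 : chartGram G φ' y = P.transpose * chartGram G φ (transition φ φ' y) * P := by
    ext i j
    rw [chartGram_eq_pullBilin, pullBilin_eq hφ hφ' hy, ← hA, Matrix.mul_apply,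
      clm_eq_sum (pullBilin G φ _ (A (stdVec n i))) (A (stdVec n j))]
    refine Finset.sum_congr rfl fun k _ ↦ ?_
    rw [Matrix.mul_apply, clm_eq_sum (pullBilin G φ _) (A (stdVec n i)),
      ContinuousLinearMap.sum_apply, smul_eq_mul, mul_comm]
    congr 1
  have h2 : (chartGram G φ' y).det = A.det ^ 2 * (chartGram G φ (transition φ φ' y)).det := by
    rw [h1, Matrix.det_mul, Matrix.det_mul, Matrix.det_transpose, clm_det_eq]
    ring
  rw [chartDensity, chartDensity, h2, abs_mul, Real.sqrt_mul (abs_nonneg _), abs_pow,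
    Real.sqrt_sq (abs_nonneg _), ENNReal.ofReal_mul (abs_nonneg _)]

/-- The change of variables formula. There is only an inequality because the chart φ' may miss a
part of E. -/
theorem chartVolume_le_of_subset (hφ : φ ∈ IsManifold.maximalAtlas (𝓡 n) ∞ M)
    (hφ' : φ' ∈ IsManifold.maximalAtlas (𝓡 n) ∞ M) {E : Set M} (hE : MeasurableSet E)
    (hs : E ⊆ φ.source) : chartVolume G φ' E ≤ chartVolume G φ E := by
  rw [chartVolume_apply hE, chartVolume_apply hE]
  set τ := transition φ φ' with hτd
  have hτ := contDiffOn_transition hφ hφ'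
  set A := φ'.symm ⁻¹' E ∩ φ'.target with hA
  have hAm : MeasurableSet A := measurableSet_inter_preimage_symm hE
  have hAs : A ⊆ τ.source := fun y hy ↦ by
    rw [hτd, transition_source]; exact ⟨hy.2, hs hy.1⟩
  calc ∫⁻ y in A, chartDensity G φ' y
      = ∫⁻ y in A, ENNReal.ofReal |(fderiv ℝ τ y).det| * chartDensity G φ (τ y) :=
        setLIntegral_congr_fun hAm fun y hy ↦ chartDensity_transition hφ hφ' (hAs hy)
    _ = ∫⁻ z in τ '' A, chartDensity G φ z :=
        (lintegral_image_eq_lintegral_abs_det_fderiv_mul volume hAm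
          (fun y hy ↦ (hasFDerivAt_of_source hτ (hAs hy)).hasFDerivWithinAt)
          (τ.injOn.mono hAs) _).symm
    _ ≤ _ := by
        refine lintegral_mono_set ?_
        rintro _ ⟨y, hy, rfl⟩
        have h1 := τ.map_source (hAs hy)
        rw [hτd, transition_target] at h1
        exact ⟨by rw [Set.mem_preimage, hτd, symm_transition (hAs hy)]; exact hy.1, h1.1⟩

/-- The volume of φ inside its domain plus the measure ⊤ outside dominates the volume of every
chart, hence their supremum. On subsets of the domain the second summand is 0. -/
theorem riemVolume_restrict (hφ : φ ∈ IsManifold.maximalAtlas (𝓡 n) ∞ M) {E : Set M}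
    (hE : MeasurableSet E) (hs : E ⊆ φ.source) :
    (riemVolume G).restrict E = (chartVolume G φ).restrict E := by
  have hle : riemVolume G ≤ chartVolume G φ + (⊤ : Measure M).restrict φ.sourceᶜ := by
    refine iSup₂_le fun φ' hφ' ↦ Measure.le_iff.2 fun B hB ↦ ?_
    have hm := φ.open_source.measurableSet
    rw [← measure_inter_add_diff B hm]
    refine (add_le_add (chartVolume_le_of_subset hφ hφ' (hB.inter hm) Set.inter_subset_right)
      (Measure.le_iff'.1 (le_top : chartVolume G φ' ≤ ⊤) (B \ φ.source))).trans ?_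
    rw [Measure.add_apply, Measure.restrict_apply hB]
    exact add_le_add (measure_mono Set.inter_subset_left) le_rfl
  refine le_antisymm ?_ (Measure.restrict_mono le_rfl (le_iSup₂ (f := fun φ _ ↦ chartVolume G φ)
    φ hφ))
  refine (Measure.restrict_mono le_rfl hle).trans ?_
  rw [Measure.restrict_add, Measure.restrict_restrict hE]
  have : E ∩ φ.sourceᶜ = ∅ := by
    ext p; simpa using fun hp ↦ hs hp
  simp [this]

/-- The function f is arbitrary, since the norm of a rough tensor field need not be measurable.
Therefore the integral is transported by measurable embeddings, under which lower integrals are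
preserved. -/
theorem lintegral_riemVolume (hG : MetricOn G U) (hU : IsOpen U)
    (hφ : φ ∈ IsManifold.maximalAtlas (𝓡 n) ∞ M) (hsU : φ.source ⊆ U) {S : Set (Model n)}
    (hS : MeasurableSet S) (hSt : S ⊆ φ.target) (f : M → ℝ≥0∞) :
    ∫⁻ p in φ.symm '' S, f p ∂(riemVolume G) = ∫⁻ y in S, chartDensity G φ y * f (φ.symm y) := by
  have hE := measurableSet_image_symm hS hSt
  have hEs : φ.symm '' S ⊆ φ.source := by
    rintro _ ⟨y, hy, rfl⟩; exact φ.map_target (hSt hy)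
  rw [riemVolume_restrict hφ hE hEs, ← lintegral_indicator hE]
  set μ := ((volume : Measure (Model n)).restrict φ.target).withDensity (chartDensity G φ) with hμ
  have hι := MeasurableEmbedding.subtype_coe φ.open_target.measurableSet
  have hμr : Measure.map (Subtype.val : φ.target → Model n) (Measure.comap Subtype.val μ) = μ := by
    rw [hι.map_comap, Subtype.range_coe, hμ, restrict_withDensity φ.open_target.measurableSet,
      Measure.restrict_restrict φ.open_target.measurableSet, Set.inter_self]
  have key : ∀ F : M → ℝ≥0∞, ∫⁻ p, F p ∂(chartVolume G φ) = ∫⁻ y, F (φ.symm y) ∂μ := by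
    intro F
    have h1 : chartVolume G φ = Measure.map (φ.target.domRestrict φ.symm)
        (Measure.comap Subtype.val μ) := by
      have h2 : chartVolume G φ = Measure.map φ.symm μ := rfl
      rw [h2, ← hμr, AEMeasurable.map_map_of_aemeasurable _ hι.measurable.aemeasurable, hμr]
      · rfl
      · rw [hμr]; exact aemeasurable_symm φ _
    rw [h1, (measurableEmbedding_symm φ).lintegral_map]
    conv_rhs => rw [← hμr, hι.lintegral_map]
    rfl
  rw [key]
  have hreg : φ.target ∩ φ.symm ⁻¹' U = φ.target :=
    Set.inter_eq_left.2 fun y hy ↦ hsU (φ.map_target hy)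
  have hdm : AEMeasurable (chartDensity G φ) (volume.restrict φ.target) := by
    have h1 : ContinuousOn (fun y ↦ √|(chartGram G φ y).det|) φ.target := by
      have h2 : ∀ a b, ContinuousOn (fun y ↦ chartGram G φ y a b) φ.target := fun a b ↦ by
        have := ((hG.smooth φ hφ).clm_apply (contDiffOn_const (c := stdVec n a))).clm_apply
          (contDiffOn_const (c := stdVec n b))
        rw [hreg] at this
        exact this.continuousOn
      have h3 : ContinuousOn (fun y ↦ (chartGram G φ y).det) φ.target := by
        simp only [Matrix.det_apply]
        exact continuousOn_finset_sum _ fun σ _ ↦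
          (continuousOn_finset_prod _ fun a _ ↦ h2 _ _).const_smul _
      exact h3.abs.sqrt
    exact (h1.aemeasurable φ.open_target.measurableSet).ennreal_ofReal
  rw [hμ, lintegral_withDensity_eq_lintegral_mul_non_measurable₀ _ hdm
    (Filter.Eventually.of_forall fun y ↦ ENNReal.ofReal_lt_top), ← lintegral_indicator
    φ.open_target.measurableSet, ← lintegral_indicator hS]
  refine lintegral_congr fun y ↦ ?_
  by_cases hy : y ∈ S
  · rw [Set.indicator_of_mem (hSt hy), Set.indicator_of_mem hy, Pi.mul_apply,
      Set.indicator_of_mem (Set.mem_image_of_mem _ hy)]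
  · rw [Set.indicator_of_notMem hy]
    by_cases hyt : y ∈ φ.target
    · rw [Set.indicator_of_mem hyt, Pi.mul_apply, Set.indicator_of_notMem, mul_zero]
      rintro ⟨z, hz, hzy⟩
      exact hy (φ.symm.injOn (hSt hz) hyt hzy ▸ hz)
    · rw [Set.indicator_of_notMem hyt]

end Volume

end ScKorn

end


noncomputable section

namespace ScKorn

/-! ### Comparison of L² norms of tensors and of their components. -/

section Comparison

variable {n : ℕ} {M : Type*} [TopologicalSpace M] [ChartedSpace (Model n) M]
  [MeasurableSpace M] [BorelSpace M] [IsManifold (𝓡 n) ∞ M] {𝕜 : Type*} [RCLike 𝕜] {m : ℕ}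
  {G : BilinField n M} {U : Set M} {φ : OpenPartialHomeomorph M (Model n)}

/-- The square of the `L²` norm of a tensor field on a set. -/
def tensorSq (G : BilinField n M) (E : Set M) (u : CovTensor 𝕜 n M m) : ℝ≥0∞ :=
  ∫⁻ p in E, ENNReal.ofReal (tensorNormSq G p (u p)) ∂(riemVolume G)

/-- The constant in the comparison of norms in a chart. -/
def normConst (n m : ℕ) (lam : ℝ) : ℝ≥0∞ :=
  ENNReal.ofReal ((n.factorial : ℝ) * (√lam) ^ n) * ENNReal.ofReal (lam ^ m * n ^ m * n ^ m)

theorem normConst_lt_top (n m : ℕ) (lam : ℝ) : normConst n m lam < ⊤ :=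
  ENNReal.mul_lt_top ENNReal.ofReal_lt_top ENNReal.ofReal_lt_top

theorem ofReal_sum_norm_sq {ι : Type*} (s : Finset ι) (f : ι → 𝕜) :
    ENNReal.ofReal (∑ i ∈ s, ‖f i‖ ^ 2) = ∑ i ∈ s, ‖f i‖ₑ ^ 2 := by
  rw [ENNReal.ofReal_sum_of_nonneg fun _ _ ↦ by positivity]
  exact Finset.sum_congr rfl fun i _ ↦ by rw [ENNReal.ofReal_pow (norm_nonneg _), ofReal_norm]

/-- The lower integral is superadditive without any measurability, and this is the direction that is
needed. -/
theorem sum_lintegral_le {X ι : Type*} [MeasurableSpace X] {μ : Measure X} (s : Finset ι)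
    (f : ι → X → ℝ≥0∞) : ∑ i ∈ s, ∫⁻ y, f i y ∂μ ≤ ∫⁻ y, ∑ i ∈ s, f i y ∂μ := by
  classical
  induction s using Finset.induction_on with
  | empty => simp
  | insert a s ha ih =>
    simp only [Finset.sum_insert ha]
    exact (add_le_add le_rfl ih).trans (le_lintegral_add _ _)

theorem sum_sqNorm_le_lintegral {ι : Type*} (s : Finset ι) (S : Set (Model n))
    (f : ι → Model n → 𝕜) :
    ∑ i ∈ s, sqNorm S (f i) ≤ ∫⁻ y in S, ENNReal.ofReal (∑ i ∈ s, ‖f i y‖ ^ 2) := by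
  simp only [ofReal_sum_norm_sq]
  exact sum_lintegral_le s _

theorem sqNorm_le_tensorSq (hG : MetricOn G U) (hU : IsOpen U) (hφ : φ ∈ IsManifold.maximalAtlas (𝓡 n) ∞ M)
  (hsU : φ.source ⊆ U) {S : Set (Model n)} (hS : MeasurableSet S) (hSt : S ⊆ φ.target) {lam : ℝ}
  (hl : 0 < lam) (hQ : ∀ y ∈ S, Pinched lam (pullBilin G φ y)) {u : CovTensor 𝕜 n M m} :
    ∑ J, sqNorm S (comp φ u J) ≤ normConst n m lam * tensorSq G (φ.symm '' S) u := by
  refine (sum_sqNorm_le_lintegral _ S _).trans ?_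
  rw [tensorSq, lintegral_riemVolume hG hU hφ hsU hS hSt,
    ← lintegral_const_mul' _ _ (normConst_lt_top n m lam).ne]
  refine setLIntegral_mono' hS fun y hy ↦ ?_
  have hyU : y ∈ φ.target ∩ φ.symm ⁻¹' U := ⟨hSt hy, hsU (φ.map_target (hSt hy))⟩
  have h1 := comp_le_tensorNormSq hG hφ hyU (hQ y hy) u
  have h2 := (det_chartGram_bounds hG hφ hyU hl (hQ y hy)).1
  have hpos : 0 < (n.factorial : ℝ) * (√lam) ^ n := by
    have := Real.sqrt_pos.2 hl
    positivity
  have h3 : 1 ≤ ENNReal.ofReal ((n.factorial : ℝ) * (√lam) ^ n) * chartDensity G φ y := by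
    rw [chartDensity, ← ENNReal.ofReal_mul hpos.le, ENNReal.one_le_ofReal]
    calc (1 : ℝ) = (n.factorial : ℝ) * (√lam) ^ n * ((n.factorial : ℝ) * (√lam) ^ n)⁻¹ :=
          (mul_inv_cancel₀ hpos.ne').symm
      _ ≤ _ := mul_le_mul_of_nonneg_left h2 hpos.le
  calc ENNReal.ofReal (∑ J, ‖comp φ u J y‖ ^ 2)
      ≤ ENNReal.ofReal (lam ^ m * n ^ m * n ^ m) *
          ENNReal.ofReal (tensorNormSq G (φ.symm y) (u (φ.symm y))) := by
        rw [← ENNReal.ofReal_mul (by positivity)]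
        exact ENNReal.ofReal_le_ofReal h1
    _ ≤ (ENNReal.ofReal ((n.factorial : ℝ) * (√lam) ^ n) * chartDensity G φ y) *
          (ENNReal.ofReal (lam ^ m * n ^ m * n ^ m) *
          ENNReal.ofReal (tensorNormSq G (φ.symm y) (u (φ.symm y)))) :=
        le_mul_of_one_le_left' h3
    _ = _ := by rw [normConst]; ring

end Comparison

end ScKorn

end


noncomputable section

namespace ScKorn

/-! ### Charts with prescribed coordinate functions. -/

section AdaptedCharts

variable {n : ℕ}

/-- The inverse function theorem, for local diffeomorphisms of `ℝⁿ`. -/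
theorem exists_local_diffeo {f : Model n → Model n} {R : Set (Model n)} (hR : IsOpen R)
    (hf : ContDiffOn ℝ ∞ f R) {a : Model n} (ha : a ∈ R)
    (hinj : Function.Injective (fderiv ℝ f a)) :
    ∃ Ψ : OpenPartialHomeomorph (Model n) (Model n), a ∈ Ψ.source ∧ Ψ.source ⊆ R ∧ (∀ y, Ψ y = f y) ∧
      ContDiffOn ℝ ∞ Ψ Ψ.source ∧ ContDiffOn ℝ ∞ Ψ.symm Ψ.target := by
  have hat : ∀ y ∈ R, ContDiffAt ℝ ∞ f y := fun y hy ↦ hf.contDiffAt (hR.mem_nhds hy)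
  have hdet : ∀ A : Model n →L[ℝ] Model n, A.det ≠ 0 → ∃ e : Model n ≃L[ℝ] Model n,
      (e : Model n →L[ℝ] Model n) = A := fun A hA ↦
    ⟨ContinuousLinearMap.toContinuousLinearEquivOfDetNeZero A hA, by ext; simp⟩
  have ha0 : (fderiv ℝ f a).det ≠ 0 := by
    have hk : LinearMap.ker ((fderiv ℝ f a : Model n →L[ℝ] Model n) : Model n →ₗ[ℝ] Model n) = ⊥ :=
      LinearMap.ker_eq_bot.2 hinj
    intro h0
    have := LinearMap.bot_lt_ker_of_det_eq_zero (f :=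
      ((fderiv ℝ f a : Model n →L[ℝ] Model n) : Model n →ₗ[ℝ] Model n)) h0
    rw [hk] at this
    exact this.ne rfl
  obtain ⟨e, he⟩ := hdet _ ha0
  have hd : HasFDerivAt f (e : Model n →L[ℝ] Model n) a := by
    rw [he]; exact ((hat a ha).differentiableAt (by simp)).hasFDerivAt
  set Ψ₀ := (hat a ha).toOpenPartialHomeomorph f hd (by simp) with hΨ₀
  -- Shrinking to the points where the derivative is invertible makes the inverse smooth on the
  -- whole target, not just near the image of a.
  set R' : Set (Model n) := R ∩ (fun y ↦ (fderiv ℝ f y).det) ⁻¹' {0}ᶜ with hR'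
  have hR'o : IsOpen R' := by
    refine ContinuousOn.isOpen_inter_preimage ?_ hR isOpen_compl_singleton
    exact contDiff_det.continuous.comp_continuousOn
      (hf.continuousOn_fderiv_of_isOpen hR (by simp))
  have hs : (Ψ₀.restrOpen R' hR'o).source = Ψ₀.source ∩ R' := rfl
  refine ⟨Ψ₀.restrOpen R' hR'o, ⟨?_, ha, ha0⟩, fun y hy ↦ hy.2.1, fun y ↦ rfl, ?_, ?_⟩
  · exact (hat a ha).mem_toOpenPartialHomeomorph_source hd (by simp)
  · exact hf.mono fun y hy ↦ hy.2.1
  · intro z hz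
    have hz' := (Ψ₀.restrOpen R' hR'o).map_target hz
    obtain ⟨e', he'⟩ := hdet _ hz'.2.2
    refine (OpenPartialHomeomorph.contDiffAt_symm (f₀' := e') _ hz ?_ ?_).contDiffWithinAt
    · rw [he']
      exact ((hat _ hz'.2.1).differentiableAt (by simp)).hasFDerivAt
    · exact hat _ hz'.2.1

variable {M : Type*} [TopologicalSpace M] [ChartedSpace (Model n) M] [IsManifold (𝓡 n) ∞ M]
  {φ : OpenPartialHomeomorph M (Model n)}

theorem mem_contDiffGroupoid_of_contDiffOn {Ψ : OpenPartialHomeomorph (Model n) (Model n)}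
    (h1 : ContDiffOn ℝ ∞ Ψ Ψ.source) (h2 : ContDiffOn ℝ ∞ Ψ.symm Ψ.target) :
    Ψ ∈ contDiffGroupoid ∞ (𝓡 n) := by
  rw [contDiffGroupoid, mem_groupoid_of_pregroupoid]
  exact ⟨by simpa [contDiffPregroupoid] using h1, by simpa [contDiffPregroupoid] using h2⟩

theorem trans_mem_maximalAtlas (hφ : φ ∈ IsManifold.maximalAtlas (𝓡 n) ∞ M)
    {Ψ : OpenPartialHomeomorph (Model n) (Model n)}
    (h1 : ContDiffOn ℝ ∞ Ψ Ψ.source) (h2 : ContDiffOn ℝ ∞ Ψ.symm Ψ.target) :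
    φ.trans Ψ ∈ IsManifold.maximalAtlas (𝓡 n) ∞ M := by
  have hΨ := mem_contDiffGroupoid_of_contDiffOn h1 h2
  rw [IsManifold.maximalAtlas, mem_maximalAtlas_iff] at hφ ⊢
  intro e' he'
  obtain ⟨l, r⟩ := hφ e' he'
  constructor
  · rw [OpenPartialHomeomorph.trans_symm_eq_symm_trans_symm, OpenPartialHomeomorph.trans_assoc]
    exact (contDiffGroupoid ∞ (𝓡 n)).trans ((contDiffGroupoid ∞ (𝓡 n)).symm hΨ) l
  · rw [← OpenPartialHomeomorph.trans_assoc]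
    exact (contDiffGroupoid ∞ (𝓡 n)).trans r hΨ

theorem restr_mem_maximalAtlas' (hφ : φ ∈ IsManifold.maximalAtlas (𝓡 n) ∞ M) {W : Set M}
    (hW : IsOpen W) : φ.restr W ∈ IsManifold.maximalAtlas (𝓡 n) ∞ M :=
  restr_mem_maximalAtlas _ hφ hW

/-- The map that replaces the coordinate `i` by the function `f`, and the coordinate `j` by the
coordinate `i`. -/
def replaceCoord (f : Model n → ℝ) (i j : Fin n) (y : Model n) : Model n :=
  WithLp.toLp 2 fun k ↦ if k = i then f y else y (Equiv.swap i j k)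

theorem contDiffOn_replaceCoord {f : Model n → ℝ} {R : Set (Model n)} (hf : ContDiffOn ℝ ∞ f R)
    (i j : Fin n) : ContDiffOn ℝ ∞ (replaceCoord f i j) R := by
  rw [contDiffOn_euclidean]
  intro k
  by_cases hk : k = i
  · simpa [replaceCoord, hk] using hf
  · simp only [replaceCoord, hk, if_false]
    exact (EuclideanSpace.proj (𝕜 := ℝ) (Equiv.swap i j k)).contDiff.contDiffOn

/-- In the kernel all coordinates other than j vanish at once, and then the j-th one vanishes
because ∂_j f ≠ 0. -/
theorem fderiv_replaceCoord_injective {f : Model n → ℝ} {a : Model n} {i j : Fin n}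
    (hf : DifferentiableAt ℝ f a) (hg : DifferentiableAt ℝ (replaceCoord f i j) a)
    (hj : fderiv ℝ f a (stdVec n j) ≠ 0) :
    Function.Injective (fderiv ℝ (replaceCoord f i j) a) := by
  have hc : ∀ v k, fderiv ℝ (replaceCoord f i j) a v k =
      if k = i then fderiv ℝ f a v else v (Equiv.swap i j k) := by
    intro v k
    have h1 : HasFDerivAt (fun y ↦ replaceCoord f i j y k)
        ((EuclideanSpace.proj (𝕜 := ℝ) k).comp (fderiv ℝ (replaceCoord f i j) a)) a :=
      (EuclideanSpace.proj (𝕜 := ℝ) k : Model n →L[ℝ] ℝ).hasFDerivAt.comp a hg.hasFDerivAt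
    by_cases hk : k = i
    · have h2 : HasFDerivAt (fun y ↦ replaceCoord f i j y k) (fderiv ℝ f a) a := by
        simpa [replaceCoord, hk] using hf.hasFDerivAt
      rw [if_pos hk, ← h1.unique h2]; rfl
    · have h2 : HasFDerivAt (fun y ↦ replaceCoord f i j y k)
          (EuclideanSpace.proj (𝕜 := ℝ) (Equiv.swap i j k) : Model n →L[ℝ] ℝ) a := by
        simp only [replaceCoord, hk, if_false]
        exact (EuclideanSpace.proj (𝕜 := ℝ) (Equiv.swap i j k) : Model n →L[ℝ] ℝ).hasFDerivAt
      rw [if_neg hk]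
      exact DFunLike.congr_fun (h1.unique h2) v
  rw [injective_iff_map_eq_zero]
  intro v hv
  have hl : ∀ l, l ≠ j → v l = 0 := fun l hlj ↦ by
    have h1 := hc v (Equiv.swap i j l)
    rw [hv, if_neg, Equiv.swap_apply_self] at h1
    · exact h1.symm
    · intro h
      apply hlj
      rw [← Equiv.swap_apply_self i j l, h, Equiv.swap_apply_left]
  have hvj : v = v j • stdVec n j := by
    ext l
    by_cases h : l = j
    · subst h; simp [stdVec_apply]
    · simp [stdVec_apply, hl l h, h]
  have h2 := hc v i
  rw [hv, if_pos rfl, hvj, map_smul, smul_eq_mul] at h2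
  have h3 : v j = 0 := by
    rcases mul_eq_zero.1 h2.symm with h | h
    · exact h
    · exact absurd h hj
  rw [hvj, h3, zero_smul]

/-- Replace a coordinate of a chart by a given function, keeping the coordinates in `s`. -/
theorem exists_chart_replace (hφ : φ ∈ IsManifold.maximalAtlas (𝓡 n) ∞ M) {q : M}
    (hq : q ∈ φ.source) {W : Set M} (hW : IsOpen W) (hqW : q ∈ W) {f : M → ℝ}
    (hf : ContMDiffOn (𝓡 n) 𝓘(ℝ, ℝ) ∞ f W) (s : Set (Fin n)) {i : Fin n} (hi : i ∉ s)
    (hv : ∃ v : Model n, (∀ j ∈ s, v j = 0) ∧ fderiv ℝ (fun y ↦ f (φ.symm y)) (φ q) v ≠ 0) :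
    ∃ φ' ∈ IsManifold.maximalAtlas (𝓡 n) ∞ M, q ∈ φ'.source ∧ φ'.source ⊆ φ.source ∩ W ∧
      (∀ p ∈ φ'.source, (φ' p) i = f p) ∧ ∀ p ∈ φ'.source, ∀ j ∈ s, (φ' p) j = (φ p) j := by
  obtain ⟨v, hvs, hv0⟩ := hv
  -- The vector v is a combination of basis vectors outside s, so f has a nonzero derivative along
  -- one of them. That old coordinate is the one to be given up.
  obtain ⟨j, hjs, hj⟩ : ∃ j, j ∉ s ∧ fderiv ℝ (fun y ↦ f (φ.symm y)) (φ q) (stdVec n j) ≠ 0 := by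
    by_contra! hcon
    rw [clm_eq_sum (fderiv ℝ (fun y ↦ f (φ.symm y)) (φ q)) v] at hv0
    refine hv0 (Finset.sum_eq_zero fun l _ ↦ ?_)
    by_cases hl : l ∈ s
    · rw [hvs l hl, zero_smul]
    · rw [hcon l hl, smul_zero]
  have hR := isOpen_region (φ := φ) hW
  have hfs := contDiffOn_comp_symm hf hφ
  have hqR : φ q ∈ φ.target ∩ φ.symm ⁻¹' W :=
    ⟨φ.map_source hq, by rw [Set.mem_preimage, φ.left_inv hq]; exact hqW⟩
  have hrep := contDiffOn_replaceCoord hfs i j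
  obtain ⟨Ψ, hΨ1, hΨ2, hΨ3, hΨ4, hΨ5⟩ := exists_local_diffeo hR hrep hqR
    (fderiv_replaceCoord_injective ((hfs.contDiffAt (hR.mem_nhds hqR)).differentiableAt (by simp))
      ((hrep.contDiffAt (hR.mem_nhds hqR)).differentiableAt (by simp)) hj)
  have hsrc : ∀ p ∈ (φ.trans Ψ).source, p ∈ φ.source ∧ φ p ∈ Ψ.source := fun p hp ↦ by
    simpa [OpenPartialHomeomorph.trans_source] using hp
  refine ⟨φ.trans Ψ, trans_mem_maximalAtlas hφ hΨ4 hΨ5, ?_, ?_, ?_, ?_⟩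
  · simp [OpenPartialHomeomorph.trans_source, hq, hΨ1]
  · intro p hp
    obtain ⟨h1, h2⟩ := hsrc p hp
    have h3 := (hΨ2 h2).2
    rw [Set.mem_preimage, φ.left_inv h1] at h3
    exact ⟨h1, h3⟩
  · intro p hp
    obtain ⟨h1, h2⟩ := hsrc p hp
    rw [OpenPartialHomeomorph.trans_apply, hΨ3]
    simp [replaceCoord, φ.left_inv h1]
  · intro p hp l hl
    obtain ⟨h1, h2⟩ := hsrc p hp
    rw [OpenPartialHomeomorph.trans_apply, hΨ3]
    have hli : l ≠ i := fun h ↦ hi (h ▸ hl)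
    have hlj : l ≠ j := fun h ↦ hjs (h ▸ hl)
    simp [replaceCoord, hli, Equiv.swap_apply_of_ne_of_ne hli hlj]

/-- A chart around a point with one prescribed coordinate. -/
theorem exists_chart_one {q : M} {W : Set M} (hW : IsOpen W) (hqW : q ∈ W) {f : M → ℝ}
    (hf : ContMDiffOn (𝓡 n) 𝓘(ℝ, ℝ) ∞ f W) (hd : dAt n f q ≠ 0) (i : Fin n) :
    ∃ φ ∈ IsManifold.maximalAtlas (𝓡 n) ∞ M, q ∈ φ.source ∧ φ.source ⊆ W ∧
      ∀ p ∈ φ.source, (φ p) i = f p := by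
  set φ := chartAt (Model n) q
  have hφ : φ ∈ IsManifold.maximalAtlas (𝓡 n) ∞ M := IsManifold.chart_mem_maximalAtlas _
  have hq : q ∈ φ.source := mem_chart_source _ _
  have hfm : MDifferentiableAt (𝓡 n) 𝓘(ℝ, ℝ) f (φ.symm (φ q)) := by
    rw [φ.left_inv hq]
    exact (hf.contMDiffAt (hW.mem_nhds hqW)).mdifferentiableAt (by simp)
  have hv : ∃ v : Model n, (∀ j ∈ (∅ : Set (Fin n)), v j = 0) ∧
      fderiv ℝ (fun y ↦ f (φ.symm y)) (φ q) v ≠ 0 := by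
    by_contra! hcon
    apply hd
    ext w
    have hs := chartD_surjective hφ (φ.map_source hq)
    obtain ⟨v, rfl⟩ := hs w
    have h1 := dAt_chartD hφ (φ.map_source hq) hfm v
    rw [hcon v (by simp)] at h1
    have h2 : rawCovector n f (φ.symm (φ q)) (chartD φ (φ q) v) = 0 := h1
    rw [φ.left_inv hq] at h2
    exact h2
  obtain ⟨φ', h1, h2, h3, h4, -⟩ := exists_chart_replace hφ hq hW hqW hf ∅ (by simp) hv
  exact ⟨φ', h1, h2, h3.trans Set.inter_subset_right, h4⟩

/-- A chart around a point with two prescribed coordinates. -/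
theorem exists_chart_two {q : M} {W : Set M} (hW : IsOpen W) (hqW : q ∈ W) {f₀ f₁ : M → ℝ}
    (hf₀ : ContMDiffOn (𝓡 n) 𝓘(ℝ, ℝ) ∞ f₀ W) (hf₁ : ContMDiffOn (𝓡 n) 𝓘(ℝ, ℝ) ∞ f₁ W)
    (hd : LinearIndependent ℝ ![dAt n f₁ q, dAt n f₀ q]) {i₀ i₁ : Fin n} (hi : i₁ ≠ i₀) :
    ∃ φ ∈ IsManifold.maximalAtlas (𝓡 n) ∞ M, q ∈ φ.source ∧ φ.source ⊆ W ∧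
      (∀ p ∈ φ.source, (φ p) i₀ = f₀ p) ∧ ∀ p ∈ φ.source, (φ p) i₁ = f₁ p := by
  rw [LinearIndependent.pair_iff] at hd
  have hd0 : dAt n f₀ q ≠ 0 := fun h ↦ by
    have := (hd 0 1 (by rw [h]; simp)).2
    norm_num at this
  obtain ⟨φ, hφ, hq, hsW, hc0⟩ := exists_chart_one hW hqW hf₀ hd0 i₀
  have hm : ∀ {f : M → ℝ}, ContMDiffOn (𝓡 n) 𝓘(ℝ, ℝ) ∞ f W →
      MDifferentiableAt (𝓡 n) 𝓘(ℝ, ℝ) f (φ.symm (φ q)) := fun hf ↦ by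
    rw [φ.left_inv hq]
    exact (hf.contMDiffAt (hW.mem_nhds hqW)).mdifferentiableAt (by simp)
  have hraw : ∀ {f : M → ℝ}, ContMDiffOn (𝓡 n) 𝓘(ℝ, ℝ) ∞ f W → ∀ v,
      rawCovector n f q (chartD φ (φ q) v) = fderiv ℝ (fun y ↦ f (φ.symm y)) (φ q) v :=
      fun {f} hf v ↦ by
    have h1 : rawCovector n f (φ.symm (φ q)) (chartD φ (φ q) v) = _ :=
      dAt_chartD hφ (φ.map_source hq) (hm hf) v
    rwa [φ.left_inv hq] at h1
  have hco : ∀ v, fderiv ℝ (fun y ↦ f₀ (φ.symm y)) (φ q) v = v i₀ := fun v ↦ by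
    have hev : (fun y ↦ f₀ (φ.symm y)) =ᶠ[𝓝 (φ q)] fun y ↦ y i₀ := by
      filter_upwards [φ.open_target.mem_nhds (φ.map_source hq)] with y hy
      rw [← hc0 _ (φ.map_target hy), φ.right_inv hy]
    rw [hev.fderiv_eq]
    exact DFunLike.congr_fun
      (EuclideanSpace.proj (𝕜 := ℝ) i₀ : Model n →L[ℝ] ℝ).hasFDerivAt.fderiv v
  have hv : ∃ v : Model n, (∀ j ∈ ({i₀} : Set (Fin n)), v j = 0) ∧
      fderiv ℝ (fun y ↦ f₁ (φ.symm y)) (φ q) v ≠ 0 := by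
    by_contra! hcon
    -- If df₁ vanished on the kernel of df₀, it would be a multiple of df₀.
    have key : ∀ v, fderiv ℝ (fun y ↦ f₁ (φ.symm y)) (φ q) v =
        v i₀ * fderiv ℝ (fun y ↦ f₁ (φ.symm y)) (φ q) (stdVec n i₀) := by
      intro v
      have := hcon (v - v i₀ • stdVec n i₀) (by simp [stdVec_apply])
      rw [map_sub, map_smul, sub_eq_zero] at this
      exact this
    have h1 := (hd 1 (-(fderiv ℝ (fun y ↦ f₁ (φ.symm y)) (φ q) (stdVec n i₀))) ?_).1
    · norm_num at h1
    · ext w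
      obtain ⟨v, rfl⟩ := chartD_surjective hφ (φ.map_source hq) w
      have e1 := hraw hf₁ v
      have e0 := hraw hf₀ v
      rw [key] at e1
      rw [hco] at e0
      change (1 : ℝ) * rawCovector n f₁ q (chartD φ (φ q) v) +
        -(fderiv ℝ (fun y ↦ f₁ (φ.symm y)) (φ q) (stdVec n i₀)) *
          rawCovector n f₀ q (chartD φ (φ q) v) = 0
      rw [e1, e0]
      ring
  obtain ⟨φ', h1, h2, h3, h4, h5⟩ := exists_chart_replace hφ hq hW hqW hf₁ {i₀} hi hv
  exact ⟨φ', h1, h2, h3.trans Set.inter_subset_right, fun p hp ↦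
    (h5 p hp i₀ rfl).trans (hc0 p (h3 hp).1), h4⟩

end AdaptedCharts

end ScKorn

end


noncomputable section

namespace ScKorn

/-! ### Uniform bounds on compact sets. -/

section Bounds

variable {n : ℕ}

theorem exists_bound_of_finite {ι X : Type*} [Fintype ι] {K : Set X} {f : ι → X → ℝ}
    (h : ∀ i, ∃ C, ∀ y ∈ K, |f i y| ≤ C) : ∃ C, ∀ y ∈ K, ∀ i, |f i y| ≤ C := by
  choose C hC using h
  refine ⟨∑ i, |C i|, fun y hy i ↦ ((hC i y hy).trans (le_abs_self _)).trans ?_⟩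
  exact Finset.single_le_sum (f := fun i ↦ |C i|) (fun _ _ ↦ abs_nonneg _) (Finset.mem_univ i)

theorem exists_bound_of_compact {X : Type*} [TopologicalSpace X] {K : Set X} (hK : IsCompact K)
    {f : X → ℝ} (hf : ContinuousOn f K) : ∃ C, ∀ y ∈ K, |f y| ≤ C :=
  hK.exists_bound_of_continuousOn hf

theorem Pinched.mono {lam lam' : ℝ} (hl : 0 < lam) (h : lam ≤ lam')
    {Q : Model n →L[ℝ] Model n →L[ℝ] ℝ} (hQ : Pinched lam Q) : Pinched lam' Q := fun v ↦
  ⟨(mul_le_mul_of_nonneg_right (inv_anti₀ hl h) (sq_nonneg _)).trans (hQ v).1,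
    (hQ v).2.trans (mul_le_mul_of_nonneg_right h (sq_nonneg _))⟩

/-- By homogeneity it is enough to bound B(v, v) and its inverse on the product of K with the unit
sphere, which is compact. -/
theorem exists_pinched {K : Set (Model n)} (hK : IsCompact K)
    {B : Model n → Model n →L[ℝ] Model n →L[ℝ] ℝ} (hB : ContinuousOn B K)
    (hp : ∀ y ∈ K, ∀ v, v ≠ 0 → 0 < B y v v) : ∃ lam > 0, ∀ y ∈ K, Pinched lam (B y) := by
  have hS : IsCompact (K ×ˢ Metric.sphere (0 : Model n) 1) := hK.prod (isCompact_sphere 0 1)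
  have hc : ContinuousOn (fun z : Model n × Model n ↦ B z.1 z.2 z.2)
      (K ×ˢ Metric.sphere (0 : Model n) 1) :=
    ((hB.comp continuousOn_fst fun z hz ↦ hz.1).clm_apply continuousOn_snd).clm_apply
      continuousOn_snd
  have hne : ∀ v ∈ Metric.sphere (0 : Model n) 1, v ≠ 0 := fun v hv h ↦ by simp [h] at hv
  have hpos : ∀ z ∈ K ×ˢ Metric.sphere (0 : Model n) 1, 0 < B z.1 z.2 z.2 := fun z hz ↦
    hp _ hz.1 _ (hne _ hz.2)
  obtain ⟨C₁, h₁⟩ := exists_bound_of_compact hS hc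
  obtain ⟨C₂, h₂⟩ := exists_bound_of_compact hS (hc.inv₀ fun z hz ↦ (hpos z hz).ne')
  set lam := max 1 (max C₁ C₂) with hlam
  have hl : 0 < lam := lt_of_lt_of_le one_pos (le_max_left _ _)
  refine ⟨lam, hl, fun y hy v ↦ ?_⟩
  by_cases hv : v = 0
  · subst hv; simp
  have hn : 0 < ‖v‖ := norm_pos_iff.2 hv
  have hz : (y, ‖v‖⁻¹ • v) ∈ K ×ˢ Metric.sphere (0 : Model n) 1 :=
    ⟨hy, by simp [norm_smul, hn.ne']⟩
  have e : B y v v = ‖v‖ ^ 2 * B y (‖v‖⁻¹ • v) (‖v‖⁻¹ • v) := by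
    simp only [map_smul, ContinuousLinearMap.smul_apply, smul_eq_mul]
    field_simp
  have hz0 := hpos _ hz
  have a1 := h₁ _ hz
  have a2 := h₂ _ hz
  simp only [Pi.inv_apply] at a1 a2 hz0
  rw [abs_of_pos hz0] at a1
  rw [abs_of_pos (inv_pos.2 hz0)] at a2
  rw [e, mul_comm _ (B y _ _)]
  constructor
  · refine mul_le_mul_of_nonneg_right ?_ (sq_nonneg _)
    rw [inv_le_comm₀ hl hz0]
    exact a2.trans ((le_max_right _ _).trans (le_max_right _ _))
  · exact mul_le_mul_of_nonneg_right
      (a1.trans ((le_max_left _ _).trans (le_max_right _ _))) (sq_nonneg _)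

end Bounds

/-! ### Patches of bounded geometry, and their construction in the interior. -/

section Patches

variable {n : ℕ} {M : Type*} [TopologicalSpace M] [ChartedSpace (Model n) M]
  [IsManifold (𝓡 n) ∞ M]

/-- A chart of `{x > 0}` together with a closed set `K` of coordinates, on which the geometry of
the scattering metric `gs` and of the metric `g` is bounded, and in which the domain `D` is a half
space or everything. -/
structure Patch (g gs : BilinField n M) (x : M → ℝ) (D : Set M)
    (φ : OpenPartialHomeomorph M (Model n)) (K H : Set (Model n)) (i : Fin n) (N : Set M) (C : ℝ) :
    Prop where
  mem : φ ∈ IsManifold.maximalAtlas (𝓡 n) ∞ M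
  source_subset : φ.source ⊆ interiorX x
  subset_target : K ⊆ φ.target
  isClosed : IsClosed K
  isOpen_diff : IsOpen (interiorX x \ {p | p ∈ φ.source ∧ φ p ∈ K})
  half : H = Set.univ ∨ H = halfSpace i ∧ IsReflStable i K
  mem_iff : ∀ y ∈ φ.target, φ.symm y ∈ D ↔ y ∈ H
  isOpen : IsOpen N
  covers : ∀ p ∈ N, 0 < x p → p ∈ φ.source ∧ φ p ∈ K
  pos : 0 < C
  pinched : ∀ y ∈ K, Pinched C (pullBilin gs φ y)
  christoffel_gs : ∀ y ∈ K, ∀ q k j, |christoffel gs φ q k j y| ≤ C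
  christoffel_g : ∀ y ∈ K, ∀ q k j, |christoffel g φ q k j y| ≤ C
  fderiv_inv : ∀ y ∈ K, ∀ k, |fderiv ℝ (fun y ↦ (x (φ.symm y))⁻¹) y (stdVec n k)| ≤ C
  fderiv_log : ∀ y ∈ K, ∀ k, |fderiv ℝ (fun y ↦ Real.log (x (φ.symm y))) y (stdVec n k)| ≤ C
  fderiv_cutoff : ∀ χ : M → ℝ, ContMDiff (𝓡 n) 𝓘(ℝ, ℝ) ∞ χ → ∃ C', ∀ y ∈ K, ∀ k,
    |fderiv ℝ (fun y ↦ χ (φ.symm y)) y (stdVec n k)| ≤ C'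

variable {x : M → ℝ} {D : Set M} {q : M}

theorem isOpen_interiorX (hx : IsBoundaryDefining n x) : IsOpen (interiorX x) :=
  isOpen_lt continuous_const hx.smooth.continuous

/-- A chart adapted to `x` and to the boundary of the domain. -/
theorem exists_base_chart (hx : IsBoundaryDefining n x) (hD : IsTransversalDomain n x D)
    (hq : q ∈ closure D) (hxq : 0 ≤ x q) {i₀ i₁ : Fin n} (hi : i₁ ≠ i₀) :
    ∃ φ ∈ IsManifold.maximalAtlas (𝓡 n) ∞ M, q ∈ φ.source ∧ ∃ H : Set (Model n),
      (H = Set.univ ∨ H = halfSpace i₁ ∧ φ q i₁ = 0) ∧ (∀ y ∈ φ.target, φ.symm y ∈ D ↔ y ∈ H) ∧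
      (x q = 0 → ∀ p ∈ φ.source, φ p i₀ = x p) ∧ (0 < x q → φ.source ⊆ interiorX x) := by
  by_cases hqD : q ∈ D
  · have huniv : ∀ φ : OpenPartialHomeomorph M (Model n), φ.source ⊆ D →
        ∀ y ∈ φ.target, φ.symm y ∈ D ↔ y ∈ (Set.univ : Set (Model n)) := fun φ h y hy ↦
      ⟨fun _ ↦ trivial, fun _ ↦ h (φ.map_target hy)⟩
    rcases hxq.eq_or_lt with h0 | h0
    · obtain ⟨φ, h1, h2, h3, h4⟩ := exists_chart_one hD.isOpen hqD hx.smooth.contMDiffOn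
        (hx.regular q h0.symm) i₀
      exact ⟨φ, h1, h2, _, Or.inl rfl, huniv φ h3, fun _ ↦ h4, fun h ↦ absurd h0 h.ne⟩
    · have hW : IsOpen (D ∩ interiorX x) := hD.isOpen.inter (isOpen_interiorX hx)
      have hsrc : ((chartAt (Model n) q).restr (D ∩ interiorX x)).source =
          (chartAt (Model n) q).source ∩ (D ∩ interiorX x) :=
        OpenPartialHomeomorph.restr_source' _ _ hW
      refine ⟨(chartAt (Model n) q).restr (D ∩ interiorX x),
        restr_mem_maximalAtlas' (IsManifold.chart_mem_maximalAtlas _) hW, ?_, _, Or.inl rfl,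
        huniv _ ?_, fun h ↦ absurd h h0.ne', fun _ ↦ ?_⟩
      · rw [hsrc]; exact ⟨mem_chart_source _ _, hqD, h0⟩
      · rw [hsrc]; exact fun p hp ↦ hp.2.1
      · rw [hsrc]; exact fun p hp ↦ hp.2.2
  · have hfr : q ∈ frontier D := ⟨hq, by rwa [hD.isOpen.interior_eq]⟩
    obtain ⟨U, ρ, hU, hqU, hρ, hDU, hdρ, hlin⟩ := hD.boundary q hfr hxq
    -- The point is not in D but is a limit of points of D ∩ U. The chart must place q on the
    -- hyperplane, so that balls around its image are stable under the reflection.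
    have hρq : ρ q = 0 := by
      refine le_antisymm ?_ ?_
      · by_contra! hcon
        have : q ∈ {p | 0 < ρ p} ∩ U := ⟨hcon, hqU⟩
        rw [← hDU] at this
        exact hqD this.1
      · have hcl : q ∈ closure (D ∩ U) := by
          rw [mem_closure_iff_nhds] at hq ⊢
          intro t ht
          obtain ⟨p, hp1, hp2⟩ := hq (t ∩ U) (Filter.inter_mem ht (hU.mem_nhds hqU))
          exact ⟨p, hp1.1, hp2, hp1.2⟩
        have hcont : ContinuousWithinAt ρ (D ∩ U) q :=
          ((hρ.continuousOn).continuousAt (hU.mem_nhds hqU)).continuousWithinAt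
        have := hcont.mem_closure_image hcl
        refine closure_minimal ?_ isClosed_Ici this
        rintro _ ⟨p, hp, rfl⟩
        rw [hDU] at hp
        exact (show 0 < ρ p from hp.1).le
    have hhalf : ∀ φ : OpenPartialHomeomorph M (Model n), φ.source ⊆ U →
        (∀ p ∈ φ.source, φ p i₁ = ρ p) → ∀ y ∈ φ.target, φ.symm y ∈ D ↔ y ∈ halfSpace i₁ := by
      intro φ hs hc y hy
      have hp := φ.map_target hy
      have e1 : φ.symm y ∈ D ↔ 0 < ρ (φ.symm y) := by
        constructor
        · intro h
          have : φ.symm y ∈ D ∩ U := ⟨h, hs hp⟩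
          rw [hDU] at this
          exact this.1
        · intro h
          have : φ.symm y ∈ {p | 0 < ρ p} ∩ U := ⟨h, hs hp⟩
          rw [← hDU] at this
          exact this.1
      rw [e1, ← hc _ hp, φ.right_inv hy]
      rfl
    rcases hxq.eq_or_lt with h0 | h0
    · obtain ⟨φ, h1, h2, h3, h4, h5⟩ := exists_chart_two hU hqU
        (hx.smooth.contMDiffOn (s := U)) hρ (hlin h0.symm) hi
      exact ⟨φ, h1, h2, _, Or.inr ⟨rfl, by rw [h5 q h2, hρq]⟩, hhalf φ h3 h5, fun _ ↦ h4,
        fun h ↦ absurd h0 h.ne⟩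
    · obtain ⟨φ, h1, h2, h3, h4⟩ := exists_chart_one (hU.inter (isOpen_interiorX hx)) ⟨hqU, h0⟩
        (hρ.mono Set.inter_subset_left) hdρ i₁
      exact ⟨φ, h1, h2, _, Or.inr ⟨rfl, by rw [h4 q h2, hρq]⟩,
        hhalf φ (h3.trans Set.inter_subset_left) h4, fun h ↦ absurd h h0.ne',
        fun _ ↦ h3.trans Set.inter_subset_right⟩

/-- The centre lies on the hyperplane, so the map z_i → -t z_i with t ≥ 1 cannot decrease the
distance to it. -/
theorem isReflStable_closedBall {c : Model n} {i : Fin n} (hc : c i = 0) {ε : ℝ} :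
    IsReflStable i (Metric.closedBall c ε) := by
  intro t ht z hz
  rw [mem_closedBall_iff_norm] at hz ⊢
  refine le_trans ?_ hz
  rw [EuclideanSpace.norm_eq, EuclideanSpace.norm_eq]
  refine Real.sqrt_le_sqrt (Finset.sum_le_sum fun k _ ↦ ?_)
  simp only [PiLp.sub_apply, scaleAt_apply, Real.norm_eq_abs, sq_abs]
  by_cases hk : k = i
  · subst hk
    simp only [hc, if_true, sub_zero]
    nlinarith [sq_nonneg (z k), mul_nonneg (sub_nonneg.2 ht) (sq_nonneg (z k))]
  · simp [hk]

theorem contDiffOn_fderiv_stdVec {f : Model n → ℝ} {R : Set (Model n)} (hR : IsOpen R)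
    (hf : ContDiffOn ℝ ∞ f R) (v : Model n) : ContinuousOn (fun y ↦ fderiv ℝ f y v) R :=
  ((hf.fderiv_of_isOpen hR (m := ∞) (by simp)).clm_apply contDiffOn_const).continuousOn

variable {g gs : BilinField n M}

/-- Patches away from the boundary `{x = 0}`. -/
theorem exists_patch_interior [T2Space M] (hx : IsBoundaryDefining n x)
    (hD : IsTransversalDomain n x D)
    (hg : MetricOn g (interiorX x)) (hgs : MetricOn gs (interiorX x)) (hq : q ∈ closure D)
    (hxq : 0 < x q) {i₀ i₁ : Fin n} (hi : i₁ ≠ i₀) :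
    ∃ φ K H N C, q ∈ N ∧ Patch g gs x D φ K H i₁ N C := by
  obtain ⟨φ, hφ, hqφ, H, hH, hDH, -, hsrc⟩ := exists_base_chart hx hD hq hxq.le hi
  have hs := hsrc hxq
  have hreg : φ.target ∩ φ.symm ⁻¹' interiorX x = φ.target :=
    Set.inter_eq_left.2 fun y hy ↦ hs (φ.map_target hy)
  obtain ⟨ε, hε, hball⟩ := Metric.nhds_basis_closedBall.mem_iff.1
    (φ.open_target.mem_nhds (φ.map_source hqφ))
  set K := Metric.closedBall (φ q) ε with hK
  have hKc : IsCompact K := isCompact_closedBall _ _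
  have hU := isOpen_interiorX hx
  have hxs : ContDiffOn ℝ ∞ (fun y ↦ x (φ.symm y)) φ.target := by
    simpa using contDiffOn_comp_symm hx.smooth.contMDiffOn (U := Set.univ) hφ
  have hxne : ∀ y ∈ φ.target, x (φ.symm y) ≠ 0 := fun y hy ↦
    (show 0 < x (φ.symm y) from hs (φ.map_target hy)).ne'
  obtain ⟨lam, hl, hpin⟩ := exists_pinched hKc (B := pullBilin gs φ) (by
      have := (hgs.smooth φ hφ).continuousOn
      rw [hreg] at this
      exact this.mono hball) fun y hy v hv ↦ pullBilin_pos hgs hφ (by rw [hreg]; exact hball hy) hv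
  have hchr : ∀ {G : BilinField n M}, MetricOn G (interiorX x) →
      ∃ C, ∀ y ∈ K, ∀ (a : Fin n × Fin n × Fin n), |christoffel G φ a.1 a.2.1 a.2.2 y| ≤ C :=
    fun hG ↦ exists_bound_of_finite fun a ↦ exists_bound_of_compact hKc (by
      have := (contDiffOn_christoffel hG hU hφ a.1 a.2.1 a.2.2).continuousOn
      rw [hreg] at this
      exact this.mono hball)
  have hfd : ∀ {f : Model n → ℝ}, ContDiffOn ℝ ∞ f φ.target →
      ∃ C, ∀ y ∈ K, ∀ k, |fderiv ℝ f y (stdVec n k)| ≤ C := fun hf ↦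
    exists_bound_of_finite fun k ↦ exists_bound_of_compact hKc
      ((contDiffOn_fderiv_stdVec φ.open_target hf _).mono hball)
  obtain ⟨C₁, h₁⟩ := hchr hgs
  obtain ⟨C₂, h₂⟩ := hchr hg
  obtain ⟨C₃, h₃⟩ := hfd (hxs.inv hxne)
  obtain ⟨C₄, h₄⟩ := hfd (hxs.log hxne)
  set C := max lam (max (max C₁ C₂) (max C₃ C₄)) with hC
  have c1 : C₁ ≤ C := ((le_max_left _ _).trans (le_max_left _ _)).trans (le_max_right _ _)
  have c2 : C₂ ≤ C := ((le_max_right _ _).trans (le_max_left _ _)).trans (le_max_right _ _)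
  have c3 : C₃ ≤ C := ((le_max_left _ _).trans (le_max_right _ _)).trans (le_max_right _ _)
  have c4 : C₄ ≤ C := ((le_max_right _ _).trans (le_max_right _ _)).trans (le_max_right _ _)
  refine ⟨φ, K, H, φ.source ∩ φ ⁻¹' Metric.ball (φ q) ε, C, ⟨hqφ, Metric.mem_ball_self hε⟩,
    ⟨hφ, hs, hball, Metric.isClosed_closedBall, ?_, ?_, hDH,
      φ.isOpen_inter_preimage Metric.isOpen_ball,
      fun p hp _ ↦ ⟨hp.1, Metric.ball_subset_closedBall hp.2⟩, hl.trans_le (le_max_left _ _),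
      fun y hy ↦ (hpin y hy).mono hl (le_max_left _ _),
      fun y hy q k j ↦ (h₁ y hy (q, k, j)).trans c1, fun y hy q k j ↦ (h₂ y hy (q, k, j)).trans c2,
      fun y hy k ↦ (h₃ y hy k).trans c3, fun y hy k ↦ (h₄ y hy k).trans c4, fun χ hχ ↦ hfd ?_⟩⟩
  -- The image of the ball is compact, hence closed in the Hausdorff manifold.
  · have hcl : IsClosed (φ.symm '' K) :=
      (hKc.image_of_continuousOn (φ.continuousOn_symm.mono hball)).isClosed
    have : interiorX x \ {p | p ∈ φ.source ∧ φ p ∈ K} = interiorX x \ φ.symm '' K := by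
      ext p
      refine and_congr_right fun _ ↦ not_congr ⟨fun h ↦ ⟨φ p, h.2, φ.left_inv h.1⟩, ?_⟩
      rintro ⟨y, hy, rfl⟩
      exact ⟨φ.map_target (hball hy), by rw [φ.right_inv (hball hy)]; exact hy⟩
    rw [this]
    exact hU.sdiff hcl
  · rcases hH with h | ⟨h, h0⟩
    · exact Or.inl h
    · exact Or.inr ⟨h, isReflStable_closedBall h0⟩
  · simpa using contDiffOn_comp_symm hχ.contMDiffOn (U := Set.univ) hφ

end Patches

end ScKorn

end


noncomputable section

namespace ScKorn

/-! ### The scattering coordinates (1/x, y/x). -/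

section ScatteringCoordinates

variable {n : ℕ} {o : Fin n} {z : Model n}

/-- The change between the coordinates `(x, y)` and the scattering coordinates `(1/x, y/x)`; it is
an involution. -/
def scMap (o : Fin n) (z : Model n) : Model n := (z o)⁻¹ • (z + (1 - z o) • stdVec n o)

theorem scMap_self (hz : z o ≠ 0) : scMap o z o = (z o)⁻¹ := by
  simp [scMap, stdVec_apply, mul_add]
  ring

theorem scMap_ne {k : Fin n} (hk : k ≠ o) : scMap o z k = (z o)⁻¹ * z k := by
  simp [scMap, stdVec_apply, hk]

theorem scMap_scMap (hz : z o ≠ 0) : scMap o (scMap o z) = z := by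
  have hz' : scMap o z o ≠ 0 := by rw [scMap_self hz]; exact inv_ne_zero hz
  ext k
  by_cases hk : k = o
  · subst hk
    rw [scMap_self hz', scMap_self hz, inv_inv]
  · rw [scMap_ne hk, scMap_ne hk, scMap_self hz, inv_inv, mul_inv_cancel_left₀ hz]

/-- The scattering frame, up to the factor `x`. -/
def scFrame (o : Fin n) (y : Model n) : Model n →L[ℝ] Model n :=
  ContinuousLinearMap.id ℝ _ - (EuclideanSpace.proj (𝕜 := ℝ) o).smulRight (stdVec n o + y)

theorem scFrame_apply (y v : Model n) : scFrame o y v = v - v o • (stdVec n o + y) := by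
  simp [scFrame]

theorem scFrame_apply_self (y v : Model n) : scFrame o y v o = -(v o * y o) := by
  simp [scFrame_apply, stdVec_apply]

theorem scFrame_apply_ne (y v : Model n) {k : Fin n} (hk : k ≠ o) :
    scFrame o y v k = v k - v o * y k := by
  simp [scFrame_apply, stdVec_apply, hk]

theorem contDiff_scFrame_apply (v : Model n) : ContDiff ℝ ∞ fun y ↦ scFrame o y v := by
  simp only [scFrame_apply]
  fun_prop

/-- Expressed at the image point, the derivative is x times a frame that is smooth up to x = 0. So
functions smooth in (x, y) have bounded derivatives in the scattering coordinates. -/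
theorem hasFDerivAt_scMap (hz : z o ≠ 0) :
    HasFDerivAt (scMap o) ((scMap o z o) • scFrame o (scMap o z)) z := by
  have hp : HasFDerivAt (fun z : Model n ↦ z o) (EuclideanSpace.proj (𝕜 := ℝ) o : Model n →L[ℝ] ℝ) z :=
    (EuclideanSpace.proj (𝕜 := ℝ) o : Model n →L[ℝ] ℝ).hasFDerivAt
  have hi : HasFDerivAt (fun z : Model n ↦ (z o)⁻¹) _ z := (hasDerivAt_inv hz).comp_hasFDerivAt z hp
  have h1 : HasFDerivAt (scMap o) _ z :=
    hi.smul ((hasFDerivAt_id z).add (((hasFDerivAt_const (1 : ℝ) z).sub hp).smul_const (stdVec n o)))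
  refine h1.congr_fderiv ?_
  ext v k
  by_cases hk : k = o
  · subst hk
    simp [scFrame_apply, stdVec_apply, scMap_self hz]
    field_simp
    ring
  · simp [scFrame_apply, stdVec_apply, scMap_self hz, scMap_ne hk, hk]
    field_simp
    ring

theorem contDiffOn_scMap : ContDiffOn ℝ ∞ (scMap o) {z : Model n | z o ≠ 0} := by
  have hp : ContDiff ℝ ∞ fun z : Model n ↦ z o := (EuclideanSpace.proj (𝕜 := ℝ) o).contDiff
  exact (hp.contDiffOn.inv fun z hz ↦ hz).smul
    (contDiff_id.add ((contDiff_const.sub hp).smul contDiff_const)).contDiffOn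

/-- The second derivative is x times a combination of first derivatives. The inhomogeneous term of
the transformation law thus stays bounded after the derivative of the coordinate change is inverted.
-/
theorem fderiv_fderiv_scMap (hz : z o ≠ 0) (u v : Model n) :
    fderiv ℝ (fderiv ℝ (scMap o)) z u v =
      -((scMap o z o) • (u o • fderiv ℝ (scMap o) z v + v o • fderiv ℝ (scMap o) z u)) := by
  have hne : IsOpen {z : Model n | z o ≠ 0} :=
    isOpen_ne_fun (EuclideanSpace.proj (𝕜 := ℝ) o).continuous continuous_const
  have hd : DifferentiableAt ℝ (fderiv ℝ (scMap o)) z :=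
    ((contDiffOn_scMap.fderiv_of_isOpen hne (m := ∞) (by simp)).contDiffAt
      (hne.mem_nhds hz)).differentiableAt (by simp)
  have h0 : fderiv ℝ (fun z ↦ fderiv ℝ (scMap o) z v) z u = fderiv ℝ (fderiv ℝ (scMap o)) z u v := by
    have : HasFDerivAt (fun z ↦ fderiv ℝ (scMap o) z v) _ z :=
      hd.hasFDerivAt.clm_apply (hasFDerivAt_const v z)
    rw [this.fderiv]
    simp
  have hev : (fun z ↦ fderiv ℝ (scMap o) z v) =ᶠ[𝓝 z]
      fun z ↦ scMap o z o • (v - v o • (stdVec n o + scMap o z)) := by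
    filter_upwards [hne.mem_nhds hz] with y hy
    rw [(hasFDerivAt_scMap hy).fderiv]
    simp [scFrame_apply]
  have hQ := hasFDerivAt_scMap hz
  have hQo : HasFDerivAt (fun z ↦ scMap o z o) _ z :=
    (EuclideanSpace.proj (𝕜 := ℝ) o : Model n →L[ℝ] ℝ).hasFDerivAt.comp z hQ
  have h1 : HasFDerivAt (fun z ↦ scMap o z o • (v - v o • (stdVec n o + scMap o z))) _ z :=
    hQo.smul ((hasFDerivAt_const v z).sub (((hasFDerivAt_const (stdVec n o) z).add hQ).const_smul
      (v o)))
  rw [← h0, hev.fderiv_eq, h1.fderiv, hQ.fderiv]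
  ext k
  simp [scFrame_apply, stdVec_apply]
  split_ifs with hk
  · subst hk; ring
  · ring

/-- `scMap` as a diffeomorphism of the half space. -/
def scHomeo (o : Fin n) : OpenPartialHomeomorph (Model n) (Model n) where
  toFun := scMap o
  invFun := scMap o
  source := halfSpace o
  target := halfSpace o
  map_source' z hz := by
    have h : 0 < z o := hz
    change 0 < scMap o z o
    rw [scMap_self h.ne']
    exact inv_pos.2 h
  map_target' z hz := by
    have h : 0 < z o := hz
    change 0 < scMap o z o
    rw [scMap_self h.ne']
    exact inv_pos.2 h
  left_inv' z hz := scMap_scMap (show 0 < z o from hz).ne'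
  right_inv' z hz := scMap_scMap (show 0 < z o from hz).ne'
  open_source := isOpen_halfSpace o
  open_target := isOpen_halfSpace o
  continuousOn_toFun := contDiffOn_scMap.continuousOn.mono fun z hz ↦ (show 0 < z o from hz).ne'
  continuousOn_invFun := contDiffOn_scMap.continuousOn.mono fun z hz ↦ (show 0 < z o from hz).ne'

theorem contDiffOn_scHomeo : ContDiffOn ℝ ∞ (scHomeo o) (scHomeo o).source :=
  contDiffOn_scMap.mono fun z hz ↦ (show 0 < z o from hz).ne'

/-- Scaling of a coordinate other than x commutes with the projective change of coordinates, so
stability under reflection carries over to the scattering coordinates. -/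
theorem scMap_scaleAt {i : Fin n} (hi : i ≠ o) (t : ℝ) (z : Model n) :
    scMap o (scaleAt i t z) = scaleAt i t (scMap o z) := by
  ext k
  by_cases hk : k = o
  · subst hk
    simp [scMap, scaleAt_apply, stdVec_apply, hi.symm]
  · by_cases hki : k = i
    · subst hki
      simp [scMap, scaleAt_apply, stdVec_apply, hi.symm, hk]
    · simp [scMap, scaleAt_apply, stdVec_apply, hi.symm, hk, hki]

end ScatteringCoordinates

/-! ### Christoffel symbols of a metric with bounded first derivatives. -/

section ChristoffelBound

variable {n : ℕ} {M : Type*} [TopologicalSpace M] [ChartedSpace (Model n) M]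
  [IsManifold (𝓡 n) ∞ M] {G : BilinField n M} {U : Set M}
  {φ : OpenPartialHomeomorph M (Model n)}

/-- An orthonormal frame bounds the inverse Gram matrix by n · lam; each Christoffel symbol is a sum
of n products of its entries with three derivatives. -/
theorem abs_christoffel_le (hG : MetricOn G U) (hφ : φ ∈ IsManifold.maximalAtlas (𝓡 n) ∞ M)
    {y : Model n} (hy : y ∈ φ.target ∩ φ.symm ⁻¹' U) {lam C : ℝ} (hl : 0 < lam)
    (hQ : Pinched lam (pullBilin G φ y))
    (hC : ∀ a b c, |fderiv ℝ (fun z ↦ chartGram G φ z a b) y (stdVec n c)| ≤ C) (q k j : Fin n) :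
    |christoffel G φ q k j y| ≤ n * (n * lam * (3 * C)) := by
  obtain ⟨b, hb⟩ := exists_orthoFrame (pullBilin_symm hG y)
    fun v hv ↦ pullBilin_pos hG hφ hy hv
  have hinv : ∀ s, |(chartGram G φ y)⁻¹ q s| ≤ n * lam := by
    intro s
    have h1 : (chartGram G φ y)⁻¹ q s = ∑ k, b k q * b k s := hb.matrix_inv q s
    rw [h1]
    refine (Finset.abs_sum_le_sum_abs _ _).trans ?_
    calc ∑ k, |b k q * b k s| ≤ ∑ _k : Fin n, lam := Finset.sum_le_sum fun k _ ↦ by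
          have h2 := hb.coord_sq_le hQ hl k q
          have h3 := hb.coord_sq_le hQ hl k s
          rw [abs_le]
          constructor <;> nlinarith [sq_nonneg (b k q - b k s), sq_nonneg (b k q + b k s)]
      _ = n * lam := by simp
  have hC0 : 0 ≤ C := (abs_nonneg _).trans (hC q q q)
  rw [christoffel, abs_mul]
  have h4 : |∑ s, (chartGram G φ y)⁻¹ q s *
    (fderiv ℝ (fun z ↦ chartGram G φ z s j) y (stdVec n k)
      + fderiv ℝ (fun z ↦ chartGram G φ z s k) y (stdVec n j)
      - fderiv ℝ (fun z ↦ chartGram G φ z k j) y (stdVec n s))| ≤ n * (n * lam * (3 * C)) := by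
    refine (Finset.abs_sum_le_sum_abs _ _).trans ?_
    calc _ ≤ ∑ _s : Fin n, n * lam * (3 * C) := Finset.sum_le_sum fun s _ ↦ by
          rw [abs_mul]
          refine mul_le_mul (hinv s) ?_ (abs_nonneg _) (by positivity)
          have a1 := abs_le.1 (hC s j k)
          have a2 := abs_le.1 (hC s k j)
          have a3 := abs_le.1 (hC k j s)
          rw [abs_le]
          constructor <;> linarith [a1.1, a1.2, a2.1, a2.2, a3.1, a3.2]
      _ = _ := by simp
  have h5 : |(1 / 2 : ℝ)| ≤ 1 := by norm_num [abs_le]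
  calc _ ≤ 1 * (n * (n * lam * (3 * C))) := mul_le_mul h5 h4 (abs_nonneg _) zero_le_one
    _ = _ := one_mul _

end ChristoffelBound

end ScKorn

end


noncomputable section

namespace ScKorn

/-! ### The two metrics in scattering coordinates. -/

section ScatteringPatch

variable {n : ℕ} {M : Type*} [TopologicalSpace M] [ChartedSpace (Model n) M]
  [IsManifold (𝓡 n) ∞ M] {x : M → ℝ} {h g : BilinField n M} {D : Set M} {q : M}
  {φ : OpenPartialHomeomorph M (Model n)} {o : Fin n}

/-- The chart `φ`, followed by the change to scattering coordinates. -/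
def scChart (φ : OpenPartialHomeomorph M (Model n)) (o : Fin n) :
    OpenPartialHomeomorph M (Model n) := φ.trans (scHomeo o)

theorem scChart_symm_apply (z : Model n) : (scChart φ o).symm z = φ.symm (scMap o z) := rfl

theorem scChart_apply (p : M) : scChart φ o p = scMap o (φ p) := rfl

theorem mem_scChart_source {p : M} : p ∈ (scChart φ o).source ↔ p ∈ φ.source ∧ 0 < φ p o := by
  simp [scChart, OpenPartialHomeomorph.trans_source, scHomeo, halfSpace]

theorem mem_scChart_target {z : Model n} :
    z ∈ (scChart φ o).target ↔ 0 < z o ∧ scMap o z ∈ φ.target := by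
  simp [scChart, OpenPartialHomeomorph.trans_target, scHomeo, halfSpace]

theorem scChart_mem (hφ : φ ∈ IsManifold.maximalAtlas (𝓡 n) ∞ M) :
    scChart φ o ∈ IsManifold.maximalAtlas (𝓡 n) ∞ M :=
  trans_mem_maximalAtlas hφ contDiffOn_scHomeo contDiffOn_scHomeo

theorem mem_transition_scChart {z : Model n} (hz : z ∈ (scChart φ o).target) :
    z ∈ (transition φ (scChart φ o)).source := by
  rw [transition_source]
  exact ⟨hz, (mem_scChart_source.1 ((scChart φ o).map_target hz)).1⟩

theorem transition_scChart {z : Model n} (hz : z ∈ (scChart φ o).target) :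
    transition φ (scChart φ o) z = scMap o z :=
  φ.right_inv (mem_scChart_target.1 hz).2

theorem transition_scChart_eventuallyEq {z : Model n} (hz : z ∈ (scChart φ o).target) :
    transition φ (scChart φ o) =ᶠ[𝓝 z] scMap o := by
  filter_upwards [(scChart φ o).open_target.mem_nhds hz] with y hy using transition_scChart hy

theorem pullBilin_scChart (hφ : φ ∈ IsManifold.maximalAtlas (𝓡 n) ∞ M) (G : BilinField n M)
    {z : Model n} (hz : z ∈ (scChart φ o).target) (v w : Model n) :
    pullBilin G (scChart φ o) z v w = (scMap o z o) ^ 2 * pullBilin G φ (scMap o z)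
      (scFrame o (scMap o z) v) (scFrame o (scMap o z) w) := by
  have hz0 := (mem_scChart_target.1 hz).1.ne'
  rw [pullBilin_eq hφ (scChart_mem hφ) (mem_transition_scChart hz), transition_scChart hz,
    (transition_scChart_eventuallyEq hz).fderiv_eq, (hasFDerivAt_scMap hz0).fderiv]
  simp
  ring

/-- The scattering metric in the scattering frame. -/
def scGram (o : Fin n) (B : Model n → Model n →L[ℝ] Model n →L[ℝ] ℝ) (y : Model n) :
    Model n →L[ℝ] Model n →L[ℝ] ℝ :=
  (EuclideanSpace.proj (𝕜 := ℝ) o : Model n →L[ℝ] ℝ).smulRight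
    (EuclideanSpace.proj (𝕜 := ℝ) o : Model n →L[ℝ] ℝ) +
    (B y).bilinearComp (scFrame o y) (scFrame o y)

theorem scGram_apply (B : Model n → Model n →L[ℝ] Model n →L[ℝ] ℝ) (y v w : Model n) :
    scGram o B y v w = v o * w o + B y (scFrame o y v) (scFrame o y w) := by
  simp [scGram]

theorem contDiffOn_scGram {B : Model n → Model n →L[ℝ] Model n →L[ℝ] ℝ} {R : Set (Model n)}
    (hB : ContDiffOn ℝ ∞ B R) : ContDiffOn ℝ ∞ (scGram o B) R := by
  refine contDiffOn_pullBilin_of_apply fun v w ↦ ?_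
  simp only [scGram_apply]
  exact contDiffOn_const.add ((hB.clm_apply (contDiff_scFrame_apply v).contDiffOn).clm_apply
    (contDiff_scFrame_apply w).contDiffOn)

/-- The differential dx applied to x times the frame vector of v is -x² v_o, so x⁻⁴ dx² becomes v_o
w_o, and the factor x² from the frame cancels x⁻² in front of h. No negative power of x remains. -/
theorem pullBilin_gsc_scChart (hx : IsBoundaryDefining n x)
    (hφ : φ ∈ IsManifold.maximalAtlas (𝓡 n) ∞ M) (hxo : ∀ p ∈ φ.source, φ p o = x p)
    {z : Model n} (hz : z ∈ (scChart φ o).target) (v w : Model n) :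
    pullBilin (gsc x h) (scChart φ o) z v w = scGram o (pullBilin h φ) (scMap o z) v w := by
  obtain ⟨hz0, hzt⟩ := mem_scChart_target.1 hz
  set y := scMap o z with hy
  have hxy : ∀ y ∈ φ.target, x (φ.symm y) = y o := fun y hy ↦ by
    rw [← hxo _ (φ.map_target hy), φ.right_inv hy]
  have hd : ∀ v, fderiv ℝ (fun y ↦ x (φ.symm y)) y v = v o := fun v ↦ by
    have hev : (fun y ↦ x (φ.symm y)) =ᶠ[𝓝 y] fun y ↦ y o := by
      filter_upwards [φ.open_target.mem_nhds hzt] with y hy using hxy y hy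
    rw [hev.fderiv_eq]
    exact DFunLike.congr_fun
      (EuclideanSpace.proj (𝕜 := ℝ) o : Model n →L[ℝ] ℝ).hasFDerivAt.fderiv v
  have hy0 : y o ≠ 0 := by rw [hy, scMap_self hz0.ne']; exact inv_ne_zero hz0.ne'
  rw [pullBilin_scChart hφ _ hz, ← hy, pullBilin_gsc hx hφ hzt, hxy y hzt, hd, hd, scGram_apply,
    scFrame_apply_self, scFrame_apply_self]
  field_simp

/-- At x = 0 the frame takes values in ker dx, where h is positive, and it is the identity on
vectors with v_o = 0; the square of v_o handles the others. For x > 0 this is the positivity of the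
scattering metric. -/
theorem scGram_pos (hx : IsBoundaryDefining n x) (hh : IsScatteringMetric x h)
    (hφ : φ ∈ IsManifold.maximalAtlas (𝓡 n) ∞ M) (hxo : ∀ p ∈ φ.source, φ p o = x p)
    {y : Model n} (hy : y ∈ φ.target) (hy0 : 0 ≤ y o) {v : Model n} (hv : v ≠ 0) :
    0 < scGram o (pullBilin h φ) y v v := by
  rcases hy0.eq_or_lt with h0 | h0
  · have hxp : x (φ.symm y) = 0 := by
      rw [← hxo _ (φ.map_target hy), φ.right_inv hy, h0]
    have hpos : ∀ w : Model n, w o = 0 → w ≠ 0 → 0 < pullBilin h φ y w w := by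
      intro w hw hw0
      refine hh.pos_boundary _ hxp (chartD φ y w) (fun hc ↦ hw0 ?_) ?_
      · exact chartD_injective hφ hy (hc.trans (map_zero (chartD φ y)).symm)
      · rw [dAt_chartD hφ hy (hx.smooth.mdifferentiableAt (by simp))]
        have hev : (fun y ↦ x (φ.symm y)) =ᶠ[𝓝 y] fun y ↦ y o := by
          filter_upwards [φ.open_target.mem_nhds hy] with y hy
          rw [← hxo _ (φ.map_target hy), φ.right_inv hy]
        rw [hev.fderiv_eq]
        exact (DFunLike.congr_fun
          (EuclideanSpace.proj (𝕜 := ℝ) o : Model n →L[ℝ] ℝ).hasFDerivAt.fderiv w).trans hw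
    have hfo : scFrame o y v o = 0 := by rw [scFrame_apply_self, ← h0, mul_zero, neg_zero]
    rw [scGram_apply]
    by_cases hvo : v o = 0
    · have : scFrame o y v = v := by rw [scFrame_apply, hvo, zero_smul, sub_zero]
      rw [hvo, this, mul_zero, zero_add]
      exact hpos v hvo hv
    · have h1 : 0 < v o * v o := mul_self_pos.2 hvo
      have h2 : 0 ≤ pullBilin h φ y (scFrame o y v) (scFrame o y v) := by
        by_cases hw : scFrame o y v = 0
        · rw [hw]; simp
        · exact (hpos _ hfo hw).le
      exact add_pos_of_pos_of_nonneg h1 h2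
  · have hz : scMap o y ∈ (scChart φ o).target := by
      rw [mem_scChart_target, scMap_scMap h0.ne', scMap_self h0.ne']
      exact ⟨inv_pos.2 h0, hy⟩
    have e := pullBilin_gsc_scChart (h := h) hx hφ hxo hz v v
    rw [scMap_scMap h0.ne'] at e
    rw [← e]
    refine pullBilin_pos (metricOn_gsc hx hh) (scChart_mem hφ) ⟨hz, ?_⟩ hv
    have hs := mem_scChart_source.1 ((scChart φ o).map_target hz)
    rw [hxo _ hs.1] at hs
    exact hs.2

/-- The Christoffel symbols of a smooth metric in scattering coordinates. -/
theorem christoffel_scChart (hg : MetricOn g Set.univ)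
    (hφ : φ ∈ IsManifold.maximalAtlas (𝓡 n) ∞ M) {z : Model n} (hz : z ∈ (scChart φ o).target)
    (l k j : Fin n) : christoffel g (scChart φ o) l k j z =
      (if l = o then -(chMap g φ (scMap o z) (scFrame o (scMap o z) (stdVec n k))
          (scFrame o (scMap o z) (stdVec n j)) o)
        else scMap o z o * (chMap g φ (scMap o z) (scFrame o (scMap o z) (stdVec n k))
          (scFrame o (scMap o z) (stdVec n j)) l) -
          chMap g φ (scMap o z) (scFrame o (scMap o z) (stdVec n k))
          (scFrame o (scMap o z) (stdVec n j)) o * scMap o z l) -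
      scMap o z o * (stdVec n k o * stdVec n j l + stdVec n j o * stdVec n k l) := by
  have hz0 := (mem_scChart_target.1 hz).1
  have law := chMap_transition hg isOpen_univ hφ (scChart_mem hφ) (mem_transition_scChart hz)
    (Set.mem_univ _) (stdVec n k) (stdVec n j)
  have hev := transition_scChart_eventuallyEq hz
  rw [transition_scChart hz, hev.fderiv_eq, (hev.fderiv (𝕜 := ℝ)).fderiv_eq,
    fderiv_fderiv_scMap hz0.ne', (hasFDerivAt_scMap hz0.ne').fderiv] at law
  set y := scMap o z with hy
  set om := chMap g φ y (scFrame o y (stdVec n k)) (scFrame o y (stdVec n j)) with hom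
  set c := chMap g (scChart φ o) z (stdVec n k) (stdVec n j) with hc
  have hy0 : y o ≠ 0 := by rw [hy, scMap_self hz0.ne']; exact inv_ne_zero hz0.ne'
  have hcl : christoffel g (scChart φ o) l k j z = c l := by
    rw [hc, chMap_stdVec]
    simp [stdVec_apply]
  rw [hcl]
  simp only [ContinuousLinearMap.smul_apply, map_smul, LinearMap.smul_apply, ← hom] at law
  -- The transformation law after division by one factor x. It is solved for c below, the component
  -- o first.
  have hcoord : ∀ i, (scFrame o y c) i = y o * om i -
      y o * (stdVec n k o * scFrame o y (stdVec n j) i +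
        stdVec n j o * scFrame o y (stdVec n k) i) := by
    intro i
    have := congrArg (fun v : Model n ↦ v i) law
    simp only [PiLp.smul_apply, PiLp.add_apply, PiLp.neg_apply, smul_eq_mul] at this
    apply mul_left_cancel₀ hy0
    rw [this]
    ring
  have ho := hcoord o
  simp only [scFrame_apply_self] at ho
  -- Here both sides of the law contain a second factor x, because the o-th component of the frame
  -- does; after its cancellation nothing singular is left.
  have hco : c o = -(om o) - y o * (stdVec n k o * stdVec n j o + stdVec n j o * stdVec n k o) := by
    apply mul_left_cancel₀ hy0
    linear_combination -ho
  by_cases hl : l = o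
  · subst hl
    rw [if_pos rfl, hco]
  · have h1 := hcoord l
    simp only [scFrame_apply_ne _ _ hl] at h1
    rw [if_neg hl]
    rw [hco] at h1
    linear_combination h1

end ScatteringPatch

end ScKorn

end


noncomputable section

namespace ScKorn

/-! ### Patches at the boundary at infinity. -/

section BoundaryPatch

variable {n : ℕ} {M : Type*} [TopologicalSpace M] [ChartedSpace (Model n) M]
  [IsManifold (𝓡 n) ∞ M] {x : M → ℝ} {h g : BilinField n M} {D : Set M} {q : M}
  {φ : OpenPartialHomeomorph M (Model n)} {o : Fin n}

/-- Derivatives in scattering coordinates of functions that are smooth up to the boundary. -/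
theorem abs_fderiv_comp_scMap {f : Model n → ℝ} (hf : ContDiffOn ℝ ∞ f φ.target)
    {K' : Set (Model n)} (hK' : IsCompact K') (hKt : K' ⊆ φ.target) :
    ∃ C, ∀ z, z o ≠ 0 → scMap o z ∈ K' → ∀ k,
      |fderiv ℝ (fun z ↦ f (scMap o z)) z (stdVec n k)| ≤ C := by
  -- By the chain rule the derivative along z_k is f' applied to x times a frame vector, which is
  -- continuous on the compact set K', boundary points included.
  have h1 : ∀ k, ∃ C, ∀ y ∈ K', |fderiv ℝ f y (y o • scFrame o y (stdVec n k))| ≤ C := fun k ↦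
    exists_bound_of_compact hK' (((hf.fderiv_of_isOpen φ.open_target (m := ∞)
      (by simp)).continuousOn.mono hKt).clm_apply
        (((EuclideanSpace.proj (𝕜 := ℝ) o).continuous.smul
          (contDiff_scFrame_apply (stdVec n k)).continuous).continuousOn))
  obtain ⟨C, hC⟩ := exists_bound_of_finite h1
  refine ⟨C, fun z hz hzK k ↦ ?_⟩
  have hd : HasFDerivAt f (fderiv ℝ f (scMap o z)) (scMap o z) :=
    ((hf.contDiffAt (φ.open_target.mem_nhds (hKt hzK))).differentiableAt (by simp)).hasFDerivAt
  have h2 : HasFDerivAt (fun z ↦ f (scMap o z)) _ z := hd.comp z (hasFDerivAt_scMap hz)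
  rw [h2.fderiv]
  simpa using hC _ hzK k

/-- Patches at the boundary `{x = 0}`. -/
theorem exists_patch_boundary [T2Space M] (hx : IsBoundaryDefining n x)
    (hh : IsScatteringMetric x h) (hD : IsTransversalDomain n x D)
    (hg : MetricOn g Set.univ) (hq : q ∈ closure D)
    (hxq : x q = 0) {o i₁ : Fin n} (hi : i₁ ≠ o) :
    ∃ φ K H N C, q ∈ N ∧ Patch g (gsc x h) x D φ K H i₁ N C := by
  obtain ⟨φ, hφ, hqφ, H, hH, hDH, hxo, -⟩ := exists_base_chart hx hD hq hxq.ge hi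
  have hxo := hxo hxq
  have hU := isOpen_interiorX hx
  have hgs := metricOn_gsc hx hh
  obtain ⟨ε, hε, hball⟩ := Metric.nhds_basis_closedBall.mem_iff.1
    (φ.open_target.mem_nhds (φ.map_source hqφ))
  have hcproj : Continuous fun y : Model n ↦ y o := (EuclideanSpace.proj (𝕜 := ℝ) o).continuous
  set K' : Set (Model n) := Metric.closedBall (φ q) ε ∩ {y | 0 ≤ y o} with hK'
  have hK'c : IsCompact K' :=
    (isCompact_closedBall _ _).inter_right (isClosed_le continuous_const hcproj)
  have hK't : K' ⊆ φ.target := Set.inter_subset_left.trans hball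
  -- The part x > 0 of a ball around q, in scattering coordinates. The bound ε⁻¹ ≤ z_o is automatic
  -- on the image of that part, since x vanishes at q; stating it keeps K closed and away from the
  -- hyperplane z_o = 0. K itself is unbounded.
  set K : Set (Model n) := {z | ε⁻¹ ≤ z o} ∩ scMap o ⁻¹' Metric.closedBall (φ q) ε with hK
  have hzpos : ∀ z ∈ K, 0 < z o := fun z hz ↦ (inv_pos.2 hε).trans_le hz.1
  have hzK' : ∀ z ∈ K, scMap o z ∈ K' := fun z hz ↦
    ⟨hz.2, by
      change 0 ≤ scMap o z o
      rw [scMap_self (hzpos z hz).ne']; exact inv_nonneg.2 (hzpos z hz).le⟩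
  set φ' := scChart φ o with hφ'd
  have hφ' : φ' ∈ IsManifold.maximalAtlas (𝓡 n) ∞ M := scChart_mem hφ
  have hKt : K ⊆ φ'.target := fun z hz ↦
    mem_scChart_target.2 ⟨hzpos z hz, hK't (hzK' z hz)⟩
  have hs : φ'.source ⊆ interiorX x := fun p hp ↦ by
    obtain ⟨h1, h2⟩ := mem_scChart_source.1 hp
    rw [hxo p h1] at h2
    exact h2
  have hreg : ∀ z ∈ K, z ∈ φ'.target ∩ φ'.symm ⁻¹' interiorX x := fun z hz ↦
    ⟨hKt hz, hs (φ'.map_target (hKt hz))⟩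
  have hqo : φ q o = 0 := by rw [hxo q hqφ, hxq]
  have hsmooth : ContDiffOn ℝ ∞ (scGram o (pullBilin h φ)) φ.target :=
    contDiffOn_scGram (contDiffOn_pullBilin hh.smooth hφ)
  obtain ⟨lam, hl, hpin⟩ := exists_pinched hK'c (hsmooth.continuousOn.mono hK't)
    fun y hy v hv ↦ scGram_pos hx hh hφ hxo (hK't hy) hy.2 hv
  have hpin' : ∀ z ∈ K, Pinched lam (pullBilin (gsc x h) φ' z) := fun z hz v ↦ by
    rw [pullBilin_gsc_scChart hx hφ hxo (hKt hz)]
    exact hpin _ (hzK' z hz) v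
  have hfd : ∀ f : M → ℝ, ContDiffOn ℝ ∞ (fun y ↦ f (φ.symm y)) φ.target →
      ∃ C, ∀ z ∈ K, ∀ k, |fderiv ℝ (fun z ↦ f (φ'.symm z)) z (stdVec n k)| ≤ C := fun f hf ↦ by
    obtain ⟨C, hC⟩ := abs_fderiv_comp_scMap (o := o) hf hK'c hK't
    exact ⟨C, fun z hz k ↦ hC z (hzpos z hz).ne' (hzK' z hz) k⟩
  -- the Christoffel symbols of the scattering metric
  have hgram : ∃ C, ∀ z ∈ K, ∀ a : Fin n × Fin n × Fin n,
      |fderiv ℝ (fun z ↦ chartGram (gsc x h) φ' z a.1 a.2.1) z (stdVec n a.2.2)| ≤ C := by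
    refine exists_bound_of_finite fun a ↦ ?_
    obtain ⟨C, hC⟩ := abs_fderiv_comp_scMap (o := o)
      (f := fun y ↦ scGram o (pullBilin h φ) y (stdVec n a.1) (stdVec n a.2.1))
      ((hsmooth.clm_apply contDiffOn_const).clm_apply contDiffOn_const) hK'c hK't
    refine ⟨C, fun z hz ↦ ?_⟩
    have hev : (fun z ↦ chartGram (gsc x h) φ' z a.1 a.2.1) =ᶠ[𝓝 z]
        fun z ↦ scGram o (pullBilin h φ) (scMap o z) (stdVec n a.1) (stdVec n a.2.1) := by
      filter_upwards [φ'.open_target.mem_nhds (hKt hz)] with z hz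
      exact pullBilin_gsc_scChart hx hφ hxo hz _ _
    rw [hev.fderiv_eq]
    exact hC z (hzpos z hz).ne' (hzK' z hz) _
  obtain ⟨C₀, h₀⟩ := hgram
  have h₁ : ∀ z ∈ K, ∀ l k j, |christoffel (gsc x h) φ' l k j z| ≤ n * (n * lam * (3 * C₀)) :=
    fun z hz l k j ↦ abs_christoffel_le hgs hφ' (hreg z hz) hl (hpin' z hz)
      (fun a b c ↦ h₀ z hz (a, b, c)) l k j
  -- the Christoffel symbols of the smooth metric
  have hchr : ∃ C, ∀ y ∈ K', ∀ a : Fin n × Fin n × Fin n,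
      |(if a.1 = o then -(chMap g φ y (scFrame o y (stdVec n a.2.1))
          (scFrame o y (stdVec n a.2.2)) o)
        else y o * (chMap g φ y (scFrame o y (stdVec n a.2.1))
          (scFrame o y (stdVec n a.2.2)) a.1) -
          chMap g φ y (scFrame o y (stdVec n a.2.1))
          (scFrame o y (stdVec n a.2.2)) o * y a.1) -
      y o * (stdVec n a.2.1 o * stdVec n a.2.2 a.1 + stdVec n a.2.2 o * stdVec n a.2.1 a.1)| ≤ C := by
    refine exists_bound_of_finite fun a ↦ exists_bound_of_compact hK'c ?_
    have hc : ∀ l, ContinuousOn (fun y ↦ chMap g φ y (scFrame o y (stdVec n a.2.1))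
        (scFrame o y (stdVec n a.2.2)) l) K' := fun l ↦ by
      have e : (fun y ↦ chMap g φ y (scFrame o y (stdVec n a.2.1))
        (scFrame o y (stdVec n a.2.2)) l) = fun y ↦ ∑ k, ∑ j, scFrame o y (stdVec n a.2.1) k *
          scFrame o y (stdVec n a.2.2) j * christoffel g φ l k j y := by
        funext y
        simp [chMap, stdVec_apply]
      rw [e]
      have hfr : ∀ v k, ContinuousOn (fun y ↦ scFrame o y v k) K' := fun v k ↦
        ((EuclideanSpace.proj (𝕜 := ℝ) k).continuous.comp
          (contDiff_scFrame_apply (o := o) v).continuous).continuousOn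
      refine continuousOn_finset_sum _ fun k _ ↦ continuousOn_finset_sum _ fun j _ ↦
        ((hfr _ _).mul (hfr _ _)).mul ?_
      have := (contDiffOn_christoffel hg isOpen_univ hφ l k j).continuousOn
      exact this.mono fun y hy ↦ ⟨hK't hy, trivial⟩
    have hp : ∀ l : Fin n, ContinuousOn (fun y : Model n ↦ y l) K' := fun l ↦
      (EuclideanSpace.proj (𝕜 := ℝ) l).continuous.continuousOn
    split_ifs
    · exact (hc o).neg.sub ((hp o).mul continuousOn_const)
    · exact (((hp o).mul (hc _)).sub ((hc o).mul (hp _))).sub ((hp o).mul continuousOn_const)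
  obtain ⟨C₂, h₂⟩ := hchr
  have hxz : ∀ z ∈ φ'.target, x (φ'.symm z) = (z o)⁻¹ := fun z hz ↦ by
    obtain ⟨h1, h2⟩ := mem_scChart_target.1 hz
    rw [hφ'd, scChart_symm_apply, ← hxo _ (φ.map_target h2), φ.right_inv h2, scMap_self h1.ne']
  have hpd : ∀ z : Model n, HasFDerivAt (fun z : Model n ↦ z o)
      (EuclideanSpace.proj (𝕜 := ℝ) o : Model n →L[ℝ] ℝ) z := fun z ↦
    (EuclideanSpace.proj (𝕜 := ℝ) o : Model n →L[ℝ] ℝ).hasFDerivAt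
  have hstd : ∀ k, |stdVec n k o| ≤ 1 := fun k ↦ by
    rw [stdVec_apply]; split_ifs <;> simp
  -- The function 1/x is the coordinate z_o, so conjugation by e^{F/x} costs only a bounded term.
  have h₃ : ∀ z ∈ K, ∀ k, |fderiv ℝ (fun z ↦ (x (φ'.symm z))⁻¹) z (stdVec n k)| ≤ 1 := by
    intro z hz k
    have hev : (fun z ↦ (x (φ'.symm z))⁻¹) =ᶠ[𝓝 z] fun z ↦ z o := by
      filter_upwards [φ'.open_target.mem_nhds (hKt hz)] with z hz
      rw [hxz z hz, inv_inv]
    rw [hev.fderiv_eq, (hpd z).fderiv]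
    exact hstd k
  have h₄ : ∀ z ∈ K, ∀ k, |fderiv ℝ (fun z ↦ Real.log (x (φ'.symm z))) z (stdVec n k)| ≤ ε := by
    intro z hz k
    have hev : (fun z ↦ Real.log (x (φ'.symm z))) =ᶠ[𝓝 z] fun z ↦ -Real.log (z o) := by
      filter_upwards [φ'.open_target.mem_nhds (hKt hz)] with z hz
      rw [hxz z hz, Real.log_inv]
    have hdl : HasFDerivAt (fun z : Model n ↦ -Real.log (z o)) _ z :=
      ((hpd z).log (hzpos z hz).ne').neg
    rw [hev.fderiv_eq, hdl.fderiv]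
    simp only [ContinuousLinearMap.neg_apply, ContinuousLinearMap.smul_apply, smul_eq_mul, abs_neg,
      abs_mul]
    have h5 : |(z o)⁻¹| ≤ ε := by
      rw [abs_of_pos (inv_pos.2 (hzpos z hz))]
      exact inv_le_of_inv_le₀ hε hz.1
    calc _ ≤ ε * 1 := mul_le_mul h5 (hstd k) (abs_nonneg _) hε.le
      _ = ε := mul_one ε
  set C := max lam (max (max (n * (n * lam * (3 * C₀))) C₂) (max 1 ε)) with hC
  have c1 : n * (n * lam * (3 * C₀)) ≤ C :=
    ((le_max_left _ _).trans (le_max_left _ _)).trans (le_max_right _ _)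
  have c2 : C₂ ≤ C := ((le_max_right _ _).trans (le_max_left _ _)).trans (le_max_right _ _)
  have c3 : 1 ≤ C := ((le_max_left _ _).trans (le_max_right _ _)).trans (le_max_right _ _)
  have c4 : ε ≤ C := ((le_max_right _ _).trans (le_max_right _ _)).trans (le_max_right _ _)
  -- The redundancy of the bound on z_o: x is the difference of the o-th coordinates of p and q,
  -- hence at most ε in the ball.
  have hmemK : ∀ p ∈ φ.source, 0 < φ p o → (φ' p ∈ K ↔ φ p ∈ Metric.closedBall (φ q) ε) := by
    intro p hp hpo
    have e : scMap o (φ' p) = φ p := by rw [hφ'd, scChart_apply, scMap_scMap hpo.ne']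
    have e2 : φ' p o = (φ p o)⁻¹ := by rw [hφ'd, scChart_apply, scMap_self hpo.ne']
    rw [hK, Set.mem_inter_iff, Set.mem_preimage, e, and_iff_right_iff_imp]
    intro hb
    change ε⁻¹ ≤ φ' p o
    rw [e2]
    refine inv_anti₀ hpo ?_
    rw [mem_closedBall_iff_norm] at hb
    have h6 := (EuclideanSpace.norm_eq (φ p - φ q)).symm ▸ hb
    have h7 : ‖(φ p - φ q) o‖ ≤ ‖φ p - φ q‖ := PiLp.norm_apply_le _ _
    rw [PiLp.sub_apply, hqo, sub_zero, Real.norm_eq_abs, abs_of_pos hpo] at h7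
    exact h7.trans hb
  refine ⟨φ', K, H, φ.source ∩ φ ⁻¹' Metric.ball (φ q) ε, C, ⟨hqφ, Metric.mem_ball_self hε⟩,
    ⟨hφ', hs, hKt, ?_, ?_, ?_, ?_,
      φ.isOpen_inter_preimage Metric.isOpen_ball, ?_, hl.trans_le (le_max_left _ _),
      fun z hz ↦ (hpin' z hz).mono hl (le_max_left _ _),
      fun z hz l k j ↦ (h₁ z hz l k j).trans c1, fun z hz l k j ↦ ?_,
      fun z hz k ↦ (h₃ z hz k).trans c3, fun z hz k ↦ (h₄ z hz k).trans c4, fun χ hχ ↦ hfd χ ?_⟩⟩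
  · refine ContinuousOn.preimage_isClosed_of_isClosed (contDiffOn_scMap.continuousOn.mono ?_)
      (isClosed_le continuous_const hcproj) Metric.isClosed_closedBall
    exact fun z hz ↦ ((inv_pos.2 hε).trans_le hz).ne'
  · have hcl : IsClosed (φ.symm '' Metric.closedBall (φ q) ε) :=
      ((isCompact_closedBall _ _).image_of_continuousOn (φ.continuousOn_symm.mono hball)).isClosed
    have : interiorX x \ {p | p ∈ φ'.source ∧ φ' p ∈ K} =
        interiorX x \ φ.symm '' Metric.closedBall (φ q) ε := by
      ext p
      refine and_congr_right fun hp ↦ not_congr ⟨fun hpK ↦ ?_, ?_⟩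
      · obtain ⟨h1, h2⟩ := mem_scChart_source.1 hpK.1
        exact ⟨φ p, (hmemK p h1 h2).1 hpK.2, φ.left_inv h1⟩
      · rintro ⟨y, hy, rfl⟩
        have h1 := φ.map_target (hball hy)
        have h2 : 0 < φ (φ.symm y) o := by rw [hxo _ h1]; exact hp
        exact ⟨mem_scChart_source.2 ⟨h1, h2⟩,
          (hmemK _ h1 h2).2 (by rw [φ.right_inv (hball hy)]; exact hy)⟩
    rw [this]
    exact hU.sdiff hcl
  · rcases hH with h | ⟨h, h0⟩
    · exact Or.inl h
    · refine Or.inr ⟨h, fun t ht z hz ↦ ?_⟩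
      obtain ⟨hz1, hz2⟩ := hz
      have e : (scaleAt i₁ (-t) z) o = z o := by rw [scaleAt_apply, if_neg hi.symm]
      rw [Set.mem_preimage, scMap_scaleAt hi] at hz2
      exact ⟨by
        change ε⁻¹ ≤ z o
        rw [← e]; exact hz1, isReflStable_closedBall h0 t ht _ hz2⟩
  · intro z hz
    obtain ⟨h1, h2⟩ := mem_scChart_target.1 hz
    rw [hφ'd, scChart_symm_apply, hDH _ h2]
    rcases hH with h | ⟨h, -⟩
    · simp [h]
    · rw [h]
      -- The coordinate is multiplied by x > 0, so the half space is unchanged.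
      change 0 < scMap o z i₁ ↔ 0 < z i₁
      rw [scMap_ne hi]
      exact mul_pos_iff_of_pos_left (inv_pos.2 h1)
  · intro p hp hxp
    have h1 : 0 < φ p o := by rw [hxo p hp.1]; exact hxp
    exact ⟨mem_scChart_source.2 ⟨hp.1, h1⟩,
      (hmemK p hp.1 h1).2 (Metric.ball_subset_closedBall hp.2)⟩
  · rw [hφ'd, christoffel_scChart hg hφ (hKt hz)]
    exact (h₂ _ (hzK' z hz) (l, k, j)).trans c2
  · simpa using contDiffOn_comp_symm hχ.contMDiffOn (U := Set.univ) hφ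

/-- Patches around the points of the closure of the domain. -/
theorem exists_patch [T2Space M] (hx : IsBoundaryDefining n x) (hh : IsScatteringMetric x h)
    (hD : IsTransversalDomain n x D) (hg : MetricOn g Set.univ) (hq : q ∈ closure D)
    (hxq : 0 ≤ x q) {o i₁ : Fin n} (hi : i₁ ≠ o) :
    ∃ φ K H N C, q ∈ N ∧ Patch g (gsc x h) x D φ K H i₁ N C := by
  rcases hxq.eq_or_lt with h0 | h0
  · exact exists_patch_boundary hx hh hD hg hq h0.symm hi
  · exact exists_patch_interior hx hD ⟨hg.symm, fun p _ ↦ hg.pos p trivial, fun φ hφ ↦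
      (hg.smooth φ hφ).mono fun y hy ↦ ⟨hy.1, trivial⟩⟩ (metricOn_gsc hx hh) hq h0 hi

end BoundaryPatch

end ScKorn

end


noncomputable section

namespace ScKorn

/-! ### Square norms of functions with pointwise bounds. -/

section SqNorm

variable {n : ℕ} {𝕜 : Type*} [RCLike 𝕜] {S T : Set (Model n)}

theorem sqNorm_inter_eq {g : Model n → 𝕜} (hT : MeasurableSet T) (h : ∀ y ∉ T, g y = 0) :
    sqNorm (S ∩ T) g = sqNorm S g := by
  unfold sqNorm
  rw [Set.inter_comm, ← Measure.restrict_restrict hT, ← lintegral_indicator hT]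
  congr 1
  funext y
  by_cases hy : y ∈ T <;> simp [hy, h]

/-- A bound for the square of the norm of a function by those of the terms of a bound for it. -/
theorem sqNorm_le_of_norm_le {ι : Type*} [Fintype ι] {g a : Model n → 𝕜} {t : ι → Model n → 𝕜}
    {A : ℝ} (hA : 0 ≤ A) (ht : ∀ j, AEStronglyMeasurable (t j) (volume.restrict S))
    (h : ∀ᵐ y ∂(volume.restrict S), ‖g y‖ ≤ ‖a y‖ + A * ∑ j, ‖t j y‖) :
    sqNorm S g ≤ 2 * sqNorm S a +
      ENNReal.ofReal (2 * A ^ 2 * Fintype.card ι) * ∑ j, sqNorm S (t j) := by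
  have hm : ∀ j ∈ Finset.univ, AEMeasurable (fun y ↦ ‖t j y‖ₑ ^ 2) (volume.restrict S) :=
    fun j _ ↦ (ht j).enorm.pow_const 2
  unfold sqNorm
  rw [← lintegral_finsetSum' _ hm, ← lintegral_const_mul' _ _ ENNReal.ofReal_ne_top,
    ← lintegral_const_mul' 2 _ (by simp), ← lintegral_add_right']
  · refine lintegral_mono_ae ?_
    filter_upwards [h] with y hy
    rw [← ofReal_sum_norm_sq, ← ofReal_norm, ← ofReal_norm, ← ENNReal.ofReal_pow (norm_nonneg _),
      ← ENNReal.ofReal_pow (norm_nonneg _), ← ENNReal.ofReal_mul (by positivity),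
      show (2 : ℝ≥0∞) = ENNReal.ofReal 2 by simp, ← ENNReal.ofReal_mul (by positivity),
      ← ENNReal.ofReal_add (by positivity) (by positivity)]
    refine ENNReal.ofReal_le_ofReal ((pow_le_pow_left₀ (norm_nonneg _) hy 2).trans ?_)
    have h1 : (∑ j, ‖t j y‖) ^ 2 ≤ Fintype.card ι * ∑ j, ‖t j y‖ ^ 2 := by
      simpa using sq_sum_le_card_mul_sum_sq (s := Finset.univ) (f := fun j ↦ ‖t j y‖)
    nlinarith [mul_le_mul_of_nonneg_left h1 (sq_nonneg A),
      sq_nonneg (‖a y‖ - A * ∑ j, ‖t j y‖)]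
  · exact (Finset.aemeasurable_fun_sum _ hm).const_mul _

theorem sum_sqNorm_le_of_norm_le {ι κ : Type*} [Fintype ι] [Fintype κ] {g a : κ → Model n → 𝕜}
    {t : ι → Model n → 𝕜} {A : ℝ} (hA : 0 ≤ A)
    (ht : ∀ j, AEStronglyMeasurable (t j) (volume.restrict S))
    (h : ∀ l, ∀ᵐ y ∂(volume.restrict S), ‖g l y‖ ≤ ‖a l y‖ + A * ∑ j, ‖t j y‖) :
    ∑ l, sqNorm S (g l) ≤ 2 * ∑ l, sqNorm S (a l) + (Fintype.card κ : ℝ≥0∞) *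
      (ENNReal.ofReal (2 * A ^ 2 * Fintype.card ι) * ∑ j, sqNorm S (t j)) := by
  refine (Finset.sum_le_sum fun l _ ↦ sqNorm_le_of_norm_le hA ht (h l)).trans ?_
  rw [Finset.sum_add_distrib, Finset.sum_const, nsmul_eq_mul, ← Finset.mul_sum]
  rfl

/-- Take a measurable representative and set it to ⊤ on a measurable null set that contains the
exceptional points. -/
theorem exists_measurable_majorant {X : Type*} [MeasurableSpace X] {μ : Measure X}
    {h : X → ℝ≥0∞} (hh : AEMeasurable h μ) :
    ∃ h', Measurable h' ∧ (∀ y, h y ≤ h' y) ∧ h' =ᵐ[μ] h := by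
  classical
  set Z := toMeasurable μ {y | ¬ h y = hh.mk h y} with hZ
  have hZ0 : μ Z = 0 := by rw [hZ, measure_toMeasurable]; exact hh.ae_eq_mk
  have hZm : MeasurableSet Z := measurableSet_toMeasurable _ _
  refine ⟨Z.piecewise (fun _ ↦ ⊤) (hh.mk h), measurable_const.piecewise hZm hh.measurable_mk,
    fun y ↦ ?_, ?_⟩
  · by_cases hy : y ∈ Z
    · simp [hy]
    · rw [Set.piecewise_eq_of_notMem _ _ _ hy]
      by_contra hcon
      exact hy (subset_toMeasurable _ _ fun heq ↦ hcon heq.le)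
  · have : ∀ᵐ y ∂μ, y ∉ Z := measure_eq_zero_iff_ae_notMem.1 hZ0
    filter_upwards [hh.ae_eq_mk, this] with y h1 h2
    rw [Set.piecewise_eq_of_notMem _ _ _ h2, h1]

end SqNorm

/-! ### Norms of tensor fields that are supported in a patch. -/

section Majorant

variable {n : ℕ} {M : Type*} [TopologicalSpace M] [ChartedSpace (Model n) M]
  [MeasurableSpace M] [BorelSpace M] [IsManifold (𝓡 n) ∞ M] {𝕜 : Type*} [RCLike 𝕜] {m : ℕ}
  {g gs : BilinField n M} {x : M → ℝ} {D : Set M} {φ : OpenPartialHomeomorph M (Model n)}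
  {K H : Set (Model n)} {i : Fin n} {N : Set M} {C : ℝ}

theorem tensorNormSq_zero (G : BilinField n M) (p : M) :
    tensorNormSq G p (0 : MultilinearMap ℝ (fun _ : Fin m ↦ TangentSpace (𝓡 n) p) 𝕜) = 0 := by
  refine Finset.sum_eq_zero fun i _ ↦ Finset.sum_eq_zero fun j _ ↦ ?_
  change _ * RCLike.re ((0 : 𝕜) * _) = 0
  simp

/-- A measurable bound for the pointwise norm of a tensor field that is supported in a patch. -/
theorem Patch.exists_majorant (hP : Patch g gs x D φ K H i N C)
    (hx : IsBoundaryDefining n x) (hG : MetricOn gs (interiorX x))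
    {c : (Fin m → Fin n) → Model n → 𝕜} (hc0 : ∀ J, ∀ y ∉ K, c J y = 0)
    (hcm : ∀ J, AEStronglyMeasurable (c J)) :
    ∃ b : M → ℝ≥0∞, Measurable b ∧
      (∀ p, ENNReal.ofReal (tensorNormSq gs p (ofComp φ c p)) ≤ b p) ∧
      ∫⁻ p in interiorX x, b p ∂(riemVolume gs) ≤
        normConst n m C * ∑ J, sqNorm Set.univ (c J) := by
  classical
  have hU := isOpen_interiorX hx
  have hreg : ∀ y ∈ φ.target, y ∈ φ.target ∩ φ.symm ⁻¹' interiorX x := fun y hy ↦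
    ⟨hy, hP.source_subset (φ.map_target hy)⟩
  have hm : AEMeasurable (fun y ↦ ∑ J, ‖c J y‖ₑ ^ 2) (volume : Measure (Model n)) :=
    Finset.aemeasurable_fun_sum _ fun J _ ↦ (hcm J).enorm.pow_const 2
  obtain ⟨b, hb, hle, hae⟩ := exists_measurable_majorant hm
  set k := ENNReal.ofReal (C ^ m * n ^ m * n ^ m) with hk
  -- The chart extended by a constant is measurable on all of M, which makes the majorant a
  -- measurable function there.
  set ψ : M → Model n := φ.source.piecewise φ fun _ ↦ 0 with hψ
  have hψm : Measurable ψ := φ.continuousOn.measurable_piecewise continuousOn_const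
    φ.open_source.measurableSet
  refine ⟨φ.source.indicator fun p ↦ k * b (ψ p),
    ((hb.comp hψm).const_mul k).indicator φ.open_source.measurableSet, fun p ↦ ?_, ?_⟩
  · by_cases hp : p ∈ φ.source
    · rw [Set.indicator_of_mem hp, hψ, Set.piecewise_eq_of_mem _ _ _ hp]
      by_cases hpK : φ p ∈ K
      · have h1 := tensorNormSq_le_comp hG hP.mem (hreg _ (φ.map_source hp)) hP.pos
          (hP.pinched _ hpK) (ofComp φ c)
        simp only [comp_ofComp hP.mem (φ.map_source hp)] at h1
        rw [φ.left_inv hp] at h1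
        refine (ENNReal.ofReal_le_ofReal h1).trans ?_
        rw [ENNReal.ofReal_mul (by have := hP.pos; positivity), ofReal_sum_norm_sq]
        exact mul_le_mul_right (hle _) _
      · rw [ofComp_eq_zero fun _ J ↦ hc0 J _ hpK, tensorNormSq_zero]
        simp
    · rw [ofComp_eq_zero fun h ↦ absurd h hp, tensorNormSq_zero]
      simp
  · rw [lintegral_indicator φ.open_source.measurableSet,
      Measure.restrict_restrict φ.open_source.measurableSet,
      Set.inter_eq_left.2 hP.source_subset, ← φ.symm_image_target_eq_source,
      lintegral_riemVolume hG hU hP.mem hP.source_subset φ.open_target.measurableSet le_rfl]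
    have h1 : ∫⁻ y in φ.target, chartDensity gs φ y * (k * b (ψ (φ.symm y))) =
        ∫⁻ y in φ.target, chartDensity gs φ y * (k * ∑ J, ‖c J y‖ₑ ^ 2) := by
      refine lintegral_congr_ae ?_
      rw [Filter.EventuallyEq, ae_restrict_iff' φ.open_target.measurableSet]
      filter_upwards [hae] with y hy hyt
      rw [hψ, Set.piecewise_eq_of_mem _ _ _ (φ.map_target hyt), φ.right_inv hyt, hy]
    rw [h1]
    have h2 : ∀ y ∈ φ.target, chartDensity gs φ y * (k * ∑ J, ‖c J y‖ₑ ^ 2) ≤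
        normConst n m C * ∑ J, ‖c J y‖ₑ ^ 2 := by
      intro y hy
      by_cases hyK : y ∈ K
      · have := (det_chartGram_bounds hG hP.mem (hreg y hy) hP.pos (hP.pinched y hyK)).2
        rw [normConst, mul_assoc]
        exact mul_le_mul' (ENNReal.ofReal_le_ofReal this) le_rfl
      · simp [hc0 _ y hyK]
    refine (setLIntegral_mono' φ.open_target.measurableSet h2).trans ?_
    unfold sqNorm
    rw [lintegral_const_mul' _ _ (normConst_lt_top n m C).ne, Measure.restrict_univ,
      ← lintegral_finsetSum' _ fun J _ ↦ (hcm J).enorm.pow_const 2]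
    exact mul_le_mul_right (setLIntegral_le_lintegral _ _) _

/-- The norms of the components on a patch. -/
theorem Patch.sum_sqNorm_le (hP : Patch g gs x D φ K H i N C) (hx : IsBoundaryDefining n x)
    (hG : MetricOn gs (interiorX x)) (hH : IsOpen H) (u : CovTensor 𝕜 n M m) :
    ∑ J, sqNorm (H ∩ K) (comp φ u J) ≤ normConst n m C * tensorSq gs (D ∩ interiorX x) u := by
  have hSt : H ∩ K ⊆ φ.target := fun y hy ↦ hP.subset_target hy.2
  have hS : MeasurableSet (H ∩ K) := hH.measurableSet.inter hP.isClosed.measurableSet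
  refine (sqNorm_le_tensorSq hG (isOpen_interiorX hx) hP.mem hP.source_subset hS hSt hP.pos
    (fun y hy ↦ hP.pinched y hy.2)).trans (mul_le_mul_right (lintegral_mono_set ?_) _)
  rintro _ ⟨y, hy, rfl⟩
  exact ⟨(hP.mem_iff y (hSt hy)).2 hy.1, hP.source_subset (φ.map_target (hSt hy))⟩

end Majorant

end ScKorn

end


noncomputable section

namespace ScKorn

/-! ### Localization and partial derivatives in a patch. -/

section ChartComputations

variable {n : ℕ} {M : Type*} [TopologicalSpace M] [ChartedSpace (Model n) M]
  [IsManifold (𝓡 n) ∞ M] {𝕜 : Type*} [RCLike 𝕜] {m : ℕ}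
  {g gs : BilinField n M} {x : M → ℝ} {D : Set M} {φ : OpenPartialHomeomorph M (Model n)}
  {K H : Set (Model n)} {i : Fin n} {N : Set M} {C : ℝ} {χ : M → ℝ}
  {t : CovTensor 𝕜 n M m} {W W' : CovTensor 𝕜 n M (m + 1)}

theorem eq_of_comp_eq (hφ : φ ∈ IsManifold.maximalAtlas (𝓡 n) ∞ M) {y : Model n}
    (hy : y ∈ φ.target) {u v : CovTensor 𝕜 n M m} (h : ∀ J, comp φ u J y = comp φ v J y) :
    u (φ.symm y) = v (φ.symm y) := by
  have hp : pullTensor φ u y = pullTensor φ v y := by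
    ext w
    rw [multilinear_expand (pullTensor φ u y), multilinear_expand (pullTensor φ v y)]
    exact Finset.sum_congr rfl fun J _ ↦ by
      rw [← comp_eq_pullTensor, ← comp_eq_pullTensor, h J]
  ext w
  choose a ha using fun b ↦ chartD_surjective hφ hy (w b)
  have := DFunLike.congr_fun hp a
  rw [pullTensor_apply, pullTensor_apply] at this
  simp only [ha] at this
  exact this

theorem Patch.isOpen_half (hP : Patch g gs x D φ K H i N C) : IsOpen H := by
  rcases hP.half with h | ⟨h, -⟩ <;> rw [h]
  · exact isOpen_univ
  · exact isOpen_halfSpace i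

theorem Patch.region_eq (hP : Patch g gs x D φ K H i N C) :
    φ.target ∩ φ.symm ⁻¹' (D ∩ interiorX x) = φ.target ∩ H := by
  ext y
  exact and_congr_right fun hy ↦ ⟨fun h ↦ (hP.mem_iff y hy).1 h.1,
    fun h ↦ ⟨(hP.mem_iff y hy).2 h, hP.source_subset (φ.map_target hy)⟩⟩

theorem Patch.interior_region_eq (hP : Patch g gs x D φ K H i N C) :
    φ.target ∩ φ.symm ⁻¹' interiorX x = φ.target :=
  Set.inter_eq_left.2 fun _ hy ↦ hP.source_subset (φ.map_target hy)

/-- The partial derivatives of the components of a tensor field, in terms of the covariant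
derivative. -/
def partialComp (G : BilinField n M) (φ : OpenPartialHomeomorph M (Model n))
    (t : CovTensor 𝕜 n M m) (W : CovTensor 𝕜 n M (m + 1)) (L : Fin (m + 1) → Fin n)
    (y : Model n) : 𝕜 :=
  comp φ W L y + ∑ a : Fin m, ∑ q : Fin n, christoffel G φ q (L (Fin.last m)) (L a.castSucc) y •
    comp φ t (Function.update (Fin.init (α := fun _ ↦ Fin n) L) a q) y

theorem partialComp_snoc (G : BilinField n M) (J : Fin m → Fin n) (k : Fin n) (y : Model n) :
    partialComp G φ t W (Fin.snoc (α := fun _ ↦ Fin n) J k) y =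
      comp φ W (Fin.snoc (α := fun _ ↦ Fin n) J k) y + ∑ a : Fin m, ∑ q : Fin n,
        christoffel G φ q k (J a) y • comp φ t (Function.update J a q) y := by
  simp only [partialComp, Fin.snoc_last, Fin.snoc_castSucc, Fin.init_snoc]

/-- The components of `χ t` on `K`. -/
def cutComp (φ : OpenPartialHomeomorph M (Model n)) (K : Set (Model n)) (χ : M → ℝ)
    (t : CovTensor 𝕜 n M m) (J : Fin m → Fin n) : Model n → 𝕜 :=
  K.indicator fun y ↦ χ (φ.symm y) • comp φ t J y

/-- The derivatives of the components of `χ t` on `K`. -/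
def cutDeriv (G : BilinField n M) (φ : OpenPartialHomeomorph M (Model n)) (K : Set (Model n))
    (χ : M → ℝ) (t : CovTensor 𝕜 n M m) (W : CovTensor 𝕜 n M (m + 1))
    (L : Fin (m + 1) → Fin n) : Model n → 𝕜 :=
  K.indicator fun y ↦ χ (φ.symm y) • partialComp G φ t W L y +
    fderiv ℝ (fun y ↦ χ (φ.symm y)) y (stdVec n (L (Fin.last m))) •
      comp φ t (Fin.init (α := fun _ ↦ Fin n) L) y

theorem Patch.cutoff_eq_zero (hP : Patch g gs x D φ K H i N C) (h0 : ∀ p ∉ N, χ p = 0)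
    {y : Model n} (hy : y ∈ φ.target \ K) : χ (φ.symm y) = 0 :=
  h0 _ fun hN ↦ hy.2 <| by
    have := (hP.covers _ hN (hP.source_subset (φ.map_target hy.1))).2
    rwa [φ.right_inv hy.1] at this

theorem Patch.fderiv_cutoff_eq_zero (hP : Patch g gs x D φ K H i N C) (h0 : ∀ p ∉ N, χ p = 0)
    {y : Model n} (hy : y ∈ φ.target \ K) : fderiv ℝ (fun y ↦ χ (φ.symm y)) y = 0 := by
  have : (fun y ↦ χ (φ.symm y)) =ᶠ[𝓝 y] fun _ ↦ 0 := by
    filter_upwards [(φ.open_target.sdiff hP.isClosed).mem_nhds hy] with z hz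
    exact hP.cutoff_eq_zero h0 hz
  rw [this.fderiv_eq]
  simp

/-- The product rule holds on the domain of the chart. The cutoff vanishes there off K, so the
result extends by zero to all of H. -/
theorem Patch.weakDeriv_cut (hP : Patch g gs x D φ K H i N C) (hx : IsBoundaryDefining n x)
    (hG : MetricOn gs (interiorX x)) (hχ : ContMDiff (𝓡 n) 𝓘(ℝ, ℝ) ∞ χ)
    (h0 : ∀ p ∉ N, χ p = 0) (hW : IsWeakCovDeriv gs (interiorX x) t W) (J : Fin m → Fin n)
    (k : Fin n) : WeakDeriv H (stdVec n k) (cutComp φ K χ t J)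
      (cutDeriv gs φ K χ t W (Fin.snoc (α := fun _ ↦ Fin n) J k)) := by
  have hcw := (isWeakCovDeriv_iff hG (isOpen_interiorX hx)).1 hW φ hP.mem
  rw [hP.interior_region_eq] at hcw
  have hS : IsOpen (φ.target ∩ H) := φ.open_target.inter hP.isOpen_half
  have hη : ContDiffOn ℝ ∞ (fun y ↦ χ (φ.symm y)) (φ.target ∩ H) := by
    have := contDiffOn_comp_symm (hχ.contMDiffOn (s := Set.univ)) hP.mem
    exact this.mono fun y hy ↦ ⟨hy.1, trivial⟩
  have h1 := (((hcw.deriv J k).mono Set.inter_subset_left).smul hS hη)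
  refine (h1.congr hS (f₁ := cutComp φ K χ t J)
    (d₁ := cutDeriv gs φ K χ t W (Fin.snoc (α := fun _ ↦ Fin n) J k)) ?_ ?_).extend_zero
    (K := K) hS (hP.isOpen_half.sdiff hP.isClosed) (fun y hy ↦ ⟨hP.subset_target hy.2, hy.1⟩)
    (fun y hy ↦ Set.indicator_of_notMem hy.2 _) (fun y hy ↦ Set.indicator_of_notMem hy.2 _)
  · intro y hy
    by_cases hyK : y ∈ K
    · rw [cutComp, Set.indicator_of_mem hyK]
    · rw [cutComp, Set.indicator_of_notMem hyK]
      simp only [hP.cutoff_eq_zero h0 ⟨hy.1, hyK⟩, zero_smul]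
  · intro y hy
    by_cases hyK : y ∈ K
    · rw [cutDeriv, Set.indicator_of_mem hyK, partialComp_snoc, Fin.snoc_last, Fin.init_snoc]
    · rw [cutDeriv, Set.indicator_of_notMem hyK]
      simp only [hP.cutoff_eq_zero h0 ⟨hy.1, hyK⟩, hP.fderiv_cutoff_eq_zero h0 ⟨hy.1, hyK⟩,
        zero_smul, ContinuousLinearMap.zero_apply, add_zero]

/-- The function `e^{F/x} x^r`. -/
def expWeight (x : M → ℝ) (F r : ℝ) (p : M) : ℝ := Real.exp (F / x p) * (x p) ^ r

theorem expWeight_pos {F r : ℝ} {p : M} (hp : 0 < x p) : 0 < expWeight x F r p :=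
  mul_pos (Real.exp_pos _) (Real.rpow_pos_of_pos hp _)

theorem contMDiffOn_expWeight (hx : IsBoundaryDefining n x) (F r : ℝ) :
    ContMDiffOn (𝓡 n) 𝓘(ℝ, ℝ) ∞ (expWeight x F r) (interiorX x) := by
  intro p hp
  have hp' : x p ≠ 0 := (show 0 < x p from hp).ne'
  have h1 : ContDiffAt ℝ ∞ (fun s : ℝ ↦ Real.exp (F / s) * s ^ r) (x p) :=
    ((contDiffAt_const.div contDiffAt_id hp').exp).mul
      (Real.contDiffAt_rpow_const_of_ne hp')
  exact (h1.contMDiffAt.comp p hx.smooth.contMDiffAt).contMDiffWithinAt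

/-- Logarithmic differentiation: the weight is the exponential of F/x + r log x. -/
theorem fderiv_expWeight (hx : IsBoundaryDefining n x)
    (hφ : φ ∈ IsManifold.maximalAtlas (𝓡 n) ∞ M) {y : Model n} (hy : y ∈ φ.target)
    (hxy : 0 < x (φ.symm y)) (F r : ℝ) (v : Model n) :
    fderiv ℝ (fun y ↦ expWeight x F r (φ.symm y)) y v = expWeight x F r (φ.symm y) *
      (F * fderiv ℝ (fun y ↦ (x (φ.symm y))⁻¹) y v +
        r * fderiv ℝ (fun y ↦ Real.log (x (φ.symm y))) y v) := by
  have hxs : ContDiffOn ℝ ∞ (fun y ↦ x (φ.symm y)) φ.target := by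
    simpa using contDiffOn_comp_symm (hx.smooth.contMDiffOn (s := Set.univ)) hφ
  have hd : DifferentiableAt ℝ (fun y ↦ x (φ.symm y)) y :=
    (hxs.contDiffAt (φ.open_target.mem_nhds hy)).differentiableAt (by simp)
  have h1 : DifferentiableAt ℝ (fun y ↦ (x (φ.symm y))⁻¹) y := hd.inv hxy.ne'
  have h2 : DifferentiableAt ℝ (fun y ↦ Real.log (x (φ.symm y))) y := hd.log hxy.ne'
  have h3 : HasFDerivAt (fun y ↦ Real.exp (F * (x (φ.symm y))⁻¹ +
      r * Real.log (x (φ.symm y)))) _ y := ((h1.hasFDerivAt.const_mul F).add (h2.hasFDerivAt.const_mul r)).exp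
  have hev : (fun y ↦ expWeight x F r (φ.symm y)) =ᶠ[𝓝 y]
      fun y ↦ Real.exp (F * (x (φ.symm y))⁻¹ + r * Real.log (x (φ.symm y))) := by
    have hpos : ∀ᶠ z in 𝓝 y, 0 < x (φ.symm z) := hd.continuousAt.eventually (lt_mem_nhds hxy)
    filter_upwards [hpos] with z hz
    rw [expWeight, Real.rpow_def_of_pos hz, ← Real.exp_add, div_eq_mul_inv, mul_comm r]
  rw [hev.fderiv_eq, HasFDerivAt.fderiv h3,
    show expWeight x F r (φ.symm y) = _ from hev.self_of_nhds]
  rfl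

/-- The partial derivatives, in terms of the covariant derivative of `e^{F/x} x^r t` for another
metric. -/
theorem Patch.ae_partialComp_eq (hP : Patch g gs x D φ K H i N C) (hx : IsBoundaryDefining n x)
    (hG : MetricOn gs (interiorX x)) (hg : MetricOn g (D ∩ interiorX x)) (hD : IsOpen D)
    {F r : ℝ} (hW : IsWeakCovDeriv gs (interiorX x) t W)
    (hW' : IsWeakCovDeriv g (D ∩ interiorX x) (fsmul (expWeight x F r) t) W') :
    ∀ᵐ y, y ∈ φ.target ∩ H → ∀ L : Fin (m + 1) → Fin n, partialComp gs φ t W L y =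
      (expWeight x F r (φ.symm y))⁻¹ • comp φ W' L y + ((∑ a : Fin m, ∑ q : Fin n,
        christoffel g φ q (L (Fin.last m)) (L a.castSucc) y •
          comp φ t (Function.update (Fin.init (α := fun _ ↦ Fin n) L) a q) y) -
      (F * fderiv ℝ (fun y ↦ (x (φ.symm y))⁻¹) y (stdVec n (L (Fin.last m))) +
        r * fderiv ℝ (fun y ↦ Real.log (x (φ.symm y))) y (stdVec n (L (Fin.last m)))) •
          comp φ t (Fin.init (α := fun _ ↦ Fin n) L) y) := by
  have hU := isOpen_interiorX hx
  have h1 := (isWeakCovDeriv_iff hG hU).1 hW φ hP.mem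
  have h2 := (isWeakCovDeriv_iff hg (hD.inter hU)).1 hW' φ hP.mem
  rw [hP.interior_region_eq] at h1
  rw [hP.region_eq] at h2
  have hS : IsOpen (φ.target ∩ H) := φ.open_target.inter hP.isOpen_half
  have hf : ContDiffOn ℝ ∞ (fun y ↦ expWeight x F r (φ.symm y)) (φ.target ∩ H) :=
    (contDiffOn_comp_symm (contMDiffOn_expWeight hx F r) hP.mem).mono fun y hy ↦
      ⟨hy.1, hP.source_subset (φ.map_target hy.1)⟩
  -- The weak derivative of the weighted components is computed twice: by the product rule from the
  -- connection of gs, and from that of g. Uniqueness equates the results almost everywhere, and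
  -- division by the weight gives the formula.
  have key := fun (J : Fin m → Fin n) (k : Fin n) ↦
    ((((h1.deriv J k).mono Set.inter_subset_left).smul hS hf).ae_unique (h2.deriv J k) hS)
  have key' := ae_all_iff.2 fun J ↦ ae_all_iff.2 (key J)
  filter_upwards [key'] with y hy hyS L
  have hpos : 0 < x (φ.symm y) := hP.source_subset (φ.map_target hyS.1)
  have hf0 : expWeight x F r (φ.symm y) ≠ 0 := (expWeight_pos hpos).ne'
  have e := hy (Fin.init (α := fun _ ↦ Fin n) L) (L (Fin.last m)) hyS
  rw [fderiv_expWeight hx hP.mem hyS.1 hpos] at e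
  have e2 : ∀ J, comp φ (fsmul (expWeight x F r) t) J y =
    expWeight x F r (φ.symm y) • comp φ t J y := fun J ↦ rfl
  rw [Fin.snoc_init_self] at e
  simp only [e2, smul_comm _ (expWeight x F r (φ.symm y)), ← Finset.smul_sum, mul_smul] at e
  rw [← smul_add] at e
  have e3 := congrArg (fun z ↦ (expWeight x F r (φ.symm y))⁻¹ • z) e
  simp only [smul_add, inv_smul_smul₀ hf0] at e3
  rw [← add_sub_assoc, eq_sub_iff_add_eq, partialComp]
  exact e3

end ChartComputations

end ScKorn

end


noncomputable section

namespace ScKorn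

/-! ### Pointwise bounds for the localized derivatives. -/

section PointwiseBounds

variable {n : ℕ} {M : Type*} [TopologicalSpace M] [ChartedSpace (Model n) M]
  [IsManifold (𝓡 n) ∞ M] {𝕜 : Type*} [RCLike 𝕜] {m : ℕ}
  {g gs : BilinField n M} {x : M → ℝ} {D : Set M} {φ : OpenPartialHomeomorph M (Model n)}
  {K H : Set (Model n)} {i : Fin n} {N : Set M} {C : ℝ} {χ : M → ℝ}
  {t : CovTensor 𝕜 n M m} {W W' om : CovTensor 𝕜 n M (m + 1)}

theorem norm_symComp_le {c : (Fin m → Fin n) → 𝕜} {B : ℝ} (h : ∀ L, ‖c L‖ ≤ B)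
    (L : Fin m → Fin n) : ‖symComp c L‖ ≤ B := by
  rw [symComp, norm_smul]
  have h1 : ‖∑ σ : Equiv.Perm (Fin m), c (L ∘ σ)‖ ≤ (m.factorial : ℝ) * B := by
    refine ((norm_sum_le _ _).trans (Finset.sum_le_sum
      fun (σ : Equiv.Perm (Fin m)) _ ↦ h (L ∘ σ))).trans (le_of_eq ?_)
    simp [Fintype.card_perm]
  have hpos : (0 : ℝ) < m.factorial := by positivity
  rw [norm_inv, Real.norm_of_nonneg hpos.le]
  calc _ ≤ (m.factorial : ℝ)⁻¹ * ((m.factorial : ℝ) * B) :=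
        mul_le_mul_of_nonneg_left h1 (by positivity)
    _ = B := by field_simp

theorem symComp_smul_add (a : ℝ) (c d : (Fin m → Fin n) → 𝕜) (L : Fin m → Fin n) :
    symComp (fun L ↦ a • c L + d L) L = a • symComp c L + symComp d L := by
  simp only [symComp, Finset.sum_add_distrib, smul_add, ← Finset.smul_sum]
  rw [smul_comm]

theorem comp_symmetrize (u : CovTensor 𝕜 n M m) (L : Fin m → Fin n) (y : Model n) :
    comp φ (symmetrize u) L y = symComp (fun L ↦ comp φ u L y) L := by
  rw [comp, symmetrize, MultilinearMap.smul_apply, MultilinearMap.sum_apply]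
  rfl

theorem norm_christoffel_sum_le {G : BilinField n M} {y : Model n} (hC : 0 ≤ C)
    (h : ∀ q k j, |christoffel G φ q k j y| ≤ C) (c : (Fin m → Fin n) → 𝕜)
    (L : Fin (m + 1) → Fin n) :
    ‖∑ a : Fin m, ∑ q : Fin n, christoffel G φ q (L (Fin.last m)) (L a.castSucc) y •
      c (Function.update (Fin.init (α := fun _ ↦ Fin n) L) a q)‖ ≤ m * n * C * ∑ J, ‖c J‖ := by
  have h1 : ∀ (a : Fin m) (q : Fin n), ‖christoffel G φ q (L (Fin.last m)) (L a.castSucc) y •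
      c (Function.update (Fin.init (α := fun _ ↦ Fin n) L) a q)‖ ≤ C * ∑ J, ‖c J‖ := by
    intro a q
    rw [norm_smul]
    exact mul_le_mul (h _ _ _) (Finset.single_le_sum (f := fun J ↦ ‖c J‖)
      (fun _ _ ↦ norm_nonneg _) (Finset.mem_univ _)) (norm_nonneg _) hC
  refine (norm_sum_le_of_le _ fun a _ ↦ norm_sum_le_of_le _ fun q _ ↦ h1 a q).trans (le_of_eq ?_)
  simp
  ring

theorem norm_smul_comp_le {a B : ℝ} (h : |a| ≤ B) (c : (Fin m → Fin n) → 𝕜) (J : Fin m → Fin n) :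
    ‖a • c J‖ ≤ B * ∑ J, ‖c J‖ := by
  rw [norm_smul]
  exact mul_le_mul h (Finset.single_le_sum (f := fun J ↦ ‖c J‖)
    (fun _ _ ↦ norm_nonneg _) (Finset.mem_univ _)) (norm_nonneg _) ((abs_nonneg _).trans h)

/-- A bound for the derivatives of the localized components by the covariant derivative. -/
theorem Patch.norm_cutDeriv_le (hP : Patch g gs x D φ K H i N C) (hχ1 : ∀ p, |χ p| ≤ 1)
    {C' : ℝ} {y : Model n} (hy : y ∈ K)
    (hC' : ∀ k, |fderiv ℝ (fun y ↦ χ (φ.symm y)) y (stdVec n k)| ≤ C') (L : Fin (m + 1) → Fin n) :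
    ‖cutDeriv gs φ K χ t W L y‖ ≤ ‖comp φ W L y‖ + (m * n * C + C') * ∑ J, ‖comp φ t J y‖ := by
  rw [cutDeriv, Set.indicator_of_mem hy]
  have h1 := norm_christoffel_sum_le hP.pos.le (hP.christoffel_gs y hy) (fun J ↦ comp φ t J y) L
  have h2 := norm_smul_comp_le (hC' (L (Fin.last m))) (fun J ↦ comp φ t J y)
    (Fin.init (α := fun _ ↦ Fin n) L)
  refine (norm_add_le _ _).trans ?_
  have h3 : ‖χ (φ.symm y) • partialComp gs φ t W L y‖ ≤ ‖partialComp gs φ t W L y‖ := by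
    rw [norm_smul]
    exact mul_le_of_le_one_left (norm_nonneg _) (hχ1 _)
  have h4 : ‖partialComp gs φ t W L y‖ ≤ _ := norm_add_le _ _
  rw [add_mul]
  linarith

/-- A bound for the symmetric part of the derivatives of the localized components. -/
theorem Patch.norm_symComp_cutDeriv_le (hP : Patch g gs x D φ K H i N C) (hχ1 : ∀ p, |χ p| ≤ 1)
    {C' F r f : ℝ} {y : Model n} (hy : y ∈ K)
    (hC' : ∀ k, |fderiv ℝ (fun y ↦ χ (φ.symm y)) y (stdVec n k)| ≤ C')
    (hom : om (φ.symm y) = f • symmetrize W' (φ.symm y))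
    (h : ∀ L : Fin (m + 1) → Fin n, partialComp gs φ t W L y =
      f • comp φ W' L y + ((∑ a : Fin m, ∑ q : Fin n,
        christoffel g φ q (L (Fin.last m)) (L a.castSucc) y •
          comp φ t (Function.update (Fin.init (α := fun _ ↦ Fin n) L) a q) y) -
      (F * fderiv ℝ (fun y ↦ (x (φ.symm y))⁻¹) y (stdVec n (L (Fin.last m))) +
        r * fderiv ℝ (fun y ↦ Real.log (x (φ.symm y))) y (stdVec n (L (Fin.last m)))) •
          comp φ t (Fin.init (α := fun _ ↦ Fin n) L) y)) (L : Fin (m + 1) → Fin n) :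
    ‖symComp (fun L ↦ cutDeriv gs φ K χ t W L y) L‖ ≤ ‖comp φ om L y‖ +
      (m * n * C + (|F| + |r|) * C + C') * ∑ J, ‖comp φ t J y‖ := by
  -- The terms of order zero in t. Only the term with W' contains derivatives, and its
  -- symmetrization is a component of om.
  set lot : (Fin (m + 1) → Fin n) → 𝕜 := fun L ↦ (∑ a : Fin m, ∑ q : Fin n,
        christoffel g φ q (L (Fin.last m)) (L a.castSucc) y •
          comp φ t (Function.update (Fin.init (α := fun _ ↦ Fin n) L) a q) y) -
      (F * fderiv ℝ (fun y ↦ (x (φ.symm y))⁻¹) y (stdVec n (L (Fin.last m))) +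
        r * fderiv ℝ (fun y ↦ Real.log (x (φ.symm y))) y (stdVec n (L (Fin.last m)))) •
          comp φ t (Fin.init (α := fun _ ↦ Fin n) L) y with hlot
  set rem : (Fin (m + 1) → Fin n) → 𝕜 := fun L ↦ χ (φ.symm y) • lot L +
    fderiv ℝ (fun y ↦ χ (φ.symm y)) y (stdVec n (L (Fin.last m))) •
      comp φ t (Fin.init (α := fun _ ↦ Fin n) L) y with hrem
  have e1 : (fun L ↦ cutDeriv gs φ K χ t W L y) = fun L ↦ (χ (φ.symm y) * f) • comp φ W' L y +
      rem L := by
    funext L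
    rw [cutDeriv, Set.indicator_of_mem hy, h L, hrem, mul_smul, smul_add, add_assoc]
  have e2 : comp φ om L y = f • symComp (fun L ↦ comp φ W' L y) L := by
    rw [← comp_symmetrize, comp, hom]
    rfl
  have hb : ∀ L, ‖rem L‖ ≤ (m * n * C + (|F| + |r|) * C + C') * ∑ J, ‖comp φ t J y‖ := by
    intro L
    have h1 := norm_christoffel_sum_le hP.pos.le (hP.christoffel_g y hy) (fun J ↦ comp φ t J y) L
    have h2 := norm_smul_comp_le (hC' (L (Fin.last m))) (fun J ↦ comp φ t J y)
      (Fin.init (α := fun _ ↦ Fin n) L)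
    have h3 : |F * fderiv ℝ (fun y ↦ (x (φ.symm y))⁻¹) y (stdVec n (L (Fin.last m))) +
        r * fderiv ℝ (fun y ↦ Real.log (x (φ.symm y))) y (stdVec n (L (Fin.last m)))| ≤
          (|F| + |r|) * C := by
      refine (abs_add_le _ _).trans ?_
      rw [abs_mul, abs_mul, add_mul]
      exact add_le_add (mul_le_mul_of_nonneg_left (hP.fderiv_inv y hy _) (abs_nonneg _))
        (mul_le_mul_of_nonneg_left (hP.fderiv_log y hy _) (abs_nonneg _))
    have h4 := norm_smul_comp_le h3 (fun J ↦ comp φ t J y) (Fin.init (α := fun _ ↦ Fin n) L)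
    have h5 : ‖χ (φ.symm y) • lot L‖ ≤ ‖lot L‖ := by
      rw [norm_smul]
      exact mul_le_of_le_one_left (norm_nonneg _) (hχ1 _)
    have h6 : ‖lot L‖ ≤ _ := norm_sub_le _ _
    refine (norm_add_le _ _).trans ?_
    rw [add_mul, add_mul]
    linarith
  rw [e1, symComp_smul_add, mul_smul, ← e2]
  refine (norm_add_le _ _).trans (add_le_add ?_ (norm_symComp_le hb L))
  rw [norm_smul]
  exact mul_le_of_le_one_left (norm_nonneg _) (hχ1 _)

theorem Patch.norm_covComp_le (hP : Patch g gs x D φ K H i N C)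
    {c : (Fin m → Fin n) → Model n → 𝕜} {d : (Fin (m + 1) → Fin n) → Model n → 𝕜}
    (hc0 : ∀ J, ∀ y ∉ K, c J y = 0) (L : Fin (m + 1) → Fin n) (y : Model n) :
    ‖covComp gs φ c d L y‖ ≤ ‖d L y‖ + m * n * C * ∑ J, ‖c J y‖ := by
  by_cases hy : y ∈ K
  · exact (norm_sub_le _ _).trans (add_le_add le_rfl
      (norm_christoffel_sum_le hP.pos.le (hP.christoffel_gs y hy) (fun J ↦ c J y) L))
  · simp [covComp, hc0 _ y hy]

end PointwiseBounds

end ScKorn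

end


noncomputable section

namespace ScKorn

/-! ### The local extension and its estimate. -/

section LocalExtension

variable {n : ℕ} {M : Type*} [TopologicalSpace M] [ChartedSpace (Model n) M]
  [MeasurableSpace M] [BorelSpace M] [IsManifold (𝓡 n) ∞ M] {𝕜 : Type*} [RCLike 𝕜] {m : ℕ}
  {g gs : BilinField n M} {x : M → ℝ} {D : Set M} {φ : OpenPartialHomeomorph M (Model n)}
  {K H : Set (Model n)} {i : Fin n} {N : Set M} {C : ℝ} {χ : M → ℝ}

theorem sqNorm_mono_norm {S : Set (Model n)} {f g : Model n → 𝕜} (h : ∀ y, ‖f y‖ ≤ ‖g y‖) :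
    sqNorm S f ≤ sqNorm S g :=
  lintegral_mono fun y ↦ pow_le_pow_left' (enorm_le_iff_norm_le.2 (h y)) 2

theorem norm_cutComp_le (hχ1 : ∀ p, |χ p| ≤ 1) (t : CovTensor 𝕜 n M m) (J : Fin m → Fin n)
    (y : Model n) : ‖cutComp φ K χ t J y‖ ≤ ‖comp φ t J y‖ := by
  by_cases hy : y ∈ K
  · rw [cutComp, Set.indicator_of_mem hy, norm_smul]
    exact mul_le_of_le_one_left (norm_nonneg _) (hχ1 _)
  · rw [cutComp, Set.indicator_of_notMem hy, norm_zero]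
    exact norm_nonneg _

/-- The Christoffel symbols are continuous only on the chart domain, which contains K; off K the
tensor components vanish. -/
theorem Patch.aestronglyMeasurable_covComp (hP : Patch g gs x D φ K H i N C)
    (hx : IsBoundaryDefining n x) (hG : MetricOn gs (interiorX x))
    {c : (Fin m → Fin n) → Model n → 𝕜} {d : (Fin (m + 1) → Fin n) → Model n → 𝕜}
    (hc0 : ∀ J, ∀ y ∉ K, c J y = 0) (hc : ∀ J, AEStronglyMeasurable (c J))
    (hd : ∀ L, AEStronglyMeasurable (d L)) (L : Fin (m + 1) → Fin n) :
    AEStronglyMeasurable (covComp gs φ c d L) := by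
  have hΓ : ∀ q k j, AEStronglyMeasurable (christoffel gs φ q k j) (volume.restrict K) := by
    intro q k j
    have := (contDiffOn_christoffel hG (isOpen_interiorX hx) hP.mem q k j).continuousOn
    rw [hP.interior_region_eq] at this
    exact (this.mono hP.subset_target).aestronglyMeasurable hP.isClosed.measurableSet
  refine (hd L).sub (Finset.aestronglyMeasurable_fun_sum _ fun a _ ↦
    Finset.aestronglyMeasurable_fun_sum _ fun q _ ↦ ?_)
  set J := Function.update (Fin.init (α := fun _ ↦ Fin n) L) a q
  have e : (fun y ↦ christoffel gs φ q (L (Fin.last m)) (L a.castSucc) y • c J y) =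
      K.indicator fun y ↦ christoffel gs φ q (L (Fin.last m)) (L a.castSucc) y • c J y := by
    funext y
    by_cases hy : y ∈ K <;> simp [hy, hc0]
  rw [e, aestronglyMeasurable_indicator_iff hP.isClosed.measurableSet]
  exact (hΓ _ _ _).smul (hc J).restrict

/-- The localized components belong to `H¹`. -/
theorem Patch.isH1_cut (hP : Patch g gs x D φ K H i N C) (hx : IsBoundaryDefining n x)
    (hG : MetricOn gs (interiorX x)) (hχ : ContMDiff (𝓡 n) 𝓘(ℝ, ℝ) ∞ χ) (hχ1 : ∀ p, |χ p| ≤ 1)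
    (h0 : ∀ p ∉ N, χ p = 0) {t : CovTensor 𝕜 n M m} {W : CovTensor 𝕜 n M (m + 1)}
    (hW : IsWeakCovDeriv gs (interiorX x) t W) (ht : tensorSq gs (D ∩ interiorX x) t < ⊤)
    (hWf : tensorSq gs (D ∩ interiorX x) W < ⊤) (hn : 0 < n) :
    IsH1 H (cutComp φ K χ t) (cutDeriv gs φ K χ t W) := by
  have hd := hP.weakDeriv_cut hx hG hχ h0 hW
  obtain ⟨C', hC'⟩ := hP.fderiv_cutoff χ hχ
  have hHm := hP.isOpen_half.measurableSet
  have hcw := (isWeakCovDeriv_iff hG (isOpen_interiorX hx)).1 hW φ hP.mem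
  rw [hP.interior_region_eq] at hcw
  have htm : ∀ J, AEStronglyMeasurable (comp φ t J) (volume.restrict (H ∩ K)) := fun J ↦
    (hcw.loc J).aestronglyMeasurable.mono_measure
      (Measure.restrict_mono (fun y hy ↦ hP.subset_target hy.2) le_rfl)
  have hft : ∑ J, sqNorm (H ∩ K) (comp φ t J) < ⊤ :=
    (hP.sum_sqNorm_le hx hG hP.isOpen_half t).trans_lt
      (ENNReal.mul_lt_top (normConst_lt_top _ _ _) ht)
  have hfW : ∑ L, sqNorm (H ∩ K) (comp φ W L) < ⊤ :=
    (hP.sum_sqNorm_le hx hG hP.isOpen_half W).trans_lt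
      (ENNReal.mul_lt_top (normConst_lt_top _ _ _) hWf)
  have hKm := hP.isClosed.measurableSet
  have hA : 0 ≤ m * n * C + |C'| := by have := hP.pos; positivity
  refine ⟨fun J ↦ memLp_two_iff.2 ⟨(hd J ⟨0, hn⟩).loc.aestronglyMeasurable, ?_⟩,
    fun L ↦ memLp_two_iff.2 ⟨?_, ?_⟩, hd⟩
  · rw [← sqNorm_inter_eq (g := cutComp φ K χ t J) hKm fun y hy ↦ Set.indicator_of_notMem hy _]
    exact (sqNorm_mono_norm (norm_cutComp_le hχ1 t J)).trans_lt
      ((ENNReal.sum_lt_top.1 hft) J (Finset.mem_univ _))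
  · have := (hd (Fin.init (α := fun _ ↦ Fin n) L) (L (Fin.last m))).loc_deriv.aestronglyMeasurable
    rwa [Fin.snoc_init_self] at this
  · rw [← sqNorm_inter_eq (g := cutDeriv gs φ K χ t W L) hKm fun y hy ↦ Set.indicator_of_notMem hy _]
    refine (sqNorm_le_of_norm_le (a := comp φ W L) hA htm ?_).trans_lt (ENNReal.add_lt_top.2
      ⟨ENNReal.mul_lt_top (by simp) ((ENNReal.sum_lt_top.1 hfW) L (Finset.mem_univ _)),
        ENNReal.mul_lt_top ENNReal.ofReal_lt_top hft⟩)
    rw [ae_restrict_iff' (hHm.inter hKm)]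
    exact .of_forall fun y hy ↦ hP.norm_cutDeriv_le hχ1 hy.2
      (fun k ↦ (hC' y hy.2 k).trans (le_abs_self _)) L

/-- Extension of the localization `χ t` of a symmetric tensor field from the domain `D`, with a
bound by the symmetrized covariant derivative. -/
theorem Patch.exists_local_extension (hn : 0 < n) (hP : Patch g gs x D φ K H i N C)
    (hx : IsBoundaryDefining n x) (hG : MetricOn gs (interiorX x))
    (hg : MetricOn g (D ∩ interiorX x)) (hD : IsOpen D) (hχ : ContMDiff (𝓡 n) 𝓘(ℝ, ℝ) ∞ χ)
    (hχ1 : ∀ p, |χ p| ≤ 1) (h0 : ∀ p ∉ N, χ p = 0) (F r : ℝ) (𝕜 : Type*) [RCLike 𝕜] :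
    ∃ A : ℝ≥0∞, A < ⊤ ∧ ∀ (t : CovTensor 𝕜 n M 3) (W W' om : CovTensor 𝕜 n M 4), IsSymm t →
      IsWeakCovDeriv gs (interiorX x) t W → tensorSq gs (D ∩ interiorX x) t < ⊤ →
      tensorSq gs (D ∩ interiorX x) W < ⊤ →
      IsWeakCovDeriv g (D ∩ interiorX x) (fsmul (expWeight x F r) t) W' →
      (∀ p ∈ D ∩ interiorX x, om p = (expWeight x F r p)⁻¹ • symmetrize W' p) →
      ∃ (e : CovTensor 𝕜 n M 3) (E : CovTensor 𝕜 n M 4) (b₁ b₂ : M → ℝ≥0∞), IsSymm e ∧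
        (∀ p ∈ D ∩ interiorX x, e p = χ p • t p) ∧ IsWeakCovDeriv gs (interiorX x) e E ∧
        Measurable b₁ ∧ Measurable b₂ ∧
        (∀ p, ENNReal.ofReal (tensorNormSq gs p (e p)) ≤ b₁ p) ∧
        (∀ p, ENNReal.ofReal (tensorNormSq gs p (E p)) ≤ b₂ p) ∧
        ∫⁻ p in interiorX x, b₁ p ∂(riemVolume gs) + ∫⁻ p in interiorX x, b₂ p ∂(riemVolume gs) ≤
          A * (tensorSq gs (D ∩ interiorX x) om + tensorSq gs (D ∩ interiorX x) t) := by
  obtain ⟨C', hC'⟩ := hP.fderiv_cutoff χ hχ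
  set k₃ := normConst n 3 C with hk₃
  set k₄ := normConst n 4 C with hk₄
  set B := ENNReal.ofReal (10 ^ 15) with hB
  -- A₁ bounds the lower order terms of the symmetrized gradient: Christoffel symbols of g, the
  -- exponential and power weights, and the gradient of the cutoff. A₂ bounds the passage from
  -- partial to covariant derivatives for gs.
  set A₁ : ℝ := (3 : ℕ) * n * C + (|F| + |r|) * C + |C'| with hA₁
  set A₂ : ℝ := (3 : ℕ) * n * C with hA₂
  have hC := hP.pos
  have hA₁0 : 0 ≤ A₁ := by positivity
  have hA₂0 : 0 ≤ A₂ := by positivity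
  set P : ℝ≥0∞ := (Fintype.card (Fin 4 → Fin n) : ℝ≥0∞) *
    ENNReal.ofReal (2 * A₁ ^ 2 * Fintype.card (Fin 3 → Fin n)) with hPd
  set Q : ℝ≥0∞ := (Fintype.card (Fin 4 → Fin n) : ℝ≥0∞) *
    ENNReal.ofReal (2 * A₂ ^ 2 * Fintype.card (Fin 3 → Fin n)) with hQd
  refine ⟨k₄ * 2 * B * 2 * k₄ + (k₃ * B * k₃ + k₄ * 2 * B * P * k₃ + k₄ * Q * B * k₃), ?_, ?_⟩
  · have f₃ : k₃ < ⊤ := normConst_lt_top _ _ _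
    have f₄ : k₄ < ⊤ := normConst_lt_top _ _ _
    have fP : P < ⊤ := ENNReal.mul_lt_top (by simp) ENNReal.ofReal_lt_top
    have fQ : Q < ⊤ := ENNReal.mul_lt_top (by simp) ENNReal.ofReal_lt_top
    have fB : B < ⊤ := ENNReal.ofReal_lt_top
    have f₂ : (2 : ℝ≥0∞) < ⊤ := by simp
    have f₅ := ENNReal.mul_lt_top (ENNReal.mul_lt_top f₄ f₂) fB
    exact ENNReal.add_lt_top.2 ⟨ENNReal.mul_lt_top (ENNReal.mul_lt_top f₅ f₂) f₄,
      ENNReal.add_lt_top.2 ⟨ENNReal.add_lt_top.2 ⟨ENNReal.mul_lt_top (ENNReal.mul_lt_top f₃ fB) f₃,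
        ENNReal.mul_lt_top (ENNReal.mul_lt_top f₅ fP) f₃⟩,
        ENNReal.mul_lt_top (ENNReal.mul_lt_top (ENNReal.mul_lt_top f₄ fQ) fB) f₃⟩⟩
  intro t W W' om hts hW htf hWf hW' hom
  have hH1 := hP.isH1_cut hx hG hχ hχ1 h0 hW htf hWf hn
  have hKm := hP.isClosed.measurableSet
  have hHm := hP.isOpen_half.measurableSet
  have hcw := (isWeakCovDeriv_iff hG (isOpen_interiorX hx)).1 hW φ hP.mem
  rw [hP.interior_region_eq] at hcw
  have htm : ∀ J, AEStronglyMeasurable (comp φ t J) (volume.restrict (H ∩ K)) := fun J ↦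
    (hcw.loc J).aestronglyMeasurable.mono_measure
      (Measure.restrict_mono (fun y hy ↦ hP.subset_target hy.2) le_rfl)
  obtain ⟨f', D', h1, hsym, hfH, hf0, hD0, hf, hDb⟩ := exists_korn_extension hP.half hH1
    (fun J σ y ↦ by
      by_cases hy : y ∈ K
      · simp only [cutComp, Set.indicator_of_mem hy, isSymm_of_comp hP.mem hts J σ]
      · simp only [cutComp, Set.indicator_of_notMem hy])
    (fun J y hy ↦ Set.indicator_of_notMem hy _) (fun L y hy ↦ Set.indicator_of_notMem hy _)
  have bt := hP.sum_sqNorm_le hx hG hP.isOpen_half t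
  have bo := hP.sum_sqNorm_le hx hG hP.isOpen_half om
  set Tt := tensorSq gs (D ∩ interiorX x) t
  set To := tensorSq gs (D ∩ interiorX x) om
  have c1 : ∑ J, sqNorm Set.univ (f' J) ≤ B * (k₃ * Tt) := by
    refine hf.trans (mul_le_mul_right ((Finset.sum_le_sum fun J _ ↦ ?_).trans bt) _)
    rw [← sqNorm_inter_eq (g := cutComp φ K χ t J) hKm fun y hy ↦ Set.indicator_of_notMem hy _]
    exact sqNorm_mono_norm (norm_cutComp_le hχ1 t J)
  -- The heart of the estimate: the full gradient of the extension is bounded through the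
  -- symmetrized one, hence by om and t. The norm of W enters nowhere.
  have c2 : ∑ L, sqNorm Set.univ (D' L) ≤ B * (2 * (k₄ * To) + P * (k₃ * Tt)) := by
    refine hDb.trans (mul_le_mul_right ?_ _)
    have hz : ∀ L, sqNorm H (fun y ↦ symComp (fun L ↦ cutDeriv gs φ K χ t W L y) L) =
        sqNorm (H ∩ K) (fun y ↦ symComp (fun L ↦ cutDeriv gs φ K χ t W L y) L) := fun L ↦
      (sqNorm_inter_eq hKm fun y hy ↦ by simp [symComp, cutDeriv, hy]).symm
    simp_rw [hz]
    refine (sum_sqNorm_le_of_norm_le (a := comp φ om) hA₁0 htm fun L ↦ ?_).trans ?_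
    · rw [ae_restrict_iff' (hHm.inter hKm)]
      filter_upwards [hP.ae_partialComp_eq hx hG hg hD hW hW'] with y hy hyS
      have hyt := hP.subset_target hyS.2
      exact hP.norm_symComp_cutDeriv_le hχ1 hyS.2
        (fun k ↦ (hC' y hyS.2 k).trans (le_abs_self _))
        (hom _ ⟨(hP.mem_iff y hyt).2 hyS.1, hP.source_subset (φ.map_target hyt)⟩)
        (hy ⟨hyt, hyS.1⟩) L
    · rw [← mul_assoc (Fintype.card _ : ℝ≥0∞)]
      exact add_le_add (mul_le_mul_right bo _) (mul_le_mul_right bt _)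
  have hf'm : ∀ J, AEStronglyMeasurable (f' J) := fun J ↦ (h1.memLp_univ J).1
  have hD'm : ∀ L, AEStronglyMeasurable (D' L) := fun L ↦ (h1.memLp_deriv_univ L).1
  have c3 : ∑ L, sqNorm Set.univ (covComp gs φ f' D' L) ≤
      2 * (B * (2 * (k₄ * To) + P * (k₃ * Tt))) + Q * (B * (k₃ * Tt)) := by
    refine (sum_sqNorm_le_of_norm_le (a := D') hA₂0 (fun J ↦ (hf'm J).restrict)
      fun L ↦ .of_forall fun y ↦ hP.norm_covComp_le hf0 L y).trans ?_
    rw [← mul_assoc (Fintype.card _ : ℝ≥0∞)]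
    exact add_le_add (mul_le_mul_right c2 _) (mul_le_mul_right c1 _)
  have hcov0 : ∀ L, ∀ y ∉ K, covComp gs φ f' D' L y = 0 := fun L y hy ↦ by
    simp [covComp, hf0 _ y hy, hD0 _ y hy]
  obtain ⟨b₁, hb₁, hle₁, hi₁⟩ := hP.exists_majorant hx hG hf0 hf'm
  obtain ⟨b₂, hb₂, hle₂, hi₂⟩ := hP.exists_majorant hx hG hcov0
    (hP.aestronglyMeasurable_covComp hx hG hf0 hf'm hD'm)
  refine ⟨ofComp φ f', ofComp φ (covComp gs φ f' D'), b₁, b₂, isSymm_ofComp hsym, ?_,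
    isWeakCovDeriv_ofComp hn hG (isOpen_interiorX hx) hP.mem hP.source_subset hP.isOpen_diff
      hf0 hD0 fun J k ↦ (h1.deriv J k).mono (Set.subset_univ _), hb₁, hb₂, hle₁, hle₂, ?_⟩
  · intro p hp
    by_cases hps : p ∈ φ.source
    · have hy := φ.map_source hps
      have hyH : φ p ∈ H := (hP.mem_iff _ hy).1 (by rw [φ.left_inv hps]; exact hp.1)
      have := eq_of_comp_eq hP.mem hy (u := ofComp φ f') (v := fsmul χ t) fun J ↦ by
        rw [comp_ofComp hP.mem hy, hfH J _ hyH]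
        by_cases hyK : φ p ∈ K
        · rw [cutComp, Set.indicator_of_mem hyK]
          rfl
        -- Off K the cutoff is zero in the chart domain, so the truncation to K has not changed χ t.
        · rw [cutComp, Set.indicator_of_notMem hyK]
          have e0 := hP.cutoff_eq_zero h0 ⟨hy, hyK⟩
          change 0 = χ (φ.symm (φ p)) • comp φ t J (φ p)
          rw [e0, zero_smul]
      rw [φ.left_inv hps] at this
      exact this
    · rw [ofComp_eq_zero fun h ↦ absurd h hps, h0 p fun hN ↦ hps (hP.covers p hN hp.2).1,
        zero_smul]
  · refine (add_le_add (hi₁.trans (mul_le_mul_right c1 _))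
      (hi₂.trans (mul_le_mul_right c3 _))).trans ?_
    calc k₃ * (B * (k₃ * Tt)) +
          k₄ * (2 * (B * (2 * (k₄ * To) + P * (k₃ * Tt))) + Q * (B * (k₃ * Tt)))
        = (k₄ * 2 * B * 2 * k₄) * To +
          (k₃ * B * k₃ + k₄ * 2 * B * P * k₃ + k₄ * Q * B * k₃) * Tt := by ring
      _ ≤ _ := by
        rw [mul_add]
        exact add_le_add (mul_le_mul_left le_self_add _) (mul_le_mul_left le_add_self _)

end LocalExtension

end ScKorn

end


noncomputable section

namespace ScKorn

/-! ### Assembly of the extension by a partition of unity. -/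

section GlobalExtension

variable {n : ℕ} {M : Type*} [TopologicalSpace M] [ChartedSpace (Model n) M]
  [MeasurableSpace M] [BorelSpace M] [IsManifold (𝓡 n) ∞ M] {𝕜 : Type*} [RCLike 𝕜] {m : ℕ}
  {g G : BilinField n M} {x : M → ℝ} {D U : Set M} {h : BilinField n M}

theorem isSymm_sum {ι : Type*} (s : Finset ι) {u : ι → CovTensor 𝕜 n M m}
    (hu : ∀ i ∈ s, IsSymm (u i)) : IsSymm fun p ↦ ∑ i ∈ s, u i p := by
  intro p σ
  ext v
  rw [MultilinearMap.domDomCongr_apply, MultilinearMap.sum_apply, MultilinearMap.sum_apply]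
  exact Finset.sum_congr rfl fun i hi ↦ DFunLike.congr_fun (hu i hi p σ) v

theorem IsSymm.fsmul {u : CovTensor 𝕜 n M m} (hu : IsSymm u) (f : M → ℝ) :
    IsSymm (fsmul f u) := by
  intro p σ
  ext v
  exact congrArg (f p • ·) (DFunLike.congr_fun (hu p σ) v)

theorem IsWeakCovDeriv.congr (hG : MetricOn G U) (hU : IsOpen U) {u u' : CovTensor 𝕜 n M m}
    {w : CovTensor 𝕜 n M (m + 1)} (hu : IsWeakCovDeriv G U u w) (h : ∀ p ∈ U, u p = u' p)
    (hn : 0 < n) : IsWeakCovDeriv G U u' w := by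
  rw [isWeakCovDeriv_iff hG hU] at hu ⊢
  intro φ hφ
  have hc := hu φ hφ
  have e : ∀ J, ∀ y ∈ φ.target ∩ φ.symm ⁻¹' U, comp φ u J y = comp φ u' J y := fun J y hy ↦ by
    rw [comp, comp, h _ hy.2]
  have hd := fun J k ↦ (hc.deriv J k).congr (isOpen_region hU) (e J)
    (d₁ := fun y ↦ comp φ w (Fin.snoc (α := fun _ ↦ Fin n) J k) y + ∑ a : Fin m, ∑ q : Fin n,
      christoffel G φ q k (J a) y • comp φ u' (Function.update J a q) y) fun y hy ↦ by
        simp only [e _ y hy]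
  exact ⟨fun J ↦ (hd J ⟨0, hn⟩).loc, hc.loc_deriv, hd⟩

theorem tensorSq_congr (hU : MeasurableSet U) {u u' : CovTensor 𝕜 n M m}
    (h : ∀ p ∈ U, u p = u' p) : tensorSq G U u = tensorSq G U u' :=
  setLIntegral_congr_fun hU fun p hp ↦ by simp only [h p hp]

theorem l2Norm_sq (G : BilinField n M) (U : Set M) (u : CovTensor 𝕜 n M m) :
    l2Norm G U u ^ 2 = tensorSq G U u := by
  rw [l2Norm, ← ENNReal.rpow_natCast, ← ENNReal.rpow_mul]
  norm_num
  rfl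

/-- The norms themselves need not be measurable; their measurable majorants allow the integral of
the sum to be split. -/
theorem tensorSq_sum_le {ι : Type*} (s : Finset ι) (hG : MetricOn G U) (hU : MeasurableSet U)
    {u : ι → CovTensor 𝕜 n M m} {b : ι → M → ℝ≥0∞} (hb : ∀ i ∈ s, Measurable (b i))
    (h : ∀ i ∈ s, ∀ p, ENNReal.ofReal (tensorNormSq G p (u i p)) ≤ b i p) :
    tensorSq G U (fun p ↦ ∑ i ∈ s, u i p) ≤
      s.card * ∑ i ∈ s, ∫⁻ p in U, b i p ∂(riemVolume G) := by
  rw [← lintegral_finsetSum _ hb, ← lintegral_const_mul' _ _ (by simp)]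
  refine setLIntegral_mono' hU fun p hp ↦ ?_
  refine (ENNReal.ofReal_le_ofReal (tensorNormSq_sum_le hG hp s u)).trans ?_
  rw [ENNReal.ofReal_mul (by positivity), ENNReal.ofReal_natCast,
    ENNReal.ofReal_sum_of_nonneg fun i _ ↦ tensorNormSq_nonneg hG hp _]
  exact mul_le_mul_right (Finset.sum_le_sum fun i hi ↦ h i hi p) _

/-- Extension of symmetric tensor fields from the domain, with a bound by the symmetrized covariant
derivative. -/
theorem exists_extension [T2Space M] [SecondCountableTopology M] (hn : 2 ≤ n)
    (hx : IsBoundaryDefining n x) (hh : IsScatteringMetric x h) (hD : IsTransversalDomain n x D)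
    (hg : MetricOn g Set.univ) (F r : ℝ) (𝕜 : Type*) [RCLike 𝕜] :
    ∃ A : ℝ≥0∞, A < ⊤ ∧ ∀ (t : CovTensor 𝕜 n M 3) (W W' om : CovTensor 𝕜 n M 4), IsSymm t →
      IsWeakCovDeriv (gsc x h) (interiorX x) t W →
      tensorSq (gsc x h) (D ∩ interiorX x) t < ⊤ → tensorSq (gsc x h) (D ∩ interiorX x) W < ⊤ →
      IsWeakCovDeriv g (D ∩ interiorX x) (fsmul (expWeight x F r) t) W' →
      (∀ p ∈ D ∩ interiorX x, om p = (expWeight x F r p)⁻¹ • symmetrize W' p) →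
      ∃ (v : CovTensor 𝕜 n M 3) (E : CovTensor 𝕜 n M 4), IsSymm v ∧
        (∀ p ∈ D ∩ interiorX x, v p = t p) ∧ IsWeakCovDeriv (gsc x h) (interiorX x) v E ∧
        tensorSq (gsc x h) (interiorX x) v + tensorSq (gsc x h) (interiorX x) E ≤
          A * (tensorSq (gsc x h) (D ∩ interiorX x) om +
            tensorSq (gsc x h) (D ∩ interiorX x) t) := by
  have : LocallyCompactSpace M := ChartedSpace.locallyCompactSpace (Model n) M
  set S : Set M := closure D ∩ {p | 0 ≤ x p} with hS
  have hG := metricOn_gsc hx hh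
  have hU := isOpen_interiorX hx
  have hgD : MetricOn g (D ∩ interiorX x) := ⟨hg.symm, fun p _ ↦ hg.pos p trivial, fun φ hφ ↦
    (hg.smooth φ hφ).mono fun y hy ↦ ⟨hy.1, trivial⟩⟩
  -- Coordinate 0 is reserved for x and coordinate 1 for the defining function of the domain.
  have hi : (⟨1, by omega⟩ : Fin n) ≠ ⟨0, by omega⟩ := by simp
  choose φ K H N C hqN hP using fun q : S ↦ exists_patch hx hh hD hg q.2.1 q.2.2 hi
  obtain ⟨s, hs⟩ := hD.isCompact.elim_finite_subcover N (fun q ↦ (hP q).isOpen)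
    fun q hq ↦ Set.mem_iUnion.2 ⟨⟨q, hq⟩, hqN _⟩
  -- The partition sums to 1 on the compact closure of the domain in X, so the local extensions of
  -- χ_i t add up to t on the domain.
  obtain ⟨χ, hχ⟩ := SmoothPartitionOfUnity.exists_isSubordinate (𝓡 n) hD.isCompact.isClosed
    (fun i : s ↦ N i) (fun i ↦ (hP i).isOpen) fun q hq ↦ by
      obtain ⟨i, hi, hq⟩ := Set.mem_iUnion₂.1 (hs hq)
      exact Set.mem_iUnion.2 ⟨⟨i, hi⟩, hq⟩
  choose A hA hloc using fun i : s ↦ (hP i).exists_local_extension (by omega) hx hG hgD hD.isOpen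
    (χ i).contMDiff (fun p ↦ abs_le.2 ⟨by linarith [χ.nonneg i p], χ.le_one i p⟩)
    (fun p hp ↦ image_eq_zero_of_notMem_tsupport fun hq ↦ hp (hχ i hq)) F r 𝕜
  refine ⟨(Finset.univ : Finset s).card * ∑ i, A i, ENNReal.mul_lt_top (by simp)
    (ENNReal.sum_lt_top.2 fun i _ ↦ hA i), fun t W W' om ht hW htf hWf hW' hom ↦ ?_⟩
  choose e E b₁ b₂ hsym heq hcov hb₁ hb₂ hle₁ hle₂ hint using fun i ↦
    hloc i t W W' om ht hW htf hWf hW' hom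
  refine ⟨fun p ↦ ∑ i, e i p, fun p ↦ ∑ i, E i p, isSymm_sum _ fun i _ ↦ hsym i, fun p hp ↦ ?_,
    IsWeakCovDeriv.sum _ hG hU fun i _ ↦ hcov i, ?_⟩
  · have h1 := χ.sum_eq_one (x := p) ⟨subset_closure hp.1,
      (show 0 < x p from hp.2).le⟩
    rw [finsum_eq_sum_of_fintype] at h1
    change ∑ i, e i p = t p
    rw [Finset.sum_congr rfl fun i _ ↦ heq i p hp, ← Finset.sum_smul, h1, one_smul]
  · refine (add_le_add (tensorSq_sum_le _ hG hU.measurableSet (fun i _ ↦ hb₁ i) fun i _ ↦ hle₁ i)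
      (tensorSq_sum_le _ hG hU.measurableSet (fun i _ ↦ hb₂ i) fun i _ ↦ hle₂ i)).trans ?_
    rw [← mul_add, ← Finset.sum_add_distrib, mul_assoc, Finset.sum_mul]
    exact mul_le_mul_right (Finset.sum_le_sum fun i _ ↦ hint i) _

end GlobalExtension

end ScKorn

end


noncomputable section

namespace ScKorn

/-! ### From square norms to the norms of the statement. -/

section MainEstimate

variable {n : ℕ} {M : Type*} [TopologicalSpace M] [ChartedSpace (Model n) M]
  [MeasurableSpace M] [BorelSpace M] [IsManifold (𝓡 n) ∞ M] {𝕜 : Type*} [RCLike 𝕜] {m : ℕ} {x : M → ℝ} {h : BilinField n M}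

theorem exists_weakCovDeriv_of_norm_lt_top {Ω : Set M} {r : ℝ} {u : CovTensor 𝕜 n M m}
    (hu : scSobolevBarNorm x h Ω r u < ⊤) : ∃ (v : CovTensor 𝕜 n M m) (W : CovTensor 𝕜 n M (m + 1)),
      IsSymm v ∧ (∀ p ∈ Ω, v p = u p) ∧
      IsWeakCovDeriv (gsc x h) (interiorX x) (weight x r v) W ∧
      tensorSq (gsc x h) (interiorX x) (weight x r v) < ⊤ ∧
      tensorSq (gsc x h) (interiorX x) W < ⊤ := by
  simp only [scSobolevBarNorm, scSobolevNorm, iInf_lt_iff] at hu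
  obtain ⟨v, hv, hvu, W, hW, hlt⟩ := hu
  rw [ENNReal.rpow_lt_top_iff_of_pos (by norm_num), ENNReal.add_lt_top, l2Norm_sq, l2Norm_sq] at hlt
  exact ⟨v, W, hv, hvu, hW, hlt.1, hlt.2⟩

theorem rpow_half_add_sq_le (A a b : ℝ≥0∞) :
    (A * (a ^ 2 + b ^ 2)) ^ (1 / 2 : ℝ) ≤ A ^ (1 / 2 : ℝ) * (a + b) := by
  rw [ENNReal.mul_rpow_of_nonneg _ _ (by norm_num)]
  refine mul_le_mul_right ?_ _
  calc (a ^ 2 + b ^ 2) ^ (1 / 2 : ℝ) ≤ ((a + b) ^ 2) ^ (1 / 2 : ℝ) := by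
        refine ENNReal.rpow_le_rpow ?_ (by norm_num)
        calc a ^ 2 + b ^ 2 ≤ a ^ 2 + b ^ 2 + 2 * a * b := le_self_add
          _ = (a + b) ^ 2 := by ring
    _ = a + b := by
        rw [← ENNReal.rpow_natCast, ← ENNReal.rpow_mul]
        norm_num

end MainEstimate

end ScKorn

end

theorem mainTheorem10 {𝕜 : Type*} [RCLike 𝕜] {n : ℕ} (hn : 3 ≤ n)
    {M : Type*} [TopologicalSpace M] [T2Space M] [SecondCountableTopology M]
    [ChartedSpace (ScKorn.Model n) M] [IsManifold (𝓡 n) ∞ M]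
    [MeasurableSpace M] [BorelSpace M]
    (g : Bundle.ContMDiffRiemannianMetric (𝓡 n) ∞ (ScKorn.Model n)
      (fun p : M ↦ TangentSpace (𝓡 n) p))
    (x : M → ℝ) (hx : ScKorn.IsBoundaryDefining n x)
    (h : ScKorn.BilinField n M) (hh : ScKorn.IsScatteringMetric x h)
    (D : Set M) (hD : ScKorn.IsTransversalDomain n x D)
    (F : ℝ) (hF : 0 < F) (r : ℝ) :
    ∃ C : ℝ≥0, ∀ u : ScKorn.CovTensor 𝕜 n M 3, ScKorn.IsSymm u →
      ScKorn.scSobolevBarNorm x h (D ∩ ScKorn.interiorX x) r u < ⊤ →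
      (∃ w, ScKorn.IsSymmDiffF g.inner x (D ∩ ScKorn.interiorX x) F u w) ∧
      ∀ w, ScKorn.IsSymmDiffF g.inner x (D ∩ ScKorn.interiorX x) F u w →
        ScKorn.scSobolevBarNorm x h (D ∩ ScKorn.interiorX x) r u ≤
          C * (ScKorn.l2Norm (ScKorn.gsc x h) (D ∩ ScKorn.interiorX x) (ScKorn.weight x r w)
            + ScKorn.l2Norm (ScKorn.gsc x h) (D ∩ ScKorn.interiorX x) (ScKorn.weight x r u)) := by
  open ScKorn in
  have hg : MetricOn g.inner Set.univ := metricOn_of_riemannian g Set.univ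
  have hG := metricOn_gsc hx hh
  have hU := isOpen_interiorX hx
  set Ω := D ∩ interiorX x with hΩ
  have hΩo : IsOpen Ω := hD.isOpen.inter hU
  have hgΩ : MetricOn g.inner Ω := metricOn_of_riemannian g Ω
  obtain ⟨A, hA, hmain⟩ := exists_extension (by omega) hx hh hD hg F r 𝕜
  have hA' : A ^ (1 / 2 : ℝ) ≠ ⊤ := (ENNReal.rpow_lt_top_of_nonneg (by norm_num) hA.ne).ne
  refine ⟨(A ^ (1 / 2 : ℝ)).toNNReal, fun u hus hu ↦ ?_⟩
  obtain ⟨v₀, W₀, hv₀, hvu, hW₀, htf, hWf⟩ := exists_weakCovDeriv_of_norm_lt_top hu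
  -- The estimate is proved for t = x^{-r} v₀, with v₀ a symmetric extension of u of finite norm.
  set t := weight x r v₀ with ht
  -- Writing e^{F/x} u as (e^{F/x} x^r) t puts the exponential and the power weight into one factor.
  have hexp : ∀ p ∈ Ω, fsmul (expWeight x F r) t p = fsmul (fun p ↦ Real.exp (F / x p)) u p := by
    intro p hp
    have hxp : 0 < x p := hp.2
    simp only [fsmul, ht, weight, expWeight, hvu p hp]
    rw [smul_smul, mul_assoc, ← Real.rpow_add hxp, add_neg_cancel, Real.rpow_zero, mul_one]
  constructor
  -- Existence of d^s_F u: pass from the connection of the scattering metric to that of g and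
  -- multiply by the smooth weight.
  · obtain ⟨W, hW⟩ := exists_isWeakCovDeriv_fsmul hG (G₂ := g.inner)
      (metricOn_of_riemannian g (interiorX x)) hU hΩo Set.inter_subset_right (by omega) hW₀
      ((contMDiffOn_expWeight hx F r).mono Set.inter_subset_right)
    exact ⟨_, W, hW.congr hgΩ hΩo hexp (by omega), fun p _ ↦ rfl⟩
  · rintro w ⟨W, hW, hw⟩
    obtain ⟨v, E, hv, hvt, hE, hle⟩ := hmain t W₀ W (weight x r w) (hv₀.fsmul _) hW₀
      ((lintegral_mono_set Set.inter_subset_right).trans_lt htf)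
      ((lintegral_mono_set Set.inter_subset_right).trans_lt hWf)
      (hW.congr hgΩ hΩo (fun p hp ↦ (hexp p hp).symm) (by omega)) fun p hp ↦ by
        have hxp : 0 < x p := hp.2
        simp only [weight, fsmul, hw p hp, expWeight]
        rw [smul_smul, mul_inv, Real.rpow_neg hxp.le, neg_div, Real.exp_neg, mul_comm]
    have hvX : ∀ p ∈ interiorX x, v p = weight x r (fsmul (fun p ↦ (x p) ^ r) v) p := by
      intro p hp
      simp only [weight, fsmul]
      rw [smul_smul, ← Real.rpow_add hp, neg_add_cancel, Real.rpow_zero, one_smul]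
    have hvΩ : ∀ p ∈ Ω, fsmul (fun p ↦ (x p) ^ r) v p = u p := by
      intro p hp
      simp only [fsmul, hvt p hp, ht, weight, hvu p hp]
      rw [smul_smul, ← Real.rpow_add hp.2, add_neg_cancel, Real.rpow_zero, one_smul]
    have htu : ∀ p ∈ Ω, t p = weight x r u p := fun p hp ↦ by
      simp only [ht, weight, fsmul, hvu p hp]
    rw [ENNReal.coe_toNNReal hA']
    -- The competitor in the quotient norm is x^r v, with v the extension of t just found.
    refine (iInf₂_le_of_le _ (hv.fsmul _) (iInf_le_of_le hvΩ
      (iInf₂_le E (hE.congr hG hU hvX (by omega))))).trans ?_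
    rw [l2Norm_sq, l2Norm_sq, ← tensorSq_congr hU.measurableSet hvX]
    rw [tensorSq_congr hΩo.measurableSet htu, ← l2Norm_sq _ _ (weight x r w),
      ← l2Norm_sq _ _ (weight x r u)] at hle
    exact (ENNReal.rpow_le_rpow hle (by norm_num)).trans (rpow_half_add_sq_le _ _ _)
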